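/- **Setting.** Let $M=\mathbb C\times\mathbb C^*$ with coordinates $t=(t^1,t^2)$ (superscripts are indices), and let $t\in M$ with $t^2\notin(-\infty,0]$; roots and the logarithm of $t^2$ are principal. Put $$\eta=\begin{pmatrix}0&1\\1&0\end{pmatrix},\quad \mu=\begin{pmatrix}\tfrac12&0\\0&-\tfrac12\end{pmatrix},\quad \mathcal U=\begin{pmatrix}t^1&2\\2t^2&t^1\end{pmatrix},\quad R=\begin{pmatrix}0&2\\0&0\end{pmatrix},\quad \Psi^{-1}=\tfrac1{\sqrt2}\begin{pmatrix}(t^2)^{-1/4}&\mathsf i(t^2)^{-1/4}\\(t^2)^{1/4}&-\mathsf i(t^2)^{1/4}\end{pmatrix},$$ $(v,w)=v^T\eta w$, and $u^{1}=t^1+2\sqrt{t^2}$, $u^2=t^1-2\sqrt{t^2}$. Fix $\psi\in\mathbb C$. **Calibration.** $S(z)=\sum_{k\ge0}S_kz^{-k}$ is determined by $S_0=1$, $(S_1)_{12}=\psi+\log t^2$ and $kS_k+S_k\mu-\mu S_k=\mathcal US_{k-1}-S_{k-1}R$ for $k\ge1$. Write $\log S=\sum_{\ell\ge1}s_\ell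 z^{-\ell}$. **Period vectors.** Let $\log\lambda$ denote the logarithm on $\mathbb C\setminus\mathsf i\mathbb R_{\ge0}$ with argument in $(-\tfrac{3\pi}2,\tfrac\pi2)$; it also defines the powers of $\lambda-u^i$. For $l\in\mathbb Z$, $i=1,2$, $I^{(l)}_{e_i}(t,\lambda)$ is the holomorphic $\mathbb C^2$-valued solution of $(\mathcal U-\lambda)\partial_\lambda I=(\mu+l+\tfrac12)I$ on $\mathbb C\setminus\bigcup_j(u^j+\mathsf i\mathbb R_{\ge0})$ with $$I^{(l)}_{e_i}=\tfrac{(-1)^l}{\sqrt{2\pi}}\Gamma(l+\tfrac12)(\lambda-u^i)^{-l-1/2}(\Psi^{-1}e_i+O(\lambda-u^i))$$ near $u^i$, where the last factor is a single-valued holomorphic function near $u^i$. For $a\in\mathbb C^2$ put $I_a^{(l)}=a_1I^{(l)}_{e_1}+a_2I^{(l)}_{e_2}$. Further, let $$I^{(l)}_{e_1,\infty}=\begin{pmatrix}\partial_\lambda^{l+1}(\log\lambda+\tfrac\psi2)\\ \partial_\lambda^l\tfrac12\end{pmatrix},\qquad I^{(l)}_{e_2,\infty}=I^{(l)}_{e_1,\infty}+\begin{pmatrix}\partial_\lambda^{l+1}\pi\mathsf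 i\\0\end{pmatrix},\qquad I^{(l)}_{a,\infty}=a_1I^{(l)}_{e_1,\infty}+a_2I^{(l)}_{e_2,\infty},$$ where $\partial_\lambda^{-1}$ is formal integration without integration constants. Put $\mathcal W_{a,a}(t,\lambda)=(I^{(0)}_a,I^{(0)}_a)$ and $\mathcal W^\infty_{a,a}(\lambda)=(I^{(0)}_{a,\infty},I^{(0)}_{a,\infty})$. **Operators.** They act on formal series in the variables $q^i_k$ ($i=1,2$, $k\ge0$) and in $\varepsilon^{\pm1}$ whose coefficients are series in $\mathbb C[\log\lambda]((\lambda^{-1}))$; infinite sums are taken coefficientwise in $\mathbb C$, and $e^A=\sum_nA^n/n!$. Put $\hat S=e^{\hat{\mathfrak s}}$, $\hat S^{-1}=e^{-\hat{\mathfrak s}}$ with $$\hat{\mathfrak s}=\frac1{2\varepsilon^2}\sum_{a,b\ge0}(-1)^{b+1}(s_{a+b+1})^k_i\eta_{kj}\,q^i_aq^j_b-\sum_{a\ge0,\ \ell\ge1}(s_\ell)^j_i\,q^i_{a+\ell}\frac{\partial}{\partial q^j_a}.$$ For $\mathfrak f=\sum_{l\in\mathbb Z}I^{l}(-z)^l$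 the vertex operator is $$e^{\widehat{\mathfrak f_-}}e^{\widehat{\mathfrak f_+}},\qquad \widehat{\mathfrak f_-}=\frac1\varepsilon\sum_{l\ge0}\eta_{ij}(I^{-l-1})^j q^i_l,\qquad \widehat{\mathfrak f_+}=\varepsilon\sum_{l\ge0}(-1)^{l+1}(I^l)^i\frac\partial{\partial q^i_l}.$$ $\Gamma^a$ is the vertex operator of $\mathfrak f_a=\sum_lI^{(l)}_a(-z)^l$, with each $I_a^{(l)}$ replaced by its asymptotic series for $|\lambda|\to\infty$, $\arg\lambda\ne\pi/2$ fixed; $\Gamma^a_\infty$ is that of $\mathfrak f_{a,\infty}=\sum_lI^{(l)}_{a,\infty}(-z)^l$. **Proposition.** For every $a\in\mathbb C^2$, as operators whose coefficients are asymptotic series for $\lambda\sim\infty$ ($\arg\lambda\neq\pi/2$), $$\hat S\,\Gamma^a_\infty\,\hat S^{-1}=\exp\Big(\frac{c(t)}2+\frac12\int_\lambda^\infty(\mathcal W_{a,a}-\mathcal W_{a,a}^\infty)\,d\rho\Big)\,\Gamma^a,\qquad c(t)=\frac{(a_1+a_2)^2}4\,(\log t^2+\psi),$$ the integral being taken along the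 ray $\{s\lambda:s\ge1\}$ for $|\lambda|$ large. Precisely: the period vectors exist, the $I_a^{(l)}$ and the exponential factor have asymptotic series, the integral converges, and for every series $F=\sum_{m,n}F_{m,n}q^m\varepsilon^n$ with $F_{m,n}\in\mathbb C$ whose component of $q$-degree $d$ has $\varepsilon$-order at least $\beta(d)$, where $\beta(d)+d\to\infty$ as $d\to\infty$ (in particular for every polynomial in the $q^i_k$ and $\varepsilon^{\pm1}$), both sides applied to $F$ converge and agree. -/

import Mathlib

namespace CatalanFM

noncomputable section

/-! ## The Dubrovin–Frobenius manifold

A point of `M = ℂ × ℂ^*` is a vector `t : Fin 2 → ℂ`; `t 0` is the flat coordinate `t^1` and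
`t 1` is the flat coordinate `t^2`.  The chart in use is `t 1 ∈ Complex.slitPlane`, with
principal branches of all roots and of the logarithm of `t 1`. -/

/-- The flat metric. -/
def eta : Matrix (Fin 2) (Fin 2) ℂ := !![0, 1; 1, 0]

/-- The grading operator. -/
def mu : Matrix (Fin 2) (Fin 2) ℂ := !![1 / 2, 0; 0, -1 / 2]

/-- Multiplication by the Euler vector field, in flat coordinates. -/
def calU (t : Fin 2 → ℂ) : Matrix (Fin 2) (Fin 2) ℂ := !![t 0, 2; 2 * t 1, t 0]

/-- The nilpotent matrix of the Levelt normal form at `z = ∞`. -/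
def calR : Matrix (Fin 2) (Fin 2) ℂ := !![0, 2; 0, 0]

/-- The canonical coordinates `u^1, u^2 = t^1 ± 2 √(t^2)`. -/
def canonCoord (t : Fin 2 → ℂ) : Fin 2 → ℂ :=
  ![t 0 + 2 * (t 1) ^ (1 / 2 : ℂ), t 0 - 2 * (t 1) ^ (1 / 2 : ℂ)]

/-- The matrix `Ψ⁻¹`, from the normalised canonical frame to the flat frame. -/
def PsiInv (t : Fin 2 → ℂ) : Matrix (Fin 2) (Fin 2) ℂ :=
  ((Real.sqrt 2 : ℝ) : ℂ)⁻¹ •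
    !![(t 1) ^ (-1 / 4 : ℂ), Complex.I * (t 1) ^ (-1 / 4 : ℂ);
       (t 1) ^ (1 / 4 : ℂ), -Complex.I * (t 1) ^ (1 / 4 : ℂ)]

/-- The bilinear form `(v, w) = ∑ η_{ij} v^i w^j`. -/
def etaForm (v w : Fin 2 → ℂ) : ℂ := ∑ i, ∑ j, eta i j * v i * w j

/-! ## The calibration -/

/-- The coefficients `S_k` of the calibration `S(t,z) = ∑_{k ≥ 0} S_k z^{-k}`: the solution of
`k S_k + S_k μ - μ S_k = 𝒰 S_{k-1} - S_{k-1} R`, `S_0 = 1`, `(S_1)_{12} = ψ + log t^2`.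
See `calS_recursion`; the entry `(S_1)_{12}` is the only one that the recursion leaves free. -/
def calS (ψ : ℂ) (t : Fin 2 → ℂ) : ℕ → Matrix (Fin 2) (Fin 2) ℂ
  | 0 => 1
  | k + 1 => Matrix.of fun i j =>
      if k = 0 ∧ i = 0 ∧ j = 1 then ψ + Complex.log (t 1)
      else (calU t * calS ψ t k - calS ψ t k * calR) i j / (((k : ℂ) + 1) + mu j j - mu i i)

theorem calS_zero (ψ : ℂ) (t : Fin 2 → ℂ) : calS ψ t 0 = 1 := by
  simp only [calS]

theorem calS_one_apply (ψ : ℂ) (t : Fin 2 → ℂ) :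
    calS ψ t 1 0 1 = ψ + Complex.log (t 1) := by
  simp [calS]

theorem calS_recursion (ψ : ℂ) (t : Fin 2 → ℂ) (k : ℕ) :
    ((k : ℂ) + 1) • calS ψ t (k + 1) + calS ψ t (k + 1) * mu - mu * calS ψ t (k + 1) =
      calU t * calS ψ t k - calS ψ t k * calR := by
  have h1 : (k : ℂ) + 1 ≠ 0 := by exact_mod_cast Nat.succ_ne_zero k
  have h2 : (k : ℂ) + 2 ≠ 0 := by exact_mod_cast Nat.succ_ne_zero (k + 1)
  have key : ∀ i j, (((k : ℂ) + 1) + mu j j - mu i i) * calS ψ t (k + 1) i j =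
      (calU t * calS ψ t k - calS ψ t k * calR) i j := by
    intro i j
    by_cases hc : k = 0 ∧ i = 0 ∧ j = 1
    · obtain ⟨rfl, rfl, rfl⟩ := hc
      simp only [calS_zero]
      norm_num [mu, calU, calR]
    · have hne : ((k : ℂ) + 1) + mu j j - mu i i ≠ 0 := by
        fin_cases i <;> fin_cases j
        · simpa [mu] using h1
        · have hk : (k : ℂ) ≠ 0 := by
            intro h
            apply hc
            exact ⟨by exact_mod_cast h, rfl, rfl⟩
          simp only [mu]
          norm_num
          intro h
          apply hk
          linear_combination h
        · simp only [mu]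
          norm_num
          intro h
          apply h2
          linear_combination h
        · simpa [mu] using h1
      rw [calS]
      simp only [Matrix.of_apply, if_neg hc]
      field_simp
  ext i j
  rw [← key i j]
  simp only [Matrix.sub_apply, Matrix.add_apply, Matrix.smul_apply, Matrix.mul_apply,
    Fin.sum_univ_two, smul_eq_mul]
  fin_cases i <;> fin_cases j <;> simp [mu] <;> ring

/-- The coefficients `s_ℓ` of `log S(z) = ∑_{ℓ ≥ 1} s_ℓ z^{-ℓ}`, with
`log S = ∑_{n ≥ 1} (-1)^{n+1} (S - 1)^n / n` as a formal power series in `z⁻¹`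
(the terms `n > ℓ` do not contribute to the coefficient of `z^{-ℓ}`). -/
def logS (ψ : ℂ) (t : Fin 2 → ℂ) (l : ℕ) : Matrix (Fin 2) (Fin 2) ℂ :=
  ∑ n ∈ Finset.Icc 1 l,
    ((-1 : ℂ) ^ (n + 1) / (n : ℂ)) • PowerSeries.coeff l ((PowerSeries.mk (calS ψ t) - 1) ^ n)

/-! ## The period vectors -/

/-- The logarithm on `ℂ` cut along the positive imaginary axis, with argument in
`(-3π/2, π/2)`; it is real on the positive real axis. -/
def cutLog (w : ℂ) : ℂ := Complex.log (Complex.I * w) - (Real.pi / 2 : ℝ) * Complex.I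

/-- The plane cut along the half-lines `L_i = u^i + 𝗂 ℝ_{≥ 0}`. -/
def cutPlane (t : Fin 2 → ℂ) : Set ℂ :=
  {w | ∀ i, ∀ y : ℝ, 0 ≤ y → w ≠ canonCoord t i + y * Complex.I}

/-- `J` is (on the cut plane) the period vector `I^{(l)}_{e_i}(t, ·)`: it is holomorphic, solves
`(𝒰 - λ) ∂_λ J = (μ + l + 1/2) J`, and near `u^i` it is
`(-1)^l (2π)^{-1/2} Γ(l+1/2) (λ - u^i)^{-l-1/2}` times a function `h` that is single valued and
holomorphic at `u^i`, with `h(u^i) = Ψ⁻¹ e_i`.  This is the normalisation of `J` at `u^i`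
together with the fact that the continuation of `J` along a small loop around `u^i` is `-J`. -/
def IsPeriodVector (t : Fin 2 → ℂ) (i : Fin 2) (l : ℤ) (J : ℂ → Fin 2 → ℂ) : Prop :=
  DifferentiableOn ℂ J (cutPlane t) ∧
  (∀ w ∈ cutPlane t,
    (calU t - w • (1 : Matrix (Fin 2) (Fin 2) ℂ)).mulVec (deriv J w) =
      (mu + ((l : ℂ) + 1 / 2) • (1 : Matrix (Fin 2) (Fin 2) ℂ)).mulVec (J w)) ∧
  ∃ h : ℂ → Fin 2 → ℂ, AnalyticAt ℂ h (canonCoord t i) ∧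
    h (canonCoord t i) = (PsiInv t).mulVec (Pi.single i 1) ∧
    ∀ᶠ w in nhds (canonCoord t i), w ∈ cutPlane t →
      J w = ((-1 : ℂ) ^ l / (Real.sqrt (2 * Real.pi) : ℝ) * Complex.Gamma ((l : ℂ) + 1 / 2) *
        Complex.exp ((-(l : ℂ) - 1 / 2) * cutLog (w - canonCoord t i))) • h w

/-- The period vector `I^{(l)}_{e_i}(t, λ)` on the cut plane. -/
def periodVector (t : Fin 2 → ℂ) (i : Fin 2) (l : ℤ) : ℂ → Fin 2 → ℂ :=
  Classical.epsilon (IsPeriodVector t i l)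

/-- `I^{(l)}_a = a_1 I^{(l)}_{e_1} + a_2 I^{(l)}_{e_2}`. -/
def period (t a : Fin 2 → ℂ) (l : ℤ) (w : ℂ) : Fin 2 → ℂ :=
  ∑ i, a i • periodVector t i l w

/-! ## Asymptotic series at `λ ~ ∞` -/

/-- Formal Laurent series in `λ⁻¹` whose coefficients are polynomials in `log λ`: the coefficient
with index `n` is the polynomial that multiplies `λ^{-n}`. -/
abbrev AsympSeries : Type := LaurentSeries (Polynomial ℂ)

/-- The partial sum, up to and including `λ^{-N}`, with the branch `cutLog` of `log λ`. -/
def partialEval (φ : AsympSeries) (N : ℤ) (w : ℂ) : ℂ :=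
  ∑ n ∈ Finset.Icc φ.order N, (φ.coeff n).eval (cutLog w) * w ^ (-n)

/-- `g(λ) ~ φ(λ)` for `|λ| ~ ∞` and fixed `arg λ ≠ π/2`. -/
def HasAsympExp (g : ℂ → ℂ) (φ : AsympSeries) : Prop :=
  ∀ ω : ℂ, ‖ω‖ = 1 → ω ≠ Complex.I → ∀ N : ℤ,
    Asymptotics.IsLittleO Filter.atTop
      (fun r : ℝ => g ((r : ℂ) * ω) - partialEval φ N ((r : ℂ) * ω))
      (fun r : ℝ => r ^ (-N))

/-- The asymptotic expansion of a function that has one. -/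
def asympExp (g : ℂ → ℂ) : AsympSeries := Classical.epsilon (HasAsympExp g)

/-- The sum of a series in `λ⁻¹` and `log λ` at a given `λ`. -/
def evalSeries (φ : AsympSeries) (w : ℂ) : ℂ :=
  ∑' n : ℤ, (φ.coeff n).eval (cutLog w) * w ^ (-n)

theorem bddBelow_support_of_zero {f : ℤ → Polynomial ℂ} (c : ℤ) (h : ∀ n < c, f n = 0) :
    BddBelow (Function.support f) := by
  refine ⟨c, fun n hn => ?_⟩
  by_contra hlt
  exact hn (h n (not_le.mp hlt))

/-- Formal differentiation `∂_λ`: `∂_λ (p(log λ) λ^{-n}) = (p' - n p)(log λ) λ^{-n-1}`. -/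
def formalDeriv (φ : AsympSeries) : AsympSeries :=
  HahnSeries.ofSuppBddBelow
    (fun n : ℤ => Polynomial.derivative (φ.coeff (n - 1)) - ((n : ℂ) - 1) • φ.coeff (n - 1))
    (bddBelow_support_of_zero (φ.order + 1) fun n hn => by
      have h : φ.coeff (n - 1) = 0 := HahnSeries.coeff_eq_zero_of_lt_order (by omega)
      simp [h])

/-- The polynomial `q` with `∂_λ (q(log λ) λ^{-n}) = p(log λ) λ^{-n-1}`, without integration
constant.  For `n = 0` it is the antiderivative of `p` that vanishes at `0`; for `n ≠ 0` it is the
polynomial solution of `q' - n q = p`.  For instance `∂_λ⁻¹ λ⁻¹ = log λ`,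
`∂_λ⁻¹ λ^k = λ^{k+1}/(k+1)` for `k ≠ -1`, and
`∂_λ⁻¹ (λ^k log λ) = λ^{k+1}/(k+1) (log λ - 1/(k+1))` for `k ≥ 0`. -/
def integCoeff (n : ℤ) (p : Polynomial ℂ) : Polynomial ℂ :=
  if n = 0 then p.sum fun k c => Polynomial.monomial (k + 1) (c / ((k : ℂ) + 1))
  else -∑ j ∈ Finset.range (p.natDegree + 1),
    (((n : ℂ) ^ (j + 1))⁻¹) • (Polynomial.derivative^[j] p)

theorem integCoeff_zero (n : ℤ) : integCoeff n 0 = 0 := by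
  simp [integCoeff]

/-- Formal integration `∂_λ⁻¹`, without integration constants. -/
def formalInt (φ : AsympSeries) : AsympSeries :=
  HahnSeries.ofSuppBddBelow (fun n : ℤ => integCoeff n (φ.coeff (n + 1)))
    (bddBelow_support_of_zero (φ.order - 1) fun n hn => by
      have h : φ.coeff (n + 1) = 0 := HahnSeries.coeff_eq_zero_of_lt_order (by omega)
      simp [h, integCoeff_zero])

/-- `∂_λ^l` for `l ∈ ℤ`. -/
def formalDerivPow (l : ℤ) (φ : AsympSeries) : AsympSeries :=
  if 0 ≤ l then formalDeriv^[l.toNat] φ else formalInt^[(-l).toNat] φ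

/-- A complex constant as an asymptotic series. -/
def asympConst (c : ℂ) : AsympSeries := HahnSeries.C (Polynomial.C c)

/-- The series `log λ`. -/
def asympLog : AsympSeries := HahnSeries.C Polynomial.X

/-- The coefficients `I^{(l)}_{e_i,∞}` of `𝔣_{e_i,∞} = ∑_l I^{(l)}_{e_i,∞} (-z)^l`:
`I^{(l)}_{e_1,∞} = (∂_λ^{l+1} (log λ + ψ/2), ∂_λ^l (1/2))` and
`I^{(l)}_{e_2,∞} = I^{(l)}_{e_1,∞} + (∂_λ^{l+1} (π 𝗂), 0)`. -/
def periodInfBasis (ψ : ℂ) (i : Fin 2) (l : ℤ) : Fin 2 → AsympSeries :=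
  ![formalDerivPow (l + 1) (asympLog + asympConst (ψ / 2)) +
      (if i = 1 then formalDerivPow (l + 1) (asympConst (Real.pi * Complex.I)) else 0),
    formalDerivPow l (asympConst (1 / 2))]

/-- `I^{(l)}_{a,∞} = a_1 I^{(l)}_{e_1,∞} + a_2 I^{(l)}_{e_2,∞}`; these are the coefficients of
`𝔣_{a,∞} = ∑_l I^{(l)}_{a,∞} (-z)^l`. -/
def periodInf (ψ : ℂ) (a : Fin 2 → ℂ) (l : ℤ) : Fin 2 → AsympSeries :=
  ∑ i, a i • periodInfBasis ψ i l

/-- The asymptotic expansions at `λ ~ ∞` of the coefficients `I^{(l)}_a(t, λ)` of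
`𝔣_a = ∑_l I^{(l)}_a (-z)^l`. -/
def periodAsymp (t a : Fin 2 → ℂ) (l : ℤ) : Fin 2 → AsympSeries :=
  fun i => asympExp fun w => period t a l w i

/-! ## The phase factor -/

/-- `𝒲_{a,a}(t, λ) = (I^{(0)}_a, I^{(0)}_a)`. -/
def calW (t a : Fin 2 → ℂ) (w : ℂ) : ℂ := etaForm (period t a 0 w) (period t a 0 w)

/-- `𝒲^∞_{a,a}(λ) = (I^{(0)}_{a,∞}, I^{(0)}_{a,∞})`. -/
def calWInf (ψ : ℂ) (a : Fin 2 → ℂ) (w : ℂ) : ℂ :=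
  etaForm (fun i => evalSeries (periodInf ψ a 0 i) w) (fun i => evalSeries (periodInf ψ a 0 i) w)

/-- The integrand, at `ρ = s λ`, of `∫_λ^∞ (𝒲_{a,a} - 𝒲^∞_{a,a}) dρ` along the ray
`{s λ : s ≥ 1}`. -/
def phaseIntegrand (ψ : ℂ) (t a : Fin 2 → ℂ) (w : ℂ) (s : ℝ) : ℂ :=
  (calW t a ((s : ℂ) * w) - calWInf ψ a ((s : ℂ) * w)) * w

/-- `c(t) = (a_1 + a_2)^2 / 4 * (log t^2 + ψ)`, where `t^2` is the second coordinate of `t`. -/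
def cConst (ψ : ℂ) (t a : Fin 2 → ℂ) : ℂ :=
  (a 0 + a 1) ^ 2 / 4 * (Complex.log (t 1) + ψ)

/-- `exp (c(t)/2 + 1/2 ∫_λ^∞ (𝒲_{a,a} - 𝒲^∞_{a,a}) dρ)`. -/
def phase (ψ : ℂ) (t a : Fin 2 → ℂ) (w : ℂ) : ℂ :=
  Complex.exp (cConst ψ t a / 2 + 1 / 2 * ∫ s in Set.Ioi (1 : ℝ), phaseIntegrand ψ t a w s)

/-! ## The Fock space and the quantization rules -/

/-- The indices of the Darboux coordinates: `(i, k)` stands for `q^{i+1}_k`. -/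
abbrev Var : Type := Fin 2 × ℕ

/-- Formal power series in the variables `q^i_k`, `i = 1, 2`, `k ≥ 0`, and formal Laurent series
in `ε` (infinite in both directions), with coefficients asymptotic series in `λ`: `F m n` is the
coefficient of `q^m ε^n`. -/
def Fock : Type := (Var →₀ ℕ) → ℤ → AsympSeries

instance : AddCommGroup Fock := inferInstanceAs (AddCommGroup ((Var →₀ ℕ) → ℤ → AsympSeries))

instance : Module ℂ Fock := inferInstanceAs (Module ℂ ((Var →₀ ℕ) → ℤ → AsympSeries))

instance : Module AsympSeries Fock :=
  inferInstanceAs (Module AsympSeries ((Var →₀ ℕ) → ℤ → AsympSeries))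

/-- The coefficient of `q^m ε^n λ^{-j} (log λ)^k`. -/
def Fock.scalarCoeff (F : Fock) (x : (Var →₀ ℕ) × ℤ × ℤ × ℕ) : ℂ :=
  ((F x.1 x.2.1).coeff x.2.2.1).coeff x.2.2.2

/-- Convergence in the Fock space is convergence in `ℂ` of each coefficient. -/
instance : TopologicalSpace Fock := TopologicalSpace.induced Fock.scalarCoeff inferInstance

/-- Multiplication by `q_v`. -/
def mulQ (v : Var) (F : Fock) : Fock :=
  fun m n => if m v = 0 then 0 else F (m - Finsupp.single v 1) n

/-- The partial derivative `∂/∂q_v`. -/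
def dQ (v : Var) (F : Fock) : Fock :=
  fun m n => ((m v : ℂ) + 1) • F (m + Finsupp.single v 1) n

/-- Multiplication by `ε^k`. -/
def epsPow (k : ℤ) (F : Fock) : Fock := fun m n => F m (n - k)

/-- The operator given as the sum of the operators `T i`. -/
def opSum {ι : Type} (T : ι → Fock → Fock) (F : Fock) : Fock := ∑' i, T i F

/-- The exponential `∑_n A^n / n!` of the operator `A = ∑_i T i`, applied to `F`. -/
def expOp {ι : Type} (T : ι → Fock → Fock) (F : Fock) : Fock :=
  ∑' n : ℕ, ((n.factorial : ℂ)⁻¹) • (opSum T)^[n] F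

/-- All infinite sums that enter in `expOp T F` converge. -/
def ExpConverges {ι : Type} (T : ι → Fock → Fock) (F : Fock) : Prop :=
  (∀ n : ℕ, Summable fun i => T i ((opSum T)^[n] F)) ∧
    Summable fun n : ℕ => ((n.factorial : ℂ)⁻¹) • (opSum T)^[n] F

/-- The part `∑_{l < 0} I^l (-z)^l` of `𝔣 = ∑_l I^l (-z)^l`. -/
def negPart (f : ℤ → Fin 2 → AsympSeries) : ℤ → Fin 2 → AsympSeries :=
  fun l => if l < 0 then f l else 0

/-- The part `∑_{l ≥ 0} I^l (-z)^l` of `𝔣 = ∑_l I^l (-z)^l`. -/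
def posPart (f : ℤ → Fin 2 → AsympSeries) : ℤ → Fin 2 → AsympSeries :=
  fun l => if 0 ≤ l then f l else 0

/-- The terms of the quantization of the linear Hamiltonian `Ω(𝔣, ·)`, `𝔣 = ∑_l I^l (-z)^l`:
`∑_{l ≥ 0} ∑_i (ε (-1)^{l+1} (I^l)^i ∂/∂q^i_l + ε⁻¹ (I^{-l-1})_i q^i_l)`,
where `(I)_i = ∑_j η_{ij} I^j`. -/
def linHatTerm (f : ℤ → Fin 2 → AsympSeries) (v : Var) (F : Fock) : Fock :=
  (((-1 : AsympSeries) ^ (v.2 + 1)) * f (v.2 : ℤ) v.1) • epsPow 1 (dQ v F) +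
    (∑ j, eta v.1 j • f (-((v.2 : ℤ) + 1)) j) • epsPow (-1) (mulQ v F)

/-- The vertex operator `e^{(𝔣_-)^} e^{(𝔣_+)^}`. -/
def vertexOp (f : ℤ → Fin 2 → AsympSeries) (F : Fock) : Fock :=
  expOp (linHatTerm (negPart f)) (expOp (linHatTerm (posPart f)) F)

/-- All infinite sums that enter in `vertexOp f F` converge. -/
def VertexConverges (f : ℤ → Fin 2 → AsympSeries) (F : Fock) : Prop :=
  ExpConverges (linHatTerm (posPart f)) F ∧
    ExpConverges (linHatTerm (negPart f)) (expOp (linHatTerm (posPart f)) F)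

/-- The terms of the quantization of the quadratic Hamiltonian `1/2 Ω(𝔰 𝔣, 𝔣)`,
`𝔰 = ∑_{ℓ ≥ 1} s_ℓ z^{-ℓ}`:
`1/(2ε²) ∑_{a,b ≥ 0} (-1)^{b+1} (s_{a+b+1})^k_i η_{kj} q^i_a q^j_b
  - ∑_{a ≥ 0, ℓ ≥ 1} (s_ℓ)^j_i q^i_{a+ℓ} ∂/∂q^j_a`.
In the first family `v = (i, a)` and `w = (j, b)`; in the second one `v = (i, ℓ - 1)` and
`w = (j, a)`. -/
def quadHatTerm (s : ℕ → Matrix (Fin 2) (Fin 2) ℂ) :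
    (Var × Var) ⊕ (Var × Var) → Fock → Fock
  | Sum.inl (v, w), F =>
      ((1 / 2 : ℂ) * (-1) ^ (w.2 + 1) * ∑ k, s (v.2 + w.2 + 1) k v.1 * eta k w.1) •
        epsPow (-2) (mulQ v (mulQ w F))
  | Sum.inr (v, w), F =>
      (-(s (v.2 + 1) w.1 v.1)) • mulQ (v.1, w.2 + (v.2 + 1)) (dQ w F)

/-- The terms of `(log S)^`. -/
def SHatTerm (ψ : ℂ) (t : Fin 2 → ℂ) : (Var × Var) ⊕ (Var × Var) → Fock → Fock :=
  quadHatTerm (logS ψ t)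

/-- The terms of `-(log S)^`. -/
def SHatNegTerm (ψ : ℂ) (t : Fin 2 → ℂ) : (Var × Var) ⊕ (Var × Var) → Fock → Fock :=
  fun x F => -SHatTerm ψ t x F

/-- `Ŝ = exp ((log S)^)`. -/
def SHat (ψ : ℂ) (t : Fin 2 → ℂ) : Fock → Fock := expOp (SHatTerm ψ t)

/-- `Ŝ⁻¹ = exp (-(log S)^)`. -/
def SHatInv (ψ : ℂ) (t : Fin 2 → ℂ) : Fock → Fock := expOp (SHatNegTerm ψ t)

/-- `F = ∑ F_{m,n} q^m ε^n`, with complex coefficients, is tame if the `ε`-order of its component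
of degree `d` in `q` is at least `β d`, where `β d + d → ∞` for `d → ∞`. -/
def IsTame (F : (Var →₀ ℕ) → ℤ → ℂ) : Prop :=
  ∃ β : ℕ → ℤ, Filter.Tendsto (fun d : ℕ => β d + (d : ℤ)) Filter.atTop Filter.atTop ∧
    ∀ m n, n < β m.degree → F m n = 0

/-- A series that does not depend on `λ`, as an element of the Fock space. -/
def toFock (F : (Var →₀ ℕ) → ℤ → ℂ) : Fock := fun m n => asympConst (F m n)

end

end CatalanFM

/-!
The operator `ŝ` and the two exponents of a vertex operator are quantizations of a quadratic and of
linear Hamiltonians. The proof has an algebraic part, which conjugates vertex operators by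
`Ŝ = e^ŝ`, and an analytic part, which identifies the vectors and the scalar factor that result.

**Conjugation.** The recursion of the calibration makes `S` symplectic, `S^*(-z) S(z) = 1`
(`symplAdj_calSeries_mul`), so `s = log S` is infinitesimally symplectic (`eta_mul_logS`). With
finitely many variables this gives `[ŝ, 𝔣^] = (s 𝔣)^` for every linear Hamiltonian, and conjugation
by `e^ŝ` replaces `𝔣` by `S 𝔣` (`expLoc_quadTrunc_mul_linTrunc`). The multiplication part `𝔣_-`
stays a multiplication operator, with coefficients `S 𝔣_-`. The differentiation part `𝔣_+` becomes
the sum of the two halves of `S 𝔣_+`, and the Weyl formula `dp_add_of_central` puts its exponential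
into normal order. Since `S 𝔣_- + (S 𝔣_+)_- = (S 𝔣)_-`, what is left is the vertex operator of `S 𝔣`
times the exponential of half the commutator of the two halves of `S 𝔣_+`.

All operators are limits of their truncations. Every term of `ŝ` and of `𝔣_-` contains a variable
and raises the height of a monomial, so the exponentials of these operators are finite sums for each
monomial. The operator of `𝔣_+` involves the variable `q^i_l` only with a coefficient `O(λ^{-l})`.
Hence the identities with the variables `l ≤ K` hold for the full operators up to `O(λ^{-K-1})`, for
all `K` (`annFull_iterate_conj`). On a tame series the derivatives are locally nilpotent with
respect to the degree in `q` plus the degree in `ε`, and the sums converge. The result is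
`conj_vertexOp`.

**The vectors.** The series `S 𝔣_{a,∞}` has coefficients `formalPeriod`, which satisfy the period
system formally. The period vectors `I^{(-1)}` have a closed form (`basePeriod`) in terms of
`√((λ - u^1)(λ - u^2))` and a primitive of its inverse. Near `u^i` this primitive is `2 artanh r`,
with `r² = (λ - u^i) / (λ - u^j)`, up to a constant, which yields the required local form. The other
period vectors are obtained by differentiation and, for `l < -1`, from the system itself; they are
unique, because a solution that vanishes to a higher order at `u^i` would violate the indicial
equation (`SolvesPeriodSystem.eq_zero`). The expansion of the closed form at infinity and the formal
period vector with `l = -1` solve the same formal system and agree in the two coefficients that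
determine a solution (`formalPeriod_neg_one`); all other indices follow (`hasAsympExp_period`).

**The factor.** The commutator is a power series in `λ⁻¹`, an infinite sum over the index `l`. Its
derivative telescopes, and the symplectic property of `S` evaluates the remainder: the result is
`𝒲^∞ - 𝒲` (`derInf_phaseSer`), and the constant term is `c(t)` (`coeff_zero_phaseSer`). On the other
hand `𝒲` is a rational function, so the integral is elementary (`integral_phaseIntegrand`). Hence
half the commutator is the expansion of the logarithm of the phase factor (`taylorSer_phaseLog`).
-/

namespace CatalanFM

noncomputable section

open Finset

set_option linter.unusedSimpArgs false

/-! ### Divided powers in noncommutative algebras -/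

section DividedPowers

variable {E : Type*} [Ring E] [Algebra ℂ E]

/-- The divided power `x ^ n / n!`. -/
def dp (x : E) (n : ℕ) : E := ((n.factorial : ℂ)⁻¹) • x ^ n

@[simp]
theorem dp_zero (x : E) : dp x 0 = 1 := by simp [dp]

theorem dp_succ (x : E) (n : ℕ) : ((n : ℂ) + 1) • dp x (n + 1) = x * dp x n := by
  have h1 : (n : ℂ) + 1 ≠ 0 := by exact_mod_cast Nat.succ_ne_zero n
  have h2 : (n.factorial : ℂ) ≠ 0 := by exact_mod_cast n.factorial_ne_zero
  rw [dp, dp, smul_smul, mul_smul_comm, ← pow_succ', Nat.factorial_succ]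
  congr 1
  push_cast
  field_simp

/-- The Leibniz rule for the coefficients of a product of two power series over a
noncommutative ring. -/
theorem leibniz_antidiagonal (α β : ℕ → E) (N : ℕ) :
    ((N : ℂ) + 1) • ∑ p ∈ antidiagonal (N + 1), α p.1 * β p.2 =
      ∑ p ∈ antidiagonal N, (((p.1 : ℂ) + 1) • α (p.1 + 1)) * β p.2 +
        ∑ p ∈ antidiagonal N, α p.1 * (((p.2 : ℂ) + 1) • β (p.2 + 1)) := by
  have e1 := Finset.Nat.sum_antidiagonal_succ (n := N)
    (f := fun p : ℕ × ℕ => ((p.1 : ℂ) • α p.1) * β p.2)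
  have e2 := Finset.Nat.sum_antidiagonal_succ' (n := N)
    (f := fun p : ℕ × ℕ => α p.1 * ((p.2 : ℂ) • β p.2))
  simp only [Nat.cast_zero, zero_smul, zero_mul, mul_zero, zero_add, Nat.cast_add,
    Nat.cast_one] at e1 e2
  rw [← e1, ← e2, ← Finset.sum_add_distrib, Finset.smul_sum]
  refine Finset.sum_congr rfl fun p hp => ?_
  have hp' : (p.1 : ℂ) + p.2 = N + 1 := by exact_mod_cast mem_antidiagonal.mp hp
  rw [← hp', add_smul, smul_mul_assoc, mul_smul_comm]

theorem smul_left_cancel_nat {a b : E} (N : ℕ) (h : ((N : ℂ) + 1) • a = ((N : ℂ) + 1) • b) :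
    a = b := by
  have h1 : (N : ℂ) + 1 ≠ 0 := by exact_mod_cast Nat.succ_ne_zero N
  have := congrArg (fun x => ((N : ℂ) + 1)⁻¹ • x) h
  simpa [smul_smul, h1] using this

theorem dp_add_of_commute {x y : E} (h : Commute x y) (N : ℕ) :
    dp (x + y) N = ∑ p ∈ antidiagonal N, dp x p.1 * dp y p.2 := by
  induction N with
  | zero => simp
  | succ N ih =>
    apply smul_left_cancel_nat N
    rw [dp_succ, ih, leibniz_antidiagonal]
    simp only [dp_succ]
    rw [Finset.mul_sum, ← Finset.sum_add_distrib]
    refine Finset.sum_congr rfl fun p _ => ?_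
    have : Commute (dp x p.1) y := by
      unfold dp
      exact (h.pow_left p.1).smul_left _
    rw [add_mul, mul_assoc, ← mul_assoc y, ← this.eq, mul_assoc]

/-- If `[x, h k] = (k + 1) h (k + 1)`, then `e^x h 0 = (∑ k, h k) e^x`, in each degree. -/
theorem dp_mul_of_commutator {x : E} {h : ℕ → E}
    (hx : ∀ k, x * h k = h k * x + ((k : ℂ) + 1) • h (k + 1)) (N : ℕ) :
    dp x N * h 0 = ∑ p ∈ antidiagonal N, h p.1 * dp x p.2 := by
  induction N with
  | zero => simp
  | succ N ih =>
    apply smul_left_cancel_nat N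
    rw [← smul_mul_assoc, dp_succ, mul_assoc, ih, leibniz_antidiagonal]
    simp only [dp_succ]
    rw [Finset.mul_sum, ← Finset.sum_add_distrib]
    refine Finset.sum_congr rfl fun p _ => ?_
    rw [← mul_assoc, hx, add_mul, add_comm, mul_assoc]

/-- The normally ordered divided power `∑ m^k/k! d^q/q!`, `k + q = N`. -/
def normalOrd (m d : E) (N : ℕ) : E := ∑ p ∈ antidiagonal N, dp m p.1 * dp d p.2

/-- The coefficient of `y^n` in `exp (z y² / 2)`. -/
def halfSquareExp (z : E) (n : ℕ) : E := if Even n then dp ((1 / 2 : ℂ) • z) (n / 2) else 0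

theorem halfSquareExp_zero (z : E) : halfSquareExp z 0 = 1 := by simp [halfSquareExp]

theorem halfSquareExp_one (z : E) : halfSquareExp z 1 = 0 := by simp [halfSquareExp]

theorem halfSquareExp_add_two (z : E) (n : ℕ) :
    ((n : ℂ) + 2) • halfSquareExp z (n + 2) = z * halfSquareExp z n := by
  unfold halfSquareExp
  by_cases hn : Even n
  · obtain ⟨k, rfl⟩ := hn
    have h1 : Even (k + k) := ⟨k, rfl⟩
    have h2 : Even (k + k + 2) := ⟨k + 1, by ring⟩
    rw [if_pos h1, if_pos h2]
    have e1 : (k + k) / 2 = k := by omega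
    have e2 : (k + k + 2) / 2 = k + 1 := by omega
    rw [e1, e2]
    have e3 : (((k + k : ℕ) : ℂ) + 2) = 2 * ((k : ℂ) + 1) := by push_cast; ring
    rw [e3, mul_smul, dp_succ, smul_mul_assoc, smul_smul]
    norm_num
  · have h2 : ¬ Even (n + 2) := by
      intro h
      exact hn ((Nat.even_add.mp h).mpr (by decide))
    rw [if_neg hn, if_neg h2, smul_zero, mul_zero]

theorem commute_halfSquareExp {z a : E} (h : Commute z a) (n : ℕ) :
    Commute (halfSquareExp z n) a := by
  unfold halfSquareExp dp
  split_ifs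
  · exact ((h.smul_left _).pow_left _).smul_left _
  · exact Commute.zero_left _

/-- The recursion behind the Weyl formula: `m + d` times a normally ordered power is reordered at
the cost of one factor `z`. -/
theorem mul_normalOrd {m d z : E} (hd : d * m = m * d + z) (hzm : Commute z m) (N : ℕ) :
    (m + d) * normalOrd m d (N + 1) =
      ((N : ℂ) + 2) • normalOrd m d (N + 2) + z * normalOrd m d N := by
  have hk : ∀ k, d * dp m (k + 1) = dp m (k + 1) * d + z * dp m k := by
    intro k
    induction k with
    | zero => simpa [dp] using hd
    | succ k ih =>
      apply smul_left_cancel_nat (k + 1)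
      have hzk : Commute z (dp m (k + 1)) := by
        unfold dp
        exact (hzm.pow_right _).smul_right _
      rw [smul_add, ← mul_smul_comm, ← smul_mul_assoc, dp_succ, ← mul_assoc, hd, add_mul,
        mul_assoc, ih, mul_add, ← mul_assoc, ← mul_assoc m z, ← hzm.eq, mul_assoc z m, ← dp_succ,
        add_assoc]
      congr 1
      rw [← dp_succ m k, mul_smul_comm]
      push_cast
      simp only [add_smul, one_smul]
  have e : ((N : ℂ) + 2) = (((N + 1 : ℕ) : ℂ) + 1) := by push_cast; ring
  have e1 := leibniz_antidiagonal (dp m) (dp d) (N + 1)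
  unfold normalOrd
  rw [e, e1]
  simp only [dp_succ]
  rw [add_mul, Finset.mul_sum, Finset.mul_sum, add_assoc]
  simp only [mul_assoc]
  congr 1
  rw [Finset.Nat.sum_antidiagonal_succ, Finset.Nat.sum_antidiagonal_succ, Finset.mul_sum,
    add_assoc, ← Finset.sum_add_distrib]
  congr 1
  · simp
  · refine Finset.sum_congr rfl fun p _ => ?_
    dsimp only
    rw [← mul_assoc, hk, add_mul, mul_assoc, mul_assoc]

/-- The Weyl formula `e^{m + d} = e^{z/2} e^m e^d` for `[d, m] = z` central, in each degree. -/
theorem dp_add_of_central {m d z : E} (hd : d * m = m * d + z) (hzm : Commute z m)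
    (hzd : Commute z d) (N : ℕ) :
    dp (m + d) N = ∑ p ∈ antidiagonal N, halfSquareExp z p.1 * normalOrd m d p.2 := by
  have h0 : (m + d) * normalOrd m d 0 = normalOrd m d 1 := by
    simp [normalOrd, Finset.Nat.antidiagonal_succ, dp, add_comm]
  induction N with
  | zero => simp [normalOrd, halfSquareExp_zero]
  | succ N ih =>
    apply smul_left_cancel_nat N
    have hc : ∀ i, Commute (halfSquareExp z i) (m + d) := fun i =>
      commute_halfSquareExp (hzm.add_right hzd) i
    rw [dp_succ, ih, leibniz_antidiagonal, Finset.mul_sum]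
    have e1 : ∀ p ∈ antidiagonal N, (m + d) * (halfSquareExp z p.1 * normalOrd m d p.2) =
        halfSquareExp z p.1 * ((m + d) * normalOrd m d p.2) := fun p _ => by
      rw [← mul_assoc, ← (hc p.1).eq, mul_assoc]
    rw [Finset.sum_congr rfl e1]
    cases N with
    | zero => simp [h0, halfSquareExp_zero, halfSquareExp_one]
    | succ N =>
      rw [Finset.Nat.sum_antidiagonal_succ' (n := N), Finset.Nat.sum_antidiagonal_succ' (n := N)
        (f := fun p => halfSquareExp z p.1 * (((p.2 : ℂ) + 1) • normalOrd m d (p.2 + 1))),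
        Finset.Nat.sum_antidiagonal_succ (n := N)
        (f := fun p => (((p.1 : ℂ) + 1) • halfSquareExp z (p.1 + 1)) * normalOrd m d p.2)]
      simp only [mul_normalOrd hd hzm, h0, mul_add, Finset.sum_add_distrib]
      -- the derivative of `exp (z y² / 2)` supplies the terms with a factor `z`
      have e2 : ∀ p ∈ antidiagonal N,
          ((((p.1 + 1 : ℕ) : ℂ) + 1) • halfSquareExp z (p.1 + 1 + 1)) * normalOrd m d p.2 =
            halfSquareExp z p.1 * (z * normalOrd m d p.2) := fun p _ => by
        have e : ((((p.1 + 1 : ℕ) : ℂ) + 1)) = (p.1 : ℂ) + 2 := by push_cast; ring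
        rw [e, halfSquareExp_add_two, ← mul_assoc,
          (commute_halfSquareExp (Commute.refl z) p.1).eq]
      rw [Finset.sum_congr rfl e2]
      simp only [Nat.cast_zero, zero_add, one_smul, halfSquareExp_one, zero_mul, Nat.cast_add,
        Nat.cast_one]
      have e3 : ∀ k : ℕ, (k : ℂ) + 1 + 1 = k + 2 := fun k => by ring
      simp only [e3]
      abel

end DividedPowers

/-! ### Exponential and logarithm of matrix power series -/

section ExpLog

/-- Both `e = exp (log (1 + X))` and `1 + X` solve `(1 + X) e' = e`, and they agree in degree
`0`. -/
theorem exp_subst_log : (PowerSeries.exp ℂ).subst (PowerSeries.log ℂ) = 1 + PowerSeries.X := by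
  set e := (PowerSeries.exp ℂ).subst (PowerSeries.log ℂ) with he
  have hd : PowerSeries.derivative ℂ e = e * PowerSeries.derivative ℂ (PowerSeries.log ℂ) := by
    rw [he, PowerSeries.derivative_subst PowerSeries.HasSubst.log, PowerSeries.derivative_exp]
  have hg : PowerSeries.derivative ℂ (PowerSeries.log ℂ) * (1 + PowerSeries.X) = 1 := by
    rw [PowerSeries.deriv_log]
    ext n
    cases n with
    | zero => simp [mul_add]
    | succ n => simp [mul_add, PowerSeries.coeff_succ_mul_X, pow_succ, PowerSeries.coeff_one]
  have h1 : PowerSeries.derivative ℂ e * (1 + PowerSeries.X) = e := by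
    rw [hd, mul_assoc, hg, mul_one]
  have hc : ∀ n, PowerSeries.coeff (n + 1) e * (n + 1) + PowerSeries.coeff n e * n =
      PowerSeries.coeff n e := by
    intro n
    have := congrArg (PowerSeries.coeff n) h1
    rw [mul_add, mul_one, map_add, PowerSeries.coeff_derivative] at this
    cases n with
    | zero => simpa using this
    | succ n =>
      rw [PowerSeries.coeff_succ_mul_X, PowerSeries.coeff_derivative] at this
      simpa using this
  have h0 : PowerSeries.coeff 0 e = 1 := by
    rw [he, PowerSeries.coeff_subst' PowerSeries.HasSubst.log, finsum_eq_single _ 0]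
    · simp
    · intro n hn
      simp [hn]
  have h1' : PowerSeries.coeff 1 e = 1 := by
    have := hc 0
    simpa [h0] using this
  have h2 : ∀ n, PowerSeries.coeff (n + 2) e = 0 := by
    intro n
    induction n with
    | zero =>
      have := hc 1
      simp [h1'] at this
      simpa using this
    | succ n ih =>
      have := hc (n + 2)
      rw [ih] at this
      simp only [zero_mul, add_zero] at this
      have hne : (((n + 2 : ℕ) : ℂ) + 1) ≠ 0 := by exact_mod_cast Nat.succ_ne_zero (n + 2)
      exact (mul_eq_zero.mp this).resolve_right hne
  ext n
  match n with
  | 0 => simp [h0]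
  | 1 => simp [h1', PowerSeries.coeff_one]
  | n + 2 => simp [h2, PowerSeries.coeff_one, PowerSeries.coeff_X]

theorem sum_range_antidiagonal {M : Type*} [AddCommMonoid M] (f : ℕ → ℕ → M) (L : ℕ) :
    ∑ N ∈ range L, ∑ p ∈ antidiagonal N, f p.1 p.2 =
      ∑ i ∈ range L, ∑ j ∈ range (L - i), f i j := by
  rw [← Finset.sum_range_diag_flip]
  refine Finset.sum_congr rfl fun N _ => ?_
  rw [Finset.Nat.sum_antidiagonal_eq_sum_range_succ_mk]

variable {R : Type*} [Ring R]

/-- The power series `a` is divisible by `X ^ n`. -/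
def VanishBelow (n : ℕ) (a : PowerSeries R) : Prop := ∀ m < n, PowerSeries.coeff m a = 0

theorem VanishBelow.mul {m n : ℕ} {a b : PowerSeries R} (ha : VanishBelow m a)
    (hb : VanishBelow n b) : VanishBelow (m + n) (a * b) := by
  intro k hk
  rw [PowerSeries.coeff_mul]
  refine Finset.sum_eq_zero fun p hp => ?_
  have hp' := mem_antidiagonal.mp hp
  by_cases h : p.1 < m
  · rw [ha _ h, zero_mul]
  · rw [hb p.2 (by omega), mul_zero]

theorem VanishBelow.mono {m n : ℕ} (h : m ≤ n) {a : PowerSeries R} (ha : VanishBelow n a) :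
    VanishBelow m a := fun k hk => ha k (by omega)

theorem VanishBelow.zero_left (a : PowerSeries R) : VanishBelow 0 a :=
  fun k hk => absurd hk (Nat.not_lt_zero k)

theorem VanishBelow.mul_left {n : ℕ} (a : PowerSeries R) {b : PowerSeries R}
    (hb : VanishBelow n b) : VanishBelow n (a * b) := by
  simpa using (VanishBelow.zero_left a).mul hb

theorem VanishBelow.mul_right {n : ℕ} {a : PowerSeries R} (b : PowerSeries R)
    (ha : VanishBelow n a) : VanishBelow n (a * b) := by
  simpa using ha.mul (VanishBelow.zero_left b)

theorem VanishBelow.add {n : ℕ} {a b : PowerSeries R} (ha : VanishBelow n a)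
    (hb : VanishBelow n b) : VanishBelow n (a + b) := fun k hk => by
  rw [map_add, ha k hk, hb k hk, add_zero]

theorem VanishBelow.sub {n : ℕ} {a b : PowerSeries R} (ha : VanishBelow n a)
    (hb : VanishBelow n b) : VanishBelow n (a - b) := fun k hk => by
  rw [map_sub, ha k hk, hb k hk, sub_zero]

theorem VanishBelow.sum {ι : Type*} {n : ℕ} {s : Finset ι} {a : ι → PowerSeries R}
    (ha : ∀ i ∈ s, VanishBelow n (a i)) : VanishBelow n (∑ i ∈ s, a i) := fun k hk => by
  rw [map_sum]
  exact Finset.sum_eq_zero fun i hi => ha i hi k hk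

theorem VanishBelow.pow {a : PowerSeries R} (ha : VanishBelow 1 a) (k : ℕ) :
    VanishBelow k (a ^ k) := by
  induction k with
  | zero => exact VanishBelow.zero_left _
  | succ k ih => rw [pow_succ]; exact ih.mul ha

theorem VanishBelow.pow_sub_pow {n : ℕ} {a b : PowerSeries R} (h : VanishBelow n (a - b))
    (k : ℕ) : VanishBelow n (a ^ k - b ^ k) := by
  induction k with
  | zero => simp [VanishBelow]
  | succ k ih =>
    have e : a ^ (k + 1) - b ^ (k + 1) = a ^ k * (a - b) + (a ^ k - b ^ k) * b := by
      rw [pow_succ, pow_succ, mul_sub, sub_mul]; abel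
    rw [e]
    exact (h.mul_left _).add (ih.mul_right _)

/-- The powers `k ≥ 2` of a series without constant term gain one order of agreement. -/
theorem VanishBelow.pow_sub_pow_succ {n : ℕ} {a b : PowerSeries R} (ha : VanishBelow 1 a)
    (hb : VanishBelow 1 b) (h : VanishBelow n (a - b)) (k : ℕ) :
    VanishBelow (n + 1) (a ^ (k + 2) - b ^ (k + 2)) := by
  have e : a ^ (k + 2) - b ^ (k + 2) =
      a ^ (k + 1) * (a - b) + (a ^ (k + 1) - b ^ (k + 1)) * b := by
    rw [pow_succ a (k + 1), pow_succ b (k + 1), mul_sub, sub_mul]; abel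
  rw [e]
  refine VanishBelow.add ?_ ((h.pow_sub_pow (k + 1)).mul hb)
  have := (ha.pow (k + 1)).mul h
  exact this.mono (by omega)

variable [Algebra ℂ R]

theorem VanishBelow.smul {n : ℕ} {a : PowerSeries R} (c : ℂ) (ha : VanishBelow n a) :
    VanishBelow n (c • a) := fun k hk => by
  rw [PowerSeries.coeff_smul, ha k hk, smul_zero]

theorem VanishBelow.dp {a : PowerSeries R} (ha : VanishBelow 1 a) (k : ℕ) :
    VanishBelow k (dp a k) := (ha.pow k).smul _

/-- The exponential of a power series without constant term. -/
def expSeries (a : PowerSeries R) : PowerSeries R :=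
  PowerSeries.mk fun n => ∑ k ∈ range (n + 1), PowerSeries.coeff n (dp a k)

theorem coeff_expSeries {a : PowerSeries R} (ha : VanishBelow 1 a) {n M : ℕ} (h : n < M) :
    PowerSeries.coeff n (expSeries a) = ∑ k ∈ range M, PowerSeries.coeff n (dp a k) := by
  rw [expSeries, PowerSeries.coeff_mk]
  refine Finset.sum_subset (by intro k; simp only [mem_range]; omega) fun k _ hk => ?_
  exact ha.dp k n (by simpa using hk)

theorem vanishBelow_expSeries_sub {a : PowerSeries R} (ha : VanishBelow 1 a) (M : ℕ) :
    VanishBelow M (expSeries a - ∑ k ∈ range M, dp a k) := fun n hn => by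
  rw [map_sub, coeff_expSeries ha hn, map_sum, sub_self]

theorem expSeries_mul_neg {a : PowerSeries R} (ha : VanishBelow 1 a) :
    expSeries a * expSeries (-a) = 1 := by
  have ha' : VanishBelow 1 (-a) := fun k hk => by rw [map_neg, ha k hk, neg_zero]
  ext n
  set L := n + 1
  set e1 := ∑ k ∈ range L, dp a k
  set e2 := ∑ k ∈ range L, dp (-a) k
  have h1 : VanishBelow L (expSeries a * expSeries (-a) - e1 * e2) := by
    have e : expSeries a * expSeries (-a) - e1 * e2 =
        expSeries a * (expSeries (-a) - e2) + (expSeries a - e1) * e2 := by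
      rw [mul_sub, sub_mul]; abel
    rw [e]
    exact ((vanishBelow_expSeries_sub ha' L).mul_left _).add
      ((vanishBelow_expSeries_sub ha L).mul_right _)
  -- the pairs `i, j < L` with `i + j ≥ L` do not contribute below the order `L`
  have h2 : VanishBelow L (e1 * e2 - ∑ N ∈ range L, ∑ p ∈ antidiagonal N,
      dp a p.1 * dp (-a) p.2) := by
    rw [sum_range_antidiagonal (fun i j => dp a i * dp (-a) j), Finset.sum_mul_sum,
      ← Finset.sum_sub_distrib]
    refine VanishBelow.sum fun i hi => ?_
    have hs : range (L - i) ⊆ range L := by intro k; simp only [mem_range]; omega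
    rw [← Finset.sum_sdiff hs, add_sub_cancel_right]
    refine VanishBelow.sum fun j hj => ((ha.dp i).mul (ha'.dp j)).mono ?_
    simp only [mem_sdiff, mem_range] at hj
    omega
  have h3 : ∑ N ∈ range L, ∑ p ∈ antidiagonal N, dp a p.1 * dp (-a) p.2 = 1 := by
    simp only [← dp_add_of_commute (Commute.neg_right (Commute.refl a))]
    rw [add_neg_cancel, Finset.sum_range_succ']
    simp [dp]
  have h4 := h1.add h2 n (Nat.lt_succ_self n)
  rw [h3] at h4
  simpa [sub_eq_zero] using h4

/-- The linear terms determine `a` and `b`, order by order: the powers of order at least two agree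
one order further than `a` and `b` do. -/
theorem expSeries_injective {a b : PowerSeries R} (ha : VanishBelow 1 a) (hb : VanishBelow 1 b)
    (h : expSeries a = expSeries b) : a = b := by
  have key : ∀ n, VanishBelow (n + 1) (a - b) := by
    intro n
    induction n with
    | zero => exact ha.sub hb
    | succ n ih =>
      intro m hm
      by_cases hmn : m < n + 1
      · exact ih m hmn
      have hmn' : m = n + 1 := by omega
      subst hmn'
      have h1 := congrArg (PowerSeries.coeff (n + 1)) h
      rw [coeff_expSeries ha (Nat.lt_add_of_pos_right (k := 2) (by omega)),
        coeff_expSeries hb (Nat.lt_add_of_pos_right (k := 2) (by omega)),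
        Finset.sum_range_succ', Finset.sum_range_succ', Finset.sum_range_succ' _ (n + 1 + 1),
        Finset.sum_range_succ' _ (n + 1)] at h1
      have h2 : ∀ k, PowerSeries.coeff (n + 1) (dp a (k + 1 + 1)) =
          PowerSeries.coeff (n + 1) (dp b (k + 1 + 1)) := by
        intro k
        have := VanishBelow.pow_sub_pow_succ ha hb ih k (n + 1) (by omega)
        rw [map_sub, sub_eq_zero] at this
        rw [dp, dp, PowerSeries.coeff_smul, PowerSeries.coeff_smul, this]
      simp only [h2] at h1
      simp only [dp_zero, zero_add, add_left_inj, add_right_inj] at h1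
      simpa [dp, sub_eq_zero] using h1
  ext n
  have := key n n (Nat.lt_succ_self n)
  rwa [map_sub, sub_eq_zero] at this

/-- The logarithm of `1 + N` for a power series `N` without constant term. -/
def logSeries (N : PowerSeries R) : PowerSeries R :=
  PowerSeries.mk fun l => ∑ n ∈ Finset.Icc 1 l,
    ((-1 : ℂ) ^ (n + 1) / (n : ℂ)) • PowerSeries.coeff l (N ^ n)

theorem vanishBelow_logSeries (N : PowerSeries R) : VanishBelow 1 (logSeries N) := by
  intro m hm
  obtain rfl : m = 0 := by omega
  simp [logSeries]

/-- The identity `exp (log (1 + N)) = 1 + N`, obtained by evaluating the truncations of the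
corresponding identity in `ℂ⟦X⟧` at `N`. -/
theorem expSeries_logSeries {N : PowerSeries R} (hN : VanishBelow 1 N) :
    expSeries (logSeries N) = 1 + N := by
  ext l
  set p : Polynomial ℂ := PowerSeries.trunc (l + 1) (PowerSeries.log ℂ)
  set q : Polynomial ℂ := ∑ k ∈ range (l + 1), dp p k - (1 + Polynomial.X) with hq
  have hlog : VanishBelow 1 (PowerSeries.log ℂ) := by
    intro m hm
    obtain rfl : m = 0 := by omega
    simp
  have hp : VanishBelow (l + 1) ((p : PowerSeries ℂ) - PowerSeries.log ℂ) := by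
    intro m hm
    rw [map_sub, Polynomial.coeff_coe, PowerSeries.coeff_trunc, if_pos hm, sub_self]
  -- `q` is the truncated identity `exp (log (1 + X)) - (1 + X) = 0`, so `X ^ (l + 1)` divides it
  have hq0 : ∀ m < l + 1, q.coeff m = 0 := by
    intro m hm
    have e1 : (PowerSeries.coeff m) ((PowerSeries.exp ℂ).subst (PowerSeries.log ℂ)) =
        ∑ k ∈ range (l + 1), PowerSeries.coeff m (dp (PowerSeries.log ℂ) k) := by
      rw [PowerSeries.coeff_subst' PowerSeries.HasSubst.log,
        finsum_eq_sum_of_support_subset (s := range (l + 1))]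
      · refine Finset.sum_congr rfl fun k _ => ?_
        simp [dp, PowerSeries.coeff_exp]
      · intro k hk
        simp only [coe_range, Set.mem_Iio]
        by_contra hlt
        apply hk
        simp only [hlog.pow k m (by omega), smul_zero]
    rw [← Polynomial.coeff_coe, hq]
    have e2 : ((∑ k ∈ range (l + 1), dp p k - (1 + Polynomial.X) : Polynomial ℂ) :
        PowerSeries ℂ) = ∑ k ∈ range (l + 1), dp (p : PowerSeries ℂ) k -
          (1 + PowerSeries.X) := by
      have e3 : ∀ k, ((dp p k : Polynomial ℂ) : PowerSeries ℂ) = dp (p : PowerSeries ℂ) k := by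
        intro k
        simp [dp, Polynomial.coe_smul, Polynomial.coe_pow]
      rw [← Polynomial.coeToPowerSeries.ringHom_apply, map_sub, map_sum]
      simp [e3]
    rw [e2, ← exp_subst_log, map_sub, e1, map_sum, ← Finset.sum_sub_distrib]
    refine Finset.sum_eq_zero fun k _ => ?_
    rw [← map_sub, dp, dp, ← smul_sub]
    exact ((hp.pow_sub_pow k).smul _) m hm
  obtain ⟨q', hq'⟩ := Polynomial.X_pow_dvd_iff.mpr hq0
  have h1 : VanishBelow (l + 1) (Polynomial.aeval N q) := by
    rw [hq', map_mul, map_pow, Polynomial.aeval_X]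
    exact (hN.pow (l + 1)).mul_right _
  have h2 : VanishBelow (l + 1) (Polynomial.aeval N p - logSeries N) := by
    intro m hm
    rw [map_sub, sub_eq_zero, Polynomial.aeval_eq_sum_range' (n := l + 1)
      (PowerSeries.natDegree_trunc_lt _ _), map_sum, logSeries, PowerSeries.coeff_mk]
    symm
    have hsub : Finset.Icc 1 m ⊆ range (l + 1) := by
      intro k; simp only [mem_range, Finset.mem_Icc]; omega
    rw [← Finset.sum_subset hsub (f := fun n => PowerSeries.coeff m (p.coeff n • N ^ n))]
    · refine Finset.sum_congr rfl fun k hk => ?_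
      simp only [Finset.mem_Icc] at hk
      rw [PowerSeries.coeff_smul, PowerSeries.coeff_trunc, if_pos (by omega),
        PowerSeries.coeff_log, if_neg (by omega)]
      congr 1
      simp
    · intro k hk hk'
      simp only [mem_range, Finset.mem_Icc] at hk hk'
      by_cases h0 : k = 0
      · subst h0
        simp [p, PowerSeries.coeff_trunc]
      · rw [PowerSeries.coeff_smul, hN.pow k m (by omega), smul_zero]
  have h3 : Polynomial.aeval N q = ∑ k ∈ range (l + 1), dp (Polynomial.aeval N p) k - (1 + N) := by
    simp [hq, dp]
  rw [coeff_expSeries (vanishBelow_logSeries N) (Nat.lt_succ_self l)]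
  have h4 : VanishBelow (l + 1) (∑ k ∈ range (l + 1), dp (Polynomial.aeval N p) k -
      ∑ k ∈ range (l + 1), dp (logSeries N) k) := by
    rw [← Finset.sum_sub_distrib]
    refine VanishBelow.sum fun k _ => ?_
    rw [dp, dp, ← smul_sub]
    exact (h2.pow_sub_pow k).smul _
  have h5 := h1.sub h4 l (Nat.lt_succ_self l)
  rw [h3] at h5
  simpa [sub_eq_zero] using h5

end ExpLog

/-! ### The symplectic property of the calibration -/

section Symplectic

local notation "Mat" => Matrix (Fin 2) (Fin 2) ℂ

theorem eta_mul_eta : eta * eta = 1 := by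
  ext i j
  fin_cases i <;> fin_cases j <;> simp [eta, Matrix.mul_apply]

theorem eta_transpose : eta.transpose = eta := by
  ext i j
  fin_cases i <;> fin_cases j <;> simp [eta]

/-- The anti-automorphism `P(z) ↦ P^*(-z)` of matrix power series in `z⁻¹`, where `*` is the
adjoint with respect to `η`. -/
def symplAdj (P : PowerSeries Mat) : PowerSeries Mat :=
  PowerSeries.mk fun k => ((-1 : ℂ) ^ k) • (eta * (PowerSeries.coeff k P).transpose * eta)

theorem symplAdj_mul (P Q : PowerSeries Mat) :
    symplAdj (P * Q) = symplAdj Q * symplAdj P := by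
  ext1 n
  rw [symplAdj, PowerSeries.coeff_mk, PowerSeries.coeff_mul, PowerSeries.coeff_mul,
    Matrix.transpose_sum, Finset.mul_sum, Finset.sum_mul, Finset.smul_sum]
  rw [← Finset.Nat.sum_antidiagonal_swap]
  refine Finset.sum_congr rfl fun p hp => ?_
  have hp' := mem_antidiagonal.mp hp
  simp only [symplAdj, PowerSeries.coeff_mk, Prod.fst_swap, Prod.snd_swap, Matrix.transpose_mul]
  rw [smul_mul_smul_comm, ← pow_add, hp']
  congr 1
  calc _ = eta * (PowerSeries.coeff p.1 Q).transpose * 1 *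
        (PowerSeries.coeff p.2 P).transpose * eta := by simp only [mul_assoc, mul_one]
    _ = _ := by rw [← eta_mul_eta]; simp only [mul_assoc]

theorem symplAdj_one : symplAdj 1 = 1 := by
  ext1 n
  rw [symplAdj, PowerSeries.coeff_mk, PowerSeries.coeff_one]
  split_ifs with h
  · subst h; simp [eta_mul_eta]
  · simp

theorem symplAdj_dp (P : PowerSeries Mat) (k : ℕ) : symplAdj (dp P k) = dp (symplAdj P) k := by
  have h1 : ∀ k, symplAdj (P ^ k) = symplAdj P ^ k := by
    intro k
    induction k with
    | zero => simp [symplAdj_one]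
    | succ k ih => rw [pow_succ', symplAdj_mul, ih, pow_succ]
  rw [dp, dp, ← h1]
  ext1 n
  simp only [symplAdj, PowerSeries.coeff_mk, PowerSeries.coeff_smul, Matrix.transpose_smul,
    mul_smul_comm, smul_mul_assoc]
  rw [smul_comm]

theorem symplAdj_expSeries (P : PowerSeries Mat) :
    symplAdj (expSeries P) = expSeries (symplAdj P) := by
  ext1 n
  rw [expSeries, expSeries, PowerSeries.coeff_mk, symplAdj, PowerSeries.coeff_mk,
    PowerSeries.coeff_mk, Matrix.transpose_sum, Finset.mul_sum, Finset.sum_mul, Finset.smul_sum]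
  refine Finset.sum_congr rfl fun k _ => ?_
  rw [← symplAdj_dp, symplAdj, PowerSeries.coeff_mk]

theorem vanishBelow_symplAdj {P : PowerSeries Mat} {n : ℕ} (hP : VanishBelow n P) :
    VanishBelow n (symplAdj P) := by
  intro m hm
  rw [symplAdj, PowerSeries.coeff_mk, hP m hm]
  simp

variable (ψ : ℂ) (t : Fin 2 → ℂ)

/-- The calibration as a matrix power series in `z⁻¹`. -/
def calSeries : PowerSeries Mat := PowerSeries.mk (calS ψ t)

theorem logS_eq (l : ℕ) :
    logS ψ t l = PowerSeries.coeff l (logSeries (calSeries ψ t - 1)) := by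
  rw [logSeries, PowerSeries.coeff_mk]
  rfl

theorem vanishBelow_calSeries_sub_one : VanishBelow 1 (calSeries ψ t - 1) := by
  intro m hm
  obtain rfl : m = 0 := by omega
  rw [map_sub, calSeries, PowerSeries.coeff_mk, calS_zero, PowerSeries.coeff_one, if_pos rfl,
    sub_self]

theorem expSeries_logS :
    expSeries (PowerSeries.mk (logS ψ t)) = calSeries ψ t := by
  have : PowerSeries.mk (logS ψ t) = logSeries (calSeries ψ t - 1) := by
    ext1 l
    rw [PowerSeries.coeff_mk, logS_eq]
  rw [this, expSeries_logSeries (vanishBelow_calSeries_sub_one ψ t), add_sub_cancel]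

theorem logS_zero : logS ψ t 0 = 0 := by simp [logS]

/-- The coefficient of `S^*(-z) S(z)` at `z^{-n}`. -/
theorem coeff_symplAdj_mul (n : ℕ) :
    PowerSeries.coeff n (symplAdj (calSeries ψ t) * calSeries ψ t) =
      ∑ p ∈ antidiagonal n, (((-1 : ℂ) ^ p.1) • (eta * (calS ψ t p.1).transpose * eta)) *
        calS ψ t p.2 := by
  rw [PowerSeries.coeff_mul]
  simp only [symplAdj, calSeries, PowerSeries.coeff_mk]

/-- The grading operator and the recursion for the coefficients of `S` give a recursion for those
of `S^*(-z) S(z)`, in which the multiplication by the Euler vector field cancels. -/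
theorem symplAdj_mul_recursion (n : ℕ) :
    let P := fun n => PowerSeries.coeff n (symplAdj (calSeries ψ t) * calSeries ψ t)
    ((n : ℂ) + 1) • P (n + 1) + P (n + 1) * mu - mu * P (n + 1) = calR * P n - P n * calR := by
  intro P
  set α : ℕ → Mat := fun k => ((-1 : ℂ) ^ k) • (eta * (calS ψ t k).transpose * eta) with hα
  set β : ℕ → Mat := calS ψ t with hβ
  have hP : ∀ n, P n = ∑ p ∈ antidiagonal n, α p.1 * β p.2 := coeff_symplAdj_mul ψ t
  have hβr : ∀ k : ℕ, ((k : ℂ) + 1) • β (k + 1) + (β (k + 1) * mu - mu * β (k + 1)) =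
      calU t * β k - β k * calR := fun k => by
    rw [← add_sub_assoc]; exact calS_recursion ψ t k
  -- the adjoint of the recursion `hβr`: here `μ` changes its sign, while `𝒰` and `R` do not
  have hαr : ∀ k : ℕ, ((k : ℂ) + 1) • α (k + 1) + (α (k + 1) * mu - mu * α (k + 1)) =
      calR * α k - α k * calU t := by
    intro k
    have h := congrArg (fun M : Mat => ((-1 : ℂ) ^ (k + 1)) • (eta * M.transpose * eta)) (hβr k)
    simp only [hα, pow_succ, mul_neg, mul_one, neg_smul] at h ⊢
    ext i j
    have h' := congrFun (congrFun h i) j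
    simp only [Matrix.add_apply, Matrix.sub_apply, Matrix.neg_apply, Matrix.smul_apply,
      Matrix.mul_apply, Matrix.transpose_apply, Fin.sum_univ_two, smul_eq_mul] at h' ⊢
    fin_cases i <;> fin_cases j <;> simp [eta, mu, calU, calR] at h' ⊢ <;>
      linear_combination (-((-1 : ℂ) ^ k)) * h'
  have h0 : α 0 * mu - mu * α 0 = 0 := by
    have : α 0 = 1 := by
      have hβ0 : β 0 = 1 := calS_zero ψ t
      simp [hα, hβ0, eta_mul_eta]
    rw [this, one_mul, mul_one, sub_self]
  have h0' : β 0 * mu - mu * β 0 = 0 := by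
    rw [hβ, calS_zero, one_mul, mul_one, sub_self]
  have e1 : P (n + 1) * mu - mu * P (n + 1) =
      ∑ p ∈ antidiagonal (n + 1), (α p.1 * mu - mu * α p.1) * β p.2 +
        ∑ p ∈ antidiagonal (n + 1), α p.1 * (β p.2 * mu - mu * β p.2) := by
    rw [hP, Finset.sum_mul, Finset.mul_sum, ← Finset.sum_sub_distrib, ← Finset.sum_add_distrib]
    refine Finset.sum_congr rfl fun p _ => ?_
    simp only [sub_mul, mul_sub, mul_assoc]
    abel
  rw [add_sub_assoc, e1, hP, leibniz_antidiagonal,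
    Finset.Nat.sum_antidiagonal_succ (f := fun p => (α p.1 * mu - mu * α p.1) * β p.2),
    Finset.Nat.sum_antidiagonal_succ' (f := fun p => α p.1 * (β p.2 * mu - mu * β p.2))]
  simp only [h0, h0', zero_mul, mul_zero, zero_add]
  -- the terms `(k + 1) α_{k+1}` and `[α_{k+1}, μ]` are put together, and likewise for `β`
  have e2 : ∀ a b c d : Mat, a + b + (c + d) = (a + c) + (b + d) := fun a b c d => by abel
  rw [e2, ← Finset.sum_add_distrib]
  have e3 : ∀ (s : Finset (ℕ × ℕ)) (f g : ℕ × ℕ → Mat), ∑ p ∈ s, f p + (∑ p ∈ s, g p) =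
      ∑ p ∈ s, (f p + g p) := fun s f g => Finset.sum_add_distrib.symm
  rw [add_comm (∑ p ∈ antidiagonal n, α p.1 * _)]
  simp only [e3, ← mul_add, ← add_mul, hαr]
  rw [hP, Finset.sum_mul, Finset.mul_sum, ← Finset.sum_sub_distrib]
  refine Finset.sum_congr rfl fun p _ => ?_
  rw [add_comm (β (p.2 + 1) * mu - mu * β (p.2 + 1)), hβr]
  simp only [sub_mul, mul_sub, mul_assoc]
  abel

/-- The calibration is symplectic: `S^*(-z) S(z) = 1`. -/
theorem symplAdj_calSeries_mul : symplAdj (calSeries ψ t) * calSeries ψ t = 1 := by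
  set P := fun n => PowerSeries.coeff n (symplAdj (calSeries ψ t) * calSeries ψ t) with hP
  have hrec : ∀ n : ℕ, ((n : ℂ) + 1) • P (n + 1) + P (n + 1) * mu - mu * P (n + 1) =
      calR * P n - P n * calR := symplAdj_mul_recursion ψ t
  have hP0 : P 0 = 1 := by
    simp [hP, symplAdj, calSeries, calS_zero, eta_mul_eta]
  -- the recursion leaves this entry free
  have hP1 : P 1 0 1 = 0 := by
    have : P 1 = _ := coeff_symplAdj_mul ψ t 1
    rw [this]
    simp only [Finset.Nat.antidiagonal_succ, Finset.Nat.antidiagonal_zero, Finset.sum_cons,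
      Finset.map_singleton, Finset.sum_singleton, Matrix.add_apply, Matrix.smul_apply,
      Matrix.mul_apply, Fin.sum_univ_two, Matrix.transpose_apply, smul_eq_mul, eta, calS_zero,
      Function.Embedding.prodMap, Function.Embedding.coeFn_mk, Prod.map]
    simp [calS_zero]
  have key : ∀ n, P (n + 1) = 0 := by
    intro n
    induction n with
    | zero =>
      have h1 := hrec 0
      rw [hP0, mul_one, one_mul, sub_self] at h1
      ext i j
      have h2 := congrFun (congrFun h1 i) j
      simp only [Matrix.add_apply, Matrix.sub_apply, Matrix.smul_apply, Matrix.mul_apply,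
        Fin.sum_univ_two, smul_eq_mul, mu, Matrix.zero_apply] at h2 ⊢
      fin_cases i <;> fin_cases j
      · simp at h2 ⊢
        linear_combination h2
      · exact hP1
      · simp at h2 ⊢
        linear_combination h2 / 2
      · simp at h2 ⊢
        linear_combination h2
    | succ n ih =>
      have h1 := hrec (n + 1)
      rw [ih, mul_zero, zero_mul, sub_self] at h1
      have n1 : (n : ℂ) + 1 ≠ 0 := by exact_mod_cast Nat.succ_ne_zero n
      have n2 : (n : ℂ) + 2 ≠ 0 := by exact_mod_cast Nat.succ_ne_zero (n + 1)
      have n3 : (n : ℂ) + 3 ≠ 0 := by exact_mod_cast Nat.succ_ne_zero (n + 2)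
      ext i j
      have h2 := congrFun (congrFun h1 i) j
      simp only [Matrix.add_apply, Matrix.sub_apply, Matrix.smul_apply, Matrix.mul_apply,
        Fin.sum_univ_two, smul_eq_mul, mu, Matrix.zero_apply] at h2 ⊢
      fin_cases i <;> fin_cases j <;> simp at h2 ⊢
      · refine (mul_eq_zero.mp ?_).resolve_left n2
        linear_combination h2
      · refine (mul_eq_zero.mp ?_).resolve_left n1
        linear_combination h2
      · refine (mul_eq_zero.mp ?_).resolve_left n3
        linear_combination h2
      · refine (mul_eq_zero.mp ?_).resolve_left n2
        linear_combination h2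
  ext1 n
  cases n with
  | zero => rw [PowerSeries.coeff_one, if_pos rfl]; exact hP0
  | succ n => rw [PowerSeries.coeff_one, if_neg (Nat.succ_ne_zero n)]; exact key n

/-- The logarithm of a symplectic series is infinitesimally symplectic: `exp (s^*(-z))` is the
inverse of `exp (s(z))`. -/
theorem eta_mul_logS (l : ℕ) :
    eta * logS ψ t l = ((-1 : ℂ) ^ (l + 1)) • ((logS ψ t l).transpose * eta) := by
  set s := PowerSeries.mk (logS ψ t) with hs
  have hs1 : VanishBelow 1 s := by
    intro m hm
    obtain rfl : m = 0 := by omega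
    rw [hs, PowerSeries.coeff_mk, logS_zero]
  have hs2 : VanishBelow 1 (-s) := fun k hk => by rw [map_neg, hs1 k hk, neg_zero]
  have h1 : symplAdj s = -s := by
    refine expSeries_injective (vanishBelow_symplAdj hs1) hs2 ?_
    have h2 : expSeries (symplAdj s) * expSeries s = 1 := by
      rw [← symplAdj_expSeries s, hs, expSeries_logS, symplAdj_calSeries_mul]
    calc expSeries (symplAdj s) = expSeries (symplAdj s) * (expSeries s * expSeries (-s)) := by
          rw [expSeries_mul_neg hs1, mul_one]
      _ = expSeries (-s) := by rw [← mul_assoc, h2, one_mul]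
  have h3 := congrArg (PowerSeries.coeff l) h1
  rw [symplAdj, PowerSeries.coeff_mk, map_neg, hs, PowerSeries.coeff_mk] at h3
  have h4 : logS ψ t l = (-((-1 : ℂ) ^ l)) • (eta * (logS ψ t l).transpose * eta) := by
    rw [neg_smul, h3, neg_neg]
  conv_lhs => rw [h4]
  rw [mul_smul_comm, ← mul_assoc, ← mul_assoc, eta_mul_eta, one_mul, pow_succ, mul_neg_one]

end Symplectic

/-! ### Creation and annihilation operators on the Fock space -/

theorem asympConst_mul (c : ℂ) (φ : AsympSeries) : asympConst c * φ = c • φ := by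
  rw [asympConst, HahnSeries.C_mul_eq_smul]
  ext1
  funext n
  simp only [HahnSeries.coeff_smul]
  rw [smul_eq_mul, Polynomial.C_mul']

/-- The ring of asymptotic series, as a type with a single chain of algebraic instances. -/
def AS : Type := AsympSeries

instance : CommRing AS := inferInstanceAs (CommRing AsympSeries)

/-- The identity, from `AS` to `AsympSeries`. -/
def AS.val : AS →+* AsympSeries := RingHom.id AsympSeries

/-- The identity, from `AsympSeries` to `AS`. -/
def AS.of : AsympSeries →+* AS := RingHom.id AsympSeries

instance : Algebra ℂ AS :=
  (AS.of.comp ((HahnSeries.C (Γ := ℤ) (R := Polynomial ℂ)).comp Polynomial.C)).toAlgebra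

@[simp] theorem AS.val_of (x : AsympSeries) : AS.val (AS.of x) = x := rfl

@[simp] theorem AS.val_smul (c : ℂ) (x : AS) : AS.val (c • x) = c • AS.val x := by
  rw [← asympConst_mul]; rfl

instance : Module AS Fock := inferInstanceAs (Module AsympSeries Fock)

theorem Fock.csmul_eq (c : ℂ) (F : Fock) : c • F = (algebraMap ℂ AS c) • F :=
  funext fun m => funext fun n => (asympConst_mul c (F m n)).symm

instance : IsScalarTower ℂ AS Fock where
  smul_assoc c x F := by rw [Algebra.smul_def, mul_smul, Fock.csmul_eq]

instance : SMulCommClass ℂ AS Fock where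
  smul_comm c x F := by rw [Fock.csmul_eq, Fock.csmul_eq, ← mul_smul, mul_comm, mul_smul]

instance : SMulCommClass AS ℂ Fock := SMulCommClass.symm _ _ _

theorem asymp_mul_smul (c : ℂ) (x y : AsympSeries) : x * (c • y) = c • (x * y) := by
  rw [← asympConst_mul, ← asympConst_mul, mul_left_comm]

section Apply

variable (F G : Fock) (m : Var →₀ ℕ) (n : ℤ)

@[simp] theorem Fock.add_apply : (F + G) m n = F m n + G m n := rfl
@[simp] theorem Fock.sub_apply : (F - G) m n = F m n - G m n := rfl
@[simp] theorem Fock.neg_apply : (-F) m n = -F m n := rfl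
@[simp] theorem Fock.zero_apply : (0 : Fock) m n = 0 := rfl
@[simp] theorem Fock.smul_apply (c : AS) : (c • F) m n = AS.val c * F m n := rfl
@[simp] theorem Fock.csmul_apply (c : ℂ) : (c • F) m n = c • F m n := rfl

/-- Evaluation of a coefficient, as an additive map. -/
def Fock.evalHom (m : Var →₀ ℕ) (n : ℤ) : Fock →+ AsympSeries where
  toFun F := F m n
  map_zero' := rfl
  map_add' _ _ := rfl

@[simp] theorem Fock.sum_apply {ι : Type*} (s : Finset ι) (f : ι → Fock) :
    (∑ i ∈ s, f i) m n = ∑ i ∈ s, f i m n := map_sum (Fock.evalHom m n) f s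

end Apply

@[ext] theorem Fock.ext {F G : Fock} (h : ∀ m n, F m n = G m n) : F = G :=
  funext fun m => funext fun n => h m n

/-- The creation operator `ε⁻¹ q_v`. -/
def crea (v : Var) : Module.End AS Fock where
  toFun F := epsPow (-1) (mulQ v F)
  map_add' F G := by
    ext1 m n; simp only [epsPow, mulQ, Fock.add_apply]; split_ifs <;> simp
  map_smul' c F := by
    ext1 m n; simp only [epsPow, mulQ, Fock.smul_apply, RingHom.id_apply]; split_ifs <;> simp

/-- The annihilation operator `ε ∂/∂q_v`. -/
def ann (v : Var) : Module.End AS Fock where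
  toFun F := epsPow 1 (dQ v F)
  map_add' F G := by
    ext1 m n; simp only [epsPow, dQ, Fock.add_apply, smul_add]
  map_smul' c F := by
    ext1 m n; simp only [epsPow, dQ, Fock.smul_apply, RingHom.id_apply, asymp_mul_smul]

theorem crea_apply (v : Var) (F : Fock) (m : Var →₀ ℕ) (n : ℤ) :
    crea v F m n = if m v = 0 then 0 else F (m - Finsupp.single v 1) (n + 1) := by
  simp [crea, epsPow, mulQ]

theorem ann_apply (v : Var) (F : Fock) (m : Var →₀ ℕ) (n : ℤ) :
    ann v F m n = ((m v : ℂ) + 1) • F (m + Finsupp.single v 1) (n - 1) := by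
  simp [ann, epsPow, dQ]

theorem ann_mul_crea (v w : Var) :
    ann v * crea w = crea w * ann v + if v = w then 1 else 0 := by
  refine LinearMap.ext fun F => Fock.ext fun m n => ?_
  rw [Module.End.mul_apply, LinearMap.add_apply, Module.End.mul_apply, Fock.add_apply,
    ann_apply, crea_apply, crea_apply, ann_apply]
  by_cases h : v = w
  · subst h
    simp only [Finsupp.add_apply, Finsupp.single_eq_same, if_true, Nat.add_eq_zero_iff,
      one_ne_zero, and_false, if_false, add_tsub_cancel_right, sub_add_cancel,
      Module.End.one_apply, Finsupp.coe_tsub, Pi.sub_apply]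
    by_cases h0 : m v = 0
    · simp [h0]
    · rw [if_neg h0]
      have h1 : m - Finsupp.single v 1 + Finsupp.single v 1 = m := by
        apply tsub_add_cancel_of_le
        rw [Finsupp.single_le_iff]
        omega
      have h2 : (((m v - 1 : ℕ) : ℂ) + 1) = m v := by
        rw [Nat.cast_sub (by omega)]; simp
      rw [h1, h2]
      exact (add_smul (m v : ℂ) 1 (F m n)).trans (congrArg _ (one_smul ℂ (F m n)))
  · simp only [Finsupp.add_apply, if_neg h, LinearMap.zero_apply, Fock.zero_apply, add_zero,
      Finsupp.single_eq_of_ne h, Finsupp.single_eq_of_ne (Ne.symm h), sub_add_cancel,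
      add_sub_cancel_right, Finsupp.coe_tsub, Pi.sub_apply, tsub_zero]
    by_cases h0 : m w = 0
    · simp [h0]
    · rw [if_neg h0, if_neg h0]
      congr 2
      ext u
      simp only [Finsupp.add_apply, Finsupp.coe_tsub, Pi.sub_apply, Finsupp.single_apply]
      by_cases hu : w = u
      · subst hu; simp [h]
      · simp [hu]

theorem crea_mul_comm (v w : Var) : crea v * crea w = crea w * crea v := by
  refine LinearMap.ext fun F => Fock.ext fun m n => ?_
  simp only [Module.End.mul_apply, crea_apply]
  by_cases h : v = w
  · subst h; rfl
  · simp only [Finsupp.coe_tsub, Pi.sub_apply, Finsupp.single_eq_of_ne h,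
      Finsupp.single_eq_of_ne (Ne.symm h), tsub_zero, tsub_right_comm]
    by_cases h1 : m v = 0 <;> by_cases h2 : m w = 0 <;> simp [h1, h2]

theorem ann_mul_comm (v w : Var) : ann v * ann w = ann w * ann v := by
  refine LinearMap.ext fun F => Fock.ext fun m n => ?_
  simp only [Module.End.mul_apply, ann_apply, smul_smul]
  by_cases h : v = w
  · subst h; rfl
  · simp only [Finsupp.add_apply, Finsupp.single_eq_of_ne h,
      Finsupp.single_eq_of_ne (Ne.symm h), add_zero, add_right_comm]
    rw [mul_comm]

/-! ### Locally nilpotent operators and their exponentials -/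

/-- The height `∑ (l + 1) m_{(i,l)}` of a monomial. -/
def height (m : Var →₀ ℕ) : ℕ := Finsupp.weight (fun v : Var => v.2 + 1) m

theorem height_add_single (m : Var →₀ ℕ) (v : Var) :
    height (m + Finsupp.single v 1) = height m + (v.2 + 1) := by
  simp [height, Finsupp.weight_single]

theorem height_sub_single {m : Var →₀ ℕ} {v : Var} (h : m v ≠ 0) :
    height (m - Finsupp.single v 1) + (v.2 + 1) = height m := by
  rw [← height_add_single]
  congr 1
  apply tsub_add_cancel_of_le
  rw [Finsupp.single_le_iff]
  omega

/-- `F` has no monomials of height less than `h`. -/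
def HeightGE (h : ℕ) (F : Fock) : Prop := ∀ m, height m < h → ∀ n, F m n = 0

theorem HeightGE.add {h : ℕ} {F G : Fock} (hF : HeightGE h F) (hG : HeightGE h G) :
    HeightGE h (F + G) := fun m hm n => by
  rw [Fock.add_apply, hF m hm, hG m hm, add_zero]

theorem HeightGE.smul {h : ℕ} {F : Fock} (c : AS) (hF : HeightGE h F) :
    HeightGE h (c • F) := fun m hm n => by
  rw [Fock.smul_apply, hF m hm, mul_zero]

theorem HeightGE.csmul {h : ℕ} {F : Fock} (c : ℂ) (hF : HeightGE h F) :
    HeightGE h (c • F) := fun m hm n => by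
  rw [Fock.csmul_apply, hF m hm, smul_zero]

theorem HeightGE.sum {ι : Type*} {h : ℕ} {s : Finset ι} {F : ι → Fock}
    (hF : ∀ i ∈ s, HeightGE h (F i)) : HeightGE h (∑ i ∈ s, F i) := fun m hm n => by
  rw [Fock.sum_apply]
  exact Finset.sum_eq_zero fun i hi => hF i hi m hm n

theorem HeightGE.mono {h h' : ℕ} (hh : h' ≤ h) {F : Fock} (hF : HeightGE h F) :
    HeightGE h' F := fun m hm => hF m (by omega)

theorem HeightGE.zero (F : Fock) : HeightGE 0 F := fun _ hm => absurd hm (Nat.not_lt_zero _)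

theorem HeightGE.crea {h : ℕ} {F : Fock} (v : Var) (hF : HeightGE h F) :
    HeightGE (h + (v.2 + 1)) (crea v F) := by
  intro m hm n
  rw [crea_apply]
  split_ifs with h0
  · rfl
  · have := height_sub_single h0
    exact hF _ (by omega) _

theorem HeightGE.ann {h : ℕ} {F : Fock} (v : Var) (hF : HeightGE (h + (v.2 + 1)) F) :
    HeightGE h (ann v F) := by
  intro m hm n
  rw [ann_apply, hF _ (by rw [height_add_single]; omega), smul_zero]

/-- The operator `x` raises the height. -/
def Raising (x : Module.End AS Fock) : Prop :=
  ∀ h F, HeightGE h F → HeightGE (h + 1) (x F)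

theorem Raising.add {x y : Module.End AS Fock} (hx : Raising x) (hy : Raising y) :
    Raising (x + y) := fun h F hF => (hx h F hF).add (hy h F hF)

theorem Raising.neg {x : Module.End AS Fock} (hx : Raising x) : Raising (-x) :=
  fun h F hF m hm n => by
    rw [LinearMap.neg_apply, Fock.neg_apply, hx h F hF m hm, neg_zero]

theorem Raising.sum {ι : Type*} {s : Finset ι} {x : ι → Module.End AS Fock}
    (hx : ∀ i ∈ s, Raising (x i)) : Raising (∑ i ∈ s, x i) := fun h F hF => by
  rw [LinearMap.sum_apply]
  exact HeightGE.sum fun i hi => hx i hi h F hF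

theorem Raising.smul {x : Module.End AS Fock} (c : AS) (hx : Raising x) :
    Raising (c • x) := fun h F hF => (hx h F hF).smul c

theorem Raising.csmul {x : Module.End AS Fock} (c : ℂ) (hx : Raising x) :
    Raising (c • x) := fun h F hF => (hx h F hF).csmul c

theorem raising_crea (v : Var) : Raising (crea v) := fun h F hF =>
  (hF.crea v).mono (by omega)

theorem Raising.heightGE_dp {x : Module.End AS Fock} (hx : Raising x) {h : ℕ} {F : Fock}
    (hF : HeightGE h F) (k : ℕ) : HeightGE (h + k) (dp x k F) := by
  have h1 : ∀ k, HeightGE (h + k) ((x ^ k) F) := by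
    intro k
    induction k with
    | zero => simpa using hF
    | succ k ih =>
      rw [pow_succ', Module.End.mul_apply]
      exact hx _ _ ih
  rw [dp, LinearMap.smul_apply]
  exact (h1 k).csmul _

/-- The exponential `∑ x^k / k!` of a height raising operator; only finitely many terms contribute
to each coefficient. -/
def expLoc (x : Module.End AS Fock) : Module.End AS Fock where
  toFun F := fun m n => ∑ k ∈ range (height m + 1), dp x k F m n
  map_add' F G := by
    refine Fock.ext fun m n => ?_
    change ∑ k ∈ range (height m + 1), dp x k (F + G) m n =
      ∑ k ∈ range (height m + 1), dp x k F m n + ∑ k ∈ range (height m + 1), dp x k G m n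
    rw [← Finset.sum_add_distrib]
    simp only [map_add, Fock.add_apply]
  map_smul' c F := by
    refine Fock.ext fun m n => ?_
    change ∑ k ∈ range (height m + 1), dp x k (c • F) m n =
      AS.val c * ∑ k ∈ range (height m + 1), dp x k F m n
    rw [Finset.mul_sum]
    simp only [map_smul, Fock.smul_apply]

theorem expLoc_apply {x : Module.End AS Fock} (hx : Raising x) (F : Fock)
    {m : Var →₀ ℕ} {M : ℕ} (hM : height m < M) (n : ℤ) :
    expLoc x F m n = ∑ k ∈ range M, dp x k F m n := by
  change ∑ k ∈ range (height m + 1), dp x k F m n = _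
  refine Finset.sum_subset (by intro k; simp only [mem_range]; omega) fun k _ hk => ?_
  exact hx.heightGE_dp (HeightGE.zero F) k m (by simp at hk; omega) n

theorem heightGE_expLoc_sub {x : Module.End AS Fock} (hx : Raising x) (F : Fock)
    {M h : ℕ} (hM : h ≤ M) : HeightGE h (expLoc x F - ∑ k ∈ range M, dp x k F) := by
  intro m hm n
  rw [Fock.sub_apply, expLoc_apply hx F (lt_of_lt_of_le hm hM), Fock.sum_apply, sub_self]

theorem HeightGE.expLoc {x : Module.End AS Fock} (hx : Raising x) {h : ℕ} {F : Fock}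
    (hF : HeightGE h F) : HeightGE h (expLoc x F) := fun m hm n => by
  rw [expLoc_apply hx F (Nat.lt_succ_self _)]
  exact Finset.sum_eq_zero fun k _ => (hx.heightGE_dp hF k) m (by omega) n

theorem expLoc_zero : expLoc 0 = 1 := by
  refine LinearMap.ext fun F => Fock.ext fun m n => ?_
  change ∑ k ∈ range (height m + 1), dp (0 : Module.End AS Fock) k F m n = F m n
  rw [Finset.sum_range_succ', Finset.sum_eq_zero]
  · simp
  · intro k _
    simp [dp]

theorem expLoc_mul {x y : Module.End AS Fock} (hx : Raising x) (hy : Raising y)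
    (hxy : Commute x y) : expLoc x * expLoc y = expLoc (x + y) := by
  refine LinearMap.ext fun F => Fock.ext fun m n => ?_
  set M := height m + 1
  have hM : height m < M := Nat.lt_succ_self _
  rw [Module.End.mul_apply, expLoc_apply (hx.add hy) F hM, expLoc_apply hx _ hM]
  -- only the divided powers of order less than `M` reach the coefficient of `q^m`
  have e1 : ∀ k, dp x k (expLoc y F) m n = ∑ j ∈ range M, (dp x k * dp y j) F m n := by
    intro k
    have h1 := hx.heightGE_dp (heightGE_expLoc_sub hy F (le_refl M)) k m (by omega) n
    rw [map_sub, Fock.sub_apply, sub_eq_zero, map_sum, Fock.sum_apply] at h1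
    exact h1
  have e2 : ∀ N, dp (x + y) N F m n = ∑ p ∈ antidiagonal N, (dp x p.1 * dp y p.2) F m n := by
    intro N
    rw [dp_add_of_commute hxy, LinearMap.sum_apply, Fock.sum_apply]
  simp only [e1, e2]
  rw [sum_range_antidiagonal (fun i j => (dp x i * dp y j) F m n)]
  refine Finset.sum_congr rfl fun i _ => ?_
  refine (Finset.sum_subset (by intro k; simp only [mem_range]; omega) fun j _ hj => ?_).symm
  simp only [mem_range] at hj
  exact hx.heightGE_dp (hy.heightGE_dp (HeightGE.zero F) j) i m (by omega) n

theorem expLoc_mul_neg {x : Module.End AS Fock} (hx : Raising x) :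
    expLoc x * expLoc (-x) = 1 := by
  rw [expLoc_mul hx hx.neg (Commute.neg_right (Commute.refl x)), add_neg_cancel, expLoc_zero]

theorem expLoc_neg_mul {x : Module.End AS Fock} (hx : Raising x) :
    expLoc (-x) * expLoc x = 1 := by
  rw [expLoc_mul hx.neg hx (Commute.neg_left (Commute.refl x)), neg_add_cancel, expLoc_zero]

/-- If `[x, h k] = (k + 1) h (k + 1)` and the sequence `h` is finite, then
`e^x h 0 = (∑ k, h k) e^x`. The operators `h k` may lower the height, but only by a bounded
amount. -/
theorem expLoc_mul_of_commutator {x : Module.End AS Fock} (hx : Raising x)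
    {h : ℕ → Module.End AS Fock}
    (hh : ∀ k, x * h k = h k * x + ((k : ℂ) + 1) • h (k + 1)) {B c : ℕ}
    (hB : ∀ k, B ≤ k → h k = 0) (hc : ∀ k H F, HeightGE (H + c) F → HeightGE H (h k F)) :
    expLoc x * h 0 = (∑ k ∈ range B, h k) * expLoc x := by
  refine LinearMap.ext fun F => Fock.ext fun m n => ?_
  set L := height m + 1 + c + B with hL
  rw [Module.End.mul_apply, expLoc_apply hx _ (M := L) (by omega), Module.End.mul_apply,
    LinearMap.sum_apply, Fock.sum_apply]
  have e1 : ∀ N, dp x N (h 0 F) m n = ∑ p ∈ antidiagonal N, (h p.1 * dp x p.2) F m n := by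
    intro N
    rw [← Module.End.mul_apply, dp_mul_of_commutator hh, LinearMap.sum_apply, Fock.sum_apply]
  simp only [e1]
  rw [sum_range_antidiagonal (fun i j => (h i * dp x j) F m n)]
  symm
  have hs : range B ⊆ range L := by intro k; simp only [mem_range]; omega
  rw [← Finset.sum_subset hs]
  · refine Finset.sum_congr rfl fun i hi => ?_
    have hi' := mem_range.mp hi
    have h1 := hc i (height m + 1) _ (heightGE_expLoc_sub hx F (M := L - i)
      (h := height m + 1 + c) (by omega)) m (by omega) n
    rw [map_sub, Fock.sub_apply, sub_eq_zero, map_sum, Fock.sum_apply] at h1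
    exact h1
  · intro i _ hi
    rw [hB i (by simpa using hi)]
    simp

/-- Intertwining relations pass to exponentials. -/
theorem expLoc_intertwine {x y y' : Module.End AS Fock} (hx : Raising x)
    (hy : Raising y) (hy' : Raising y') (h : y' * expLoc x = expLoc x * y) :
    expLoc y' * expLoc x = expLoc x * expLoc y := by
  have hk : ∀ k, dp y' k * expLoc x = expLoc x * dp y k := by
    intro k
    have : y' ^ k * expLoc x = expLoc x * y ^ k := by
      induction k with
      | zero => simp
      | succ k ih => rw [pow_succ', mul_assoc, ih, ← mul_assoc, h, mul_assoc, ← pow_succ']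
    rw [dp, dp, smul_mul_assoc, this, mul_smul_comm]
  refine LinearMap.ext fun F => Fock.ext fun m n => ?_
  have hM : height m < height m + 1 := Nat.lt_succ_self _
  have h1 := (heightGE_expLoc_sub hy F (le_refl (height m + 1))).expLoc hx m hM n
  rw [map_sub, Fock.sub_apply, sub_eq_zero, map_sum, Fock.sum_apply] at h1
  rw [Module.End.mul_apply, Module.End.mul_apply, h1, expLoc_apply hy' _ hM]
  refine Finset.sum_congr rfl fun k _ => ?_
  rw [← Module.End.mul_apply, hk, Module.End.mul_apply]

/-! ### Quantized quadratic and linear Hamiltonians with finitely many variables -/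

/-- The variables `q^i_l` with `l ≤ K`. -/
def varsLE (K : ℕ) : Finset Var := Finset.univ ×ˢ range (K + 1)

@[simp] theorem mem_varsLE {K : ℕ} {v : Var} : v ∈ varsLE K ↔ v.2 ≤ K := by
  simp [varsLE, Nat.lt_succ_iff]

theorem sum_varsLE {M : Type*} [AddCommMonoid M] (K : ℕ) (f : Var → M) :
    ∑ v ∈ varsLE K, f v = ∑ l ∈ range (K + 1), ∑ i, f (i, l) := by
  rw [varsLE, Finset.sum_product_right]

/-- The coefficient of `q_v q_w` in the quantization of `𝔰`. -/
def quadCoeff (s : ℕ → Matrix (Fin 2) (Fin 2) ℂ) (v w : Var) : ℂ :=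
  (1 / 2 : ℂ) * (-1) ^ (w.2 + 1) * ∑ k, s (v.2 + w.2 + 1) k v.1 * eta k w.1

/-- The coefficient of `q_v ∂_w` in minus the quantization of `𝔰`. -/
def shiftCoeff (s : ℕ → Matrix (Fin 2) (Fin 2) ℂ) (v w : Var) : ℂ :=
  if w.2 < v.2 then s (v.2 - w.2) w.1 v.1 else 0

/-- The part of the quantization of `𝔰` that only involves the variables `q^i_l` with `l ≤ K`. -/
def quadTrunc (s : ℕ → Matrix (Fin 2) (Fin 2) ℂ) (K : ℕ) : Module.End AS Fock :=
  ∑ v ∈ varsLE K, ∑ w ∈ varsLE K, quadCoeff s v w • (crea v * crea w) -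
    ∑ v ∈ varsLE K, ∑ w ∈ varsLE K, shiftCoeff s v w • (crea v * ann w)

/-- The part of the multiplication operator `ε⁻¹ ∑ g_v q_v` with the variables `l ≤ K`. -/
def creaTrunc (K : ℕ) (g : Var → AS) : Module.End AS Fock :=
  ∑ v ∈ varsLE K, g v • crea v

/-- The part of the differentiation operator `ε ∑ c_v ∂_v` with the variables `l ≤ K`. -/
def annTrunc (K : ℕ) (c : Var → AS) : Module.End AS Fock :=
  ∑ v ∈ varsLE K, c v • ann v

theorem annTrunc_congr {K : ℕ} {c c' : Var → AS} (h : ∀ v ∈ varsLE K, c v = c' v) :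
    annTrunc K c = annTrunc K c' := by
  rw [annTrunc, annTrunc]
  exact Finset.sum_congr rfl fun v hv => by rw [h v hv]

theorem creaTrunc_congr {K : ℕ} {c c' : Var → AS} (h : ∀ v ∈ varsLE K, c v = c' v) :
    creaTrunc K c = creaTrunc K c' := by
  rw [creaTrunc, creaTrunc]
  exact Finset.sum_congr rfl fun v hv => by rw [h v hv]

theorem creaTrunc_add (K : ℕ) (c c' : Var → AS) :
    creaTrunc K c + creaTrunc K c' = creaTrunc K fun v => c v + c' v := by
  simp only [creaTrunc, ← Finset.sum_add_distrib, add_smul]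

section Commutator

variable {L : Type*} [Ring L]

/-- The commutator of two elements of a ring. -/
def commut (x y : L) : L := x * y - y * x

theorem commut_add_right (x y z : L) : commut x (y + z) = commut x y + commut x z := by
  simp only [commut, mul_add, add_mul]; abel

theorem commut_sub_left (x y z : L) : commut (x - y) z = commut x z - commut y z := by
  simp only [commut, mul_sub, sub_mul]; abel

theorem commut_sum_right {ι : Type*} (x : L) (s : Finset ι) (f : ι → L) :
    commut x (∑ i ∈ s, f i) = ∑ i ∈ s, commut x (f i) := by
  simp only [commut, Finset.mul_sum, Finset.sum_mul, Finset.sum_sub_distrib]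

theorem commut_sum_left {ι : Type*} (s : Finset ι) (f : ι → L) (x : L) :
    commut (∑ i ∈ s, f i) x = ∑ i ∈ s, commut (f i) x := by
  simp only [commut, Finset.mul_sum, Finset.sum_mul, Finset.sum_sub_distrib]

end Commutator

theorem commut_crea_crea_ann (v w u : Var) :
    commut (crea v * crea w) (ann u) =
      -((if u = w then crea v else 0) + if u = v then crea w else 0) := by
  rw [commut, ← mul_assoc, ann_mul_crea, add_mul, mul_assoc (crea v) (ann u), ann_mul_crea,
    mul_add, mul_assoc]
  split_ifs <;> (simp; try abel)

theorem commut_crea_crea_crea (v w u : Var) : commut (crea v * crea w) (crea u) = 0 := by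
  rw [commut, mul_assoc, crea_mul_comm w u, ← mul_assoc, crea_mul_comm v u, mul_assoc,
    sub_self]

theorem commut_crea_ann_ann (v w u : Var) :
    commut (crea v * ann w) (ann u) = -(if u = v then ann w else 0) := by
  rw [commut, ← mul_assoc, ann_mul_crea, add_mul, mul_assoc, mul_assoc, ann_mul_comm w u]
  split_ifs <;> simp

theorem commut_crea_ann_crea (v w u : Var) :
    commut (crea v * ann w) (crea u) = if w = u then crea v else 0 := by
  rw [commut, mul_assoc, ann_mul_crea, mul_add, ← mul_assoc, ← mul_assoc, crea_mul_comm v u]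
  split_ifs <;> simp

theorem commut_smul_smul (a : ℂ) (b : AS) (x y : Module.End AS Fock) :
    commut (a • x) (b • y) = (a • b) • commut (x) (y) := by
  simp only [commut, smul_mul_assoc, mul_smul_comm, smul_assoc]
  rw [smul_sub, smul_sub, smul_comm a b (x * y)]

theorem commut_double_sum (V : Finset Var) (q : Var → Var → ℂ)
    (x : Var → Var → Module.End AS Fock) (c : Var → AS)
    (y : Var → Module.End AS Fock) :
    commut (∑ v ∈ V, ∑ w ∈ V, q v w • x v w) (∑ u ∈ V, c u • y u) =
      ∑ v ∈ V, ∑ w ∈ V, ∑ u ∈ V, (q v w • c u) • commut (x v w) (y u) := by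
  rw [commut_sum_left]
  refine Finset.sum_congr rfl fun v _ => ?_
  rw [commut_sum_left]
  refine Finset.sum_congr rfl fun w _ => ?_
  rw [commut_sum_right]
  exact Finset.sum_congr rfl fun u _ => commut_smul_smul _ _ _ _

/-- Only the derivations in `ŝ` act on the multiplication operators. -/
theorem commut_quadTrunc_creaTrunc (s : ℕ → Matrix (Fin 2) (Fin 2) ℂ) (K : ℕ)
    (g : Var → AS) :
    commut (quadTrunc s K) (creaTrunc K g) =
      creaTrunc K fun u => -∑ w ∈ varsLE K, shiftCoeff s u w • g w := by
  rw [quadTrunc, creaTrunc, creaTrunc, commut_sub_left, commut_double_sum, commut_double_sum]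
  simp only [commut_crea_crea_crea, smul_zero, Finset.sum_const_zero, zero_sub]
  rw [← Finset.sum_neg_distrib]
  refine Finset.sum_congr rfl fun v _ => ?_
  rw [neg_smul, Finset.sum_smul]
  congr 1
  refine Finset.sum_congr rfl fun w hw => ?_
  simp only [commut_crea_ann_crea, smul_ite, smul_zero]
  rw [Finset.sum_ite_eq, if_pos hw]

/-- On the differentiation operators the derivations in `ŝ` give a differentiation operator, and the
quadratic part of `ŝ` gives a multiplication operator. -/
theorem commut_quadTrunc_annTrunc (s : ℕ → Matrix (Fin 2) (Fin 2) ℂ) (K : ℕ)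
    (c : Var → AS) :
    commut (quadTrunc s K) (annTrunc K c) =
      annTrunc K (fun u => ∑ v ∈ varsLE K, shiftCoeff s v u • c v) +
      creaTrunc K fun u => -∑ v ∈ varsLE K, (quadCoeff s u v + quadCoeff s v u) • c v := by
  rw [quadTrunc, creaTrunc, annTrunc, annTrunc, commut_sub_left, commut_double_sum,
    commut_double_sum, sub_eq_add_neg, add_comm]
  congr 1
  · rw [Finset.sum_comm, ← Finset.sum_neg_distrib]
    refine Finset.sum_congr rfl fun w _ => ?_
    rw [Finset.sum_smul, ← Finset.sum_neg_distrib]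
    refine Finset.sum_congr rfl fun v hv => ?_
    simp only [commut_crea_ann_ann, smul_neg, smul_ite, smul_zero, Finset.sum_neg_distrib, neg_neg]
    rw [Finset.sum_ite_eq', if_pos hv]
  · have e1 : ∀ v ∈ varsLE K, ∀ w ∈ varsLE K,
        ∑ u ∈ varsLE K, (quadCoeff s v w • c u) • commut (crea v * crea w) (ann u) =
          -((quadCoeff s v w • c w) • crea v) - (quadCoeff s v w • c v) • crea w := by
      intro v hv w hw
      simp only [commut_crea_crea_ann, smul_neg, smul_add, smul_ite, smul_zero,
        Finset.sum_neg_distrib, Finset.sum_add_distrib]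
      rw [Finset.sum_ite_eq', if_pos hw, Finset.sum_ite_eq', if_pos hv]
      abel
    rw [Finset.sum_congr rfl fun v hv => Finset.sum_congr rfl fun w hw => e1 v hv w hw]
    simp only [Finset.sum_sub_distrib]
    rw [Finset.sum_comm (f := fun v w => (quadCoeff s v w • c v) • crea w),
      ← Finset.sum_sub_distrib]
    refine Finset.sum_congr rfl fun v _ => ?_
    rw [← Finset.sum_sub_distrib, neg_smul, Finset.sum_smul, ← Finset.sum_neg_distrib]
    refine Finset.sum_congr rfl fun w _ => ?_
    rw [add_smul, add_smul, neg_add, sub_eq_add_neg]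

/-- Matrices over the asymptotic series. -/
abbrev AMat : Type := Matrix (Fin 2) (Fin 2) AS

/-- The entry `(i, 0)` of the coefficient of `X ^ n`. -/
def colCoeff (φ : PowerSeries AMat) (n : ℕ) (i : Fin 2) : AS :=
  (PowerSeries.coeff n φ : AMat) i 0

/-- The quantization of the linear Hamiltonian of `𝔣 = z^K φ(z⁻¹)`, for the first column of `φ`,
restricted to the variables `q^i_l` with `l ≤ K`: here `I^l = (-1)^l φ_{K-l}`. -/
def linTrunc (K : ℕ) (φ : PowerSeries AMat) : Module.End AS Fock :=
  annTrunc K (fun v => -colCoeff φ (K - v.2) v.1) +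
    creaTrunc K fun v => (-1 : ℂ) ^ (v.2 + 1) •
      ∑ j, eta v.1 j • colCoeff φ (K + v.2 + 1) j

/-- A complex matrix power series as one over the asymptotic series. -/
def liftSeries : PowerSeries (Matrix (Fin 2) (Fin 2) ℂ) →+* PowerSeries AMat :=
  PowerSeries.map (algebraMap ℂ AS).mapMatrix

theorem colCoeff_liftSeries_mul (s : ℕ → Matrix (Fin 2) (Fin 2) ℂ) (φ : PowerSeries AMat)
    (n : ℕ) (i : Fin 2) :
    colCoeff (liftSeries (PowerSeries.mk s) * φ) n i =
      ∑ p ∈ antidiagonal n, ∑ j, s p.1 i j • colCoeff φ p.2 j := by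
  rw [colCoeff, PowerSeries.coeff_mul, Matrix.sum_apply]
  refine Finset.sum_congr rfl fun p _ => ?_
  rw [Matrix.mul_apply]
  refine Finset.sum_congr rfl fun j _ => ?_
  simp only [liftSeries, PowerSeries.coeff_map, PowerSeries.coeff_mk, RingHom.mapMatrix_apply,
    Matrix.map_apply, ← Algebra.smul_def, colCoeff]

theorem sum_antidiagonal_sub {M : Type*} [AddCommMonoid M] (f : ℕ → ℕ → M) (hf : ∀ k, f 0 k = 0)
    {l K : ℕ} (hl : l ≤ K) :
    ∑ p ∈ antidiagonal (K - l), f p.1 p.2 =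
      ∑ p ∈ range (K + 1), if l < p then f (p - l) (K - p) else 0 := by
  rw [Finset.Nat.sum_antidiagonal_eq_sum_range_succ f,
    show K + 1 = l + (K - l + 1) by omega, Finset.sum_range_add,
    Finset.sum_eq_zero (s := range l), zero_add]
  · refine Finset.sum_congr rfl fun k hk => ?_
    rcases Nat.eq_zero_or_pos k with rfl | hk0
    · simp [hf]
    · rw [if_pos (by omega)]
      congr 1 <;> omega
  · intro p hp
    rw [if_neg (by simp only [mem_range] at hp; omega)]

theorem sum_antidiagonal_add {M : Type*} [AddCommMonoid M] (f : ℕ → ℕ → M) (hf : ∀ k, f 0 k = 0)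
    {l K : ℕ} (hl : l ≤ K) :
    ∑ p ∈ antidiagonal (K + l + 1), f p.1 p.2 =
      ∑ a ∈ range (K + 1), (if a < l then f (l - a) (K + a + 1) else 0) +
        ∑ b ∈ range (K + 1), f (l + b + 1) (K - b) := by
  have e1 : ∑ a ∈ range (K + 1), (if a < l then f (l - a) (K + a + 1) else 0) =
      ∑ a ∈ range (l + 1), f a (K + l + 1 - a) := by
    rw [show K + 1 = l + (K + 1 - l) by omega, Finset.sum_range_add,
      Finset.sum_eq_zero (s := range (K + 1 - l)), add_zero, Finset.sum_range_succ' _ l, hf,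
      add_zero, ← Finset.sum_range_reflect]
    · refine Finset.sum_congr rfl fun a ha => ?_
      simp only [mem_range] at ha
      rw [if_pos (by omega)]
      congr 1 <;> omega
    · intro a _
      rw [if_neg (by omega)]
  rw [e1, Finset.Nat.sum_antidiagonal_eq_sum_range_succ f,
    show (K + l + 1).succ = (l + 1) + (K + 1) by omega, Finset.sum_range_add _ (l + 1)]
  congr 1
  refine Finset.sum_congr rfl fun b hb => ?_
  simp only [mem_range] at hb
  congr 1 <;> omega

/-- The infinitesimally symplectic condition moves `s_l` across `η`. -/
theorem neg_sum_eta_smul {M : Type*} [AddCommGroup M] [Module ℂ M]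
    {s : ℕ → Matrix (Fin 2) (Fin 2) ℂ}
    (hs : ∀ l, eta * s l = ((-1 : ℂ) ^ (l + 1)) • ((s l).transpose * eta)) {a l : ℕ} (ha : a < l)
    (i : Fin 2) (X : Fin 2 → M) :
    -∑ j, s (l - a) j i • (-1 : ℂ) ^ (a + 1) • ∑ k, eta j k • X k =
      (-1 : ℂ) ^ (l + 1) • ∑ j, eta i j • ∑ k, s (l - a) j k • X k := by
  have hη : ∀ k, ∑ j, eta i j * s (l - a) j k =
      (-1 : ℂ) ^ (l - a + 1) * ∑ j, s (l - a) j i * eta j k := by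
    intro k
    have := congrFun (congrFun (hs (l - a)) i) k
    rw [Matrix.smul_apply, Matrix.mul_apply, Matrix.mul_apply, smul_eq_mul] at this
    simpa only [Matrix.transpose_apply] using this
  have hsign : (-1 : ℂ) ^ (l + 1) * (-1 : ℂ) ^ (l - a + 1) = -((-1) ^ (a + 1)) := by
    rw [← pow_add, show l + 1 + (l - a + 1) = 2 * (l - a) + (a + 1) + 1 by omega,
      pow_succ, pow_add, pow_mul]
    norm_num
  have key : ∀ k, -∑ j, s (l - a) j i * ((-1 : ℂ) ^ (a + 1) * eta j k) =
      (-1 : ℂ) ^ (l + 1) * ∑ j, eta i j * s (l - a) j k := by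
    intro k
    rw [hη, ← mul_assoc, hsign, neg_mul, Finset.mul_sum]
    congr 1
    exact Finset.sum_congr rfl fun j _ => by ring
  have k0 := key 0
  have k1 := key 1
  simp only [Fin.sum_univ_two] at k0 k1 ⊢
  linear_combination (norm := module) k0 • X 0 + k1 • X 1

/-- The quantization is a representation: `[ŝ, 𝔣^] = (s 𝔣)^`.  The contribution of the quadratic
part of `ŝ` supplies the coefficients of `s 𝔣_+` with negative index. -/
theorem commut_quadTrunc_linTrunc {s : ℕ → Matrix (Fin 2) (Fin 2) ℂ} (hs0 : s 0 = 0)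
    (hs : ∀ l, eta * s l = ((-1 : ℂ) ^ (l + 1)) • ((s l).transpose * eta)) (K : ℕ)
    (φ : PowerSeries AMat) :
    commut (quadTrunc s K) (linTrunc K φ) = linTrunc K (liftSeries (PowerSeries.mk s) * φ) := by
  have hquad : ∀ v w : Var, quadCoeff s v w =
      (1 / 2 : ℂ) * (-1) ^ (v.2 + 1) * (eta * s (v.2 + w.2 + 1)) v.1 w.1 := by
    intro v w
    rw [hs, quadCoeff, Matrix.smul_apply, Matrix.mul_apply, smul_eq_mul]
    simp only [Matrix.transpose_apply]
    have : (-1 : ℂ) ^ (w.2 + 1) = (-1) ^ (v.2 + 1) * (-1) ^ (v.2 + w.2 + 1 + 1) := by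
      rw [← pow_add, show v.2 + 1 + (v.2 + w.2 + 1 + 1) = 2 * (v.2 + 1) + (w.2 + 1) by ring,
        pow_add _ (2 * (v.2 + 1)), pow_mul]
      norm_num
    rw [this]
    ring
  -- the infinitesimally symplectic condition makes the quadratic form symmetric
  have hsymm : ∀ v w : Var, quadCoeff s v w + quadCoeff s w v =
      (-1 : ℂ) ^ (v.2 + 1) * (eta * s (v.2 + w.2 + 1)) v.1 w.1 := by
    intro v w
    have h1 : quadCoeff s w v = quadCoeff s v w := by
      rw [hquad v w, quadCoeff, Matrix.mul_apply]
      congr 1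
      rw [show w.2 + v.2 + 1 = v.2 + w.2 + 1 by ring]
      refine Finset.sum_congr rfl fun k _ => ?_
      rw [mul_comm]
      congr 1
      exact congrFun (congrFun eta_transpose v.1) k
    rw [h1, hquad]
    ring
  rw [linTrunc, commut_add_right, commut_quadTrunc_annTrunc, commut_quadTrunc_creaTrunc, linTrunc,
    add_assoc,
    creaTrunc_add]
  refine congrArg₂ _ (annTrunc_congr fun u hu => ?_) (creaTrunc_congr fun u hu => ?_)
  · rw [colCoeff_liftSeries_mul, sum_antidiagonal_sub
      (fun p q => ∑ j, s p u.1 j • colCoeff φ q j) (by simp [hs0]) (mem_varsLE.mp hu),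
      sum_varsLE, ← Finset.sum_neg_distrib]
    refine Finset.sum_congr rfl fun p _ => ?_
    simp only [shiftCoeff]
    split_ifs
    · simp only [smul_neg, Finset.sum_neg_distrib]
    · simp
  · simp only [colCoeff_liftSeries_mul]
    have e1 : ∀ j, ∑ p ∈ antidiagonal (K + u.2 + 1), ∑ k,
          s p.1 j k • colCoeff φ p.2 k = _ := fun j =>
      sum_antidiagonal_add (fun p q => ∑ k, s p j k • colCoeff φ q k)
        (by simp [hs0]) (mem_varsLE.mp hu)
    rw [sum_varsLE, sum_varsLE]
    simp only [e1, smul_add, Finset.sum_add_distrib]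
    rw [add_comm]
    refine congrArg₂ _ ?_ ?_
    · -- the part with negative indices, moved by the differential operator in `ŝ`
      simp only [Finset.smul_sum (s := range (K + 1))]
      rw [Finset.sum_comm (s := univ) (t := range (K + 1)), ← Finset.sum_neg_distrib]
      simp only [Finset.smul_sum (s := range (K + 1))]
      refine Finset.sum_congr rfl fun a _ => ?_
      simp only [shiftCoeff]
      by_cases ha : a < u.2
      · simp only [if_pos ha]
        rw [neg_sum_eta_smul hs ha, Finset.smul_sum]
      · simp only [if_neg ha, zero_smul, smul_zero, Finset.sum_const_zero, neg_zero]
    · -- the part with nonnegative indices, moved by the quadratic part of `ŝ`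
      simp only [Finset.smul_sum (s := range (K + 1))]
      rw [Finset.sum_comm (s := univ) (t := range (K + 1)), ← Finset.sum_neg_distrib]
      simp only [Finset.smul_sum (s := range (K + 1))]
      refine Finset.sum_congr rfl fun b _ => ?_
      simp only [hsymm, Matrix.mul_apply, Fin.sum_univ_two]
      module

/-! ### Conjugation of linear Hamiltonians, with finitely many variables -/

theorem annTrunc_add (K : ℕ) (c c' : Var → AS) :
    annTrunc K c + annTrunc K c' = annTrunc K fun v => c v + c' v := by
  simp only [annTrunc, ← Finset.sum_add_distrib, add_smul]

theorem smul_annTrunc (K : ℕ) (a : ℂ) (c : Var → AS) :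
    a • annTrunc K c = annTrunc K fun v => a • c v := by
  simp only [annTrunc, Finset.smul_sum, smul_assoc]

theorem smul_creaTrunc (K : ℕ) (a : ℂ) (c : Var → AS) :
    a • creaTrunc K c = creaTrunc K fun v => a • c v := by
  simp only [creaTrunc, Finset.smul_sum, smul_assoc]

@[simp] theorem annTrunc_zero (K : ℕ) : annTrunc K (fun _ => 0) = 0 := by simp [annTrunc]

@[simp] theorem creaTrunc_zero (K : ℕ) : creaTrunc K (fun _ => 0) = 0 := by simp [creaTrunc]

theorem colCoeff_add (φ χ : PowerSeries AMat) (n : ℕ) (i : Fin 2) :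
    colCoeff (φ + χ) n i = colCoeff φ n i + colCoeff χ n i := by
  simp [colCoeff]

theorem colCoeff_smul (a : ℂ) (φ : PowerSeries AMat) (n : ℕ) (i : Fin 2) :
    colCoeff (a • φ) n i = a • colCoeff φ n i := by
  simp [colCoeff]

/-- Only the coefficients of `z^l` with `-K - 1 ≤ l ≤ K` act on the variables `q^i_l`, `l ≤ K`. -/
theorem linTrunc_congr {K : ℕ} {φ χ : PowerSeries AMat}
    (h : ∀ n < 2 * K + 2, PowerSeries.coeff n φ = PowerSeries.coeff n χ) :
    linTrunc K φ = linTrunc K χ := by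
  rw [linTrunc, linTrunc]
  refine congrArg₂ _ (annTrunc_congr fun v hv => ?_) (creaTrunc_congr fun v hv => ?_)
  · rw [colCoeff, colCoeff, h _ (by omega)]
  · have := mem_varsLE.mp hv
    simp only [colCoeff, h (K + v.2 + 1) (by omega)]

theorem linTrunc_add (K : ℕ) (φ χ : PowerSeries AMat) :
    linTrunc K (φ + χ) = linTrunc K φ + linTrunc K χ := by
  simp only [linTrunc]
  rw [add_add_add_comm, annTrunc_add, creaTrunc_add]
  simp only [colCoeff_add, neg_add, smul_add, Finset.sum_add_distrib]

theorem linTrunc_zero (K : ℕ) : linTrunc K 0 = 0 := by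
  simp [linTrunc, colCoeff]

theorem linTrunc_sum {ι : Type*} (K : ℕ) (s : Finset ι) (φ : ι → PowerSeries AMat) :
    linTrunc K (∑ i ∈ s, φ i) = ∑ i ∈ s, linTrunc K (φ i) :=
  map_sum (AddMonoidHom.mk' (linTrunc K) (linTrunc_add K)) φ s

theorem linTrunc_smul (K : ℕ) (a : ℂ) (φ : PowerSeries AMat) :
    linTrunc K (a • φ) = a • linTrunc K φ := by
  simp only [linTrunc, smul_add, smul_annTrunc, smul_creaTrunc]
  simp only [colCoeff_smul, smul_neg, Finset.smul_sum, smul_comm a]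

theorem raising_quadTrunc (s : ℕ → Matrix (Fin 2) (Fin 2) ℂ) (K : ℕ) :
    Raising (quadTrunc s K) := by
  rw [quadTrunc, sub_eq_add_neg]
  refine Raising.add (Raising.sum fun v _ => Raising.sum fun w _ => Raising.csmul _ ?_)
    (Raising.neg (Raising.sum fun v _ => Raising.sum fun w _ => ?_))
  · intro h F hF
    exact (((hF.crea w).crea v)).mono (by omega)
  · rw [shiftCoeff]
    split_ifs with hvw
    · refine Raising.csmul _ fun h F hF m hm n => ?_
      rw [Module.End.mul_apply, crea_apply]
      split_ifs with h0
      · rfl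
      · have h1 := height_sub_single h0
        rw [ann_apply, hF _ (by rw [height_add_single]; omega), smul_zero]
    · rw [zero_smul]
      intro h F _ m _ n
      rfl

theorem raising_creaTrunc (K : ℕ) (g : Var → AS) : Raising (creaTrunc K g) :=
  Raising.sum fun v _ => (raising_crea v).smul _

theorem HeightGE.linTrunc {K h : ℕ} {F : Fock} (φ : PowerSeries AMat)
    (hF : HeightGE (h + (K + 1)) F) : HeightGE h (linTrunc K φ F) := by
  rw [CatalanFM.linTrunc, LinearMap.add_apply, annTrunc, creaTrunc, LinearMap.sum_apply,
    LinearMap.sum_apply]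
  refine HeightGE.add (HeightGE.sum fun v hv => ?_) (HeightGE.sum fun v hv => ?_)
  · have := mem_varsLE.mp hv
    exact (HeightGE.ann v (hF.mono (by omega))).smul _
  · exact ((hF.crea v).mono (by omega)).smul _

theorem vanishBelow_mk {R : Type*} [Ring R] {s : ℕ → R} (hs0 : s 0 = 0) :
    VanishBelow 1 (PowerSeries.mk s) := by
  intro m hm
  obtain rfl : m = 0 := by omega
  simpa using hs0

theorem liftSeries_smul (a : ℂ) (x : PowerSeries (Matrix (Fin 2) (Fin 2) ℂ)) :
    liftSeries (a • x) = a • liftSeries x := by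
  ext n i j
  simp only [liftSeries, PowerSeries.coeff_map, PowerSeries.coeff_smul, RingHom.mapMatrix_apply,
    Matrix.map_apply, Matrix.smul_apply]
  rw [smul_eq_mul, map_mul, Algebra.smul_def]

/-- Conjugation by the exponential of `ŝ` multiplies a linear Hamiltonian by `S = exp s`. -/
theorem expLoc_quadTrunc_mul_linTrunc {s : ℕ → Matrix (Fin 2) (Fin 2) ℂ} (hs0 : s 0 = 0)
    (hs : ∀ l, eta * s l = ((-1 : ℂ) ^ (l + 1)) • ((s l).transpose * eta)) (K : ℕ)
    (φ : PowerSeries AMat) :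
    expLoc (quadTrunc s K) * linTrunc K φ =
      linTrunc K (liftSeries (expSeries (PowerSeries.mk s)) * φ) * expLoc (quadTrunc s K) := by
  have hv := vanishBelow_mk hs0
  have hlift : ∀ (n : ℕ) (x : PowerSeries (Matrix (Fin 2) (Fin 2) ℂ)), VanishBelow n x →
      VanishBelow n (liftSeries x) := by
    intro n x hx m hm
    simp [liftSeries, hx m hm]
  set h : ℕ → Module.End AS Fock := fun k =>
    linTrunc K (liftSeries (dp (PowerSeries.mk s) k) * φ) with hh
  -- the iterated commutators with `ŝ` are the quantizations of `s^k φ / k!`; since `s` has no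
  -- constant term, the truncation kills them from `k = 2 K + 2` on
  have h1 := expLoc_mul_of_commutator (raising_quadTrunc s K) (h := h) ?_ (B := 2 * K + 2)
    (c := K + 1) ?_ ?_
  · simp only [hh, dp_zero, map_one, one_mul] at h1
    rw [h1]
    congr 1
    rw [← linTrunc_sum, ← Finset.sum_mul, ← map_sum]
    refine linTrunc_congr fun n hn => ?_
    have h2 := (hlift _ _ (vanishBelow_expSeries_sub hv (2 * K + 2))).mul_right φ n hn
    rw [map_sub, sub_mul, map_sub, sub_eq_zero] at h2
    exact h2.symm
  · intro k
    have h2 := commut_quadTrunc_linTrunc hs0 hs K (liftSeries (dp (PowerSeries.mk s) k) * φ)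
    rw [commut, sub_eq_iff_eq_add, ← mul_assoc, ← map_mul, ← dp_succ, liftSeries_smul,
      smul_mul_assoc, linTrunc_smul, add_comm] at h2
    exact h2
  · intro k hk
    rw [hh]
    change linTrunc K _ = 0
    rw [← linTrunc_zero K]
    refine linTrunc_congr fun n hn => ?_
    rw [map_zero]
    exact (hlift _ _ (hv.dp k)).mul_right φ n (by omega)
  · intro k H F hF
    exact hF.linTrunc _

theorem linTrunc_mul_expLoc_neg {s : ℕ → Matrix (Fin 2) (Fin 2) ℂ} (hs0 : s 0 = 0)
    (hs : ∀ l, eta * s l = ((-1 : ℂ) ^ (l + 1)) • ((s l).transpose * eta)) (K : ℕ)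
    (φ : PowerSeries AMat) :
    linTrunc K φ * expLoc (-quadTrunc s K) =
      expLoc (-quadTrunc s K) * linTrunc K (liftSeries (expSeries (PowerSeries.mk s)) * φ) := by
  have h1 := expLoc_quadTrunc_mul_linTrunc hs0 hs K φ
  have h2 := congrArg (expLoc (-quadTrunc s K) * · * expLoc (-quadTrunc s K)) h1
  have h3 := expLoc_mul_neg (raising_quadTrunc s K)
  have h4 := expLoc_neg_mul (raising_quadTrunc s K)
  rw [← mul_assoc, h4, one_mul, mul_assoc _ (_ * _), mul_assoc _ (expLoc _), h3, mul_one] at h2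
  exact h2

/-! ### Convergence in the Fock space -/

theorem Fock.scalarCoeff_injective : Function.Injective Fock.scalarCoeff := by
  intro F G h
  ext m n j k
  exact congrFun h (m, n, j, k)

theorem Fock.isInducing_scalarCoeff : Topology.IsInducing Fock.scalarCoeff := ⟨rfl⟩

instance : T2Space Fock :=
  Topology.IsEmbedding.t2Space ⟨Fock.isInducing_scalarCoeff, Fock.scalarCoeff_injective⟩

/-- `Fock.scalarCoeff` as an additive map. -/
def Fock.scalarCoeffHom : Fock →+ ((Var →₀ ℕ) × ℤ × ℤ × ℕ → ℂ) where
  toFun := Fock.scalarCoeff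
  map_zero' := by funext x; simp [Fock.scalarCoeff]
  map_add' F G := by funext x; simp [Fock.scalarCoeff]

theorem Fock.hasSum_iff {ι : Type*} {f : ι → Fock} {G : Fock} :
    HasSum f G ↔ ∀ m n j k, HasSum (fun i => ((f i m n).coeff j).coeff k)
      (((G m n).coeff j).coeff k) := by
  have h1 : HasSum f G ↔ HasSum (Fock.scalarCoeffHom ∘ f) (Fock.scalarCoeffHom G) :=
    (Topology.IsInducing.hasSum_iff Fock.isInducing_scalarCoeff (g := Fock.scalarCoeffHom) f G).symm
  rw [h1, Pi.hasSum]
  constructor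
  · intro h m n j k
    exact h (m, n, j, k)
  · rintro h ⟨m, n, j, k⟩
    exact h m n j k

/-- A sum with only finitely many contributions to each coefficient of `q^m ε^n λ^{-j}`. -/
theorem Fock.hasSum_of_locallyFinite {ι : Type*} {f : ι → Fock} {G : Fock}
    (h : ∀ m n j, ∃ s : Finset ι, (∀ i ∉ s, (f i m n).coeff j = 0) ∧
      ∑ i ∈ s, (f i m n).coeff j = (G m n).coeff j) : HasSum f G := by
  rw [Fock.hasSum_iff]
  intro m n j k
  obtain ⟨s, hs, hG⟩ := h m n j
  rw [← hG, Polynomial.finsetSum_coeff]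
  exact hasSum_sum_of_ne_finset_zero fun i hi => by rw [hs i hi, Polynomial.coeff_zero]

/-- If the sum of the operators `T i` is `A` on all iterates of `A` on `F`, the sums in `expOp T F`
can be read with `A`. -/
theorem expConverges_and_expOp_eq {ι : Type} {T : ι → Fock → Fock} {A : Fock → Fock} {F G : Fock}
    (hA : ∀ n : ℕ, HasSum (fun i => T i (A^[n] F)) (A (A^[n] F)))
    (hG : HasSum (fun n : ℕ => ((n.factorial : ℂ)⁻¹) • A^[n] F) G) :
    ExpConverges T F ∧ expOp T F = G := by
  have h1 : ∀ n, (opSum T)^[n] F = A^[n] F := by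
    intro n
    induction n with
    | zero => rfl
    | succ n ih =>
      rw [Function.iterate_succ_apply', Function.iterate_succ_apply', ih]
      exact (hA n).tsum_eq
  refine ⟨⟨fun n => ?_, ?_⟩, ?_⟩
  · rw [h1]; exact (hA n).summable
  · simp only [h1]; exact hG.summable
  · rw [expOp]; simp only [h1]; exact hG.tsum_eq

/-- For height raising operators `expOp` is `expLoc`. -/
theorem expConverges_and_expOp_eq_expLoc {ι : Type} {T : ι → Fock → Fock}
    {x : Module.End AS Fock} (hx : Raising x) (hT : ∀ F, HasSum (fun i => T i F) (x F)) (F : Fock) :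
    ExpConverges T F ∧ expOp T F = expLoc x F := by
  refine expConverges_and_expOp_eq (A := x) (fun n => hT _) ?_
  refine Fock.hasSum_of_locallyFinite fun m n j => ⟨range (height m + 1), fun k hk => ?_, ?_⟩
  · have := hx.heightGE_dp (HeightGE.zero F) k m (by simp at hk; omega) n
    rw [dp, LinearMap.smul_apply, Module.End.pow_apply] at this
    rw [this]; rfl
  · rw [expLoc_apply hx F (Nat.lt_succ_self _), HahnSeries.coeff_sum]
    refine Finset.sum_congr rfl fun k _ => ?_
    rw [dp, LinearMap.smul_apply, Module.End.pow_apply]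

/-! ### Quantized Hamiltonians with infinitely many variables -/

/-- The monomial `q^m` only involves the variables `q^i_l` with `l ≤ K`. -/
def SuppLE (K : ℕ) (m : Var →₀ ℕ) : Prop := ∀ v, m v ≠ 0 → v.2 ≤ K

theorem SuppLE.mono {K K' : ℕ} (h : K ≤ K') {m : Var →₀ ℕ} (hm : SuppLE K m) : SuppLE K' m :=
  fun v hv => (hm v hv).trans h

theorem suppLE_height (m : Var →₀ ℕ) : SuppLE (height m) m := fun v hv => by
  have := height_sub_single hv
  omega

theorem SuppLE.sub_single {K : ℕ} {m : Var →₀ ℕ} (hm : SuppLE K m) (v : Var) :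
    SuppLE K (m - Finsupp.single v 1) := fun w hw => hm w fun h => hw (by
  rw [Finsupp.coe_tsub, Pi.sub_apply, h, Nat.zero_sub])

theorem SuppLE.add_single {K : ℕ} {m : Var →₀ ℕ} (hm : SuppLE K m) {v : Var} (hv : v.2 ≤ K) :
    SuppLE K (m + Finsupp.single v 1) := fun w hw => by
  by_cases h : w = v
  · rw [h]; exact hv
  · refine hm w ?_
    rwa [Finsupp.add_apply, Finsupp.single_eq_of_ne h, add_zero] at hw

/-- The operator whose coefficient of `q^m` is that of `T K`, for every large `K`. -/
def locOp (T : ℕ → Module.End AS Fock) : Module.End AS Fock where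
  toFun F := fun m n => T (height m) F m n
  map_add' F G := by
    refine Fock.ext fun m n => ?_
    change T (height m) (F + G) m n = T (height m) F m n + T (height m) G m n
    rw [map_add]; rfl
  map_smul' c F := by
    refine Fock.ext fun m n => ?_
    change T (height m) (c • F) m n = AS.val c * T (height m) F m n
    rw [map_smul]; rfl

/-- The coefficient of `q^m` in `T K F` does not depend on `K`, once all variables in `q^m` have
index at most `K`. -/
def Stable (T : ℕ → Module.End AS Fock) : Prop :=
  ∀ K K' m, K ≤ K' → SuppLE K m → ∀ F n, T K F m n = T K' F m n

theorem locOp_apply {T : ℕ → Module.End AS Fock} (hT : Stable T) {K : ℕ} {m : Var →₀ ℕ}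
    (hm : SuppLE K m) (F : Fock) (n : ℤ) : locOp T F m n = T K F m n := by
  change T (height m) F m n = _
  rw [hT _ (max K (height m)) m (le_max_right _ _) (suppLE_height m),
    hT K (max K (height m)) m (le_max_left _ _) hm]

theorem locOp_apply_height (T : ℕ → Module.End AS Fock) (F : Fock) (m : Var →₀ ℕ) (n : ℤ) :
    locOp T F m n = T (height m) F m n := rfl

theorem asymp_zero_smul (x : AsympSeries) : (0 : ℂ) • x = 0 := by
  rw [← asympConst_mul, asympConst, map_zero, map_zero, zero_mul]

theorem asymp_neg_smul (c : ℂ) (x : AsympSeries) : (-c) • x = -(c • x) := by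
  rw [← asympConst_mul, ← asympConst_mul, asympConst, map_neg, map_neg]
  exact neg_mul (α := AS) _ _

theorem raising_locOp {T : ℕ → Module.End AS Fock} (hT : ∀ K, Raising (T K)) :
    Raising (locOp T) := fun h F hF m hm n => hT (height m) h F hF m hm n

theorem crea_apply_of_not_suppLE {K : ℕ} {m : Var →₀ ℕ} (hm : SuppLE K m) {v : Var}
    (hv : K < v.2) (F : Fock) (n : ℤ) : crea v F m n = 0 := by
  rw [crea_apply, if_pos]
  by_contra h
  have := hm v h
  omega

theorem creaTrunc_apply (K : ℕ) (g : Var → AS) (F : Fock) (m : Var →₀ ℕ) (n : ℤ) :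
    creaTrunc K g F m n = ∑ v ∈ varsLE K, AS.val (g v) * crea v F m n := by
  rw [creaTrunc, LinearMap.sum_apply, Fock.sum_apply]
  rfl

theorem annTrunc_apply (K : ℕ) (g : Var → AS) (F : Fock) (m : Var →₀ ℕ) (n : ℤ) :
    annTrunc K g F m n = ∑ v ∈ varsLE K, AS.val (g v) * ann v F m n := by
  rw [annTrunc, LinearMap.sum_apply, Fock.sum_apply]
  rfl

theorem quadTrunc_apply (s : ℕ → Matrix (Fin 2) (Fin 2) ℂ) (K : ℕ) (F : Fock) (m : Var →₀ ℕ)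
    (n : ℤ) : quadTrunc s K F m n =
      ∑ v ∈ varsLE K, ∑ w ∈ varsLE K, quadCoeff s v w • crea v (crea w F) m n -
        ∑ v ∈ varsLE K, ∑ w ∈ varsLE K, shiftCoeff s v w • crea v (ann w F) m n := by
  rw [quadTrunc, LinearMap.sub_apply, Fock.sub_apply]
  simp only [LinearMap.sum_apply, Fock.sum_apply]
  rfl

theorem varsLE_mono {K K' : ℕ} (h : K ≤ K') : varsLE K ⊆ varsLE K' := fun v hv => by
  rw [mem_varsLE] at *
  omega

theorem stable_creaTrunc (g : Var → AS) : Stable fun K => creaTrunc K g := by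
  intro K K' m hK hm F n
  simp only [creaTrunc_apply]
  refine Finset.sum_subset (varsLE_mono hK) fun v _ hv => ?_
  rw [crea_apply_of_not_suppLE hm (by simpa using hv), mul_zero]

theorem crea_crea_eq_zero {K : ℕ} {m : Var →₀ ℕ} (hm : SuppLE K m) {w : Var}
    (hw : K < w.2) (v : Var) (F : Fock) (n : ℤ) : crea v (crea w F) m n = 0 := by
  rw [← Module.End.mul_apply, crea_mul_comm, Module.End.mul_apply,
    crea_apply_of_not_suppLE hm hw]

theorem stable_quadTrunc (s : ℕ → Matrix (Fin 2) (Fin 2) ℂ) : Stable (quadTrunc s) := by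
  intro K K' m hK hm F n
  simp only [quadTrunc_apply]
  congr 1
  · refine (Finset.sum_congr rfl fun v _ => ?_).trans
      (Finset.sum_subset (varsLE_mono hK) fun v _ hv => ?_)
    · refine Finset.sum_subset (varsLE_mono hK) fun w _ hw => ?_
      rw [crea_crea_eq_zero hm (by simpa using hw), smul_zero]
    · refine Finset.sum_eq_zero fun w _ => ?_
      rw [crea_apply_of_not_suppLE hm (by simpa using hv), smul_zero]
  · refine (Finset.sum_congr rfl fun v hv => ?_).trans
      (Finset.sum_subset (varsLE_mono hK) fun v _ hv => ?_)
    · refine Finset.sum_subset (varsLE_mono hK) fun w _ hw => ?_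
      rw [mem_varsLE] at hv hw
      rw [shiftCoeff, if_neg (by omega), asymp_zero_smul]
    · refine Finset.sum_eq_zero fun w _ => ?_
      rw [crea_apply_of_not_suppLE hm (by simpa using hv), smul_zero]

/-- The quantization of the quadratic Hamiltonian of `𝔰`. -/
def quadFull (s : ℕ → Matrix (Fin 2) (Fin 2) ℂ) : Module.End AS Fock := locOp (quadTrunc s)

/-- The multiplication operator `ε⁻¹ ∑ g_v q_v`. -/
def creaFull (g : Var → AS) : Module.End AS Fock := locOp fun K => creaTrunc K g

theorem raising_quadFull (s : ℕ → Matrix (Fin 2) (Fin 2) ℂ) : Raising (quadFull s) :=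
  raising_locOp fun K => raising_quadTrunc s K

theorem raising_creaFull (g : Var → AS) : Raising (creaFull g) :=
  raising_locOp fun K => raising_creaTrunc K g

theorem creaFull_add (g g' : Var → AS) :
    creaFull (fun v => g v + g' v) = creaFull g + creaFull g' := by
  refine LinearMap.ext fun F => Fock.ext fun m n => ?_
  rw [LinearMap.add_apply, Fock.add_apply, creaFull, creaFull, creaFull, locOp_apply_height,
    locOp_apply_height, locOp_apply_height, ← creaTrunc_add, LinearMap.add_apply, Fock.add_apply]

theorem commute_creaFull (g g' : Var → AS) : Commute (creaFull g) (creaFull g') := by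
  have h : ∀ (x : AS) (y : Module.End AS Fock) (a : AS) (b : Module.End AS Fock),
      Commute y b → Commute (x • y) (a • b) := fun x y a b hyb => (hyb.smul_left x).smul_right a
  refine LinearMap.ext fun F => Fock.ext fun m n => ?_
  have e : ∀ g g' : Var → AS, (creaFull g * creaFull g') F m n =
      (creaTrunc (height m) g * creaTrunc (height m) g') F m n := by
    intro g g'
    rw [Module.End.mul_apply, Module.End.mul_apply]
    rw [creaFull, locOp_apply_height, creaTrunc_apply, creaTrunc_apply]
    refine Finset.sum_congr rfl fun v _ => ?_
    rw [crea_apply, crea_apply]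
    refine congrArg (AS.val (g v) * ·) ?_
    split_ifs with h0
    · rfl
    · exact locOp_apply (stable_creaTrunc g') ((suppLE_height m).sub_single v) F _
  rw [e, e]
  have hc : Commute (creaTrunc (height m) g) (creaTrunc (height m) g') :=
    Commute.sum_left _ _ _ fun v _ => Commute.sum_right _ _ _ fun w _ =>
      h _ _ _ _ (crea_mul_comm v w)
  rw [hc.eq]

theorem hasSum_crea (g : Var → AS) (F : Fock) :
    HasSum (fun v => g v • crea v F) (creaFull g F) := by
  refine Fock.hasSum_of_locallyFinite fun m n j => ⟨varsLE (height m), fun v hv => ?_, ?_⟩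
  · rw [Fock.smul_apply, crea_apply_of_not_suppLE (suppLE_height m) (by simpa using hv), mul_zero]
    rfl
  · rw [creaFull, locOp_apply_height, creaTrunc_apply, HahnSeries.coeff_sum]
    simp only [Fock.smul_apply]

/-- The index of the shifted variable `q^i_{a+ℓ}` as a summation index. -/
theorem sum_range_shift {M : Type*} [AddCommMonoid M] (h : ℕ → M) (a N : ℕ)
    (hN : ∀ x, N ≤ x → h x = 0) :
    ∑ l ∈ range N, h (a + l + 1) = ∑ x ∈ range N, if a < x then h x else 0 := by
  have h1 : ∑ x ∈ range (a + 1 + N), (if a < x then h x else 0) =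
      ∑ l ∈ range N, h (a + l + 1) := by
    rw [Finset.sum_range_add, Finset.sum_eq_zero, zero_add]
    · refine Finset.sum_congr rfl fun l _ => ?_
      rw [if_pos (by omega)]
      congr 1
      omega
    · intro x hx
      rw [if_neg (by simp only [mem_range] at hx; omega)]
  rw [← h1]
  refine (Finset.sum_subset (by intro x; simp only [mem_range]; omega) fun x _ hx => ?_).symm
  rw [hN x (by simpa using hx)]
  simp

/-- Each monomial `q^m` receives contributions from finitely many terms of `ŝ` only, since every
term contains a factor `q_v` that has to divide `q^m`. -/
theorem hasSum_quadHatTerm (s : ℕ → Matrix (Fin 2) (Fin 2) ℂ) (F : Fock) :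
    HasSum (fun x => quadHatTerm s x F) (quadFull s F) := by
  refine Fock.hasSum_of_locallyFinite fun m n j => ?_
  set K := height m with hK
  have hm := suppLE_height m
  have e1 : ∀ v w, quadHatTerm s (Sum.inl (v, w)) F m n =
      quadCoeff s v w • crea v (crea w F) m n := by
    intro v w
    change quadCoeff s v w • epsPow (-2) (mulQ v (mulQ w F)) m n = _
    congr 1
    simp only [epsPow, mulQ, crea_apply]
    split_ifs <;> [rfl; rfl; skip]
    congr 1
    ring
  have e2 : ∀ v w, quadHatTerm s (Sum.inr (v, w)) F m n =
      -(s (v.2 + 1) w.1 v.1 • crea (v.1, w.2 + v.2 + 1) (ann w F) m n) := by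
    intro v w
    rw [← asymp_neg_smul]
    change (-(s (v.2 + 1) w.1 v.1)) • mulQ (v.1, w.2 + (v.2 + 1)) (dQ w F) m n = _
    congr 1
    simp only [mulQ, dQ, crea_apply, ann_apply, add_assoc, add_sub_cancel_right]
  refine ⟨(varsLE K ×ˢ varsLE K).disjSum (varsLE K ×ˢ varsLE K), ?_, ?_⟩
  · rintro (⟨v, w⟩ | ⟨v, w⟩) hx
    · rw [Finset.inl_mem_disjSum, Finset.mem_product, mem_varsLE, mem_varsLE, not_and_or] at hx
      rw [e1]
      rcases hx with hx | hx
      · rw [crea_apply_of_not_suppLE hm (by simpa using hx), smul_zero]; rfl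
      · rw [crea_crea_eq_zero hm (by simpa using hx), smul_zero]; rfl
    · rw [Finset.inr_mem_disjSum, Finset.mem_product, mem_varsLE, mem_varsLE, not_and_or] at hx
      rw [e2, crea_apply_of_not_suppLE hm (by dsimp only at hx ⊢; omega), smul_zero, neg_zero]; rfl
  · rw [← HahnSeries.coeff_sum, Finset.sum_disjSum, Finset.sum_product, Finset.sum_product]
    rw [quadFull, locOp_apply_height, quadTrunc_apply]
    simp only [e1, e2]
    rw [sub_eq_add_neg]
    refine congrArg (fun x => HahnSeries.coeff x j) (congrArg _ ?_)
    refine Finset.sum_comm.trans ?_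
    rw [Finset.sum_comm (f := fun v w => shiftCoeff s v w • crea v (ann w F) m n),
      ← Finset.sum_neg_distrib]
    refine Finset.sum_congr rfl fun w _ => ?_
    rw [Finset.sum_neg_distrib]
    refine congrArg (-·) ?_
    rw [sum_varsLE, sum_varsLE]
    refine Finset.sum_comm.trans (Eq.trans ?_ Finset.sum_comm)
    refine Finset.sum_congr rfl fun i _ => ?_
    -- the terms are indexed by the shift `ℓ`, those of `quadTrunc` by the variable that is
    -- multiplied
    have h3 := sum_range_shift
      (fun x => s (x - w.2) w.1 i • crea (i, x) (ann w F) m n) w.2 (K + 1) ?_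
    · simp only [shiftCoeff, ite_smul, asymp_zero_smul]
      rw [← h3]
      refine Finset.sum_congr rfl fun l _ => ?_
      have h5 : w.2 + l + 1 - w.2 = l + 1 := by omega
      simp only [h5]
    · intro x hx
      rw [crea_apply_of_not_suppLE hm (by dsimp only; omega), smul_zero]

/-! ### Continuity -/

instance : IsTopologicalAddGroup Fock := topologicalAddGroup_induced Fock.scalarCoeffHom

theorem Fock.continuous_scalarCoeff (x : (Var →₀ ℕ) × ℤ × ℤ × ℕ) :
    Continuous fun F : Fock => F.scalarCoeff x :=
  (continuous_apply x).comp Fock.isInducing_scalarCoeff.continuous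

theorem Fock.continuous_of_scalarCoeff {f : Fock → Fock}
    (h : ∀ x, Continuous fun F => (f F).scalarCoeff x) : Continuous f :=
  continuous_induced_rng.mpr (continuous_pi h)

theorem Fock.scalarCoeff_smul (c : ℂ) (F : Fock) (x : (Var →₀ ℕ) × ℤ × ℤ × ℕ) :
    (c • F).scalarCoeff x = c * F.scalarCoeff x := by
  simp [Fock.scalarCoeff]

theorem continuous_csmul (c : ℂ) {f : Fock → Fock} (hf : Continuous f) :
    Continuous fun F => c • f F := Fock.continuous_of_scalarCoeff fun x => by
  simp only [Fock.scalarCoeff_smul]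
  exact continuous_const.mul ((Fock.continuous_scalarCoeff x).comp hf)

theorem continuous_crea (v : Var) : Continuous (crea v) :=
  Fock.continuous_of_scalarCoeff fun x => by
    by_cases h : x.1 v = 0
    · simp only [Fock.scalarCoeff, crea_apply, if_pos h]
      exact continuous_const
    · simp only [Fock.scalarCoeff, crea_apply, if_neg h]
      exact Fock.continuous_scalarCoeff (x.1 - Finsupp.single v 1, x.2.1 + 1, x.2.2)

theorem continuous_ann (v : Var) : Continuous (ann v) :=
  Fock.continuous_of_scalarCoeff fun x => by
    have h : ∀ F, (ann v F).scalarCoeff x = ((x.1 v : ℂ) + 1) *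
        F.scalarCoeff (x.1 + Finsupp.single v 1, x.2.1 - 1, x.2.2) := by
      intro F
      rw [Fock.scalarCoeff, ann_apply]
      simp [Fock.scalarCoeff]
    simp only [h]
    exact continuous_const.mul (Fock.continuous_scalarCoeff _)

theorem continuous_quadTrunc (s : ℕ → Matrix (Fin 2) (Fin 2) ℂ) (K : ℕ) :
    Continuous (quadTrunc s K) := by
  have h : ∀ F, quadTrunc s K F =
      ∑ v ∈ varsLE K, ∑ w ∈ varsLE K, quadCoeff s v w • crea v (crea w F) -
        ∑ v ∈ varsLE K, ∑ w ∈ varsLE K, shiftCoeff s v w • crea v (ann w F) := by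
    intro F
    ext1 m n
    rw [quadTrunc_apply]
    simp only [Fock.sub_apply, Fock.sum_apply, Fock.csmul_apply]
  change Continuous fun F => quadTrunc s K F
  simp only [h]
  refine Continuous.sub ?_ ?_
  · refine continuous_finsetSum _ fun v _ => continuous_finsetSum _ fun w _ => ?_
    exact continuous_csmul _ ((continuous_crea v).comp (continuous_crea w))
  · refine continuous_finsetSum _ fun v _ => continuous_finsetSum _ fun w _ => ?_
    exact continuous_csmul _ ((continuous_crea v).comp (continuous_ann w))

theorem continuous_locOp {T : ℕ → Module.End AS Fock} (hT : ∀ K, Continuous (T K)) :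
    Continuous (locOp T) := Fock.continuous_of_scalarCoeff fun x => by
  have h := (Fock.continuous_scalarCoeff x).comp (hT (height x.1))
  exact h

theorem continuous_neg_end {x : Module.End AS Fock} (hx : Continuous x) :
    Continuous (-x : Module.End AS Fock) := by
  change Continuous fun F => -(x F)
  exact hx.neg

/-- Each coefficient of `expLoc x F` is a finite sum of coefficients of `x^k F / k!`. -/
theorem continuous_expLoc {x : Module.End AS Fock} (hx : Continuous x) :
    Continuous (expLoc x) := by
  have hp : ∀ k, Continuous fun F => dp x k F := by
    intro k
    have h1 : Continuous ⇑(x ^ k) := by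
      rw [Module.End.coe_pow]
      exact hx.iterate k
    exact continuous_csmul _ h1
  refine Fock.continuous_of_scalarCoeff fun y => ?_
  have h : ∀ F, (expLoc x F).scalarCoeff y =
      ∑ k ∈ range (height y.1 + 1), (dp x k F).scalarCoeff y := by
    intro F
    change (((∑ k ∈ range (height y.1 + 1), dp x k F y.1 y.2.1 : AsympSeries)).coeff _).coeff _ = _
    rw [HahnSeries.coeff_sum, Polynomial.finsetSum_coeff]
    rfl
  simp only [h]
  exact continuous_finsetSum _ fun k _ => (Fock.continuous_scalarCoeff y).comp (hp k)

/-! ### Truncation in powers of `λ⁻¹` -/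

/-- `x` is `O(λ^{-N})`. -/
def Van (N : ℤ) (x : AsympSeries) : Prop := ∀ j < N, x.coeff j = 0

namespace Van

variable {N : ℤ} {x y : AsympSeries}

theorem zero (N : ℤ) : Van N 0 := fun _ _ => rfl

theorem one : Van 0 1 := fun j hj => by
  rw [HahnSeries.coeff_one, if_neg (by omega)]

theorem mono {N' : ℤ} (h : N' ≤ N) (hx : Van N x) : Van N' x := fun j hj => hx j (by omega)

theorem add (hx : Van N x) (hy : Van N y) : Van N (x + y) := fun j hj => by
  rw [HahnSeries.coeff_add, hx j hj, hy j hj, add_zero]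

theorem sub (hx : Van N x) (hy : Van N y) : Van N (x - y) := fun j hj => by
  rw [HahnSeries.coeff_sub, hx j hj, hy j hj, sub_zero]

theorem csmul (c : ℂ) (hx : Van N x) : Van N (c • x) := fun j hj => by
  rw [HahnSeries.coeff_smul, hx j hj, smul_zero]

theorem sum {ι : Type*} {s : Finset ι} {f : ι → AsympSeries} (hf : ∀ i ∈ s, Van N (f i)) :
    Van N (∑ i ∈ s, f i) := fun j hj => by
  rw [HahnSeries.coeff_sum]
  exact Finset.sum_eq_zero fun i hi => hf i hi j hj

theorem mul {M : ℤ} (hx : Van N x) (hy : Van M y) : Van (N + M) (x * y) := fun j hj => by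
  rw [HahnSeries.coeff_mul]
  refine Finset.sum_eq_zero fun p hp => ?_
  rw [Finset.mem_antidiagonal] at hp
  obtain ⟨h1, h2, h3⟩ := hp
  rcases lt_or_ge p.1 N with h | h
  · exact absurd (hx _ h) h1
  · exact absurd (hy _ (by omega)) h2

theorem pow (hx : Van 0 x) (k : ℕ) : Van 0 (x ^ k) := by
  induction k with
  | zero => rw [pow_zero]; exact one
  | succ k ih => rw [pow_succ]; simpa using ih.mul hx

end Van

/-- The product of two series in `λ⁻¹` without positive powers. -/
theorem coeff_mul_of_van {x y : AsympSeries} (hx : Van 0 x) (hy : Van 0 y) (j : ℕ) :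
    (x * y).coeff j = ∑ p ∈ antidiagonal j, x.coeff p.1 * y.coeff p.2 := by
  have h : ∀ z : AsympSeries, Van 0 z →
      HahnSeries.ofPowerSeries ℤ (Polynomial ℂ) (PowerSeries.mk fun n => z.coeff n) = z := by
    intro z hz
    ext1
    funext n
    rcases lt_or_ge n 0 with hn | hn
    · rw [hz n hn, HahnSeries.ofPowerSeries_apply]
      refine HahnSeries.embDomain_of_notMem_range ?_
      rintro ⟨k, hk⟩
      change (k : ℤ) = n at hk
      omega
    · lift n to ℕ using hn
      rw [HahnSeries.ofPowerSeries_apply_coeff, PowerSeries.coeff_mk]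
  conv_lhs => rw [← h x hx, ← h y hy, ← map_mul]
  rw [HahnSeries.ofPowerSeries_apply_coeff, PowerSeries.coeff_mul]
  simp only [PowerSeries.coeff_mk]

/-- All coefficients of `F` are free of positive powers of `λ`. -/
def Reg (F : Fock) : Prop := ∀ m n, Van 0 (F m n)

/-- The coefficients of the monomials in the variables `q^i_l`, `l ≤ K`, are `O(λ^{-N})`. -/
def VanOn (K : ℕ) (N : ℤ) (F : Fock) : Prop := ∀ m, SuppLE K m → ∀ n, Van N (F m n)

namespace VanOn

variable {K : ℕ} {N : ℤ} {F G : Fock}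

theorem add (hF : VanOn K N F) (hG : VanOn K N G) : VanOn K N (F + G) :=
  fun m hm n => (hF m hm n).add (hG m hm n)

theorem sub (hF : VanOn K N F) (hG : VanOn K N G) : VanOn K N (F - G) :=
  fun m hm n => (hF m hm n).sub (hG m hm n)

theorem csmul (c : ℂ) (hF : VanOn K N F) : VanOn K N (c • F) := fun m hm n => (hF m hm n).csmul c

theorem smul {M : ℤ} {c : AS} (hc : Van M (AS.val c)) (hF : VanOn K N F) :
    VanOn K (M + N) (c • F) := fun m hm n => hc.mul (hF m hm n)

theorem sum {ι : Type*} {s : Finset ι} {f : ι → Fock} (hf : ∀ i ∈ s, VanOn K N (f i)) :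
    VanOn K N (∑ i ∈ s, f i) := fun m hm n => by
  rw [Fock.sum_apply]
  exact Van.sum fun i hi => hf i hi m hm n

theorem crea (v : Var) (hF : VanOn K N F) : VanOn K N (crea v F) := fun m hm n => by
  rw [crea_apply]
  split_ifs
  · exact Van.zero N
  · exact hF _ (hm.sub_single v) _

theorem ann {v : Var} (hv : v.2 ≤ K) (hF : VanOn K N F) : VanOn K N (ann v F) := fun m hm n => by
  rw [ann_apply]
  exact (hF _ (hm.add_single hv) _).csmul _

theorem quadTrunc (s : ℕ → Matrix (Fin 2) (Fin 2) ℂ) (hF : VanOn K N F) :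
    VanOn K N (quadTrunc s K F) := by
  rw [CatalanFM.quadTrunc, LinearMap.sub_apply, LinearMap.sum_apply, LinearMap.sum_apply]
  refine VanOn.sub (VanOn.sum fun v hv => ?_) (VanOn.sum fun v hv => ?_)
  · rw [LinearMap.sum_apply]
    exact VanOn.sum fun w hw => ((hF.crea w).crea v).csmul _
  · rw [LinearMap.sum_apply]
    exact VanOn.sum fun w hw => ((hF.ann (mem_varsLE.mp hw)).crea v).csmul _

theorem creaTrunc {M : ℤ} {g : Var → AS} (hg : ∀ v ∈ varsLE K, Van M (AS.val (g v)))
    (hF : VanOn K N F) : VanOn K (M + N) (creaTrunc K g F) := by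
  rw [CatalanFM.creaTrunc, LinearMap.sum_apply]
  exact VanOn.sum fun v hv => (hF.crea v).smul (hg v hv)

theorem annTrunc {M : ℤ} {c : Var → AS} (hc : ∀ v ∈ varsLE K, Van M (AS.val (c v)))
    (hF : VanOn K N F) : VanOn K (M + N) (annTrunc K c F) := by
  rw [CatalanFM.annTrunc, LinearMap.sum_apply]
  exact VanOn.sum fun v hv => (hF.ann (mem_varsLE.mp hv)).smul (hc v hv)

end VanOn

/-! ### Differentiation operators with infinitely many variables -/

/-- The coefficients of a differentiation operator `ε ∑ c_v ∂_v` that is defined on regular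
elements of the Fock space: `c_{(i,l)} = O(λ^{-l})`. -/
def Good (c : Var → AS) : Prop := ∀ v, Van v.2 (AS.val (c v))

theorem Good.van {c : Var → AS} (hc : Good c) (v : Var) : Van 0 (AS.val (c v)) :=
  (hc v).mono (Int.natCast_nonneg _)

/-- The differentiation operator `ε ∑ c_v ∂_v`; only the variables `q^i_l` with `l ≤ j` contribute
to the coefficient of `λ^{-j}`. -/
def annFull (c : Var → AS) (F : Fock) : Fock := fun m n =>
  HahnSeries.ofPowerSeries ℤ (Polynomial ℂ)
    (PowerSeries.mk fun j => (annTrunc j c F m n).coeff (j : ℤ))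

theorem coeff_annFull (c : Var → AS) (F : Fock) (m : Var →₀ ℕ) (n : ℤ) (j : ℕ) :
    (annFull c F m n).coeff (j : ℤ) = (annTrunc j c F m n).coeff (j : ℤ) := by
  rw [annFull, HahnSeries.ofPowerSeries_apply_coeff, PowerSeries.coeff_mk]

theorem reg_annFull (c : Var → AS) (F : Fock) : Reg (annFull c F) := fun m n j hj => by
  rw [annFull, HahnSeries.ofPowerSeries_apply]
  refine HahnSeries.embDomain_of_notMem_range ?_
  rintro ⟨k, hk⟩
  change (k : ℤ) = j at hk
  omega

theorem Reg.ann {F : Fock} (hF : Reg F) (v : Var) : Reg (ann v F) := fun m n => by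
  rw [ann_apply]
  exact (hF _ _).csmul _

theorem Good.coeff_mul_ann {c : Var → AS} (hc : Good c) {F : Fock} (hF : Reg F) {v : Var} {j : ℤ}
    (hv : j < v.2) (m : Var →₀ ℕ) (n : ℤ) : (AS.val (c v) * ann v F m n).coeff j = 0 :=
  (hc v).mul ((hF.ann v) m n) j (by omega)

theorem coeff_annTrunc {c : Var → AS} (hc : Good c) {F : Fock} (hF : Reg F) {K j : ℕ} (hj : j ≤ K)
    (m : Var →₀ ℕ) (n : ℤ) :
    (annTrunc K c F m n).coeff (j : ℤ) = (annTrunc j c F m n).coeff (j : ℤ) := by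
  rw [annTrunc_apply, annTrunc_apply, HahnSeries.coeff_sum, HahnSeries.coeff_sum]
  refine (Finset.sum_subset (varsLE_mono hj) fun v _ hv => ?_).symm
  rw [mem_varsLE] at hv
  exact hc.coeff_mul_ann hF (by omega) m n

theorem van_annFull_sub {c : Var → AS} (hc : Good c) {F : Fock} (hF : Reg F) (K : ℕ) :
    VanOn K (K + 1) (annFull c F - annTrunc K c F) := fun m hm n j hj => by
  rw [Fock.sub_apply, HahnSeries.coeff_sub]
  rcases lt_or_ge j 0 with h | h
  · rw [reg_annFull c F m n j h, annTrunc_apply]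
    rw [Van.sum (fun v _ => (hc.van v).mul (hF.ann v m n)) j (by simpa using h), sub_zero]
  · lift j to ℕ using h
    rw [coeff_annFull, coeff_annTrunc hc hF (K := K) (by omega), sub_self]

theorem hasSum_ann {c : Var → AS} (hc : Good c) {F : Fock} (hF : Reg F) :
    HasSum (fun v => c v • ann v F) (annFull c F) := by
  refine Fock.hasSum_of_locallyFinite fun m n j => ?_
  rcases lt_or_ge j 0 with h | h
  · refine ⟨∅, fun v _ => ?_, ?_⟩
    · exact (hc.van v).mul (hF.ann v m n) j (by simpa using h)
    · rw [Finset.sum_empty, reg_annFull c F m n j h]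
  · lift j to ℕ using h
    refine ⟨varsLE j, fun v hv => ?_, ?_⟩
    · rw [mem_varsLE] at hv
      exact hc.coeff_mul_ann hF (by omega) m n
    · rw [coeff_annFull, annTrunc_apply, HahnSeries.coeff_sum]
      simp only [Fock.smul_apply]

/-! ### Approximation of operators by operators in finitely many variables -/

/-- `F` is regular and agrees with `G` up to terms with variables `q^i_l`, `l > K`, and up to
`O(λ^{-K-1})`. -/
structure Rel (K : ℕ) (F G : Fock) : Prop where
  reg : Reg F
  van : VanOn K 0 G
  sub : VanOn K (K + 1) (F - G)

/-- The operator `B` is the truncation of the operator `A` to order `K`. -/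
def Approx (K : ℕ) (A : Fock → Fock) (B : Module.End AS Fock) : Prop :=
  ∀ F G, Rel K F G → Rel K (A F) (B G)

theorem Rel.refl {F : Fock} (hF : Reg F) (K : ℕ) : Rel K F F :=
  ⟨hF, fun m _ n => hF m n, fun m _ n => by rw [sub_self]; exact Van.zero _⟩

theorem Rel.add {K : ℕ} {F G F' G' : Fock} (h : Rel K F G) (h' : Rel K F' G') :
    Rel K (F + F') (G + G') :=
  ⟨fun m n => (h.reg m n).add (h'.reg m n), h.van.add h'.van, by
    rw [add_sub_add_comm]; exact h.sub.add h'.sub⟩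

theorem Rel.csmul {K : ℕ} {F G : Fock} (c : ℂ) (h : Rel K F G) : Rel K (c • F) (c • G) :=
  ⟨fun m n => (h.reg m n).csmul c, h.van.csmul c, by
    rw [← smul_sub]; exact h.sub.csmul c⟩

theorem Rel.zero (K : ℕ) : Rel K 0 0 := Rel.refl (fun _ _ => Van.zero 0) K

theorem Rel.sum {K : ℕ} {ι : Type*} {s : Finset ι} {F G : ι → Fock}
    (h : ∀ i ∈ s, Rel K (F i) (G i)) : Rel K (∑ i ∈ s, F i) (∑ i ∈ s, G i) := by
  classical
  induction s using Finset.induction_on with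
  | empty => exact Rel.zero K
  | insert i s hi ih =>
    rw [Finset.sum_insert hi, Finset.sum_insert hi]
    exact (h i (Finset.mem_insert_self i s)).add
      (ih fun j hj => h j (Finset.mem_insert_of_mem hj))

theorem Rel.smul {K : ℕ} {F G : Fock} {x y : AS} (hx : Van 0 (AS.val x)) (hy : Van 0 (AS.val y))
    (hxy : Van (K + 1) (AS.val (x - y))) (h : Rel K F G) : Rel K (x • F) (y • G) :=
  ⟨fun m n => by simpa using hx.mul (h.reg m n), by simpa using h.van.smul hy, by
    have e : x • F - y • G = x • (F - G) + (x - y) • G := by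
      rw [smul_sub, sub_smul]; abel
    rw [e]
    refine VanOn.add ?_ ?_
    · simpa using h.sub.smul hx
    · simpa using h.van.smul hxy⟩

theorem Approx.iterate {K : ℕ} {A : Fock → Fock} {B : Module.End AS Fock} (h : Approx K A B)
    (N : ℕ) : Approx K (A^[N]) (B ^ N) := by
  intro F G hFG
  induction N with
  | zero => exact hFG
  | succ N ih =>
    rw [Function.iterate_succ_apply', pow_succ', Module.End.mul_apply]
    exact h _ _ ih

theorem Approx.dp {K : ℕ} {A B : Module.End AS Fock} (h : Approx K A B) (N : ℕ) :
    Approx K (fun F => dp A N F) (dp B N) := by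
  intro F G hFG
  have := (h.iterate N F G hFG).csmul ((N.factorial : ℂ)⁻¹)
  simp only [CatalanFM.dp, LinearMap.smul_apply]
  rwa [Module.End.pow_apply A]

/-- Two regular elements with common truncations to all orders are equal. -/
theorem eq_of_rel {F F' : Fock} (h : ∀ K, ∃ G, Rel K F G ∧ Rel K F' G) : F = F' := by
  refine Fock.ext fun m n => ?_
  ext1
  funext j
  set K := max (height m) j.toNat
  obtain ⟨G, h1, h2⟩ := h K
  have hm : SuppLE K m := (suppLE_height m).mono (le_max_left _ _)
  have hj : j < (K : ℤ) + 1 := by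
    have : j.toNat ≤ K := le_max_right _ _
    omega
  have e1 := h1.sub m hm n j hj
  have e2 := h2.sub m hm n j hj
  rw [Fock.sub_apply, HahnSeries.coeff_sub, sub_eq_zero] at e1 e2
  rw [e1, e2]

/-- The variables `q^i_l` with `l > K` enter a differentiation operator only with coefficients that
are `O(λ^{-K-1})`. -/
theorem approx_annFull {K : ℕ} {c c' : Var → AS} (hc : Good c)
    (hc' : ∀ v ∈ varsLE K, Van 0 (AS.val (c' v)))
    (h : ∀ v ∈ varsLE K, Van (K + 1) (AS.val (c v - c' v))) :
    Approx K (annFull c) (annTrunc K c') := by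
  intro F G hFG
  refine ⟨reg_annFull c F, by simpa using hFG.van.annTrunc hc', ?_⟩
  have e : annFull c F - annTrunc K c' G = (annFull c F - annTrunc K c F) +
      (annTrunc K c (F - G) + annTrunc K (fun v => c v - c' v) G) := by
    have : annTrunc K (fun v => c v - c' v) G = annTrunc K c G - annTrunc K c' G := by
      simp only [annTrunc, LinearMap.sum_apply, ← Finset.sum_sub_distrib, LinearMap.smul_apply,
        sub_smul, LinearMap.sub_apply]
    rw [this, map_sub]
    abel
  rw [e]
  refine (van_annFull_sub hc hFG.reg K).add (VanOn.add ?_ ?_)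
  · simpa using hFG.sub.annTrunc (M := 0) fun v _ => hc.van v
  · simpa using hFG.van.annTrunc h

/-- An operator that is defined by its truncations is approximated by them, because the coefficients
of the monomials in the variables `l ≤ K` only depend on such coefficients of the argument. -/
theorem approx_locOp {T : ℕ → Module.End AS Fock} (hT : Stable T)
    (hV : ∀ (K : ℕ) (N : ℤ) F, 0 ≤ N → VanOn K N F → VanOn K N (T K F)) {K : ℕ}
    {B : Module.End AS Fock}
    (hB : ∀ G, VanOn K 0 G → VanOn K 0 (B G) ∧ VanOn K (K + 1) (T K G - B G)) :
    Approx K (locOp T) B := by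
  intro F G hFG
  refine ⟨fun m n => ?_, (hB G hFG.van).1, ?_⟩
  · rw [locOp_apply_height]
    exact hV (height m) 0 F le_rfl (fun m' _ n' => hFG.reg m' n') m (suppLE_height m) n
  · have e : VanOn K (K + 1) (T K (F - G) + (T K G - B G)) :=
      (hV K _ _ (by omega) hFG.sub).add (hB G hFG.van).2
    intro m hm n
    have := e m hm n
    rw [map_sub, sub_add_sub_cancel, Fock.sub_apply] at this
    rwa [Fock.sub_apply, locOp_apply hT hm]

theorem approx_quadFull (s : ℕ → Matrix (Fin 2) (Fin 2) ℂ) (K : ℕ) :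
    Approx K (quadFull s) (quadTrunc s K) :=
  approx_locOp (stable_quadTrunc s) (fun K N F _ hF => hF.quadTrunc s) fun G hG =>
    ⟨hG.quadTrunc s, by rw [sub_self]; exact fun m _ n => Van.zero _⟩

theorem approx_creaFull {K : ℕ} {g g' : Var → AS} (hg : ∀ v, Van 0 (AS.val (g v)))
    (hg' : ∀ v ∈ varsLE K, Van 0 (AS.val (g' v)))
    (h : ∀ v ∈ varsLE K, Van (K + 1) (AS.val (g v - g' v))) :
    Approx K (creaFull g) (creaTrunc K g') :=
  approx_locOp (stable_creaTrunc g)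
    (fun K N F _ hF => by simpa using hF.creaTrunc (M := 0) fun v _ => hg v) fun G hG => by
      refine ⟨by simpa using hG.creaTrunc hg', ?_⟩
      have : creaTrunc K g G - creaTrunc K g' G = creaTrunc K (fun v => g v - g' v) G := by
        simp only [creaTrunc, LinearMap.sum_apply, ← Finset.sum_sub_distrib, LinearMap.smul_apply,
          sub_smul, LinearMap.sub_apply]
      rw [this]
      simpa using hG.creaTrunc h

theorem Approx.neg {K : ℕ} {A B : Module.End AS Fock} (h : Approx K A B) : Approx K (-A) (-B) := by
  intro F G hFG
  have h1 := (h F G hFG).csmul (-1)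
  rwa [neg_one_smul, neg_one_smul] at h1

theorem Approx.expLoc {K : ℕ} {A B : Module.End AS Fock} (h : Approx K A B) :
    Approx K (expLoc A) (expLoc B) := by
  intro F G hFG
  have h1 := fun m : Var →₀ ℕ => Rel.sum (s := range (height m + 1)) fun k _ => h.dp k F G hFG
  refine ⟨fun m n => ?_, fun m hm n => ?_, fun m hm n => ?_⟩
  · have := (h1 m).reg m n
    rwa [Fock.sum_apply] at this
  · have := (h1 m).van m hm n
    rwa [Fock.sum_apply] at this
  · have := (h1 m).sub m hm n
    rwa [Fock.sub_apply, Fock.sum_apply, Fock.sum_apply] at this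

/-! ### Conjugation of differentiation operators -/

theorem annTrunc_mul_creaTrunc (K : ℕ) (c g : Var → AS) :
    annTrunc K c * creaTrunc K g =
      creaTrunc K g * annTrunc K c + (∑ v ∈ varsLE K, c v * g v) • (1 : Module.End AS Fock) := by
  have e : ∀ v ∈ varsLE K, (c v • ann v) * creaTrunc K g =
      creaTrunc K g * (c v • ann v) + (c v * g v) • (1 : Module.End AS Fock) := by
    intro v hv
    have e2 : ∀ w, (c v • ann v) * (g w • crea w) =
        (g w • crea w) * (c v • ann v) +
          if v = w then (c v * g w) • (1 : Module.End AS Fock) else 0 := by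
      intro w
      rw [smul_mul_smul_comm, smul_mul_smul_comm, ann_mul_crea, smul_add, mul_comm (g w)]
      split_ifs <;> simp
    rw [creaTrunc, Finset.mul_sum, Finset.sum_mul, Finset.sum_congr rfl fun w _ => e2 w,
      Finset.sum_add_distrib, Finset.sum_ite_eq, if_pos hv]
  rw [annTrunc, Finset.sum_mul, Finset.sum_congr rfl e, Finset.sum_add_distrib, ← Finset.mul_sum,
    Finset.sum_smul]

theorem dp_smul_one (z : AS) (n : ℕ) :
    dp (z • (1 : Module.End AS Fock)) n = dp z n • (1 : Module.End AS Fock) := by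
  rw [dp, dp, smul_pow, one_pow, smul_assoc]

theorem halfSquareExp_smul_one (z : AS) (n : ℕ) :
    halfSquareExp (z • (1 : Module.End AS Fock)) n =
      halfSquareExp z n • (1 : Module.End AS Fock) := by
  rw [halfSquareExp, halfSquareExp, ← smul_assoc, dp_smul_one]
  split_ifs <;> simp

theorem dp_mul_of_intertwine {E : Type*} [Ring E] [Algebra ℂ E] {x y z : E} (h : y * x = x * z)
    (k : ℕ) : dp y k * x = x * dp z k := by
  have : y ^ k * x = x * z ^ k := by
    induction k with
    | zero => simp
    | succ k ih => rw [pow_succ', mul_assoc, ih, ← mul_assoc, h, mul_assoc, ← pow_succ']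
  rw [dp, dp, smul_mul_assoc, this, mul_smul_comm]

theorem van_mul_sub_mul {N : ℤ} {x x' y y' : AS} (hx : Van 0 (AS.val x)) (hy' : Van 0 (AS.val y'))
    (h : Van N (AS.val (x - y))) (h' : Van N (AS.val (x' - y'))) :
    Van N (AS.val (x * x' - y * y')) := by
  have e : x * x' - y * y' = x * (x' - y') + (x - y) * y' := by ring
  rw [e, map_add, map_mul, map_mul]
  refine Van.add ?_ ?_
  · simpa using hx.mul h'
  · simpa using h.mul hy'

theorem van_val_csmul {N : ℤ} {x : AS} (c : ℂ) (hx : Van N (AS.val x)) :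
    Van N (AS.val (c • x)) := by
  rw [AS.val_smul]; exact hx.csmul c

theorem van_dp {x : AS} (hx : Van 0 (AS.val x)) (n : ℕ) : Van 0 (AS.val (dp x n)) := by
  rw [dp]
  refine van_val_csmul _ ?_
  rw [map_pow]
  exact hx.pow n

theorem van_dp_sub {N : ℤ} {x y : AS} (hx : Van 0 (AS.val x)) (hy : Van 0 (AS.val y))
    (h : Van N (AS.val (x - y))) (n : ℕ) : Van N (AS.val (dp x n - dp y n)) := by
  rw [dp, dp, ← smul_sub]
  refine van_val_csmul _ ?_
  induction n with
  | zero => simpa using Van.zero N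
  | succ n ih =>
    rw [pow_succ, pow_succ]
    refine van_mul_sub_mul ?_ hy ih h
    rw [map_pow]
    exact hx.pow n

theorem van_halfSquareExp {x : AS} (hx : Van 0 (AS.val x)) (n : ℕ) :
    Van 0 (AS.val (halfSquareExp x n)) := by
  rw [halfSquareExp]
  split_ifs
  · exact van_dp (van_val_csmul _ hx) _
  · rw [map_zero]; exact Van.zero 0

theorem van_halfSquareExp_sub {N : ℤ} {x y : AS} (hx : Van 0 (AS.val x)) (hy : Van 0 (AS.val y))
    (h : Van N (AS.val (x - y))) (n : ℕ) :
    Van N (AS.val (halfSquareExp x n - halfSquareExp y n)) := by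
  rw [halfSquareExp, halfSquareExp]
  split_ifs
  · refine van_dp_sub (van_val_csmul _ hx) (van_val_csmul _ hy) ?_ _
    rw [← smul_sub]
    exact van_val_csmul _ h
  · rw [sub_zero, map_zero]; exact Van.zero N

/-- The coefficients of the derivatives in the quantization of `∑_l f^l (-z)^l`. -/
def posCoeff (f : ℤ → Fin 2 → AS) (v : Var) : AS := (-1 : ℂ) ^ (v.2 + 1) • f v.2 v.1

/-- The coefficients of the variables in the quantization of `∑_l f^l (-z)^l`. -/
def negCoeff (f : ℤ → Fin 2 → AS) (v : Var) : AS := ∑ j, eta v.1 j • f (-((v.2 : ℤ) + 1)) j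

/-- The contribution of `S_k` to the component `i` of the coefficient of `(-z)^l` in the product
`S (∑_l f^l (-z)^l)`. -/
def conjTerm (S : ℕ → Matrix (Fin 2) (Fin 2) ℂ) (f : ℤ → Fin 2 → AS) (l : ℤ) (k : ℕ) (i : Fin 2) :
    AS := (-1 : ℂ) ^ k • ∑ j, S k i j • f (l + k) j

/-- The coefficients of the variables in the quantization of `S f_-`. -/
def conjNegCoeff (S : ℕ → Matrix (Fin 2) (Fin 2) ℂ) (f : ℤ → Fin 2 → AS) (v : Var) : AS :=
  ∑ j, eta v.1 j • ∑ k ∈ range (v.2 + 1), conjTerm S f (-((v.2 : ℤ) + 1)) k j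

/-- The coefficients of the variables in the quantization of `(S f_+)_-`, for `G = S f`. -/
def mixCoeff (S : ℕ → Matrix (Fin 2) (Fin 2) ℂ) (f G : ℤ → Fin 2 → AS) (v : Var) : AS :=
  negCoeff G v - conjNegCoeff S f v

/-- The part of `z^{-K} ∑_l f^l (-z)^l` selected by `p`, as a power series in `z⁻¹`. -/
def shiftedSeries (f : ℤ → Fin 2 → AS) (K : ℕ) (p : ℕ → Prop) [DecidablePred p] :
    PowerSeries AMat :=
  PowerSeries.mk fun n => Matrix.of fun i _ =>
    if p n then (-1 : ℂ) ^ (K + n) • f ((K : ℤ) - n) i else 0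

theorem colCoeff_shiftedSeries (f : ℤ → Fin 2 → AS) (K : ℕ) (p : ℕ → Prop) [DecidablePred p]
    (n : ℕ) (i : Fin 2) : colCoeff (shiftedSeries f K p) n i =
      if p n then (-1 : ℂ) ^ (K + n) • f ((K : ℤ) - n) i else 0 := by
  simp [colCoeff, shiftedSeries]

theorem colCoeff_mul_shiftedSeries (S : ℕ → Matrix (Fin 2) (Fin 2) ℂ) (f : ℤ → Fin 2 → AS) (K : ℕ)
    (p : ℕ → Prop) [DecidablePred p] (n : ℕ) (i : Fin 2) :
    colCoeff (liftSeries (PowerSeries.mk S) * shiftedSeries f K p) n i =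
      (-1 : ℂ) ^ (K + n) • ∑ k ∈ range (n + 1),
        if p (n - k) then conjTerm S f ((K : ℤ) - n) k i else 0 := by
  rw [colCoeff_liftSeries_mul, Finset.Nat.sum_antidiagonal_eq_sum_range_succ
    (fun a b => ∑ j, S a i j • colCoeff (shiftedSeries f K p) b j), Finset.smul_sum]
  refine Finset.sum_congr rfl fun k hk => ?_
  rw [mem_range] at hk
  simp only [colCoeff_shiftedSeries]
  split_ifs
  · rw [conjTerm, smul_smul, ← pow_add, Finset.smul_sum]
    refine Finset.sum_congr rfl fun j _ => ?_
    rw [smul_comm]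
    have e1 : (-1 : ℂ) ^ (K + (n - k)) = (-1) ^ (K + n + k) := by
      rw [show K + n + k = K + (n - k) + 2 * k by omega, pow_add _ _ (2 * k), pow_mul]
      norm_num
    have e2 : (K : ℤ) - ((n - k : ℕ) : ℤ) = (K : ℤ) - n + k := by omega
    rw [e1, e2]
  · simp

section Conjugation

variable {s S : ℕ → Matrix (Fin 2) (Fin 2) ℂ} {f G : ℤ → Fin 2 → AS}

theorem linTrunc_shiftedSeries_pos (K : ℕ) :
    linTrunc K (shiftedSeries f K (· ≤ K)) = annTrunc K (posCoeff f) := by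
  rw [linTrunc, ← add_zero (annTrunc K (posCoeff f)), ← creaTrunc_zero K]
  refine congrArg₂ _ (annTrunc_congr fun v hv => ?_) (creaTrunc_congr fun v hv => ?_)
  · have hv := mem_varsLE.mp hv
    rw [colCoeff_shiftedSeries, if_pos (by omega), posCoeff, ← neg_one_smul ℂ, smul_smul]
    have e1 : (-1 : ℂ) * (-1) ^ (K + (K - v.2)) = (-1) ^ (v.2 + 1) := by
      rw [show K + (K - v.2) = 2 * (K - v.2) + v.2 by omega, pow_add, pow_mul]
      norm_num [pow_succ]
    have e2 : (K : ℤ) - ((K - v.2 : ℕ) : ℤ) = v.2 := by omega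
    rw [e1, e2]
  · simp only [colCoeff_shiftedSeries]
    rw [Finset.sum_eq_zero, smul_zero]
    intro j _
    rw [if_neg (by omega), smul_zero]

theorem linTrunc_shiftedSeries_neg (K : ℕ) :
    linTrunc K (shiftedSeries f K (K < ·)) = creaTrunc K (negCoeff f) := by
  rw [linTrunc, ← zero_add (creaTrunc K (negCoeff f)), ← annTrunc_zero K]
  refine congrArg₂ _ (annTrunc_congr fun v hv => ?_) (creaTrunc_congr fun v hv => ?_)
  · rw [colCoeff_shiftedSeries, if_neg (by omega), neg_zero]
  · simp only [colCoeff_shiftedSeries]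
    rw [negCoeff, Finset.smul_sum]
    refine Finset.sum_congr rfl fun j _ => ?_
    rw [if_pos (by omega), smul_comm _ (eta v.1 j),
      smul_smul ((-1 : ℂ) ^ (v.2 + 1)), ← pow_add]
    have e1 : (-1 : ℂ) ^ (v.2 + 1 + (K + (K + v.2 + 1))) = 1 := by
      rw [show v.2 + 1 + (K + (K + v.2 + 1)) = 2 * (K + v.2 + 1) by omega, pow_mul]
      norm_num
    have e2 : (K : ℤ) - ((K + v.2 + 1 : ℕ) : ℤ) = -((v.2 : ℤ) + 1) := by push_cast; ring
    rw [e1, e2, one_smul]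

theorem linTrunc_mul_shiftedSeries_neg (K : ℕ) :
    linTrunc K (liftSeries (PowerSeries.mk S) * shiftedSeries f K (K < ·)) =
      creaTrunc K (conjNegCoeff S f) := by
  rw [linTrunc, ← zero_add (creaTrunc K (conjNegCoeff S f)), ← annTrunc_zero K]
  refine congrArg₂ _ (annTrunc_congr fun v hv => ?_) (creaTrunc_congr fun v hv => ?_)
  · rw [colCoeff_mul_shiftedSeries, Finset.sum_eq_zero, smul_zero, neg_zero]
    intro k _
    rw [if_neg (by omega)]
  · rw [conjNegCoeff, Finset.smul_sum]
    refine Finset.sum_congr rfl fun j _ => ?_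
    rw [colCoeff_mul_shiftedSeries, smul_comm _ (eta v.1 j),
      smul_smul ((-1 : ℂ) ^ (v.2 + 1)), ← pow_add]
    have e1 : (-1 : ℂ) ^ (v.2 + 1 + (K + (K + v.2 + 1))) = 1 := by
      rw [show v.2 + 1 + (K + (K + v.2 + 1)) = 2 * (K + v.2 + 1) by omega, pow_mul]
      norm_num
    have e2 : (K : ℤ) - ((K + v.2 + 1 : ℕ) : ℤ) = -((v.2 : ℤ) + 1) := by push_cast; ring
    rw [e1, e2, one_smul]
    congr 1
    rw [show K + v.2 + 1 + 1 = v.2 + 1 + (K + 1) by omega, Finset.sum_range_add,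
      Finset.sum_eq_zero (s := range (K + 1)), add_zero]
    · refine Finset.sum_congr rfl fun k hk => ?_
      rw [mem_range] at hk
      rw [if_pos (by omega)]
    · intro k _
      rw [if_neg (by omega)]

/-- Conjugation by `Ŝ` multiplies `f_-` by `S`. -/
theorem creaFull_conj (hs0 : s 0 = 0)
    (hs : ∀ l, eta * s l = ((-1 : ℂ) ^ (l + 1)) • ((s l).transpose * eta))
    (hS : expSeries (PowerSeries.mk s) = PowerSeries.mk S) :
    creaFull (conjNegCoeff S f) * expLoc (quadFull s) =
      expLoc (quadFull s) * creaFull (negCoeff f) := by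
  -- it suffices to compare with the operators in finitely many variables, for each monomial
  have e : ∀ (K : ℕ) (m : Var →₀ ℕ), SuppLE K m → ∀ (F : Fock) n,
      expLoc (quadFull s) F m n = expLoc (quadTrunc s K) F m n := by
    intro K m hm F n
    have hp : ∀ (k : ℕ) (m : Var →₀ ℕ), SuppLE K m → ∀ n,
        (quadFull s ^ k) F m n = (quadTrunc s K ^ k) F m n := by
      intro k
      induction k with
      | zero => intro m _ n; rfl
      | succ k ih =>
        intro m hm n
        rw [pow_succ', pow_succ', Module.End.mul_apply, Module.End.mul_apply, quadFull,
          locOp_apply (stable_quadTrunc s) hm]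
        -- operators in the variables `l ≤ K` do not see the other variables
        have h0 : ∀ D : Fock, (∀ m, SuppLE K m → ∀ n, D m n = 0) →
            ∀ m, SuppLE K m → ∀ n, quadTrunc s K D m n = 0 := by
          intro D hD m hm n
          have h1 : ∀ N : ℤ, VanOn K N D := fun N m hm n => by rw [hD m hm n]; exact Van.zero N
          ext1
          funext j
          exact (h1 (j + 1)).quadTrunc s m hm n j (by omega)
        have h1 := h0 ((locOp (quadTrunc s) ^ k) F - (quadTrunc s K ^ k) F)
          (fun m hm n => by rw [Fock.sub_apply, sub_eq_zero]; exact ih m hm n) m hm n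
        rwa [map_sub, Fock.sub_apply, sub_eq_zero] at h1
    rw [expLoc_apply (raising_quadFull s) F (Nat.lt_succ_self _),
      expLoc_apply (raising_quadTrunc s K) F (Nat.lt_succ_self _)]
    refine Finset.sum_congr rfl fun k _ => ?_
    rw [dp, dp, LinearMap.smul_apply, LinearMap.smul_apply, Fock.csmul_apply, Fock.csmul_apply,
      hp k m hm n]
  refine LinearMap.ext fun F => Fock.ext fun m n => ?_
  set K := height m with hK
  have hm := suppLE_height m
  have h1 := congrArg (fun x => x F m n)
    (expLoc_quadTrunc_mul_linTrunc hs0 hs K (shiftedSeries f K (K < ·)))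
  simp only [hS, linTrunc_mul_shiftedSeries_neg, linTrunc_shiftedSeries_neg,
    Module.End.mul_apply] at h1
  rw [Module.End.mul_apply, Module.End.mul_apply, creaFull, locOp_apply_height, creaTrunc_apply]
  rw [creaTrunc_apply] at h1
  rw [e K m hm]
  have h2 : ∀ D : Fock, (∀ m, SuppLE K m → ∀ n, D m n = 0) →
      ∀ m, SuppLE K m → ∀ n, expLoc (quadTrunc s K) D m n = 0 := by
    intro D hD m hm n
    ext1
    funext j
    have h1 : ∀ k, VanOn K (j + 1) ((quadTrunc s K ^ k) D) := by
      intro k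
      induction k with
      | zero =>
        intro m hm n
        rw [pow_zero, Module.End.one_apply, hD m hm n]
        exact Van.zero _
      | succ k ih => rw [pow_succ', Module.End.mul_apply]; exact ih.quadTrunc s
    rw [expLoc_apply (raising_quadTrunc s K) D (Nat.lt_succ_self _)]
    exact Van.sum (fun k _ => ((h1 k).csmul _) m hm n) j (by omega)
  have h3 := h2 (creaFull (negCoeff f) F - creaTrunc K (negCoeff f) F) (fun m hm n => by
    rw [Fock.sub_apply, sub_eq_zero, creaFull, locOp_apply (stable_creaTrunc _) hm]) m hm n
  rw [map_sub, Fock.sub_apply, sub_eq_zero] at h3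
  rw [h3, h1]
  refine Finset.sum_congr rfl fun v _ => ?_
  rw [crea_apply, crea_apply]
  refine congrArg (AS.val (conjNegCoeff S f v) * ·) ?_
  split_ifs
  · rfl
  · exact e K _ (hm.sub_single v) F _

theorem good_posCoeff (hf : ∀ (l : ℤ) i, Van l (AS.val (f l i))) : Good (posCoeff f) :=
  fun v => van_val_csmul _ (hf v.2 v.1)

/-- `Φ_j = ∑_{k+q=j} M^k/k! D^q/q!`, the part of degree `j` in `(M, D)` of the normally ordered
exponential, where `D` is a differentiation operator. -/
def normalOrdFull (r c : Var → AS) (F : Fock) (j : ℕ) : Fock :=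
  ∑ p ∈ antidiagonal j, dp (creaFull r) p.1 (((p.2.factorial : ℂ)⁻¹) • (annFull c)^[p.2] F)

theorem val_sum {ι : Type*} (s : Finset ι) (x : ι → AS) :
    AS.val (∑ i ∈ s, x i) = ∑ i ∈ s, AS.val (x i) := map_sum AS.val x s

variable (hG : ∀ (l : ℤ) (B : ℕ) i,
  Van (l + B) (AS.val (G l i - ∑ k ∈ range B, conjTerm S f l k i)))

include hG in
theorem van_of_conj (l : ℤ) (i : Fin 2) : Van l (AS.val (G l i)) := by
  simpa using hG l 0 i

include hG in
/-- The terms of `S f` with the indices `k ≤ l` cancel in `(S f_+)_-`, and the remaining ones have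
no positive powers of `λ`. -/
theorem van_mixCoeff (v : Var) : Van 0 (AS.val (mixCoeff S f G v)) := by
  rw [mixCoeff, negCoeff, conjNegCoeff, ← Finset.sum_sub_distrib, val_sum]
  refine Van.sum fun j _ => ?_
  rw [← smul_sub]
  refine van_val_csmul _ ((hG (-((v.2 : ℤ) + 1)) (v.2 + 1) j).mono ?_)
  push_cast
  omega

include hG in
/-- Conjugation by `Ŝ⁻¹` turns the powers of the differentiation operator of `f_+` into those of
the linear Hamiltonian of `S f_+`, which the Weyl formula puts into normal order. -/
theorem annFull_iterate_conj (hs0 : s 0 = 0)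
    (hs : ∀ l, eta * s l = ((-1 : ℂ) ^ (l + 1)) • ((s l).transpose * eta))
    (hS : expSeries (PowerSeries.mk s) = PowerSeries.mk S)
    (hf : ∀ (l : ℤ) i, Van l (AS.val (f l i))) {X : AS} (hX0 : Van 0 (AS.val X))
    (hX : ∀ K : ℕ, Van (K + 1)
      (AS.val (X - ∑ v ∈ varsLE K, posCoeff G v * mixCoeff S f G v)))
    {F : Fock} (hF : Reg F) (N : ℕ) :
    ((N.factorial : ℂ)⁻¹) • (annFull (posCoeff f))^[N] (expLoc (-quadFull s) F) =
      expLoc (-quadFull s) (∑ p ∈ antidiagonal N,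
        halfSquareExp X p.1 • normalOrdFull (mixCoeff S f G) (posCoeff G) F p.2) := by
  -- compare both sides with the operators in the variables `l ≤ K`, up to `O(λ^{-K-1})`
  refine eq_of_rel fun K => ?_
  set L := liftSeries (PowerSeries.mk S) * shiftedSeries f K (· ≤ K) with hL
  set c' : Var → AS := fun v => -colCoeff L (K - v.2) v.1 with hc'
  set r' : Var → AS := fun v => (-1 : ℂ) ^ (v.2 + 1) •
      ∑ j, eta v.1 j • colCoeff L (K + v.2 + 1) j with hr'
  have hlin : linTrunc K L = annTrunc K c' + creaTrunc K r' := rfl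
  have hmul : annTrunc K (posCoeff f) * expLoc (-quadTrunc s K) =
      expLoc (-quadTrunc s K) * (creaTrunc K r' + annTrunc K c') := by
    have := linTrunc_mul_expLoc_neg hs0 hs K (shiftedSeries f K (· ≤ K))
    rwa [hS, linTrunc_shiftedSeries_pos, ← hL, hlin, add_comm (annTrunc K c')] at this
  -- the truncated coefficients approximate the true ones
  have hGood := good_posCoeff (van_of_conj hG)
  have hcdiff : ∀ v ∈ varsLE K, Van (K + 1) (AS.val (posCoeff G v - c' v)) := by
    intro v hv
    have hv := mem_varsLE.mp hv
    have e : c' v = (-1 : ℂ) ^ (v.2 + 1) • ∑ k ∈ range (K - v.2 + 1), conjTerm S f v.2 k v.1 := by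
      rw [hc']
      dsimp only
      rw [hL, colCoeff_mul_shiftedSeries, ← neg_one_smul ℂ, smul_smul]
      have e1 : (-1 : ℂ) * (-1) ^ (K + (K - v.2)) = (-1) ^ (v.2 + 1) := by
        rw [show K + (K - v.2) = 2 * (K - v.2) + v.2 by omega, pow_add, pow_mul]
        norm_num [pow_succ]
      have e2 : (K : ℤ) - ((K - v.2 : ℕ) : ℤ) = v.2 := by omega
      rw [e1, e2]
      congr 1
      refine Finset.sum_congr rfl fun k _ => ?_
      rw [if_pos (by omega)]
    rw [e, posCoeff, ← smul_sub]
    refine van_val_csmul _ ((hG v.2 (K - v.2 + 1) v.1).mono ?_)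
    omega
  have hrdiff : ∀ v ∈ varsLE K, Van (K + 1) (AS.val (mixCoeff S f G v - r' v)) := by
    intro v hv
    have e : ∀ j, (-1 : ℂ) ^ (v.2 + 1) • colCoeff L (K + v.2 + 1) j =
        ∑ k ∈ range (K + 1), conjTerm S f (-((v.2 : ℤ) + 1)) (v.2 + 1 + k) j := by
      intro j
      rw [hL, colCoeff_mul_shiftedSeries, smul_smul, ← pow_add]
      have e1 : (-1 : ℂ) ^ (v.2 + 1 + (K + (K + v.2 + 1))) = 1 := by
        rw [show v.2 + 1 + (K + (K + v.2 + 1)) = 2 * (K + v.2 + 1) by omega, pow_mul]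
        norm_num
      have e2 : (K : ℤ) - ((K + v.2 + 1 : ℕ) : ℤ) = -((v.2 : ℤ) + 1) := by push_cast; ring
      rw [e1, e2, one_smul, show K + v.2 + 1 + 1 = v.2 + 1 + (K + 1) by omega,
        Finset.sum_range_add, Finset.sum_eq_zero, zero_add]
      · refine Finset.sum_congr rfl fun k _ => ?_
        rw [if_pos (by omega)]
      · intro k hk
        rw [mem_range] at hk
        rw [if_neg (by omega)]
    have e3 : r' v = ∑ j, eta v.1 j •
        ∑ k ∈ range (K + 1), conjTerm S f (-((v.2 : ℤ) + 1)) (v.2 + 1 + k) j := by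
      rw [hr']
      dsimp only
      rw [Finset.smul_sum]
      refine Finset.sum_congr rfl fun j _ => ?_
      rw [smul_comm, e]
    rw [e3, mixCoeff, negCoeff, conjNegCoeff, ← Finset.sum_sub_distrib, ← Finset.sum_sub_distrib,
      val_sum]
    refine Van.sum fun j _ => ?_
    rw [← smul_sub, ← smul_sub, sub_sub, ← Finset.sum_range_add]
    refine van_val_csmul _ ((hG (-((v.2 : ℤ) + 1)) (v.2 + 1 + (K + 1)) j).mono ?_)
    push_cast
    omega
  have hvan : ∀ x y : AS, Van 0 (AS.val x) → Van (K + 1) (AS.val (x - y)) → Van 0 (AS.val y) := by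
    intro x y hx hxy
    have := hx.sub (hxy.mono (by omega))
    rwa [map_sub, sub_sub_cancel] at this
  have hc0 : ∀ v ∈ varsLE K, Van 0 (AS.val (c' v)) := fun v hv =>
    hvan _ _ (hGood.van v) (hcdiff v hv)
  have hr0 : ∀ v ∈ varsLE K, Van 0 (AS.val (r' v)) := fun v hv =>
    hvan _ _ (van_mixCoeff hG v) (hrdiff v hv)
  set z : AS := ∑ v ∈ varsLE K, c' v * r' v with hz
  have hz0 : Van 0 (AS.val z) := by
    rw [hz, val_sum]
    exact Van.sum fun v hv => by rw [map_mul]; simpa using (hc0 v hv).mul (hr0 v hv)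
  -- the commutator of the truncated operators approximates `X`
  have hXz : Van (K + 1) (AS.val (X - z)) := by
    have h1 : Van (K + 1) (AS.val (∑ v ∈ varsLE K, posCoeff G v * mixCoeff S f G v - z)) := by
      rw [hz, ← Finset.sum_sub_distrib, val_sum]
      exact Van.sum fun v hv =>
        van_mul_sub_mul (hGood.van v) (hr0 v hv) (hcdiff v hv) (hrdiff v hv)
    have := (hX K).add h1
    rwa [← map_add, sub_add_sub_cancel] at this
  have hA : Approx K (expLoc (-quadFull s)) (expLoc (-quadTrunc s K)) :=
    (approx_quadFull s K).neg.expLoc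
  have hD : Approx K (annFull (posCoeff f)) (annTrunc K (posCoeff f)) :=
    approx_annFull (good_posCoeff hf) (fun v _ => (good_posCoeff hf).van v)
      fun v _ => by rw [sub_self, map_zero]; exact Van.zero _
  have hDG : Approx K (annFull (posCoeff G)) (annTrunc K c') := approx_annFull hGood hc0 hcdiff
  have hM : Approx K (creaFull (mixCoeff S f G)) (creaTrunc K r') :=
    approx_creaFull (van_mixCoeff hG) hr0 hrdiff
  refine ⟨(dp (annTrunc K (posCoeff f)) N * expLoc (-quadTrunc s K)) F, ?_, ?_⟩
  · rw [Module.End.mul_apply, dp, LinearMap.smul_apply]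
    exact (hD.iterate N _ _ (hA _ _ (Rel.refl hF K))).csmul _
  · rw [dp_mul_of_intertwine hmul, dp_add_of_central (z := z • (1 : Module.End AS Fock))
      (annTrunc_mul_creaTrunc K c' r') ((Commute.one_left _).smul_left z)
      ((Commute.one_left _).smul_left z), Module.End.mul_apply]
    refine hA _ _ ?_
    rw [LinearMap.sum_apply]
    refine Rel.sum fun p _ => ?_
    rw [halfSquareExp_smul_one, smul_one_mul, LinearMap.smul_apply]
    refine Rel.smul (van_halfSquareExp hX0 _) (van_halfSquareExp hz0 _)
      (van_halfSquareExp_sub hX0 hz0 hXz _) ?_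
    rw [normalOrdFull, normalOrd, LinearMap.sum_apply]
    refine Rel.sum fun q _ => ?_
    rw [Module.End.mul_apply]
    refine hM.dp q.1 _ _ ?_
    rw [dp, LinearMap.smul_apply]
    exact (hDG.iterate q.2 _ _ (Rel.refl hF K)).csmul _

end Conjugation

/-! ### Convergence of the vertex operators -/

/-- In the degree `g` (the degree in `q` plus the degree in `ε`), the coefficients of the monomials
`q^m` with `|m| ≥ D` vanish. -/
def ZeroAt (g : ℤ) (D : ℕ) (F : Fock) : Prop :=
  ∀ m n, (m.degree : ℤ) + n = g → D ≤ m.degree → F m n = 0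

theorem degree_add_single (m : Var →₀ ℕ) (v : Var) :
    (m + Finsupp.single v 1).degree = m.degree + 1 := by
  rw [map_add, Finsupp.degree_single]

theorem degree_sub_single {m : Var →₀ ℕ} {v : Var} (h : m v ≠ 0) :
    (m - Finsupp.single v 1).degree + 1 = m.degree := by
  rw [← degree_add_single]
  congr 1
  apply tsub_add_cancel_of_le
  rw [Finsupp.single_le_iff]
  omega

theorem ZeroAt.creaFull {g : ℤ} {F : Fock} (hF : ZeroAt g 0 F) (r : Var → AS) :
    ZeroAt g 0 (creaFull r F) := fun m n hg _ => by
  rw [CatalanFM.creaFull, locOp_apply_height, creaTrunc_apply]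
  refine Finset.sum_eq_zero fun v _ => ?_
  rw [crea_apply]
  split_ifs with h
  · rw [mul_zero]
  · have := degree_sub_single h
    rw [hF _ _ (by omega) (Nat.zero_le _), mul_zero]

theorem ZeroAt.dp_creaFull {g : ℤ} {F : Fock} (hF : ZeroAt g 0 F) (r : Var → AS) (k : ℕ) :
    ZeroAt g 0 (dp (CatalanFM.creaFull r) k F) := by
  have h : ∀ k, ZeroAt g 0 ((CatalanFM.creaFull r ^ k) F) := by
    intro k
    induction k with
    | zero => exact hF
    | succ k ih => rw [pow_succ', Module.End.mul_apply]; exact ih.creaFull r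
  intro m n hg hm
  rw [dp, LinearMap.smul_apply, Fock.csmul_apply, h k m n hg hm, smul_zero]

theorem ZeroAt.annFull {g : ℤ} {D : ℕ} {F : Fock} (hF : ZeroAt g (D + 1) F) (c : Var → AS) :
    ZeroAt g D (annFull c F) := fun m n hg hm => by
  ext1
  funext j
  rcases lt_or_ge j 0 with hj | hj
  · exact reg_annFull c F m n j hj
  · lift j to ℕ using hj
    rw [coeff_annFull, annTrunc_apply, Finset.sum_eq_zero]
    · intro v _
      have := degree_add_single m v
      rw [ann_apply, hF _ _ (by omega) (by omega), smul_zero, mul_zero]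

/-- A differentiation operator preserves the degree `|m| + n` and lowers `|m|`, so it is nilpotent
in each degree. -/
theorem ZeroAt.annFull_iterate {g : ℤ} {c : Var → AS} (q : ℕ) :
    ∀ {D : ℕ} {F : Fock}, ZeroAt g D F → D ≤ q → ZeroAt g 0 ((CatalanFM.annFull c)^[q] F) := by
  induction q with
  | zero =>
    intro D F hF hD m n hg hm
    exact hF m n hg (by omega)
  | succ q ih =>
    intro D F hF hD
    rw [Function.iterate_succ_apply]
    refine ih (D := D - 1) (ZeroAt.annFull (fun m n hg hm => hF m n hg (by omega)) c) (by omega)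

/-- In each degree, the monomials that occur have bounded degree in `q`. -/
def TameFock (F : Fock) : Prop := ∀ g, ∃ D, ZeroAt g D F

/-- In the degree `g = |m| + n`, a monomial with `β |m| + |m| > g` has `n < β |m|`. -/
theorem tameFock_toFock {F : (Var →₀ ℕ) → ℤ → ℂ} (hF : IsTame F) : TameFock (toFock F) := by
  intro g
  obtain ⟨β, hβ, h⟩ := hF
  obtain ⟨D, hD⟩ := Filter.eventually_atTop.mp (hβ.eventually_gt_atTop g)
  refine ⟨D, fun m n hg hm => ?_⟩
  have := hD m.degree hm
  rw [toFock, h m n (by omega), asympConst, map_zero, map_zero]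

theorem reg_toFock (F : (Var →₀ ℕ) → ℤ → ℂ) : Reg (toFock F) := fun m n j hj => by
  rw [toFock, asympConst, HahnSeries.C_apply, HahnSeries.coeff_single_of_ne (by omega)]

/-- The exponential of a differentiation operator. -/
def annExp (c : Var → AS) (F : Fock) : Fock := fun m n =>
  ∑ᶠ q : ℕ, (((q.factorial : ℂ)⁻¹) • (annFull c)^[q] F) m n

theorem annExp_apply (c : Var → AS) {F : Fock} {m : Var →₀ ℕ} {n : ℤ} {D : ℕ}
    (hF : ZeroAt (m.degree + n) D F) {Q : ℕ} (hQ : D ≤ Q) :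
    annExp c F m n = ∑ q ∈ range Q, (((q.factorial : ℂ)⁻¹) • (annFull c)^[q] F) m n := by
  refine finsum_eq_sum_of_support_subset _ fun q hq => ?_
  by_contra h
  refine hq ?_
  dsimp only
  rw [Fock.csmul_apply, hF.annFull_iterate (c := c) q (by simp at h; omega) m n rfl (Nat.zero_le _),
    smul_zero]

theorem hasSum_annExp (c : Var → AS) {F : Fock} (hF : TameFock F) :
    HasSum (fun q : ℕ => ((q.factorial : ℂ)⁻¹) • (annFull c)^[q] F) (annExp c F) := by
  refine Fock.hasSum_of_locallyFinite fun m n j => ?_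
  obtain ⟨D, hD⟩ := hF (m.degree + n)
  refine ⟨range D, fun q hq => ?_, ?_⟩
  · rw [Fock.csmul_apply, hD.annFull_iterate (c := c) q (by simpa using hq) m n rfl (Nat.zero_le _),
      smul_zero]
    rfl
  · rw [annExp_apply c hD le_rfl, HahnSeries.coeff_sum]

/-- A large power of the multiplication operator exceeds the height of `q^m`, and a large power of
the differentiation operator vanishes in the degree `|m| + n`. -/
theorem normalOrdFull_eq_zero (r c : Var → AS) {F : Fock} {m : Var →₀ ℕ} {n : ℤ} {D : ℕ}
    (hF : ZeroAt (m.degree + n) D F) {j : ℕ} (hj : height m + 1 + D ≤ j) :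
    normalOrdFull r c F j m n = 0 := by
  rw [normalOrdFull, Fock.sum_apply]
  refine Finset.sum_eq_zero fun p hp => ?_
  rw [HasAntidiagonal.mem_antidiagonal] at hp
  rcases lt_or_ge (height m) p.1 with h | h
  · exact (raising_creaFull r).heightGE_dp (HeightGE.zero _) p.1 m (by omega) n
  · have h1 : ZeroAt (m.degree + n) 0 (((p.2.factorial : ℂ)⁻¹) • (annFull c)^[p.2] F) := by
      intro m' n' hg hm
      rw [Fock.csmul_apply, hF.annFull_iterate (c := c) p.2 (by omega) m' n' hg hm, smul_zero]
    exact h1.dp_creaFull r p.1 m n rfl (Nat.zero_le _)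

/-- The normally ordered powers add up to the product of the two exponentials. -/
theorem sum_normalOrdFull (r c : Var → AS) {F : Fock} {m : Var →₀ ℕ} {n : ℤ} {D : ℕ}
    (hF : ZeroAt (m.degree + n) D F) :
    ∑ j ∈ range (height m + 1 + D), normalOrdFull r c F j m n =
      expLoc (creaFull r) (annExp c F) m n := by
  simp only [normalOrdFull, Fock.sum_apply]
  rw [sum_range_antidiagonal (fun a b => dp (creaFull r) a
    (((b.factorial : ℂ)⁻¹) • (annFull c)^[b] F) m n),
    expLoc_apply (raising_creaFull r) _ (Nat.lt_succ_self _)]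
  symm
  refine (Finset.sum_congr rfl fun k hk => ?_).trans
    (Finset.sum_subset (s₁ := range (height m + 1)) ?_ fun k _ hk => ?_)
  · rw [mem_range] at hk
    have h1 : ZeroAt (m.degree + n) 0 (annExp c F -
        ∑ q ∈ range (height m + 1 + D - k), ((q.factorial : ℂ)⁻¹) • (annFull c)^[q] F) := by
      intro m' n' hg _
      rw [Fock.sub_apply, Fock.sum_apply, annExp_apply c (D := D) (Q := height m + 1 + D - k)
        (by rw [hg]; exact hF) (by omega),
        sub_self]
    have h2 := h1.dp_creaFull r k m n rfl (Nat.zero_le _)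
    rw [map_sub, Fock.sub_apply, sub_eq_zero, map_sum, Fock.sum_apply] at h2
    exact h2
  · intro k
    simp only [mem_range]
    omega
  · rw [mem_range] at hk
    refine Finset.sum_eq_zero fun q _ => ?_
    exact (raising_creaFull r).heightGE_dp (HeightGE.zero _) k m (by omega) n

/-- The Cauchy product of convergent series with a finite second index. -/
theorem hasSum_antidiagonal_of_finite {y : ℕ → ℕ → ℂ} {L : ℕ} {Y : ℕ → ℂ}
    (h0 : ∀ i l, L ≤ l → y i l = 0) (h : ∀ l, HasSum (fun i => y i l) (Y l)) :
    HasSum (fun N => ∑ p ∈ antidiagonal N, y p.1 p.2) (∑ l ∈ range L, Y l) := by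
  have h1 : ∀ l, HasSum (fun N => if l ≤ N then y (N - l) l else 0) (Y l) := by
    intro l
    refine (Function.Injective.hasSum_iff (g := fun i => i + l) (add_left_injective l) ?_).mp ?_
    · intro N hN
      rw [if_neg]
      intro hl
      exact hN ⟨N - l, by dsimp only; omega⟩
    · convert h l using 2 with i
      simp
  convert hasSum_sum fun l (_ : l ∈ range L) => h1 l using 2 with N
  rw [← Finset.Nat.sum_antidiagonal_swap]
  simp only [Prod.fst_swap, Prod.snd_swap]
  rw [Finset.Nat.sum_antidiagonal_eq_sum_range_succ (fun a b => y b a)]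
  have e1 : ∑ k ∈ range N.succ, y (N - k) k =
      ∑ k ∈ range (N + 1 + L), if k ≤ N then y (N - k) k else 0 := by
    refine (Finset.sum_congr rfl fun k hk => ?_).trans
      (Finset.sum_subset (by intro k; simp only [mem_range]; omega) fun k _ hk => ?_)
    · rw [mem_range] at hk
      rw [if_pos (by omega)]
    · rw [mem_range] at hk
      rw [if_neg (by omega)]
  rw [e1]
  symm
  refine Finset.sum_subset (by intro k; simp only [mem_range]; omega) fun k _ hk => ?_
  rw [mem_range] at hk
  rw [h0 _ k (by omega), ite_self]

/-- Coefficientwise convergence of regular asymptotic series. -/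
def CoeffHasSum (ξ : ℕ → AsympSeries) (E : AsympSeries) : Prop :=
  ∀ (j : ℕ) k, HasSum (fun i => ((ξ i).coeff (j : ℤ)).coeff k) ((E.coeff (j : ℤ)).coeff k)

theorem CoeffHasSum.mul_right {ξ : ℕ → AsympSeries} {E : AsympSeries} (h : CoeffHasSum ξ E)
    (hξ : ∀ i, Van 0 (ξ i)) (hE : Van 0 E) {y : AsympSeries} (hy : Van 0 y) :
    CoeffHasSum (fun i => ξ i * y) (E * y) := by
  intro j k
  simp only [coeff_mul_of_van (hξ _) hy, coeff_mul_of_van hE hy, Polynomial.finsetSum_coeff,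
    Polynomial.coeff_mul]
  exact hasSum_sum fun p _ => hasSum_sum fun q _ => (h p.1 q.1).mul_right _

theorem coeffHasSum_halfSquareExp {X : AS} {E : AsympSeries}
    (h : CoeffHasSum (fun p => AS.val (dp ((1 / 2 : ℂ) • X) p)) E) :
    CoeffHasSum (fun i => AS.val (halfSquareExp X i)) E := by
  intro j k
  refine (Function.Injective.hasSum_iff (g := fun i : ℕ => i + i) ?_ ?_).mp ?_
  · intro a b hab
    dsimp only at hab
    omega
  · intro i hi
    have : ¬ Even i := fun ⟨r, hr⟩ => hi ⟨r, hr.symm⟩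
    have h2 : halfSquareExp X i = 0 := if_neg this
    dsimp only
    rw [h2, map_zero]
    rfl
  · convert h j k using 2 with p
    have h1 : Even (p + p) := ⟨p, rfl⟩
    have h2 : halfSquareExp X (p + p) = dp ((1 / 2 : ℂ) • X) ((p + p) / 2) := if_pos h1
    dsimp only [Function.comp_apply]
    rw [h2, show (p + p) / 2 = p by omega]

/-- The Weyl formula after summation: the central factors add up to `E`, and the normally ordered
powers to the product of the exponentials. -/
theorem hasSum_normalOrdered {r c : Var → AS} {X : AS} (hX0 : Van 0 (AS.val X)) {E : AS}
    (hE0 : Van 0 (AS.val E))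
    (hE : CoeffHasSum (fun p => AS.val (dp ((1 / 2 : ℂ) • X) p)) (AS.val E))
    (hr : ∀ v, Van 0 (AS.val (r v))) {F : Fock} (hF : TameFock F) (hR : Reg F) :
    HasSum (fun N => ∑ p ∈ antidiagonal N, halfSquareExp X p.1 • normalOrdFull r c F p.2)
      (E • expLoc (creaFull r) (annExp c F)) := by
  rw [Fock.hasSum_iff]
  intro m n j k
  have hV : ∀ l, Reg (normalOrdFull r c F l) := by
    intro l m n
    have h1 : ∀ q, Reg ((annFull c)^[q] F) := by
      intro q
      cases q with
      | zero => exact hR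
      | succ q => rw [Function.iterate_succ_apply']; exact reg_annFull c _
    have h2 : ∀ (k : ℕ) (H : Fock), Reg H → Reg (dp (creaFull r) k H) := by
      intro k H hH
      have h3 : ∀ k, Reg ((creaFull r ^ k) H) := by
        intro k
        induction k with
        | zero => exact hH
        | succ k ih =>
          intro m n
          rw [pow_succ', Module.End.mul_apply]
          change Van 0 (creaTrunc (height m) r ((creaFull r ^ k) H) m n)
          have : VanOn (height m) 0 ((creaFull r ^ k) H) := fun m _ n => ih m n
          simpa using this.creaTrunc (M := 0) (fun v _ => hr v) m (suppLE_height m) n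
      intro m n
      exact (h3 k m n).csmul _
    rw [normalOrdFull, Fock.sum_apply]
    exact Van.sum fun p _ => h2 p.1 _ (fun m n => (h1 p.2 m n).csmul _) m n
  obtain ⟨D, hD⟩ := hF (m.degree + n)
  have hξ := fun i => van_halfSquareExp hX0 i
  rcases lt_or_ge j 0 with hj | hj
  · have e1 : ∀ N, ((∑ p ∈ antidiagonal N,
        halfSquareExp X p.1 • normalOrdFull r c F p.2) m n).coeff j = 0 := by
      intro N
      rw [Fock.sum_apply]
      exact Van.sum (fun p _ => (hξ p.1).mul (hV p.2 m n)) j (by simpa using hj)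
    have e2 : ((E • expLoc (creaFull r) (annExp c F)) m n).coeff j = 0 := by
      rw [Fock.smul_apply, ← sum_normalOrdFull r c hD]
      exact hE0.mul (Van.sum fun l _ => hV l m n) j (by simpa using hj)
    simp only [e1, e2]
    exact hasSum_zero
  · lift j to ℕ using hj
    have h3 := hasSum_antidiagonal_of_finite (L := height m + 1 + D)
      (y := fun i l => ((AS.val (halfSquareExp X i) * normalOrdFull r c F l m n).coeff
        (j : ℤ)).coeff k)
      (Y := fun l => ((AS.val E * normalOrdFull r c F l m n).coeff (j : ℤ)).coeff k)
      (fun i l hl => by rw [normalOrdFull_eq_zero r c hD hl, mul_zero]; rfl)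
      (fun l => (coeffHasSum_halfSquareExp hE).mul_right hξ hE0 (hV l m n) j k)
    convert h3 using 1
    · funext N
      rw [Fock.sum_apply, HahnSeries.coeff_sum, Polynomial.finsetSum_coeff]
      rfl
    · rw [Fock.smul_apply, ← sum_normalOrdFull r c hD, Finset.mul_sum, HahnSeries.coeff_sum,
        Polynomial.finsetSum_coeff]

/-! ### The conjugation formula for vertex operators -/

theorem Fock.asymp_smul_apply (c : AsympSeries) (F : Fock) (m : Var →₀ ℕ) (n : ℤ) :
    (c • F) m n = c * F m n := rfl

theorem linHatTerm_posPart (f : ℤ → Fin 2 → AsympSeries) (v : Var) (F : Fock) :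
    linHatTerm (posPart f) v F = posCoeff (fun l i => AS.of (f l i)) v • ann v F := by
  refine Fock.ext fun m n => ?_
  have e1 : posPart f (v.2 : ℤ) = f v.2 := if_pos (Int.natCast_nonneg _)
  have e2 : posPart f (-((v.2 : ℤ) + 1)) = 0 := if_neg (by omega)
  have e3 : ((-1 : AsympSeries) ^ (v.2 + 1)) = asympConst ((-1) ^ (v.2 + 1)) := by
    rw [asympConst, map_pow, map_pow, map_neg, map_neg, map_one, map_one]
  rw [linHatTerm, e1, e2, e3, Fock.add_apply, Fock.smul_apply, posCoeff, AS.val_smul, AS.val_of,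
    ← asympConst_mul]
  simp only [Fock.asymp_smul_apply, Pi.zero_apply, smul_zero, Finset.sum_const_zero, zero_mul,
    add_zero]
  rfl

theorem linHatTerm_negPart (f : ℤ → Fin 2 → AsympSeries) (v : Var) (F : Fock) :
    linHatTerm (negPart f) v F = negCoeff (fun l i => AS.of (f l i)) v • crea v F := by
  refine Fock.ext fun m n => ?_
  have e1 : negPart f (v.2 : ℤ) = 0 := if_neg (by omega)
  have e2 : negPart f (-((v.2 : ℤ) + 1)) = f (-((v.2 : ℤ) + 1)) := if_pos (by omega)
  rw [linHatTerm, e1, e2, Fock.add_apply, Fock.smul_apply, negCoeff, val_sum]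
  simp only [Fock.asymp_smul_apply, Pi.zero_apply, mul_zero, zero_mul, zero_add, AS.val_smul,
    AS.val_of]
  rfl

/-- A vertex operator in terms of the operators on the Fock space, given the sum `H` of its first
exponential. -/
theorem vertexConverges_of {f : ℤ → Fin 2 → AsympSeries} {F H : Fock}
    (hf : ∀ (l : ℤ) i, Van l (f l i)) (hF : Reg F)
    (hH : HasSum (fun q : ℕ => ((q.factorial : ℂ)⁻¹) •
      (annFull (posCoeff fun l i => AS.of (f l i)))^[q] F) H) :
    VertexConverges f F ∧
      vertexOp f F = expLoc (creaFull (negCoeff fun l i => AS.of (f l i))) H := by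
  have hgood : Good (posCoeff fun l i => AS.of (f l i)) := good_posCoeff hf
  have h1 := expConverges_and_expOp_eq (T := linHatTerm (posPart f)) (F := F) (G := H)
    (A := annFull (posCoeff fun l i => AS.of (f l i))) (fun n => by
      simp only [linHatTerm_posPart]
      refine hasSum_ann hgood ?_
      cases n with
      | zero => exact hF
      | succ n => rw [Function.iterate_succ_apply']; exact reg_annFull _ _) hH
  have h2 := expConverges_and_expOp_eq_expLoc (T := linHatTerm (negPart f))
    (raising_creaFull (negCoeff fun l i => AS.of (f l i))) (fun F => by
      simp only [linHatTerm_negPart]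
      exact hasSum_crea _ F) H
  rw [VertexConverges, vertexOp, h1.2]
  exact ⟨⟨h1.1, h2.1⟩, h2.2⟩

/-- The conjugation formula for a vertex operator: if `G = S f`, and `E` is the exponential of half
the symplectic pairing of the two parts of `S f_+`, then `Ŝ Γ_f Ŝ⁻¹ = E Γ_G` on tame series. -/
theorem conj_vertexOp {s S : ℕ → Matrix (Fin 2) (Fin 2) ℂ} (hs0 : s 0 = 0)
    (hs : ∀ l, eta * s l = ((-1 : ℂ) ^ (l + 1)) • ((s l).transpose * eta))
    (hS : expSeries (PowerSeries.mk s) = PowerSeries.mk S) {f G : ℤ → Fin 2 → AsympSeries}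
    (hf : ∀ (l : ℤ) i, Van l (f l i))
    (hG : ∀ (l : ℤ) (B : ℕ) i, Van (l + B) (G l i -
      ∑ k ∈ range B, AS.val (conjTerm S (fun l i => AS.of (f l i)) l k i)))
    {X : AS} (hX0 : Van 0 (AS.val X))
    (hX : ∀ K : ℕ, Van (K + 1) (AS.val (X - ∑ v ∈ varsLE K, posCoeff (fun l i => AS.of (G l i)) v *
      mixCoeff S (fun l i => AS.of (f l i)) (fun l i => AS.of (G l i)) v)))
    {E : AsympSeries} (hE0 : Van 0 E)
    (hE : CoeffHasSum (fun p => AS.val (dp ((1 / 2 : ℂ) • X) p)) E)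
    {F : (Var →₀ ℕ) → ℤ → ℂ} (hF : IsTame F) :
    ExpConverges (fun x F => -quadHatTerm s x F) (toFock F) ∧
    VertexConverges f (expOp (fun x F => -quadHatTerm s x F) (toFock F)) ∧
    ExpConverges (quadHatTerm s)
      (vertexOp f (expOp (fun x F => -quadHatTerm s x F) (toFock F))) ∧
    VertexConverges G (toFock F) ∧
    expOp (quadHatTerm s) (vertexOp f (expOp (fun x F => -quadHatTerm s x F) (toFock F))) =
      E • vertexOp G (toFock F) := by
  set fA : ℤ → Fin 2 → AS := fun l i => AS.of (f l i)
  set GA : ℤ → Fin 2 → AS := fun l i => AS.of (G l i)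
  have hGA : ∀ (l : ℤ) (B : ℕ) i,
      Van (l + B) (AS.val (GA l i - ∑ k ∈ range B, conjTerm S fA l k i)) := by
    intro l B i
    rw [map_sub, val_sum]
    exact hG l B i
  have hR := reg_toFock F
  have hT := tameFock_toFock hF
  have h1 := expConverges_and_expOp_eq_expLoc (T := fun x F => -quadHatTerm s x F)
    (raising_quadFull s).neg (fun F => (hasSum_quadHatTerm s F).neg) (toFock F)
  rw [h1.2]
  -- the first exponential of the vertex operator is moved through `Ŝ⁻¹`
  have hreg : Reg (expLoc (-quadFull s) (toFock F)) :=
    (((approx_quadFull s 0).neg.expLoc) _ _ (Rel.refl hR 0)).reg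
  have hr := van_mixCoeff hGA
  have h2 : HasSum (fun N : ℕ => ((N.factorial : ℂ)⁻¹) •
      (annFull (posCoeff fA))^[N] (expLoc (-quadFull s) (toFock F)))
      (expLoc (-quadFull s) (AS.of E •
        expLoc (creaFull (mixCoeff S fA GA)) (annExp (posCoeff GA) (toFock F)))) := by
    simp only [annFull_iterate_conj hGA hs0 hs hS hf hX0 hX hR]
    exact (hasSum_normalOrdered hX0 (E := AS.of E) hE0 hE hr hT hR).map
      (expLoc (-quadFull s)) (continuous_expLoc (continuous_neg_end
        (continuous_locOp fun K => continuous_quadTrunc s K)))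
  have h3 := vertexConverges_of hf hreg h2
  have h4 := vertexConverges_of (f := G) (van_of_conj hGA) hR (hasSum_annExp (posCoeff GA) hT)
  have h5 := expConverges_and_expOp_eq_expLoc (raising_quadFull s) (hasSum_quadHatTerm s)
    (vertexOp f (expLoc (-quadFull s) (toFock F)))
  refine ⟨h1.1, h3.1, h5.1, h4.1, ?_⟩
  rw [h5.2, h3.2, h4.2]
  have hq := raising_quadFull s
  -- `Ŝ e^{M} Ŝ⁻¹ = e^{M'}`
  have h6 : expLoc (quadFull s) * expLoc (creaFull (negCoeff fA)) * expLoc (-quadFull s) =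
      expLoc (creaFull (conjNegCoeff S fA)) := by
    rw [← expLoc_intertwine hq (raising_creaFull _) (raising_creaFull _)
      (creaFull_conj hs0 hs hS), mul_assoc, expLoc_mul_neg hq, mul_one]
  -- `S f_- + (S f_+)_- = (S f)_-`
  have h7 : expLoc (creaFull (conjNegCoeff S fA)) * expLoc (creaFull (mixCoeff S fA GA)) =
      expLoc (creaFull (negCoeff GA)) := by
    rw [expLoc_mul (raising_creaFull _) (raising_creaFull _) (commute_creaFull _ _),
      ← creaFull_add]
    congr 2
    funext v
    rw [mixCoeff, add_sub_cancel]
  rw [← Module.End.mul_apply, ← Module.End.mul_apply, h6, map_smul, ← Module.End.mul_apply, h7]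
  rfl

/-! ### The period vectors at infinity -/

theorem formalDeriv_single (n : ℤ) (p : Polynomial ℂ) :
    formalDeriv (HahnSeries.single n p) =
      HahnSeries.single (n + 1) (Polynomial.derivative p - (n : ℂ) • p) := by
  ext1
  funext m
  change Polynomial.derivative ((HahnSeries.single n p).coeff (m - 1)) -
    ((m : ℂ) - 1) • (HahnSeries.single n p).coeff (m - 1) = _
  by_cases h : m = n + 1
  · subst h
    simp
  · rw [HahnSeries.coeff_single_of_ne h, HahnSeries.coeff_single_of_ne (by omega)]
    simp

theorem formalInt_single (n : ℤ) (p : Polynomial ℂ) :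
    formalInt (HahnSeries.single n p) = HahnSeries.single (n - 1) (integCoeff (n - 1) p) := by
  ext1
  funext m
  change integCoeff m ((HahnSeries.single n p).coeff (m + 1)) = _
  by_cases h : m = n - 1
  · subst h
    simp
  · rw [HahnSeries.coeff_single_of_ne h, HahnSeries.coeff_single_of_ne (by omega), integCoeff_zero]

/-- `integCoeff n` inverts the operator `p ↦ p' - n p`, through which `∂_λ` acts on the coefficient
of `λ^{-n}`. -/
theorem derivative_integCoeff {n : ℤ} (hn : n ≠ 0) (p : Polynomial ℂ) :
    Polynomial.derivative (integCoeff n p) - (n : ℂ) • integCoeff n p = p := by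
  have hn' : (n : ℂ) ≠ 0 := by exact_mod_cast hn
  rw [integCoeff, if_neg hn, map_neg, map_sum, smul_neg, Finset.smul_sum]
  have h := Finset.sum_range_sub' (fun j => ((n : ℂ) ^ j)⁻¹ • Polynomial.derivative^[j] p)
    (p.natDegree + 1)
  have h0 : Polynomial.derivative^[p.natDegree + 1] p = 0 :=
    Polynomial.iterate_derivative_eq_zero (Nat.lt_succ_self _)
  rw [h0, smul_zero, sub_zero, pow_zero, inv_one, one_smul, Function.iterate_zero_apply,
    Finset.sum_sub_distrib] at h
  rw [sub_neg_eq_add, neg_add_eq_sub]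
  refine Eq.trans ?_ h
  congr 1
  · refine Finset.sum_congr rfl fun j _ => ?_
    rw [smul_smul]
    congr 1
    field_simp
    ring
  · refine Finset.sum_congr rfl fun j _ => ?_
    rw [Polynomial.derivative_smul, Function.iterate_succ_apply']

/-- The coefficients of the iterated derivatives and integrals of a polynomial in `log λ`. -/
def powCoeff (p : Polynomial ℂ) (l : ℤ) : Polynomial ℂ :=
  (formalDerivPow l (HahnSeries.single 0 p)).coeff l

/-- A derivative or integral, of any order `l`, of a polynomial in `log λ` is a single term
`λ^{-l} p_l(log λ)`, and one recursion in `l` covers the derivatives and the integrals. -/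
theorem formalDerivPow_single_and_succ (p : Polynomial ℂ) (l : ℤ) :
    formalDerivPow l (HahnSeries.single 0 p) = HahnSeries.single l (powCoeff p l) ∧
      powCoeff p (l + 1) = Polynomial.derivative (powCoeff p l) - (l : ℂ) • powCoeff p l := by
  have hpos : ∀ l : ℕ, formalDerivPow l (HahnSeries.single 0 p) =
      HahnSeries.single (l : ℤ) (powCoeff p l) := by
    intro l
    induction l with
    | zero => simp [powCoeff, formalDerivPow]
    | succ l ih =>
      have h1 : formalDerivPow ((l + 1 : ℕ) : ℤ) (HahnSeries.single 0 p) =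
          formalDeriv (formalDerivPow l (HahnSeries.single 0 p)) := by
        rw [formalDerivPow, formalDerivPow, if_pos (by omega), if_pos (by omega), Int.toNat_natCast,
          Int.toNat_natCast, Function.iterate_succ_apply']
      rw [ih, formalDeriv_single] at h1
      rw [powCoeff, h1]
      push_cast
      rw [HahnSeries.coeff_single_same]
  have hneg_step : ∀ l : ℕ, formalDerivPow (-((l : ℤ) + 1)) (HahnSeries.single 0 p) =
      formalInt (formalDerivPow (-(l : ℤ)) (HahnSeries.single 0 p)) := by
    intro l
    have e1 : (-(-((l : ℤ) + 1))).toNat = l + 1 := by omega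
    rw [formalDerivPow, if_neg (by omega), e1, Function.iterate_succ_apply']
    rcases Nat.eq_zero_or_pos l with rfl | hl
    · simp [formalDerivPow]
    · have e2 : (-(-(l : ℤ))).toNat = l := by omega
      rw [formalDerivPow, if_neg (by omega), e2]
  have hneg : ∀ l : ℕ, formalDerivPow (-(l : ℤ)) (HahnSeries.single 0 p) =
      HahnSeries.single (-(l : ℤ)) (powCoeff p (-(l : ℤ))) := by
    intro l
    induction l with
    | zero => simpa using hpos 0
    | succ l ih =>
      have h1 := hneg_step l
      rw [ih, formalInt_single] at h1
      rw [powCoeff, Nat.cast_succ, h1, show -(l : ℤ) - 1 = -((l : ℤ) + 1) by ring,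
        HahnSeries.coeff_single_same]
  have hall : ∀ l : ℤ, formalDerivPow l (HahnSeries.single 0 p) =
      HahnSeries.single l (powCoeff p l) := by
    intro l
    rcases Int.eq_nat_or_neg l with ⟨k, rfl | rfl⟩
    · exact hpos k
    · exact hneg k
  refine ⟨hall l, ?_⟩
  rcases lt_or_ge l 0 with hl | hl
  · obtain ⟨k, rfl⟩ : ∃ k : ℕ, l = -((k : ℤ) + 1) := ⟨(-l - 1).toNat, by omega⟩
    have h1 := hneg_step k
    rw [hall, hall, formalInt_single] at h1
    have h2 := congrArg (fun x => HahnSeries.coeff x (-((k : ℤ) + 1))) h1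
    simp only [show -(k : ℤ) - 1 = -((k : ℤ) + 1) by ring, HahnSeries.coeff_single_same] at h2
    rw [h2, derivative_integCoeff (by omega)]
    congr 1
    ring
  · lift l to ℕ using hl
    have h1 : formalDerivPow ((l : ℤ) + 1) (HahnSeries.single 0 p) =
        formalDeriv (formalDerivPow l (HahnSeries.single 0 p)) := by
      have e : ((l : ℤ) + 1).toNat = l + 1 := by omega
      rw [formalDerivPow, formalDerivPow, if_pos (by omega), if_pos (by omega), e,
        Int.toNat_natCast, Function.iterate_succ_apply']
    rw [hall ((l : ℤ) + 1), hall l, formalDeriv_single] at h1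
    exact HahnSeries.single_injective _ h1

/-- A sequence of polynomials that is obtained from `0` by differentiation and by integration
without constants vanishes. -/
theorem eq_zero_of_recursion {y : ℤ → Polynomial ℂ} (h0 : y 0 = 0)
    (h : ∀ l, y (l + 1) = Polynomial.derivative (y l) - (l : ℂ) • y l) (l : ℤ) : y l = 0 := by
  have hinj : ∀ (n : ℤ) (p : Polynomial ℂ), n ≠ 0 → Polynomial.derivative p - (n : ℂ) • p = 0 →
      p = 0 := by
    intro n p hn hp
    have hn' : (n : ℂ) ≠ 0 := by exact_mod_cast hn
    by_contra hp0
    rw [sub_eq_zero] at hp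
    have h1 : (Polynomial.derivative p).degree < p.degree := Polynomial.degree_derivative_lt hp0
    rw [hp, Polynomial.degree_smul_of_smul_regular _ (IsSMulRegular.of_ne_zero hn')] at h1
    exact lt_irrefl _ h1
  rcases Int.eq_nat_or_neg l with ⟨k, rfl | rfl⟩
  · induction k with
    | zero => exact h0
    | succ k ih =>
      push_cast
      rw [h, ih]
      simp
  · induction k with
    | zero => exact h0
    | succ k ih =>
      refine hinj (-((k + 1 : ℕ) : ℤ)) _ (by omega) ?_
      rw [← h, ← ih]
      congr 1
      push_cast
      ring

/-- The polynomial in `log λ` in the first component of `I^{(l)}_{a,∞}`. -/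
def thetaCoeff (ψ : ℂ) (a : Fin 2 → ℂ) (l : ℤ) : Polynomial ℂ :=
  a 0 • powCoeff (Polynomial.X + Polynomial.C (ψ / 2)) (l + 1) +
    a 1 • (powCoeff (Polynomial.X + Polynomial.C (ψ / 2)) (l + 1) +
      powCoeff (Polynomial.C (Real.pi * Complex.I)) (l + 1))

/-- The constant in the second component of `I^{(l)}_{a,∞}`. -/
def chiCoeff (a : Fin 2 → ℂ) (l : ℤ) : Polynomial ℂ :=
  (a 0 + a 1) • powCoeff (Polynomial.C (1 / 2)) l

theorem powCoeff_zero (p : Polynomial ℂ) : powCoeff p 0 = p := by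
  simp [powCoeff, formalDerivPow]

theorem asymp_smul_single (c : ℂ) (n : ℤ) (p : Polynomial ℂ) :
    c • (HahnSeries.single n p : AsympSeries) = HahnSeries.single n (c • p) := by
  ext1
  funext m
  rw [HahnSeries.coeff_smul]
  by_cases h : m = n
  · subst h; simp
  · rw [HahnSeries.coeff_single_of_ne h, HahnSeries.coeff_single_of_ne h, smul_zero]

theorem asymp_single_add (n : ℤ) (p q : Polynomial ℂ) :
    (HahnSeries.single n p + HahnSeries.single n q : AsympSeries) = HahnSeries.single n (p + q) :=
  (HahnSeries.single_add n p q).symm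

theorem periodInf_zero (ψ : ℂ) (a : Fin 2 → ℂ) (l : ℤ) :
    periodInf ψ a l 0 = HahnSeries.single (l + 1) (thetaCoeff ψ a l) := by
  have e1 : asympLog + asympConst (ψ / 2) =
      HahnSeries.single 0 (Polynomial.X + Polynomial.C (ψ / 2)) := by
    rw [asympLog, asympConst, HahnSeries.C_apply, HahnSeries.C_apply, asymp_single_add]
  have e2 : asympConst (Real.pi * Complex.I) =
      HahnSeries.single 0 (Polynomial.C (Real.pi * Complex.I)) := by
    rw [asympConst, HahnSeries.C_apply]
  rw [periodInf, Finset.sum_apply, Fin.sum_univ_two]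
  simp only [Pi.smul_apply, periodInfBasis, Matrix.cons_val_zero, e1, e2,
    (formalDerivPow_single_and_succ _ _).1, asymp_smul_single, zero_ne_one, if_false, if_true,
    add_zero, asymp_single_add, thetaCoeff]

theorem periodInf_one (ψ : ℂ) (a : Fin 2 → ℂ) (l : ℤ) :
    periodInf ψ a l 1 = HahnSeries.single l (chiCoeff a l) := by
  have e2 : asympConst (1 / 2) = HahnSeries.single 0 (Polynomial.C (1 / 2)) := by
    rw [asympConst, HahnSeries.C_apply]
  rw [periodInf, Finset.sum_apply, Fin.sum_univ_two]
  simp only [Pi.smul_apply, periodInfBasis, Matrix.cons_val_one, Matrix.cons_val_fin_one, e2,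
    (formalDerivPow_single_and_succ _ _).1, asymp_smul_single, asymp_single_add, chiCoeff, add_smul]

theorem thetaCoeff_neg_one (ψ : ℂ) (a : Fin 2 → ℂ) : thetaCoeff ψ a (-1) =
    (a 0 + a 1) • Polynomial.X +
      Polynomial.C ((a 0 + a 1) * (ψ / 2) + a 1 * (Real.pi * Complex.I)) := by
  rw [thetaCoeff, neg_add_cancel, powCoeff_zero, powCoeff_zero]
  simp only [Polynomial.smul_eq_C_mul, map_add, map_mul]
  ring

theorem chiCoeff_zero (a : Fin 2 → ℂ) : chiCoeff a 0 = Polynomial.C ((a 0 + a 1) / 2) := by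
  rw [chiCoeff, powCoeff_zero, Polynomial.smul_C, smul_eq_mul, mul_one_div]

theorem thetaCoeff_succ (ψ : ℂ) (a : Fin 2 → ℂ) (l : ℤ) : thetaCoeff ψ a (l + 1) =
    Polynomial.derivative (thetaCoeff ψ a l) - ((l : ℂ) + 1) • thetaCoeff ψ a l := by
  have h := fun p => (formalDerivPow_single_and_succ p (l + 1)).2
  simp only [thetaCoeff, h, map_add, Polynomial.derivative_smul]
  push_cast
  module

theorem derivative_chiCoeff (a : Fin 2 → ℂ) (l : ℤ) :
    Polynomial.derivative (chiCoeff a l) = 0 := by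
  have h := fun p => fun l => (formalDerivPow_single_and_succ p l).2
  refine eq_zero_of_recursion (y := fun l => Polynomial.derivative (chiCoeff a l)) ?_ ?_ l
  · simp [chiCoeff_zero]
  · intro l
    simp only [chiCoeff, h, Polynomial.derivative_smul, map_sub]
    module

theorem chiCoeff_succ (a : Fin 2 → ℂ) (l : ℤ) : chiCoeff a (l + 1) = -((l : ℂ) • chiCoeff a l) := by
  have h1 : chiCoeff a (l + 1) = Polynomial.derivative (chiCoeff a l) - (l : ℂ) • chiCoeff a l := by
    simp only [chiCoeff, (formalDerivPow_single_and_succ _ _).2, Polynomial.derivative_smul]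
    module
  rw [h1, derivative_chiCoeff, zero_sub]

/-- The two components of `I_{a,∞}` are related by `p_θ' = 2 p_χ`, since `log λ` and `1/2` are. -/
theorem derivative_thetaCoeff (ψ : ℂ) (a : Fin 2 → ℂ) (l : ℤ) :
    Polynomial.derivative (thetaCoeff ψ a l) = (2 : ℂ) • chiCoeff a (l + 1) := by
  have h := eq_zero_of_recursion
    (y := fun l => Polynomial.derivative (thetaCoeff ψ a (l - 1)) - (2 : ℂ) • chiCoeff a l) ?_ ?_
    (l + 1)
  · rwa [add_sub_cancel_right, sub_eq_zero] at h
  · rw [zero_sub, thetaCoeff_neg_one, chiCoeff_zero, Polynomial.derivative_add,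
      Polynomial.derivative_smul, Polynomial.derivative_X, Polynomial.derivative_C, add_zero,
      Polynomial.smul_C, Polynomial.smul_eq_C_mul, mul_one, ← map_sub, smul_eq_mul]
    simp only [mul_div_cancel₀ _ (two_ne_zero' ℂ), sub_self, map_zero, mul_div_assoc']
  · intro l
    have h1 := thetaCoeff_succ ψ a (l - 1)
    rw [sub_add_cancel] at h1
    simp only [add_sub_cancel_right, h1, chiCoeff_succ, map_sub, Polynomial.derivative_smul,
      derivative_chiCoeff]
    push_cast
    module

theorem thetaCoeff_succ' (ψ : ℂ) (a : Fin 2 → ℂ) (l : ℤ) : thetaCoeff ψ a (l + 1) =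
    (2 : ℂ) • chiCoeff a (l + 1) - ((l : ℂ) + 1) • thetaCoeff ψ a l := by
  rw [thetaCoeff_succ, derivative_thetaCoeff]

/-! ### The formal period vectors `S f_∞` -/

/-- `(-1)^k S_k`, extended by zero to negative `k`. -/
def signedS (ψ : ℂ) (t : Fin 2 → ℂ) (k : ℤ) : Matrix (Fin 2) (Fin 2) ℂ :=
  if 0 ≤ k then (-1 : ℂ) ^ k.toNat • calS ψ t k.toNat else 0

theorem signedS_natCast (ψ : ℂ) (t : Fin 2 → ℂ) (k : ℕ) :
    signedS ψ t k = (-1 : ℂ) ^ k • calS ψ t k := by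
  rw [signedS, if_pos (Int.natCast_nonneg k), Int.toNat_natCast]

theorem signedS_of_neg (ψ : ℂ) (t : Fin 2 → ℂ) {k : ℤ} (hk : k < 0) : signedS ψ t k = 0 :=
  if_neg (by omega)

theorem signedS_zero (ψ : ℂ) (t : Fin 2 → ℂ) : signedS ψ t 0 = 1 := by
  simp [signedS, calS_zero]

/-- The recursion for `S_k`, valid for all integers `k`. -/
theorem signedS_recursion (ψ : ℂ) (t : Fin 2 → ℂ) (k : ℤ) :
    calU t * signedS ψ t (k - 1) = signedS ψ t (k - 1) * calR - (k : ℂ) • signedS ψ t k -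
      signedS ψ t k * mu + mu * signedS ψ t k := by
  rcases lt_trichotomy k 0 with hk | rfl | hk
  · rw [signedS_of_neg ψ t hk, signedS_of_neg ψ t (by omega)]
    simp
  · rw [signedS_zero, signedS_of_neg ψ t (by omega)]
    simp
  · obtain ⟨n, rfl⟩ : ∃ n : ℕ, k = n + 1 := ⟨(k - 1).toNat, by omega⟩
    have h := calS_recursion ψ t n
    have e : signedS ψ t ((n : ℤ) + 1) = (-1 : ℂ) ^ (n + 1) • calS ψ t (n + 1) := by
      exact_mod_cast signedS_natCast ψ t (n + 1)
    rw [add_sub_cancel_right, signedS_natCast, e, Matrix.mul_smul]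
    simp only [pow_succ, Matrix.smul_mul, Matrix.mul_smul]
    push_cast
    rw [show calU t * calS ψ t n = calS ψ t n * calR + (((n : ℂ) + 1) • calS ψ t (n + 1) +
      calS ψ t (n + 1) * mu - mu * calS ψ t (n + 1)) by rw [h]; abel]
    module

/-- The formal period vectors `S f_{a,∞}`; they are the asymptotic expansions of the period
vectors. -/
def formalPeriod (ψ : ℂ) (t a : Fin 2 → ℂ) (l : ℤ) (i : Fin 2) : AsympSeries :=
  HahnSeries.ofSuppBddBelow
    (fun n : ℤ => signedS ψ t (n - 1 - l) i 0 • thetaCoeff ψ a (n - 1) +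
      signedS ψ t (n - l) i 1 • chiCoeff a n)
    (bddBelow_support_of_zero l fun n hn => by
      rw [signedS_of_neg ψ t (by omega), signedS_of_neg ψ t (by omega)]
      simp)

theorem coeff_formalPeriod (ψ : ℂ) (t a : Fin 2 → ℂ) (l : ℤ) (i : Fin 2) (n : ℤ) :
    (formalPeriod ψ t a l i).coeff n = signedS ψ t (n - 1 - l) i 0 • thetaCoeff ψ a (n - 1) +
      signedS ψ t (n - l) i 1 • chiCoeff a n := rfl

theorem formalDeriv_formalPeriod (ψ : ℂ) (t a : Fin 2 → ℂ) (l : ℤ) (i : Fin 2) :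
    formalDeriv (formalPeriod ψ t a l i) = formalPeriod ψ t a (l + 1) i := by
  ext1
  funext n
  change Polynomial.derivative ((formalPeriod ψ t a l i).coeff (n - 1)) -
    ((n : ℂ) - 1) • (formalPeriod ψ t a l i).coeff (n - 1) = _
  rw [coeff_formalPeriod, coeff_formalPeriod, map_add, Polynomial.derivative_smul,
    Polynomial.derivative_smul, derivative_chiCoeff]
  have h1 := thetaCoeff_succ ψ a (n - 1 - 1)
  have h2 := chiCoeff_succ a (n - 1)
  rw [sub_add_cancel] at h1 h2
  rw [h1, h2, show n - 1 - (l + 1) = n - 1 - 1 - l by ring, show n - (l + 1) = n - 1 - l by ring]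
  push_cast
  module

/-- The formal period vectors satisfy `(𝒰 - λ) I^{(l+1)} = (μ + l + 1/2) I^{(l)}`. -/
theorem formalPeriod_algebraic (ψ : ℂ) (t a : Fin 2 → ℂ) (l : ℤ) (i : Fin 2) (n : ℤ) :
    ∑ j, calU t i j • (formalPeriod ψ t a (l + 1) j).coeff n -
      (formalPeriod ψ t a (l + 1) i).coeff (n + 1) =
      (mu i i + l + 1 / 2) • (formalPeriod ψ t a l i).coeff n := by
  simp only [coeff_formalPeriod]
  have h1 := congrFun (congrFun (signedS_recursion ψ t (n - 1 - l)) i) 0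
  have h2 := congrFun (congrFun (signedS_recursion ψ t (n - l)) i) 1
  have h3 := thetaCoeff_succ' ψ a (n - 1)
  have h4 := chiCoeff_succ a n
  rw [sub_add_cancel] at h3
  rw [show n - 1 - (l + 1) = n - 1 - l - 1 by ring, show n - (l + 1) = n - l - 1 by ring,
    show n + 1 - 1 - (l + 1) = n - 1 - l by ring, show n + 1 - (l + 1) = n - l by ring,
    show n + 1 - 1 = n by ring, h3, h4]
  simp only [Matrix.mul_apply, Matrix.sub_apply, Matrix.add_apply, Matrix.smul_apply, smul_eq_mul,
    Fin.sum_univ_two] at h1 h2 ⊢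
  have e : n - l - 1 = n - 1 - l := by ring
  rw [e] at h2 ⊢
  set T := signedS ψ t (n - 1 - l)
  set T' := signedS ψ t (n - l)
  set T'' := signedS ψ t (n - 1 - l - 1)
  -- the columns of the recursion for `S`; `μ` acts on them from the right by `1/2` and `-1/2`, and
  -- `R` contributes to the second column only
  have c1 : calU t i 0 * T'' 0 0 + calU t i 1 * T'' 1 0 =
      -(((n : ℂ) - 1 - l) * T i 0) - T i 0 * (1 / 2) + mu i i * T i 0 := by
    rw [h1]
    fin_cases i <;> simp [calR, mu]
  have c2 : calU t i 0 * T 0 1 + calU t i 1 * T 1 1 =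
      2 * T i 0 - ((n : ℂ) - l) * T' i 1 + T' i 1 * (1 / 2) + mu i i * T' i 1 := by
    rw [h2]
    fin_cases i <;> simp [calR, mu] <;> ring
  have c3 : calU t i 0 • (T'' 0 0 • thetaCoeff ψ a (n - 1) + T 0 1 • chiCoeff a n) +
      calU t i 1 • (T'' 1 0 • thetaCoeff ψ a (n - 1) + T 1 1 • chiCoeff a n) =
      (calU t i 0 * T'' 0 0 + calU t i 1 * T'' 1 0) • thetaCoeff ψ a (n - 1) +
      (calU t i 0 * T 0 1 + calU t i 1 * T 1 1) • chiCoeff a n := by module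
  rw [c3, c1, c2]
  push_cast
  module

theorem van_periodInf (ψ : ℂ) (a : Fin 2 → ℂ) (l : ℤ) (i : Fin 2) :
    Van l (periodInf ψ a l i) := by
  intro n hn
  fin_cases i
  · change (periodInf ψ a l 0).coeff n = 0
    rw [periodInf_zero, HahnSeries.coeff_single_of_ne (by omega)]
  · change (periodInf ψ a l 1).coeff n = 0
    rw [periodInf_one, HahnSeries.coeff_single_of_ne (by omega)]

theorem val_conjTerm (ψ : ℂ) (t a : Fin 2 → ℂ) (l : ℤ) (k : ℕ) (i : Fin 2) :
    AS.val (conjTerm (calS ψ t) (fun l i => AS.of (periodInf ψ a l i)) l k i) =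
      HahnSeries.single (l + k + 1) (signedS ψ t k i 0 • thetaCoeff ψ a (l + k)) +
        HahnSeries.single (l + k) (signedS ψ t k i 1 • chiCoeff a (l + k)) := by
  rw [conjTerm, AS.val_smul, val_sum, Fin.sum_univ_two, AS.val_smul, AS.val_smul, AS.val_of,
    AS.val_of, periodInf_zero, periodInf_one, asymp_smul_single, asymp_smul_single, smul_add,
    asymp_smul_single, asymp_smul_single, signedS_natCast, smul_smul, smul_smul]
  rfl

/-- In the product of the first `B` terms of `S` with `f_{a,∞}`, each power of `λ` receives at most
one contribution from each component of `f_{a,∞}`. -/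
theorem coeff_sum_conjTerm (ψ : ℂ) (t a : Fin 2 → ℂ) (l : ℤ) (B : ℕ) (i : Fin 2) (n : ℤ) :
    (∑ k ∈ range B,
      AS.val (conjTerm (calS ψ t) (fun l i => AS.of (periodInf ψ a l i)) l k i)).coeff n =
      (if n - 1 - l < B then signedS ψ t (n - 1 - l) i 0 • thetaCoeff ψ a (n - 1) else 0) +
        if n - l < B then signedS ψ t (n - l) i 1 • chiCoeff a n else 0 := by
  have hs : ∀ (g : ℤ → Polynomial ℂ) (m : ℤ), (∀ x < 0, g x = 0) →
      ∑ k ∈ range B, (if m = k then g k else 0) = if m < B then g m else 0 := by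
    intro g m hg
    rcases lt_or_ge m 0 with hm | hm
    · rw [hg m hm, ite_self]
      refine Finset.sum_eq_zero fun k _ => if_neg (by omega)
    · lift m to ℕ using hm
      simp only [Nat.cast_inj, Nat.cast_lt]
      rw [Finset.sum_ite_eq]
      simp only [mem_range]
  rw [HahnSeries.coeff_sum]
  simp only [val_conjTerm, HahnSeries.coeff_add, Finset.sum_add_distrib]
  have h1 := hs (fun x => signedS ψ t x i 0 • thetaCoeff ψ a (l + x)) (n - 1 - l)
      (fun x hx => by rw [signedS_of_neg ψ t hx]; simp)
  have h2 := hs (fun x => signedS ψ t x i 1 • chiCoeff a (l + x)) (n - l)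
      (fun x hx => by rw [signedS_of_neg ψ t hx]; simp)
  simp only [show l + (n - 1 - l) = n - 1 by ring, show l + (n - l) = n by ring] at h1 h2
  rw [← h1, ← h2]
  congr 1
  · refine Finset.sum_congr rfl fun k _ => ?_
    by_cases h : n - 1 - l = k
    · rw [if_pos h, show n = l + k + 1 by omega, HahnSeries.coeff_single_same]
    · rw [if_neg h, HahnSeries.coeff_single_of_ne (by omega)]
  · refine Finset.sum_congr rfl fun k _ => ?_
    by_cases h : n - l = k
    · rw [if_pos h, show n = l + k by omega, HahnSeries.coeff_single_same]
    · rw [if_neg h, HahnSeries.coeff_single_of_ne (by omega)]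

/-- The series `S f_{a,∞}` converges in powers of `λ⁻¹`. -/
theorem van_formalPeriod_sub (ψ : ℂ) (t a : Fin 2 → ℂ) (l : ℤ) (B : ℕ) (i : Fin 2) :
    Van (l + B) (formalPeriod ψ t a l i - ∑ k ∈ range B,
      AS.val (conjTerm (calS ψ t) (fun l i => AS.of (periodInf ψ a l i)) l k i)) := by
  intro n hn
  rw [HahnSeries.coeff_sub, coeff_sum_conjTerm, if_pos (by omega), if_pos (by omega),
    coeff_formalPeriod, sub_self]

/-- The system satisfied by the period vectors with `l = -1` has, as a formal system, at most one
solution with given coefficients of `λ^0` in the first and of `λ^1` in the second component. -/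
theorem asymp_eq_of_system (t : Fin 2 → ℂ) {v w : Fin 2 → AsympSeries}
    (hv : ∀ i n, ∑ j, calU t i j • (formalDeriv (v j)).coeff n - (formalDeriv (v i)).coeff (n + 1) =
      (mu i i - 1 / 2) • (v i).coeff n)
    (hw : ∀ i n, ∑ j, calU t i j • (formalDeriv (w j)).coeff n - (formalDeriv (w i)).coeff (n + 1) =
      (mu i i - 1 / 2) • (w i).coeff n)
    (h0 : (v 0).coeff 0 = (w 0).coeff 0) (h1 : (v 1).coeff (-1) = (w 1).coeff (-1)) : v = w := by
  -- differentiation lowers the degree, so `p ↦ p' - n p` is injective for `n ≠ 0`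
  have hinj : ∀ (n : ℂ) (p q : Polynomial ℂ), n ≠ 0 → Polynomial.derivative p - n • p =
      Polynomial.derivative q - n • q → p = q := by
    intro n p q hn hpq
    by_contra hne
    have h2 : Polynomial.derivative (p - q) = n • (p - q) := by
      rw [map_sub, smul_sub, sub_eq_sub_iff_sub_eq_sub.mp hpq]
    have h3 := Polynomial.degree_derivative_lt (sub_ne_zero.mpr hne)
    rw [h2, Polynomial.degree_smul_of_smul_regular _ (IsSMulRegular.of_ne_zero hn)] at h3
    exact lt_irrefl _ h3
  have hd : ∀ (φ : AsympSeries) (n : ℤ), (formalDeriv φ).coeff n =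
      Polynomial.derivative (φ.coeff (n - 1)) - ((n : ℂ) - 1) • φ.coeff (n - 1) := fun _ _ => rfl
  -- all four series vanish below `b`, and the system determines the coefficients one after the
  -- other
  set b := min (min (v 0).order (v 1).order) (min (w 0).order (w 1).order) with hb
  have hbv : ∀ i, b ≤ (v i).order := Fin.forall_fin_two.mpr ⟨by omega, by omega⟩
  have hbw : ∀ i, b ≤ (w i).order := Fin.forall_fin_two.mpr ⟨by omega, by omega⟩
  have key : ∀ k : ℕ, ∀ i, (v i).coeff (b - 1 + k) = (w i).coeff (b - 1 + k) := by
    intro k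
    induction k with
    | zero =>
      have hlow : ∀ φ : AsympSeries, b ≤ φ.order → φ.coeff (b - 1 + (0 : ℕ)) = 0 := fun φ h =>
        HahnSeries.coeff_eq_zero_of_lt_order (by push_cast; omega)
      exact fun i => (hlow _ (hbv i)).trans (hlow _ (hbw i)).symm
    | succ k ih =>
      set n := b - 1 + (k : ℤ) + 1 with hn
      have e : b - 1 + ((k + 1 : ℕ) : ℤ) = n := by push_cast; ring
      rw [e]
      have hprev : ∀ i, (formalDeriv (v i)).coeff n = (formalDeriv (w i)).coeff n := by
        intro i
        rw [hd, hd, show n - 1 = b - 1 + (k : ℤ) by ring, ih]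
      have h3 : ∀ i, (formalDeriv (v i)).coeff (n + 1) + (mu i i - 1 / 2) • (v i).coeff n =
          (formalDeriv (w i)).coeff (n + 1) + (mu i i - 1 / 2) • (w i).coeff n := by
        intro i
        rw [← hv i n, ← hw i n, add_sub_cancel, add_sub_cancel]
        simp only [hprev]
      have h4 : ∀ i, Polynomial.derivative ((v i).coeff n) -
            ((n : ℂ) - (mu i i - 1 / 2)) • (v i).coeff n =
          Polynomial.derivative ((w i).coeff n) - ((n : ℂ) - (mu i i - 1 / 2)) • (w i).coeff n := by
        intro i
        have := h3 i
        rw [hd, hd, add_sub_cancel_right] at this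
        push_cast at this
        rw [add_sub_cancel_right] at this
        linear_combination (norm := module) this
      intro i
      fin_cases i
      · -- the resonance `n = μ_i - 1/2` occurs once for each component, at the prescribed
        -- coefficient
        by_cases hn0 : n = 0
        · rw [hn0]; exact h0
        · refine hinj _ _ _ ?_ (h4 0)
          simpa [mu] using hn0
      · by_cases hn0 : n = -1
        · rw [hn0]; exact h1
        · refine hinj _ _ _ ?_ (h4 1)
          simp only [mu]
          norm_num
          intro h
          apply hn0
          have h5 : (n : ℂ) = ((-1 : ℤ) : ℂ) := by push_cast; linear_combination h
          exact_mod_cast h5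
  funext i
  ext1
  funext n
  rcases lt_or_ge n (b - 1) with h | h
  · have hlow : ∀ φ : AsympSeries, b ≤ φ.order → φ.coeff n = 0 := fun φ h =>
        HahnSeries.coeff_eq_zero_of_lt_order (by omega)
    exact (hlow _ (hbv i)).trans (hlow _ (hbw i)).symm
  · obtain ⟨k, rfl⟩ : ∃ k : ℕ, n = b - 1 + k := ⟨(n - (b - 1)).toNat, by omega⟩
    exact key k i

/-! ### Power series in `λ⁻¹` -/

/-- A power series in `λ⁻¹` with complex coefficients as an asymptotic series. -/
def emb : PowerSeries ℂ →+* AsympSeries :=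
  (HahnSeries.ofPowerSeries ℤ (Polynomial ℂ)).comp (PowerSeries.map Polynomial.C)

theorem coeff_emb (φ : PowerSeries ℂ) (n : ℕ) :
    (emb φ).coeff (n : ℤ) = Polynomial.C (PowerSeries.coeff n φ) := by
  rw [emb, RingHom.comp_apply, HahnSeries.ofPowerSeries_apply_coeff, PowerSeries.coeff_map]

theorem van_emb (φ : PowerSeries ℂ) : Van 0 (emb φ) := by
  intro j hj
  rw [emb, RingHom.comp_apply, HahnSeries.ofPowerSeries_apply]
  refine HahnSeries.embDomain_of_notMem_range ?_
  rintro ⟨k, hk⟩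
  have : (k : ℤ) = j := hk
  omega

theorem van_emb_of_dvd {φ : PowerSeries ℂ} {n : ℕ} (h : PowerSeries.X ^ n ∣ φ) :
    Van n (emb φ) := by
  intro j hj
  rcases lt_or_ge j 0 with h0 | h0
  · exact van_emb φ j h0
  · lift j to ℕ using h0
    rw [coeff_emb, PowerSeries.X_pow_dvd_iff.mp h j (by exact_mod_cast hj), map_zero]

theorem emb_smul (c : ℂ) (φ : PowerSeries ℂ) : emb (c • φ) = c • emb φ := by
  rw [PowerSeries.smul_eq_C_mul, map_mul, ← asympConst_mul]
  congr 1
  rw [emb, RingHom.comp_apply, PowerSeries.map_C, HahnSeries.ofPowerSeries_C]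
  rfl

theorem emb_ext {φ : AsympSeries} {g : PowerSeries ℂ} (h0 : Van 0 φ)
    (h : ∀ n : ℕ, φ.coeff n = Polynomial.C (PowerSeries.coeff n g)) : φ = emb g := by
  ext1
  funext n
  rcases lt_or_ge n 0 with hn | hn
  · rw [h0 n hn, van_emb g n hn]
  · lift n to ℕ using hn
    rw [h, coeff_emb]

/-! ### The phase form as a power series -/

section

variable (ψ : ℂ) (t a : Fin 2 → ℂ)

/-- The coefficients of `S f_{a,∞,+}`, where `f_{a,∞,+}` is the part of `f_{a,∞}` with nonnegative
powers of `z`. -/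
def halfSer (l : ℤ) (i : Fin 2) : PowerSeries ℂ :=
  PowerSeries.mk fun n => match n with
    | 0 => signedS ψ t (-l) i 1 * ((a 0 + a 1) / 2)
    | n + 1 => signedS ψ t (n - l) i 0 * ((a 0 + a 1) * ((-1) ^ n * n.factorial))

theorem coeff_halfSer_zero (l : ℤ) (i : Fin 2) : PowerSeries.coeff 0 (halfSer ψ t a l i) =
    signedS ψ t (-l) i 1 * ((a 0 + a 1) / 2) := by
  rw [halfSer, PowerSeries.coeff_mk]

theorem coeff_halfSer_succ (l : ℤ) (i : Fin 2) (n : ℕ) :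
    PowerSeries.coeff (n + 1) (halfSer ψ t a l i) =
      signedS ψ t (n - l) i 0 * ((a 0 + a 1) * ((-1) ^ n * n.factorial)) := by
  rw [halfSer, PowerSeries.coeff_mk]

theorem chiCoeff_nat (n : ℕ) :
    chiCoeff a n = Polynomial.C (if n = 0 then (a 0 + a 1) / 2 else 0) := by
  induction n with
  | zero => rw [Nat.cast_zero, chiCoeff_zero, if_pos rfl]
  | succ n ih =>
    have h := chiCoeff_succ a n
    rw [Nat.cast_succ, h, ih]
    rcases Nat.eq_zero_or_pos n with rfl | hn
    · simp
    · simp [hn.ne']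

theorem thetaCoeff_nat (n : ℕ) :
    thetaCoeff ψ a n = Polynomial.C ((a 0 + a 1) * ((-1) ^ n * n.factorial)) := by
  induction n with
  | zero =>
    have h := thetaCoeff_succ ψ a (-1)
    rw [neg_add_cancel, thetaCoeff_neg_one] at h
    rw [Nat.cast_zero, h]
    simp [Polynomial.smul_eq_C_mul]
  | succ n ih =>
    have h := thetaCoeff_succ ψ a n
    rw [Nat.cast_succ, h, ih, Polynomial.derivative_C, zero_sub, Polynomial.smul_C, ← map_neg]
    congr 1
    rw [Nat.factorial_succ, pow_succ, smul_eq_mul]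
    push_cast
    ring

/-- For `l ≥ 0` the terms of `f_{a,∞}` with negative powers of `z` do not contribute to
`S f_{a,∞}`. -/
theorem formalPeriod_eq_emb (l : ℕ) (i : Fin 2) :
    formalPeriod ψ t a l i = emb (halfSer ψ t a l i) := by
  refine emb_ext (fun j hj => ?_) fun n => ?_
  · rw [coeff_formalPeriod, signedS_of_neg ψ t (by omega), signedS_of_neg ψ t (by omega)]
    simp
  · rw [coeff_formalPeriod, chiCoeff_nat]
    rcases n with _ | n
    · rw [coeff_halfSer_zero, signedS_of_neg ψ t (by push_cast; omega), if_pos rfl]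
      simp [Polynomial.smul_C]
    · rw [coeff_halfSer_succ, if_neg (by omega), show ((n + 1 : ℕ) : ℤ) - 1 = n by push_cast; ring,
        thetaCoeff_nat, Polynomial.smul_C]
      simp

theorem X_pow_dvd_halfSer (l : ℕ) (i : Fin 2) :
    (PowerSeries.X : PowerSeries ℂ) ^ l ∣ halfSer ψ t a l i := by
  rw [PowerSeries.X_pow_dvd_iff]
  intro m hm
  rcases m with _ | m
  · rw [coeff_halfSer_zero, signedS_of_neg ψ t (by omega)]
    simp
  · rw [coeff_halfSer_succ, signedS_of_neg ψ t (by omega)]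
    simp

/-- The vector `I^{(0)}_{a,∞}` as a vector of power series. -/
def halfInf (i : Fin 2) : PowerSeries ℂ :=
  ![PowerSeries.C (a 0 + a 1) * PowerSeries.X, PowerSeries.C ((a 0 + a 1) / 2)] i

/-- The coefficients of the negative powers of `z` in `S f_{a,∞,+}`, obtained from `S f_{a,∞}` by
subtracting `S f_{a,∞,-}`, contain no logarithms. -/
theorem val_mixCoeff (v : Var) :
    AS.val (mixCoeff (calS ψ t) (fun l i => AS.of (periodInf ψ a l i))
      (fun l i => AS.of (formalPeriod ψ t a l i)) v) =
      ∑ j, eta v.1 j • emb (halfSer ψ t a (-((v.2 : ℤ) + 1)) j) := by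
  have key : ∀ j, formalPeriod ψ t a (-((v.2 : ℤ) + 1)) j - ∑ k ∈ range (v.2 + 1),
      AS.val (conjTerm (calS ψ t) (fun l i => AS.of (periodInf ψ a l i)) (-((v.2 : ℤ) + 1)) k j) =
      emb (halfSer ψ t a (-((v.2 : ℤ) + 1)) j) := by
    intro j
    refine emb_ext (fun n hn => ?_) fun n => ?_
    · rw [HahnSeries.coeff_sub, coeff_sum_conjTerm, if_pos (by push_cast; omega),
        if_pos (by push_cast; omega), coeff_formalPeriod, sub_self]
    · rw [HahnSeries.coeff_sub, coeff_sum_conjTerm, coeff_formalPeriod]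
      rcases n with _ | n
      · rw [if_pos (by push_cast; omega), if_neg (by push_cast; omega), coeff_halfSer_zero,
          chiCoeff_nat, if_pos rfl, add_zero, add_sub_cancel_left, Nat.cast_zero, zero_sub,
          Polynomial.smul_C, smul_eq_mul]
      · rw [if_neg (by push_cast; omega), if_neg (by push_cast; omega), chiCoeff_nat,
          if_neg (Nat.succ_ne_zero n), coeff_halfSer_succ,
          show ((n + 1 : ℕ) : ℤ) - 1 = n by push_cast; ring, thetaCoeff_nat, Polynomial.smul_C]
        simp
  rw [mixCoeff, negCoeff, conjNegCoeff, map_sub, map_sum, map_sum, ← Finset.sum_sub_distrib]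
  refine Finset.sum_congr rfl fun j _ => ?_
  rw [← key, AS.val_smul, AS.val_smul, map_sum, AS.val_of, ← asympConst_mul, ← asympConst_mul,
    ← asympConst_mul, mul_sub]

/-- The terms of the phase form `∑_l (-1)^{l+1} (h^l, h^{-l-1})`, `h = S f_{a,∞,+}`. -/
def phaseTerm (l : ℕ) : PowerSeries ℂ :=
  (-1) ^ (l + 1) * (halfSer ψ t a l 0 * halfSer ψ t a (-((l : ℤ) + 1)) 1 +
    halfSer ψ t a l 1 * halfSer ψ t a (-((l : ℤ) + 1)) 0)

/-- The phase form `∑_l (-1)^{l+1} (h^l, h^{-l-1})`, `h = S f_{a,∞,+}`. -/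
def phaseSer : PowerSeries ℂ :=
  PowerSeries.mk fun n => ∑ l ∈ range (n + 1), PowerSeries.coeff n (phaseTerm ψ t a l)

theorem X_pow_dvd_phaseTerm (l : ℕ) : (PowerSeries.X : PowerSeries ℂ) ^ l ∣ phaseTerm ψ t a l :=
  ((X_pow_dvd_halfSer ψ t a l 0).mul_right _ |>.add
    ((X_pow_dvd_halfSer ψ t a l 1).mul_right _)).mul_left _

theorem X_pow_dvd_phaseSer_sub (K : ℕ) : (PowerSeries.X : PowerSeries ℂ) ^ (K + 1) ∣
    phaseSer ψ t a - ∑ l ∈ range (K + 1), phaseTerm ψ t a l := by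
  rw [PowerSeries.X_pow_dvd_iff]
  intro m hm
  rw [map_sub, map_sum, phaseSer, PowerSeries.coeff_mk, sub_eq_zero]
  refine Finset.sum_subset (Finset.range_subset_range.mpr (by omega)) fun l _ hl => ?_
  exact PowerSeries.X_pow_dvd_iff.mp (X_pow_dvd_phaseTerm ψ t a l) m (by simpa using hl)

/-- The phase form is the commutator of the two halves of the linear Hamiltonian of
`S f_{a,∞,+}`. -/
theorem emb_phaseTerm (l : ℕ) : emb (phaseTerm ψ t a l) =
    ∑ i : Fin 2, AS.val (posCoeff (fun l i => AS.of (formalPeriod ψ t a l i)) (i, l) *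
      mixCoeff (calS ψ t) (fun l i => AS.of (periodInf ψ a l i))
      (fun l i => AS.of (formalPeriod ψ t a l i)) (i, l)) := by
  have h1 : ((-1 : PowerSeries ℂ) ^ (l + 1)) = PowerSeries.C ((-1 : ℂ) ^ (l + 1)) := by
    rw [map_pow, map_neg, map_one]
  simp only [map_mul, val_mixCoeff, posCoeff, AS.val_smul, AS.val_of, formalPeriod_eq_emb]
  rw [phaseTerm, h1, ← PowerSeries.smul_eq_C_mul, emb_smul, map_add, map_mul, map_mul]
  simp only [Fin.sum_univ_two, ← asympConst_mul]
  have e : ∀ i j, asympConst (eta i j) = if i = j then 0 else 1 := by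
    intro i j
    fin_cases i <;> fin_cases j <;> simp [eta, asympConst]
  simp only [e]
  norm_num
  ring

/-- The commutator of the two halves of the linear Hamiltonian, restricted to the variables `l ≤ K`,
is the phase form up to `O(λ^{-K-1})`. -/
theorem van_phaseSer_sub (K : ℕ) : Van (K + 1) (AS.val (AS.of (emb (phaseSer ψ t a)) -
    ∑ v ∈ varsLE K, posCoeff (fun l i => AS.of (formalPeriod ψ t a l i)) v *
      mixCoeff (calS ψ t) (fun l i => AS.of (periodInf ψ a l i))
      (fun l i => AS.of (formalPeriod ψ t a l i)) v)) := by
  have h := van_emb_of_dvd (X_pow_dvd_phaseSer_sub ψ t a K)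
  rw [map_sub, map_sum] at h
  simp only [emb_phaseTerm] at h
  rw [sum_varsLE, map_sub, AS.val_of, map_sum]
  simp only [map_sum]
  exact_mod_cast h

/-- The derivation `∂_λ = -x² ∂_x`, `x = λ⁻¹`, of power series in `λ⁻¹`. -/
def derInf (φ : PowerSeries ℂ) : PowerSeries ℂ := -(PowerSeries.X ^ 2 * PowerSeries.derivative ℂ φ)

theorem derInf_add (φ χ : PowerSeries ℂ) : derInf (φ + χ) = derInf φ + derInf χ := by
  rw [derInf, derInf, derInf, map_add]
  ring

theorem derInf_mul (φ χ : PowerSeries ℂ) : derInf (φ * χ) = derInf φ * χ + φ * derInf χ := by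
  rw [derInf, derInf, derInf, Derivation.leibniz, smul_eq_mul, smul_eq_mul]
  ring

theorem coeff_derInf_zero (φ : PowerSeries ℂ) : PowerSeries.coeff 0 (derInf φ) = 0 := by
  simp [derInf]

theorem coeff_derInf_succ (φ : PowerSeries ℂ) (n : ℕ) :
    PowerSeries.coeff (n + 1) (derInf φ) = -(n * PowerSeries.coeff n φ) := by
  rw [derInf, map_neg, pow_two, mul_assoc, PowerSeries.coeff_succ_X_mul]
  rcases n with _ | n
  · simp
  · rw [PowerSeries.coeff_succ_X_mul, PowerSeries.coeff_derivative]
    push_cast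
    ring

theorem X_pow_dvd_derInf {φ : PowerSeries ℂ} {n : ℕ} (h : PowerSeries.X ^ n ∣ φ) :
    PowerSeries.X ^ n ∣ derInf φ := by
  rw [PowerSeries.X_pow_dvd_iff] at h ⊢
  intro m hm
  rcases m with _ | m
  · exact coeff_derInf_zero φ
  · rw [coeff_derInf_succ, h m (by omega)]
    simp

/-- The derivative `∂_λ` raises the index of `S f_{a,∞}`. On the part `S f_{a,∞,+}` a correction
remains, because `I^{(0)}_{a,∞}` is a derivative of a term of `f_{a,∞,-}`. -/
theorem derInf_halfSer (l : ℤ) (i : Fin 2) : derInf (halfSer ψ t a l i) =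
    halfSer ψ t a (l + 1) i - ∑ j, signedS ψ t (-(l + 1)) i j • halfInf a j := by
  ext n
  have hc : ∀ n, PowerSeries.coeff n (∑ j, signedS ψ t (-(l + 1)) i j • halfInf a j) =
      (if n = 1 then signedS ψ t (-(l + 1)) i 0 * (a 0 + a 1) else 0) +
        if n = 0 then signedS ψ t (-(l + 1)) i 1 * ((a 0 + a 1) / 2) else 0 := by
    intro n
    rw [Fin.sum_univ_two, map_add]
    simp only [halfInf, Matrix.cons_val_zero, Matrix.cons_val_one,
      Matrix.cons_val_fin_one, PowerSeries.coeff_smul, PowerSeries.coeff_C_mul,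
      PowerSeries.coeff_C, PowerSeries.coeff_X, smul_eq_mul, mul_ite, mul_one, mul_zero]
  rw [map_sub, hc]
  rcases n with _ | _ | n
  · rw [coeff_derInf_zero, coeff_halfSer_zero]
    simp
  · rw [coeff_derInf_succ, coeff_halfSer_succ]
    simp
  · rw [coeff_derInf_succ, coeff_halfSer_succ, coeff_halfSer_succ, Nat.factorial_succ, pow_succ,
      show ((n + 1 : ℕ) : ℤ) - (l + 1) = n - l by push_cast; ring]
    simp
    ring

/-- The entries of `S^*(-z) S(z) = 1`, multiplied by `η`. -/
theorem symplectic_sum (n : ℕ) (c : Fin 2) :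
    ∑ p ∈ antidiagonal n, (signedS ψ t p.1 0 0 * calS ψ t p.2 1 c +
      signedS ψ t p.1 1 0 * calS ψ t p.2 0 c) = if n = 0 then eta 0 c else 0 := by
  have h := coeff_symplAdj_mul ψ t n
  rw [symplAdj_calSeries_mul] at h
  have h2 := congrArg (fun M => (eta * M) 0 c) h
  simp only [Finset.mul_sum, Matrix.sum_apply] at h2
  have h3 : (eta * PowerSeries.coeff n (1 : PowerSeries (Matrix (Fin 2) (Fin 2) ℂ))) 0 c =
      if n = 0 then eta 0 c else 0 := by
    rw [PowerSeries.coeff_one]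
    split_ifs
    · rw [mul_one]
    · rw [mul_zero]; rfl
  rw [← h3, h2]
  refine Finset.sum_congr rfl fun p _ => ?_
  rw [signedS_natCast]
  simp only [Matrix.mul_apply, Fin.sum_univ_two, Matrix.smul_apply, Matrix.transpose_apply,
    smul_eq_mul]
  simp [eta]
  ring

/-- The symplectic property of `S`, in the form `∑_l S_l^* h^l = f^0` modulo high powers. -/
theorem X_pow_dvd_symplectic (K : ℕ) (c : Fin 2) : (PowerSeries.X : PowerSeries ℂ) ^ (K + 1) ∣
    ∑ l ∈ range (K + 1), (calS ψ t l 1 c • halfSer ψ t a l 0 + calS ψ t l 0 c • halfSer ψ t a l 1) -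
      (eta 0 c • halfInf a 0 + eta 1 c • halfInf a 1) := by
  rw [PowerSeries.X_pow_dvd_iff]
  intro m hm
  have hs : PowerSeries.coeff m (∑ l ∈ range (K + 1), (calS ψ t l 1 c • halfSer ψ t a l 0 +
      calS ψ t l 0 c • halfSer ψ t a l 1)) = ∑ l ∈ range (m + 1), PowerSeries.coeff m
      (calS ψ t l 1 c • halfSer ψ t a l 0 + calS ψ t l 0 c • halfSer ψ t a l 1) := by
    rw [map_sum]
    symm
    refine Finset.sum_subset (Finset.range_subset_range.mpr (by omega)) fun l _ hl => ?_
    have hl' : m < l := by simpa using hl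
    simp only [map_add, PowerSeries.coeff_smul,
      PowerSeries.X_pow_dvd_iff.mp (X_pow_dvd_halfSer ψ t a l _) m hl', smul_zero, add_zero]
  rw [map_sub, hs]
  simp only [map_add, PowerSeries.coeff_smul, smul_eq_mul]
  have e0 : ∀ m, PowerSeries.coeff m (halfInf a 0) = if m = 1 then a 0 + a 1 else 0 := by
    intro m
    simp only [halfInf, Matrix.cons_val_zero, PowerSeries.coeff_C_mul, PowerSeries.coeff_X,
      mul_ite, mul_one, mul_zero]
  have e1 : ∀ m, PowerSeries.coeff m (halfInf a 1) = if m = 0 then (a 0 + a 1) / 2 else 0 := by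
    intro m
    simp [halfInf, PowerSeries.coeff_C]
  rw [e0, e1]
  rcases m with _ | m
  · rw [zero_add, Finset.sum_range_one, coeff_halfSer_zero, coeff_halfSer_zero]
    simp only [Nat.cast_zero, neg_zero, signedS_zero, calS_zero]
    revert c
    refine Fin.forall_fin_two.mpr ⟨?_, ?_⟩ <;> simp [eta]
  · -- for `l = m + 1` there is no contribution, and the others form a convolution of the
    -- coefficients of `S`
    have hlast : ∀ i, PowerSeries.coeff (m + 1) (halfSer ψ t a ((m + 1 : ℕ) : ℤ) i) = 0 := by
      intro i
      rw [coeff_halfSer_succ, signedS_of_neg ψ t (by push_cast; omega)]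
      simp
    rw [Finset.sum_range_succ, hlast, hlast, mul_zero, mul_zero, add_zero, add_zero,
      ← Finset.Nat.sum_antidiagonal_eq_sum_range_succ (fun l _ => calS ψ t l 1 c *
        PowerSeries.coeff (m + 1) (halfSer ψ t a l 0) + calS ψ t l 0 c *
        PowerSeries.coeff (m + 1) (halfSer ψ t a l 1))]
    have h1 : ∑ p ∈ antidiagonal m, (calS ψ t p.1 1 c *
        PowerSeries.coeff (m + 1) (halfSer ψ t a p.1 0) + calS ψ t p.1 0 c *
        PowerSeries.coeff (m + 1) (halfSer ψ t a p.1 1)) =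
        (∑ p ∈ antidiagonal m, (signedS ψ t p.1 0 0 * calS ψ t p.2 1 c +
          signedS ψ t p.1 1 0 * calS ψ t p.2 0 c)) *
          ((a 0 + a 1) * ((-1) ^ m * m.factorial)) := by
      rw [← Finset.Nat.sum_antidiagonal_swap, Finset.sum_mul]
      refine Finset.sum_congr rfl fun p hp => ?_
      have hp' := HasAntidiagonal.mem_antidiagonal.mp hp
      have e : ((m : ℤ) - p.2) = p.1 := by omega
      simp only [Prod.fst_swap, Prod.snd_swap, coeff_halfSer_succ, e]
      ring
    rw [h1, symplectic_sum]
    by_cases hm0 : m = 0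
    · subst hm0
      simp
    · simp [hm0]

theorem eq_of_X_pow_dvd {φ χ : PowerSeries ℂ}
    (h : ∀ K : ℕ, PowerSeries.X ^ (K + 1) ∣ φ - χ) : φ = χ := by
  ext n
  have h1 := PowerSeries.X_pow_dvd_iff.mp (h n) n (Nat.lt_succ_self n)
  rwa [map_sub, sub_eq_zero] at h1

/-- The derivative of the phase form is the difference of the phase densities: the sum
telescopes, and what remains is given by the symplectic property of `S`. -/
theorem derInf_phaseSer : derInf (phaseSer ψ t a) =
    PowerSeries.C ((a 0 + a 1) ^ 2) * PowerSeries.X -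
      2 * (halfSer ψ t a 0 0 * halfSer ψ t a 0 1) := by
  refine eq_of_X_pow_dvd fun K => ?_
  set h := halfSer ψ t a with hh
  set α : ℕ → PowerSeries ℂ := fun l => h l 0 * h (-(l : ℤ)) 1 + h l 1 * h (-(l : ℤ)) 0 with hα
  -- the index of the second factor is negative; differentiation turns each term into a difference
  -- of consecutive terms, up to the corrections by `I^{(0)}_{a,∞}`
  have hterm : ∀ l : ℕ, derInf (phaseTerm ψ t a l) = (-1) ^ (l + 1) * α (l + 1) -
      (-1) ^ l * α l + ((calS ψ t l 1 0 • h l 0 + calS ψ t l 0 0 • h l 1) * halfInf a 0 +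
        (calS ψ t l 1 1 • h l 0 + calS ψ t l 0 1 • h l 1) * halfInf a 1) := by
    intro l
    have hpos : ∀ i, derInf (h l i) = h (l + 1) i := by
      intro i
      rw [derInf_halfSer, signedS_of_neg ψ t (by omega)]
      simp [hh]
    have hneg : ∀ i, derInf (h (-((l : ℤ) + 1)) i) =
        h (-(l : ℤ)) i - (-1) ^ l * ∑ j, calS ψ t l i j • halfInf a j := by
      intro i
      rw [derInf_halfSer, show -(-((l : ℤ) + 1) + 1) = l by ring,
        show -((l : ℤ) + 1) + 1 = -l by ring, signedS_natCast, Finset.mul_sum]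
      refine congrArg₂ (· - ·) rfl (Finset.sum_congr rfl fun j _ => ?_)
      rw [Matrix.smul_apply, smul_assoc, PowerSeries.smul_eq_C_mul _ ((-1 : ℂ) ^ l), map_pow,
        map_neg, map_one]
    have hconst : derInf ((-1 : PowerSeries ℂ) ^ (l + 1)) = 0 := by
      rw [show ((-1 : PowerSeries ℂ) ^ (l + 1)) = PowerSeries.C ((-1 : ℂ) ^ (l + 1)) by
        rw [map_pow, map_neg, map_one], derInf, PowerSeries.derivative_C]
      simp
    have hsq : ((-1 : PowerSeries ℂ) ^ l) * (-1) ^ l = 1 := by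
      rw [← pow_add, ← two_mul, pow_mul]
      simp
    rw [phaseTerm, derInf_mul, hconst, zero_mul, zero_add, derInf_add, derInf_mul, derInf_mul,
      ← hh, hpos, hpos, hneg, hneg]
    simp only [Fin.sum_univ_two, hα, Nat.cast_succ, PowerSeries.smul_eq_C_mul, pow_succ]
    linear_combination ((PowerSeries.C (calS ψ t l 1 0) * h l 0 + PowerSeries.C (calS ψ t l 0 0) *
      h l 1) * halfInf a 0 + (PowerSeries.C (calS ψ t l 1 1) * h l 0 +
      PowerSeries.C (calS ψ t l 0 1) * h l 1) * halfInf a 1) * hsq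
  have hsum : ∑ l ∈ range (K + 1), derInf (phaseTerm ψ t a l) = (-1) ^ (K + 1) * α (K + 1) -
      α 0 +
      ((∑ l ∈ range (K + 1), (calS ψ t l 1 0 • h l 0 + calS ψ t l 0 0 • h l 1)) *
          halfInf a 0 +
        (∑ l ∈ range (K + 1), (calS ψ t l 1 1 • h l 0 + calS ψ t l 0 1 • h l 1)) *
          halfInf a 1) := by
    simp only [hterm, Finset.sum_add_distrib, Finset.sum_mul, add_mul]
    rw [Finset.sum_range_sub (fun l => (-1) ^ l * α l)]
    simp
  have hsum' : derInf (∑ l ∈ range (K + 1), phaseTerm ψ t a l) =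
      ∑ l ∈ range (K + 1), derInf (phaseTerm ψ t a l) := by
    have h0 : derInf 0 = 0 := by simp [derInf]
    exact map_sum (⟨⟨derInf, h0⟩, derInf_add⟩ : PowerSeries ℂ →+ PowerSeries ℂ) _ _
  have hd1 : PowerSeries.X ^ (K + 1) ∣ derInf (phaseSer ψ t a) -
      ∑ l ∈ range (K + 1), derInf (phaseTerm ψ t a l) := by
    have h1 := X_pow_dvd_derInf (X_pow_dvd_phaseSer_sub ψ t a K)
    rw [← hsum']
    convert h1 using 1
    rw [eq_comm, eq_sub_iff_add_eq, ← derInf_add, sub_add_cancel]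
  have hd2 : PowerSeries.X ^ (K + 1) ∣ (-1) ^ (K + 1) * α (K + 1) :=
    ((X_pow_dvd_halfSer ψ t a (K + 1) 0).mul_right _ |>.add
      ((X_pow_dvd_halfSer ψ t a (K + 1) 1).mul_right _)).mul_left _
  -- the symplectic property evaluates the sum of the corrections
  have hd3 := fun c => X_pow_dvd_symplectic ψ t a K c
  have hd4 := ((hd1.add hd2).add ((hd3 0).mul_right (halfInf a 0))).add
    ((hd3 1).mul_right (halfInf a 1))
  rw [hsum] at hd4
  convert hd4 using 1
  simp only [← hh]
  have hα0 : α 0 = 2 * (h 0 0 * h 0 1) := by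
    simp only [hα, Nat.cast_zero, neg_zero]
    ring
  -- the remaining boundary term is `(I^{(0)}_{a,∞}, I^{(0)}_{a,∞})`
  have he : (eta 0 0 • halfInf a 0 + eta 1 0 • halfInf a 1) * halfInf a 0 +
      (eta 0 1 • halfInf a 0 + eta 1 1 • halfInf a 1) * halfInf a 1 =
      PowerSeries.C ((a 0 + a 1) ^ 2) * PowerSeries.X := by
    simp only [eta, halfInf, Matrix.of_apply, Matrix.cons_val_zero, Matrix.cons_val_one,
      Matrix.cons_val_fin_one, zero_smul, one_smul, zero_add, add_zero]
    have : PowerSeries.C ((a 0 + a 1) ^ 2) = PowerSeries.C ((a 0 + a 1) / 2) *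
        PowerSeries.C (a 0 + a 1) +
        PowerSeries.C (a 0 + a 1) * PowerSeries.C ((a 0 + a 1) / 2) := by
      rw [← map_mul, ← map_mul, ← map_add]
      congr 1
      ring
    rw [this]
    ring
  rw [hα0]
  linear_combination he

/-- At `λ = ∞` only the entry `(S_1)_{12} = ψ + log t^2` contributes to the phase form. -/
theorem coeff_zero_phaseSer : PowerSeries.coeff 0 (phaseSer ψ t a) = cConst ψ t a := by
  rw [phaseSer, PowerSeries.coeff_mk, zero_add, Finset.sum_range_one, phaseTerm]
  simp only [PowerSeries.coeff_zero_eq_constantCoeff, map_mul, map_add, map_pow, map_neg, map_one]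
  simp only [← PowerSeries.coeff_zero_eq_constantCoeff_apply, coeff_halfSer_zero]
  have h1 : signedS ψ t 1 = (-1 : ℂ) ^ 1 • calS ψ t 1 := by
    exact_mod_cast signedS_natCast ψ t 1
  simp only [Nat.cast_zero, neg_zero, zero_add, neg_neg, signedS_zero, h1, Matrix.smul_apply,
    calS_one_apply, cConst]
  simp
  ring

/-- The exponential of a power series, coefficient by coefficient, is the solution of its
differential equation. -/
theorem hasSum_coeff_dp {y E : PowerSeries ℂ}
    (h0 : PowerSeries.coeff 0 E = Complex.exp (PowerSeries.coeff 0 y))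
    (hE : PowerSeries.derivative ℂ E = PowerSeries.derivative ℂ y * E) (j : ℕ) :
    HasSum (fun p => PowerSeries.coeff j (dp y p)) (PowerSeries.coeff j E) := by
  induction j using Nat.strong_induction_on with
  | _ j ih =>
    rcases j with _ | j
    · have hd : ∀ p, PowerSeries.coeff 0 (dp y p) =
          (PowerSeries.coeff 0 y) ^ p / p.factorial := by
        intro p
        rw [dp, PowerSeries.coeff_smul, PowerSeries.coeff_zero_eq_constantCoeff, map_pow,
          smul_eq_mul, div_eq_inv_mul]
      simp only [hd, h0, Complex.exp_eq_exp_ℂ]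
      exact NormedSpace.expSeries_div_hasSum_exp (𝔸 := ℂ) _
    · rw [← hasSum_nat_add_iff' 1]
      have hj : (j : ℂ) + 1 ≠ 0 := by exact_mod_cast Nat.succ_ne_zero j
      have hder : ∀ φ : PowerSeries ℂ, PowerSeries.coeff (j + 1) φ =
          PowerSeries.coeff j (PowerSeries.derivative ℂ φ) / (j + 1) := by
        intro φ
        rw [PowerSeries.coeff_derivative, mul_div_cancel_right₀ _ hj]
      have hdp : ∀ p, PowerSeries.derivative ℂ (dp y (p + 1)) =
          PowerSeries.derivative ℂ y * dp y p := by
        intro p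
        have hp : (p : ℂ) + 1 ≠ 0 := by exact_mod_cast Nat.succ_ne_zero p
        have h := Derivation.leibniz_pow (PowerSeries.derivative ℂ) y (p + 1)
        change PowerSeries.derivative ℂ (dp y (p + 1)) = PowerSeries.derivative ℂ y * dp y p
        rw [dp, Derivation.map_smul, h, dp, add_tsub_cancel_right, Nat.factorial_succ]
        rw [← Nat.cast_smul_eq_nsmul ℂ, smul_smul, smul_eq_mul, mul_smul_comm, mul_comm (y ^ p)]
        congr 1
        push_cast
        field_simp
      have h1 : ∀ p, PowerSeries.coeff (j + 1) (dp y (p + 1)) =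
          (∑ q ∈ antidiagonal j, PowerSeries.coeff q.1 (PowerSeries.derivative ℂ y) *
            PowerSeries.coeff q.2 (dp y p)) / (j + 1) := by
        intro p
        rw [hder, hdp, PowerSeries.coeff_mul]
      have h2 : PowerSeries.coeff (j + 1) E - ∑ i ∈ range 1, PowerSeries.coeff (j + 1) (dp y i) =
          (∑ q ∈ antidiagonal j, PowerSeries.coeff q.1 (PowerSeries.derivative ℂ y) *
            PowerSeries.coeff q.2 E) / (j + 1) := by
        rw [hder, hE, PowerSeries.coeff_mul, Finset.sum_range_one, dp_zero, PowerSeries.coeff_one]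
        simp
      rw [h2]
      simp only [h1]
      refine HasSum.div_const (hasSum_sum fun q hq => ?_) _
      refine (ih q.2 ?_).mul_left _
      have := HasAntidiagonal.mem_antidiagonal.mp hq
      omega

theorem coeffHasSum_emb {X E : PowerSeries ℂ}
    (h : ∀ j, HasSum (fun p => PowerSeries.coeff j (dp ((1 / 2 : ℂ) • X) p))
      (PowerSeries.coeff j E)) :
    CoeffHasSum (fun p => AS.val (dp ((1 / 2 : ℂ) • AS.of (emb X)) p)) (emb E) := by
  intro j k
  have e : ∀ p, AS.val (dp ((1 / 2 : ℂ) • AS.of (emb X)) p) = emb (dp ((1 / 2 : ℂ) • X) p) := by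
    intro p
    rw [dp, dp, AS.val_smul, map_pow, AS.val_smul, AS.val_of, emb_smul, map_pow, emb_smul]
  simp only [e, coeff_emb]
  rcases k with _ | k
  · simpa only [Polynomial.coeff_C_zero] using h j
  · simp only [Polynomial.coeff_C_succ]
    exact hasSum_zero

end

/-! ### The cut plane -/

theorem cutLog_exp {w : ℂ} (hw : w ≠ 0) : Complex.exp (cutLog w) = w := by
  have h : Complex.exp ((Real.pi / 2 : ℝ) * Complex.I) = Complex.I := by
    push_cast
    exact Complex.exp_pi_div_two_mul_I
  rw [cutLog, Complex.exp_sub, Complex.exp_log (mul_ne_zero Complex.I_ne_zero hw), h,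
    mul_div_cancel_left₀ _ Complex.I_ne_zero]

theorem hasDerivAt_cutLog {w : ℂ} (hw : Complex.I * w ∈ Complex.slitPlane) :
    HasDerivAt cutLog w⁻¹ w := by
  have h := (((hasDerivAt_id w).const_mul Complex.I).clog hw).sub_const
    ((Real.pi / 2 : ℝ) * Complex.I)
  have hw0 : w ≠ 0 := by
    rintro rfl
    rw [mul_zero] at hw
    exact Complex.zero_notMem_slitPlane hw
  refine h.congr_deriv ?_
  simp only [id]
  field_simp

theorem mem_cutPlane_iff (t : Fin 2 → ℂ) (w : ℂ) :
    w ∈ cutPlane t ↔ ∀ i, Complex.I * (w - canonCoord t i) ∈ Complex.slitPlane := by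
  refine forall_congr' fun i => ?_
  rw [Complex.mem_slitPlane_iff]
  simp only [Complex.mul_re, Complex.mul_im, Complex.I_re, Complex.I_im, Complex.sub_re,
    Complex.sub_im, zero_mul, one_mul, zero_sub, zero_add, neg_sub]
  constructor
  · intro h
    by_contra! hc
    refine h ((w - canonCoord t i).im) (by simpa using hc.1) ?_
    apply Complex.ext
    · simp
      linear_combination hc.2
    · simp
  · rintro h y hy rfl
    simp at h
    linarith

theorem isOpen_cutPlane (t : Fin 2 → ℂ) : IsOpen (cutPlane t) := by
  have h : cutPlane t = ⋂ i, (fun w => Complex.I * (w - canonCoord t i)) ⁻¹' Complex.slitPlane := by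
    ext w
    simp [mem_cutPlane_iff]
  rw [h]
  exact isOpen_iInter_of_finite fun i => Complex.isOpen_slitPlane.preimage (by fun_prop)

/-- The cuts go upwards, so every point is joined to a lower half-plane by a vertical half-line. -/
theorem isPreconnected_cutPlane (t : Fin 2 → ℂ) : IsPreconnected (cutPlane t) := by
  set c := min (canonCoord t 0).im (canonCoord t 1).im with hc
  have hci : ∀ i, c ≤ (canonCoord t i).im :=
    Fin.forall_fin_two.mpr ⟨min_le_left _ _, min_le_right _ _⟩
  set H : Set ℂ := {w | w.im < c} with hH
  have hHc : Convex ℝ H := convex_halfSpace_im_lt c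
  have hHs : H ⊆ cutPlane t := by
    rintro w hw i y hy rfl
    have h1 : (canonCoord t i + y * Complex.I).im < c := hw
    have h2 := hci i
    simp at h1
    linarith
  refine isPreconnected_of_forall (((c - 1 : ℝ) : ℂ) * Complex.I) fun w hw => ?_
  -- the vertical half-line downwards from `w` meets the half-plane `H`
  set V : Set ℂ := (fun y : ℝ => w - y * Complex.I) '' Set.Ici 0 with hV
  have hVc : IsPreconnected V := (convex_Ici (0 : ℝ)).isPreconnected.image _ (by fun_prop)
  refine ⟨H ∪ V, Set.union_subset hHs ?_, Or.inl (by simp [hH]), Or.inr ⟨0, by simp, by simp⟩, ?_⟩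
  · rintro _ ⟨y, hy, rfl⟩ i y' hy' h
    have hy0 : 0 ≤ y := hy
    refine hw i (y + y') (by positivity) ?_
    push_cast
    linear_combination h
  · refine hHc.isPreconnected.union (w - ((max 0 (w.im - c) + 1 : ℝ) : ℂ) * Complex.I) ?_ ?_ hVc
    · have := le_max_right 0 (w.im - c)
      simp only [hH, Set.mem_ofPred_eq, Complex.sub_im, Complex.mul_im, Complex.ofReal_re,
        Complex.ofReal_im, Complex.I_re, Complex.I_im]
      linarith
    · exact ⟨_, by simp only [Set.mem_Ici]; positivity, rfl⟩

theorem sqrt_sq {t : Fin 2 → ℂ} (ht : t 1 ∈ Complex.slitPlane) :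
    (t 1) ^ (1 / 2 : ℂ) * (t 1) ^ (1 / 2 : ℂ) = t 1 := by
  rw [← Complex.cpow_add _ _ (Complex.slitPlane_ne_zero ht)]
  norm_num

theorem cpow_eq_exp {z : ℂ} (hz : z ∈ Complex.slitPlane) (c : ℂ) :
    z ^ c = Complex.exp (c * Complex.log z) := by
  rw [Complex.cpow_def_of_ne_zero (Complex.slitPlane_ne_zero hz), mul_comm]

theorem exp_half_log_re_pos {z : ℂ} (hz : z ∈ Complex.slitPlane) :
    0 < (Complex.exp (1 / 2 * Complex.log z)).re := by
  rw [Complex.exp_re]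
  have h1 : (1 / 2 * Complex.log z).im = z.arg / 2 := by
    rw [show (1 / 2 : ℂ) = ((1 / 2 : ℝ) : ℂ) by norm_num, Complex.im_ofReal_mul, Complex.log_im]
    ring
  have h2 := Complex.neg_pi_lt_arg z
  have h3 : z.arg < Real.pi :=
    lt_of_le_of_ne (Complex.arg_le_pi z) (Complex.mem_slitPlane_iff_arg.mp hz).1
  rw [h1]
  refine mul_pos (Real.exp_pos _) (Real.cos_pos_of_mem_Ioo ⟨?_, ?_⟩) <;> linarith

theorem sqrt_re_pos {t : Fin 2 → ℂ} (ht : t 1 ∈ Complex.slitPlane) :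
    0 < ((t 1) ^ (1 / 2 : ℂ)).re := by
  rw [cpow_eq_exp ht]
  exact exp_half_log_re_pos ht

/-- The two cuts are on different vertical lines, since the principal square root of `t^2` has
positive real part. -/
theorem canonCoord_re {t : Fin 2 → ℂ} (ht : t 1 ∈ Complex.slitPlane) {i j : Fin 2} (hij : i ≠ j) :
    (canonCoord t i - canonCoord t j).re ≠ 0 := by
  have h := sqrt_re_pos ht
  fin_cases i <;> fin_cases j <;> simp_all [canonCoord] <;> intro h' <;> linarith

theorem frequently_mem_cutPlane {t : Fin 2 → ℂ} (ht : t 1 ∈ Complex.slitPlane) (i : Fin 2) :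
    ∃ᶠ w in nhdsWithin (canonCoord t i) {canonCoord t i}ᶜ, w ∈ cutPlane t := by
  -- approach `u^i` from below
  have h1 : Filter.Tendsto (fun y : ℝ => canonCoord t i - y * Complex.I) (nhdsWithin 0 (Set.Ioi 0))
      (nhdsWithin (canonCoord t i) {canonCoord t i}ᶜ) := by
    refine tendsto_nhdsWithin_of_tendsto_nhds_of_eventually_within _ ?_ ?_
    · have : Continuous fun y : ℝ => canonCoord t i - y * Complex.I := by fun_prop
      have h := this.tendsto 0
      simp only [Complex.ofReal_zero, zero_mul, sub_zero] at h
      exact h.mono_left nhdsWithin_le_nhds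
    · filter_upwards [self_mem_nhdsWithin] with y hy h
      have h0 : (0 : ℝ) < y := hy
      have : (y : ℂ) = 0 := by simpa using h
      have : y = 0 := by exact_mod_cast this
      linarith
  refine h1.frequently (Filter.Eventually.frequently ?_)
  filter_upwards [self_mem_nhdsWithin] with y hy j y' hy' h
  have h0 : (0 : ℝ) < y := hy
  by_cases hij : i = j
  · subst hij
    have := congrArg Complex.im h
    simp at this
    linarith
  · refine canonCoord_re ht hij ?_
    have := congrArg Complex.re h
    simp at this
    simp [this]

/-- Two functions that are holomorphic at `u^i` and agree on the cut plane near `u^i` agree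
near `u^i`. -/
theorem eventuallyEq_of_cutPlane {t : Fin 2 → ℂ} (ht : t 1 ∈ Complex.slitPlane) {i : Fin 2}
    {E : Type*} [NormedAddCommGroup E] [NormedSpace ℂ E] {f g : ℂ → E}
    (hf : AnalyticAt ℂ f (canonCoord t i)) (hg : AnalyticAt ℂ g (canonCoord t i))
    (h : ∀ᶠ w in nhds (canonCoord t i), w ∈ cutPlane t → f w = g w) :
    ∀ᶠ w in nhds (canonCoord t i), f w = g w := by
  rw [← AnalyticAt.frequently_eq_iff_eventually_eq hf hg]
  exact ((frequently_mem_cutPlane ht i).and_eventually (h.filter_mono nhdsWithin_le_nhds)).mono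
    fun w hw => hw.2 hw.1

/-! ### The period system -/

theorem hasDerivAt_smulVec {c : ℂ → ℂ} {c' w : ℂ} {h : ℂ → Fin 2 → ℂ} {h' : Fin 2 → ℂ}
    (hc : HasDerivAt c c' w) (hh : HasDerivAt h h' w) :
    HasDerivAt (fun w => c w • h w) (c w • h' + c' • h w) w := hc.smul hh

theorem hasDerivAt_addVec {w : ℂ} {g h : ℂ → Fin 2 → ℂ} {g' h' : Fin 2 → ℂ}
    (hg : HasDerivAt g g' w) (hh : HasDerivAt h h' w) :
    HasDerivAt (fun w => g w + h w) (g' + h') w := hg.add hh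

theorem hasDerivAt_subVec {w : ℂ} {g h : ℂ → Fin 2 → ℂ} {g' h' : Fin 2 → ℂ}
    (hg : HasDerivAt g g' w) (hh : HasDerivAt h h' w) :
    HasDerivAt (fun w => g w - h w) (g' - h') w := hg.sub hh

theorem analyticAt_smulVec {c : ℂ → ℂ} {u : ℂ} {h : ℂ → Fin 2 → ℂ} (hc : AnalyticAt ℂ c u)
    (hh : AnalyticAt ℂ h u) : AnalyticAt ℂ (fun w => c w • h w) u := hc.smul hh

theorem analyticAt_addVec {u : ℂ} {g h : ℂ → Fin 2 → ℂ} (hg : AnalyticAt ℂ g u)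
    (hh : AnalyticAt ℂ h u) : AnalyticAt ℂ (fun w => g w + h w) u := hg.add hh

theorem euler_mulVec (t : Fin 2 → ℂ) (w : ℂ) (v : Fin 2 → ℂ) :
    (calU t - w • (1 : Matrix (Fin 2) (Fin 2) ℂ)).mulVec v = (calU t).mulVec v - w • v := by
  rw [Matrix.sub_mulVec, Matrix.smul_mulVec, Matrix.one_mulVec]

theorem hasDerivAt_mulVec (M : Matrix (Fin 2) (Fin 2) ℂ) {J : ℂ → Fin 2 → ℂ} {J' : Fin 2 → ℂ}
    {w : ℂ} (h : HasDerivAt J J' w) : HasDerivAt (fun w => M.mulVec (J w)) (M.mulVec J') w :=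
  (LinearMap.toContinuousLinearMap M.mulVecLin).hasFDerivAt.comp_hasDerivAt w h

theorem hasDerivAt_euler (t : Fin 2 → ℂ) {J : ℂ → Fin 2 → ℂ} {J' : Fin 2 → ℂ} {w : ℂ}
    (h : HasDerivAt J J' w) :
    HasDerivAt (fun w => (calU t - w • (1 : Matrix (Fin 2) (Fin 2) ℂ)).mulVec (J w))
      ((calU t - w • (1 : Matrix (Fin 2) (Fin 2) ℂ)).mulVec J' - J w) w := by
  simp only [euler_mulVec]
  refine (hasDerivAt_subVec (hasDerivAt_mulVec (calU t) h)
    (hasDerivAt_smulVec (hasDerivAt_id w) h)).congr_deriv ?_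
  simp only [id, one_smul]
  abel

theorem analyticAt_mulVec (M : Matrix (Fin 2) (Fin 2) ℂ) {h : ℂ → Fin 2 → ℂ} {u : ℂ}
    (hh : AnalyticAt ℂ h u) : AnalyticAt ℂ (fun w => M.mulVec (h w)) u := by
  rw [Complex.analyticAt_iff_eventually_differentiableAt] at hh ⊢
  exact hh.mono fun w hw => (hasDerivAt_mulVec M hw.hasDerivAt).differentiableAt

theorem analyticAt_euler (t : Fin 2 → ℂ) {h : ℂ → Fin 2 → ℂ} {u : ℂ} (hh : AnalyticAt ℂ h u) :
    AnalyticAt ℂ (fun w => (calU t - w • (1 : Matrix (Fin 2) (Fin 2) ℂ)).mulVec (h w)) u := by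
  rw [Complex.analyticAt_iff_eventually_differentiableAt] at hh ⊢
  exact hh.mono fun w hw => (hasDerivAt_euler t hw.hasDerivAt).differentiableAt

/-- The matrix `μ + l + 1/2`. -/
def muShift (l : ℤ) : Matrix (Fin 2) (Fin 2) ℂ :=
  mu + ((l : ℂ) + 1 / 2) • (1 : Matrix (Fin 2) (Fin 2) ℂ)

theorem muShift_mulVec (l : ℤ) (v : Fin 2 → ℂ) :
    (muShift l).mulVec v = mu.mulVec v + ((l : ℂ) + 1 / 2) • v := by
  rw [muShift, Matrix.add_mulVec, Matrix.smul_mulVec, Matrix.one_mulVec]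

/-- `J` is a holomorphic solution on the cut plane of `(𝒰 - λ) ∂_λ J = (μ + l + 1/2) J`. -/
def SolvesPeriodSystem (t : Fin 2 → ℂ) (l : ℤ) (J : ℂ → Fin 2 → ℂ) : Prop :=
  DifferentiableOn ℂ J (cutPlane t) ∧ ∀ w ∈ cutPlane t,
    (calU t - w • (1 : Matrix (Fin 2) (Fin 2) ℂ)).mulVec (deriv J w) = (muShift l).mulVec (J w)

/-- Near `u^i`, `J` is `c (λ - u^i)^{-l-1/2}` times the holomorphic function `h`. -/
def HasLocalFactor (t : Fin 2 → ℂ) (i : Fin 2) (l : ℤ) (c : ℂ) (J h : ℂ → Fin 2 → ℂ) : Prop :=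
  AnalyticAt ℂ h (canonCoord t i) ∧ ∀ᶠ w in nhds (canonCoord t i), w ∈ cutPlane t →
    J w = (c * Complex.exp ((-(l : ℂ) - 1 / 2) * cutLog (w - canonCoord t i))) • h w

theorem hasDerivAt_cutPow {u w : ℂ} (hw : Complex.I * (w - u) ∈ Complex.slitPlane) (c α : ℂ)
    {h : ℂ → Fin 2 → ℂ} {h' : Fin 2 → ℂ} (hh : HasDerivAt h h' w) :
    HasDerivAt (fun w => (c * Complex.exp (α * cutLog (w - u))) • h w)
      ((c * Complex.exp (α * cutLog (w - u))) • ((α / (w - u)) • h w + h')) w := by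
  have h1 : HasDerivAt (fun w => cutLog (w - u)) (w - u)⁻¹ w := by
    have := (hasDerivAt_cutLog hw).comp w ((hasDerivAt_id w).sub_const u)
    rw [mul_one] at this
    exact this
  refine (hasDerivAt_smulVec ((h1.const_mul α).cexp.const_mul c) hh).congr_deriv ?_
  rw [smul_add, smul_smul, add_comm]
  refine congrArg₂ (· + ·) (congrArg (· • h w) ?_) rfl
  rw [div_eq_mul_inv]
  ring

theorem sub_ne_zero_of_mem_cutPlane {t : Fin 2 → ℂ} {w : ℂ} (hw : w ∈ cutPlane t) (i : Fin 2) :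
    w - canonCoord t i ≠ 0 := by
  have h := (mem_cutPlane_iff t w).mp hw i
  intro h0
  rw [h0, mul_zero] at h
  exact Complex.zero_notMem_slitPlane h

theorem HasLocalFactor.deriv_eq {t : Fin 2 → ℂ} {i : Fin 2} {l : ℤ} {c : ℂ} {J h : ℂ → Fin 2 → ℂ}
    (hJ : HasLocalFactor t i l c J h) :
    ∀ᶠ w in nhds (canonCoord t i), w ∈ cutPlane t → deriv J w =
      (c * Complex.exp ((-(l : ℂ) - 1 / 2) * cutLog (w - canonCoord t i))) •
        (((-(l : ℂ) - 1 / 2) / (w - canonCoord t i)) • h w + deriv h w) := by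
  obtain ⟨ha, he⟩ := hJ
  filter_upwards [he.eventually_nhds, ha.eventually_analyticAt] with w hw hwa hwc
  have h1 : J =ᶠ[nhds w] fun w =>
      (c * Complex.exp ((-(l : ℂ) - 1 / 2) * cutLog (w - canonCoord t i))) • h w := by
    filter_upwards [hw, (isOpen_cutPlane t).mem_nhds hwc] with z hz hzc using hz hzc
  rw [h1.deriv_eq]
  exact (hasDerivAt_cutPow ((mem_cutPlane_iff t w).mp hwc i) _ _
    hwa.differentiableAt.hasDerivAt).deriv

/-- The differential equation of the factor `g` in a solution `(λ - u)^β g(λ)` of the period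
system with index `l`. -/
def FactorODE (t : Fin 2 → ℂ) (u : ℂ) (l : ℤ) (β : ℂ) (g : ℂ → Fin 2 → ℂ) : Prop :=
  ∀ᶠ w in nhds u, (calU t - w • (1 : Matrix (Fin 2) (Fin 2) ℂ)).mulVec
    (β • g w + (w - u) • deriv g w) = (w - u) • (muShift l).mulVec (g w)

/-- Splitting off a power of `λ - u` shifts the exponent. -/
theorem FactorODE.of_pow {t : Fin 2 → ℂ} {u : ℂ} {l : ℤ} {β : ℂ} {h g : ℂ → Fin 2 → ℂ}
    (hode : FactorODE t u l β h) {n : ℕ} (hg : AnalyticAt ℂ g u)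
    (hgm : ∀ᶠ w in nhds u, h w = (w - u) ^ (n + 1) • g w) : FactorODE t u l (β + (n + 1)) g := by
  have hid : AnalyticAt ℂ (fun w : ℂ => w - u) u := by fun_prop
  refine (AnalyticAt.frequently_eq_iff_eventually_eq (analyticAt_euler t (analyticAt_addVec
    (analyticAt_smulVec analyticAt_const hg) (analyticAt_smulVec hid hg.deriv)))
    (analyticAt_smulVec hid (analyticAt_mulVec _ hg))).mp (Filter.Eventually.frequently ?_)
  filter_upwards [hode.filter_mono nhdsWithin_le_nhds,
    hgm.eventually_nhds.filter_mono nhdsWithin_le_nhds, self_mem_nhdsWithin,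
    hg.eventually_analyticAt.filter_mono nhdsWithin_le_nhds] with w hw hw2 hwu hwa
  have hy : w - u ≠ 0 := sub_ne_zero.mpr hwu
  have hd : deriv h w = (w - u) ^ (n + 1) • deriv g w +
      (((n + 1 : ℕ) : ℂ) * (w - u) ^ n) • g w := by
    have e : h =ᶠ[nhds w] fun z => (z - u) ^ (n + 1) • g z := hw2
    rw [e.deriv_eq]
    have hp : HasDerivAt (fun z => (z - u) ^ (n + 1)) (((n + 1 : ℕ) : ℂ) * (w - u) ^ n) w := by
      have := ((hasDerivAt_id w).sub_const u).fun_pow (n + 1)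
      simpa only [id, add_tsub_cancel_right, mul_one] using this
    exact (hasDerivAt_smulVec hp hwa.differentiableAt.hasDerivAt).deriv
  rw [hd, hw2.self_of_nhds] at hw
  have hpow : (w - u) ^ (n + 1) ≠ 0 := pow_ne_zero _ hy
  refine smul_right_injective (Fin 2 → ℂ) hpow ?_
  simp only
  rw [smul_comm, ← Matrix.mulVec_smul, ← Matrix.mulVec_smul, ← hw]
  congr 1
  rw [pow_succ]
  push_cast
  module

/-- The equation of the factor, in the first two orders at `u`. -/
theorem FactorODE.expand {t : Fin 2 → ℂ} {u : ℂ} {l : ℤ} {β : ℂ} {g : ℂ → Fin 2 → ℂ}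
    (hode : FactorODE t u l β g) (hβ : β ≠ 0) (hg : AnalyticAt ℂ g u) :
    (calU t).mulVec (g u) = u • g u ∧
    (calU t).mulVec ((β + 1) • deriv g u) - u • ((β + 1) • deriv g u) =
      mu.mulVec (g u) + ((l : ℂ) + 1 / 2 + β) • g u := by
  constructor
  · have := hode.self_of_nhds
    rw [sub_self, zero_smul, zero_smul, add_zero, Matrix.mulVec_smul, euler_mulVec] at this
    exact sub_eq_zero.mp ((smul_eq_zero.mp this).resolve_left hβ)
  · have hgd := hg.differentiableAt.hasDerivAt
    have hgd' := hg.deriv.differentiableAt.hasDerivAt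
    have hsub := (hasDerivAt_id u).sub_const u
    have hl := hasDerivAt_euler t (hasDerivAt_addVec
      (hasDerivAt_smulVec (hasDerivAt_const u β) hgd) (hasDerivAt_smulVec hsub hgd'))
    have hr := hasDerivAt_smulVec hsub (hasDerivAt_mulVec (muShift l) hgd)
    have h1 := (hl.congr_of_eventuallyEq (f₁ := fun w => (w - u) • (muShift l).mulVec (g w))
      (hode.mono fun w hw => hw.symm)).unique hr
    simp only [id, sub_self, zero_smul, add_zero, zero_add, one_smul, euler_mulVec,
      muShift_mulVec] at h1
    rw [add_smul, one_smul, add_smul, ← add_assoc, ← h1]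
    abel

/-- The differential equation for the holomorphic factor of a solution at `u^i`. -/
theorem SolvesPeriodSystem.factor_ode {t : Fin 2 → ℂ} (ht : t 1 ∈ Complex.slitPlane) {i : Fin 2}
    {l : ℤ} {c : ℂ} (hc : c ≠ 0) {J h : ℂ → Fin 2 → ℂ} (hs : SolvesPeriodSystem t l J)
    (hJ : HasLocalFactor t i l c J h) :
    FactorODE t (canonCoord t i) l (-(l : ℂ) - 1 / 2) h := by
  have hid : AnalyticAt ℂ (fun w : ℂ => w - canonCoord t i) (canonCoord t i) := by fun_prop
  refine eventuallyEq_of_cutPlane ht (analyticAt_euler t (analyticAt_addVec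
    (analyticAt_smulVec analyticAt_const hJ.1) (analyticAt_smulVec hid hJ.1.deriv)))
    (analyticAt_smulVec hid (analyticAt_mulVec _ hJ.1)) ?_
  filter_upwards [hJ.deriv_eq, hJ.2] with w hd he hwc
  have h1 := hs.2 w hwc
  have hy := sub_ne_zero_of_mem_cutPlane hwc i
  have hcne : c * Complex.exp ((-(l : ℂ) - 1 / 2) * cutLog (w - canonCoord t i)) ≠ 0 :=
    mul_ne_zero hc (Complex.exp_ne_zero _)
  rw [hd hwc, he hwc, Matrix.mulVec_smul, Matrix.mulVec_smul] at h1
  have h2 := smul_right_injective (Fin 2 → ℂ) hcne h1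
  rw [← h2, ← Matrix.mulVec_smul, smul_add, smul_smul, mul_div_cancel₀ _ hy]

/-! ### Uniqueness of the period vectors -/

/-- If `v` is an eigenvector of `𝒰` for `u^i` and `μ v + m v`, `m ≠ 0`, is in the image of
`𝒰 - u^i`, then `v = 0`, because `μ` maps the eigenvector to that image. -/
theorem eq_zero_of_resonance {t : Fin 2 → ℂ} (ht : t 1 ∈ Complex.slitPlane) (i : Fin 2) {m : ℂ}
    (hm : m ≠ 0) {v x : Fin 2 → ℂ}
    (h1 : (calU t).mulVec v = canonCoord t i • v)
    (h2 : (calU t).mulVec x - canonCoord t i • x = mu.mulVec v + m • v) : v = 0 := by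
  set σ := (t 1) ^ (1 / 2 : ℂ) with hσ
  have hσ0 : σ ≠ 0 := by
    intro h
    have := sqrt_re_pos ht
    rw [← hσ, h] at this
    simp at this
  have hσ2 : σ * σ = t 1 := sqrt_sq ht
  obtain ⟨e, he, hu⟩ : ∃ e : ℂ, e * e = 1 ∧ canonCoord t i = t 0 + e * (2 * σ) := by
    fin_cases i
    · exact ⟨1, by ring, by simp [canonCoord, hσ]⟩
    · exact ⟨-1, by ring, by simp [canonCoord, hσ]; ring⟩
  rw [hu] at h1 h2
  have a0 := congrFun h1 0
  have a1 := congrFun h1 1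
  have b0 := congrFun h2 0
  have b1 := congrFun h2 1
  simp [calU, mu, Matrix.mulVec, dotProduct, Fin.sum_univ_two, ← hσ2] at a0 a1 b0 b1
  have e1 : v 1 = e * σ * v 0 := by linear_combination a0 / 2
  -- pairing with the left null vector `(σ, ±1)` of `𝒰 - u^i`
  have e2 : 2 * m * σ * v 0 = 0 := by
    rw [e1] at b1
    linear_combination (-σ) * b0 - e * b1 - (2 * σ * x 1 - (1 / 2 : ℂ) * σ * v 0 + m * σ * v 0) * he
  have e3 : v 0 = 0 := by
    rcases mul_eq_zero.mp e2 with h | h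
    · exact absurd h (mul_ne_zero (mul_ne_zero two_ne_zero hm) hσ0)
    · exact h
  funext j
  fin_cases j
  · exact e3
  · simpa [e3] using e1

/-- A solution of the period system whose holomorphic factor vanishes at `u^i` is zero. -/
theorem SolvesPeriodSystem.eq_zero {t : Fin 2 → ℂ} (ht : t 1 ∈ Complex.slitPlane) {i : Fin 2}
    {l : ℤ} {c : ℂ} (hc : c ≠ 0) {J h : ℂ → Fin 2 → ℂ} (hs : SolvesPeriodSystem t l J)
    (hJ : HasLocalFactor t i l c J h) (h0 : h (canonCoord t i) = 0) :
    ∀ w ∈ cutPlane t, J w = 0 := by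
  set u := canonCoord t i with hu
  have hzero : ∀ᶠ w in nhds u, h w = 0 := by
    by_contra hne
    -- otherwise `h = (λ - u)^{n+1} g` with `g(u) ≠ 0`, and the first two orders of the equation of
    -- `g` are incompatible
    obtain ⟨m, g, hg, hg0, hgm⟩ := (hJ.1.exists_eventuallyEq_pow_smul_nonzero_iff).mpr hne
    obtain ⟨n, rfl⟩ : ∃ n, m = n + 1 := by
      refine Nat.exists_eq_succ_of_ne_zero ?_
      rintro rfl
      have := hgm.self_of_nhds
      rw [h0, pow_zero, one_smul] at this
      exact hg0 this.symm
    have hode := (hs.factor_ode ht hc hJ).of_pow hg hgm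
    set β : ℂ := (-(l : ℂ) - 1 / 2) + ((n : ℂ) + 1) with hβ
    have hβ0 : β ≠ 0 := by
      intro hβ0
      -- the exponent is a half-integer
      have h1 : ((2 * (n + 1 - l) : ℤ) : ℂ) = ((1 : ℤ) : ℂ) := by
        push_cast
        linear_combination 2 * hβ0
      have h2 : (2 * ((n : ℤ) + 1 - l)) = 1 := by exact_mod_cast h1
      omega
    obtain ⟨hv, hx⟩ := hode.expand hβ0 hg
    refine hg0 (eq_zero_of_resonance ht i (m := (n : ℂ) + 1) (by exact_mod_cast Nat.succ_ne_zero n)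
      hv (hx.trans ?_))
    rw [hβ]
    congr 2
    ring
  obtain ⟨z, hz1, hz2⟩ : ∃ z ∈ cutPlane t, J =ᶠ[nhds z] fun _ => 0 := by
    have hall : ∀ᶠ w in nhds u, ∀ᶠ z in nhds w, z ∈ cutPlane t → J z = 0 := by
      refine Filter.Eventually.eventually_nhds ?_
      filter_upwards [hzero, hJ.2] with w hw hw2 hwc
      rw [hw2 hwc, hw, smul_zero]
    obtain ⟨z, hz, hz'⟩ := ((frequently_mem_cutPlane ht i).and_eventually
      (hall.filter_mono nhdsWithin_le_nhds)).exists
    refine ⟨z, hz, ?_⟩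
    filter_upwards [hz', (isOpen_cutPlane t).mem_nhds hz] with w hw hwc using hw hwc
  exact AnalyticOnNhd.eqOn_of_preconnected_of_eventuallyEq
    (hs.1.analyticOnNhd (isOpen_cutPlane t)) (fun _ _ => analyticAt_const)
    (isPreconnected_cutPlane t) hz1 hz2

/-- The normalisation constant `(-1)^l (2π)^{-1/2} Γ(l + 1/2)`. -/
def periodConst (l : ℤ) : ℂ :=
  (-1 : ℂ) ^ l / (Real.sqrt (2 * Real.pi) : ℝ) * Complex.Gamma ((l : ℂ) + 1 / 2)

theorem half_ne_zero (l : ℤ) : (l : ℂ) + 1 / 2 ≠ 0 := by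
  intro h
  have h1 : ((2 * l : ℤ) : ℂ) = ((-1 : ℤ) : ℂ) := by
    push_cast
    linear_combination 2 * h
  have h2 : 2 * l = -1 := by exact_mod_cast h1
  omega

theorem sqrt_two_pi_ne_zero : ((Real.sqrt (2 * Real.pi) : ℝ) : ℂ) ≠ 0 := by
  exact_mod_cast (Real.sqrt_pos.mpr (by positivity)).ne'

theorem periodConst_ne_zero (l : ℤ) : periodConst l ≠ 0 := by
  refine mul_ne_zero (div_ne_zero (zpow_ne_zero _ (by norm_num)) sqrt_two_pi_ne_zero)
    (Complex.Gamma_ne_zero fun m h => ?_)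
  have := half_ne_zero (l + m)
  apply this
  push_cast
  linear_combination h

/-- The normalisation constants are compatible with differentiation of `(λ - u)^{-l-1/2}`. -/
theorem periodConst_succ (l : ℤ) :
    periodConst (l + 1) = periodConst l * (-(l : ℂ) - 1 / 2) := by
  rw [periodConst, periodConst, zpow_add_one₀ (by norm_num),
    show (((l + 1 : ℤ) : ℂ) + 1 / 2) = ((l : ℂ) + 1 / 2) + 1 by push_cast; ring,
    Complex.Gamma_add_one _ (half_ne_zero l)]
  ring

theorem isPeriodVector_iff (t : Fin 2 → ℂ) (i : Fin 2) (l : ℤ) (J : ℂ → Fin 2 → ℂ) :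
    IsPeriodVector t i l J ↔ SolvesPeriodSystem t l J ∧
      ∃ h, HasLocalFactor t i l (periodConst l) J h ∧
        h (canonCoord t i) = (PsiInv t).mulVec (Pi.single i 1) := by
  constructor
  · rintro ⟨h1, h2, h, h3, h4, h5⟩
    exact ⟨⟨h1, h2⟩, h, ⟨h3, h5⟩, h4⟩
  · rintro ⟨⟨h1, h2⟩, h, ⟨h3, h5⟩, h4⟩
    exact ⟨h1, h2, h, h3, h4, h5⟩

theorem IsPeriodVector.unique {t : Fin 2 → ℂ} (ht : t 1 ∈ Complex.slitPlane) {i : Fin 2} {l : ℤ}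
    {J K : ℂ → Fin 2 → ℂ} (hJ : IsPeriodVector t i l J) (hK : IsPeriodVector t i l K) :
    Set.EqOn J K (cutPlane t) := by
  rw [isPeriodVector_iff] at hJ hK
  obtain ⟨⟨hJd, hJs⟩, h, ⟨hha, hh⟩, hh0⟩ := hJ
  obtain ⟨⟨hKd, hKs⟩, k, ⟨hka, hk⟩, hk0⟩ := hK
  have hs : SolvesPeriodSystem t l (J - K) := by
    refine ⟨hJd.sub hKd, fun w hw => ?_⟩
    have hn := (isOpen_cutPlane t).mem_nhds hw
    rw [deriv_sub (hJd.differentiableAt hn) (hKd.differentiableAt hn), Matrix.mulVec_sub, hJs w hw,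
      hKs w hw, ← Matrix.mulVec_sub, Pi.sub_apply]
  intro w hw
  have := hs.eq_zero ht (periodConst_ne_zero l) (i := i) (h := h - k) ⟨hha.sub hka, ?_⟩
    (by rw [Pi.sub_apply, hh0, hk0, sub_self]) w hw
  · exact sub_eq_zero.mp this
  · filter_upwards [hh, hk] with w h1 h2 hw
    rw [Pi.sub_apply, Pi.sub_apply, h1 hw, h2 hw, smul_sub]

/-! ### Raising and lowering the index of a period vector -/

theorem exp_mul_cutLog_sub_one {y : ℂ} (hy : y ≠ 0) (α : ℂ) :
    Complex.exp ((α - 1) * cutLog y) = Complex.exp (α * cutLog y) / y := by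
  rw [sub_mul, one_mul, Complex.exp_sub, cutLog_exp hy]

/-- The derivative of a period vector is the period vector with the next index. -/
theorem IsPeriodVector.deriv {t : Fin 2 → ℂ} {i : Fin 2} {l : ℤ} {J : ℂ → Fin 2 → ℂ}
    (hJ : IsPeriodVector t i l J) : IsPeriodVector t i (l + 1) (deriv J) := by
  rw [isPeriodVector_iff] at hJ ⊢
  obtain ⟨⟨hJd, hJs⟩, h, hf, hh0⟩ := hJ
  have hJa := hJd.analyticOnNhd (isOpen_cutPlane t)
  set α : ℂ := -(l : ℂ) - 1 / 2 with hα
  have hα0 : α ≠ 0 := by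
    have := half_ne_zero l
    intro h0
    apply this
    linear_combination -h0
  refine ⟨⟨fun w hw => (hJa w hw).deriv.differentiableAt.differentiableWithinAt, fun w hw => ?_⟩,
    fun w => h w + (α⁻¹ * (w - canonCoord t i)) • _root_.deriv h w, ⟨?_, ?_⟩, ?_⟩
  · have h1 := hasDerivAt_euler t (hJa w hw).deriv.differentiableAt.hasDerivAt
    have h2 := hasDerivAt_mulVec (muShift l) (hJa w hw).differentiableAt.hasDerivAt
    have h3 := (h1.congr_of_eventuallyEq (f₁ := fun w => (muShift l).mulVec (J w)) ?_).unique h2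
    · rw [sub_eq_iff_eq_add] at h3
      rw [h3, muShift_mulVec, muShift_mulVec]
      push_cast
      module
    · filter_upwards [(isOpen_cutPlane t).mem_nhds hw] with z hz using (hJs z hz).symm
  · have hid : AnalyticAt ℂ (fun w : ℂ => α⁻¹ * (w - canonCoord t i)) (canonCoord t i) := by
      fun_prop
    exact analyticAt_addVec hf.1 (analyticAt_smulVec hid hf.1.deriv)
  · filter_upwards [hf.deriv_eq] with w hw hwc
    have hy := sub_ne_zero_of_mem_cutPlane hwc i
    rw [hw hwc, periodConst_succ, ← hα,
      show (-((l + 1 : ℤ) : ℂ) - 1 / 2) = α - 1 by rw [hα]; push_cast; ring,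
      exp_mul_cutLog_sub_one hy, smul_add, smul_add, smul_smul, smul_smul]
    congr 2
    · field_simp
    · field_simp
  · simp [hh0]

theorem muShift_apply (l : ℤ) (v : Fin 2 → ℂ) :
    (muShift l).mulVec v = ![((l : ℂ) + 1) * v 0, (l : ℂ) * v 1] := by
  rw [muShift_mulVec]
  funext j
  fin_cases j
  · simp [mu, Matrix.mulVec, dotProduct, Fin.sum_univ_two]
    ring
  · simp [mu, Matrix.mulVec, dotProduct, Fin.sum_univ_two]
    ring

theorem muShift_inv {l : ℤ} (h0 : l ≠ 0) (h1 : l + 1 ≠ 0) (v : Fin 2 → ℂ) :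
    (muShift l).mulVec ((Matrix.diagonal ![((l : ℂ) + 1)⁻¹, (l : ℂ)⁻¹]).mulVec v) = v := by
  have h0' : (l : ℂ) ≠ 0 := by exact_mod_cast h0
  have h1' : (l : ℂ) + 1 ≠ 0 := by exact_mod_cast h1
  rw [muShift_apply]
  funext j
  fin_cases j
  · simp [Matrix.mulVec_diagonal, h1']
  · simp [Matrix.mulVec_diagonal, h0']

theorem muShift_inv' {l : ℤ} (h0 : l ≠ 0) (h1 : l + 1 ≠ 0) (v : Fin 2 → ℂ) :
    (Matrix.diagonal ![((l : ℂ) + 1)⁻¹, (l : ℂ)⁻¹]).mulVec ((muShift l).mulVec v) = v := by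
  have h0' : (l : ℂ) ≠ 0 := by exact_mod_cast h0
  have h1' : (l : ℂ) + 1 ≠ 0 := by exact_mod_cast h1
  rw [muShift_apply]
  funext j
  fin_cases j
  · simp [Matrix.mulVec_diagonal, h1']
  · simp [Matrix.mulVec_diagonal, h0']

/-- For `l ≠ 0, -1` the system itself recovers the period vector with index `l` from the one with
index `l + 1`. -/
theorem IsPeriodVector.lower {t : Fin 2 → ℂ} (ht : t 1 ∈ Complex.slitPlane) {i : Fin 2} {l : ℤ}
    (hl0 : l ≠ 0) (hl1 : l + 1 ≠ 0) {J : ℂ → Fin 2 → ℂ} (hJ : IsPeriodVector t i (l + 1) J) :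
    IsPeriodVector t i l fun w => (Matrix.diagonal ![((l : ℂ) + 1)⁻¹, (l : ℂ)⁻¹]).mulVec
      ((calU t - w • (1 : Matrix (Fin 2) (Fin 2) ℂ)).mulVec (J w)) := by
  rw [isPeriodVector_iff] at hJ ⊢
  obtain ⟨hs, h, hf, hh0⟩ := hJ
  set D := Matrix.diagonal ![((l : ℂ) + 1)⁻¹, (l : ℂ)⁻¹] with hD
  set u := canonCoord t i with hu
  have hJa := hs.1.analyticOnNhd (isOpen_cutPlane t)
  -- the derivative of the vector defined by the right-hand side is `J` again
  have hder : ∀ w ∈ cutPlane t, HasDerivAt (fun w => D.mulVec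
      ((calU t - w • (1 : Matrix (Fin 2) (Fin 2) ℂ)).mulVec (J w))) (J w) w := by
    intro w hw
    have h1 := hasDerivAt_mulVec D (hasDerivAt_euler t (hJa w hw).differentiableAt.hasDerivAt)
    rw [hs.2 w hw] at h1
    convert h1 using 1
    rw [eq_comm, show (muShift (l + 1)).mulVec (J w) - J w = (muShift l).mulVec (J w) by
      rw [muShift_mulVec, muShift_mulVec]; push_cast; module]
    exact muShift_inv' hl0 hl1 _
  have hode := hs.factor_ode ht (periodConst_ne_zero _) hf
  set α : ℂ := -((l + 1 : ℤ) : ℂ) - 1 / 2 with hα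
  have hα0 : α ≠ 0 := by
    have := half_ne_zero (l + 1)
    intro h0
    apply this
    linear_combination -h0
  set g : ℂ → Fin 2 → ℂ := fun w =>
    (calU t - w • (1 : Matrix (Fin 2) (Fin 2) ℂ)).mulVec (h w) with hg
  have hga : AnalyticAt ℂ g u := analyticAt_euler t hf.1
  -- the equation of the factor `h` at `u^i` says that `(𝒰 - λ) h` vanishes there
  have hg0 : g u = 0 := by
    have := hode.self_of_nhds
    rw [sub_self, zero_smul, zero_smul, add_zero, Matrix.mulVec_smul] at this
    exact (smul_eq_zero.mp this).resolve_left hα0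
  have hka : AnalyticAt ℂ (dslope g u) u := by
    obtain ⟨p, hp⟩ := hga
    exact ⟨_, hp.has_fpower_series_dslope_fslope⟩
  have hk : ∀ w, g w = (w - u) • dslope g u w := by
    intro w
    rw [sub_smul_dslope, hg0, sub_zero]
  -- the value of the difference quotient at `u^i`, from the equation divided by `λ - u^i`
  have hk0 : (α + 1) • dslope g u u = (muShift l).mulVec (h u) := by
    have h1 : ∀ᶠ w in nhds u, α • dslope g u w +
        (calU t - w • (1 : Matrix (Fin 2) (Fin 2) ℂ)).mulVec (_root_.deriv h w) =
        (muShift (l + 1)).mulVec (h w) := by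
      refine (AnalyticAt.frequently_eq_iff_eventually_eq (analyticAt_addVec
        (analyticAt_smulVec analyticAt_const hka) (analyticAt_euler t hf.1.deriv))
        (analyticAt_mulVec (muShift (l + 1)) hf.1)).mp
        (Filter.Eventually.frequently ?_)
      filter_upwards [hode.filter_mono nhdsWithin_le_nhds, self_mem_nhdsWithin] with w hw hwu
      have hy : w - u ≠ 0 := sub_ne_zero.mpr hwu
      refine smul_right_injective (Fin 2 → ℂ) hy ?_
      simp only
      rw [← hw, Matrix.mulVec_add, Matrix.mulVec_smul, Matrix.mulVec_smul, smul_add, smul_comm,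
        ← hk]
    have h2 := h1.self_of_nhds
    have h3 : dslope g u u = (calU t - u • (1 : Matrix (Fin 2) (Fin 2) ℂ)).mulVec
        (_root_.deriv h u) - h u := by
      rw [dslope_same]
      exact (hasDerivAt_euler t hf.1.differentiableAt.hasDerivAt).deriv
    rw [muShift_mulVec] at h2 ⊢
    rw [eq_comm, ← sub_eq_iff_eq_add'] at h2
    rw [eq_sub_iff_add_eq, ← h2] at h3
    rw [add_smul, one_smul, eq_comm, ← sub_eq_zero]
    rw [← sub_eq_zero] at h3
    refine Eq.trans ?_ (neg_eq_zero.mpr h3)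
    push_cast
    module
  have hβ : α + 1 ≠ 0 := by
    have := half_ne_zero l
    intro h0
    apply this
    rw [hα] at h0
    push_cast at h0
    linear_combination -h0
  refine ⟨⟨fun w hw => (hder w hw).differentiableAt.differentiableWithinAt, fun w hw => ?_⟩,
    fun w => (α + 1) • D.mulVec (dslope g u w),
    ⟨analyticAt_smulVec analyticAt_const (analyticAt_mulVec D hka), ?_⟩, ?_⟩
  · rw [(hder w hw).deriv, hD, muShift_inv hl0 hl1]
  · filter_upwards [hf.2] with w hw hwc
    have hy := sub_ne_zero_of_mem_cutPlane hwc i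
    have e1 : α = (α + 1) - 1 := by ring
    have e2 : (-(l : ℂ) - 1 / 2) = α + 1 := by rw [hα]; push_cast; ring
    have e3 : (calU t - w • (1 : Matrix (Fin 2) (Fin 2) ℂ)).mulVec (h w) =
        (w - u) • dslope g u w := hk w
    rw [hw hwc, ← hα, Matrix.mulVec_smul, e3, e1, exp_mul_cutLog_sub_one hy, periodConst_succ, e2,
      Matrix.mulVec_smul, Matrix.mulVec_smul, smul_smul, smul_smul]
    congr 1
    have hy' : w - u ≠ 0 := hy
    simp only [← hu]
    field_simp
    ring
  · simp only
    rw [← Matrix.mulVec_smul, hk0, hD, muShift_inv' hl0 hl1, hh0]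

/-! ### The period vectors with index `-1` -/

/-- The branch of `√(𝗂 (λ - u))` with positive real part. -/
def rootAt (u w : ℂ) : ℂ := Complex.exp (1 / 2 * Complex.log (Complex.I * (w - u)))

section

variable {u u' w : ℂ}

theorem rootAt_ne_zero : rootAt u w ≠ 0 := Complex.exp_ne_zero _

theorem rootAt_mul_self (hw : w ≠ u) : rootAt u w * rootAt u w = Complex.I * (w - u) := by
  rw [rootAt, ← Complex.exp_add, ← add_mul]
  norm_num
  rw [Complex.exp_log (mul_ne_zero Complex.I_ne_zero (sub_ne_zero.mpr hw))]

theorem ne_of_mem_slitPlane (hw : Complex.I * (w - u) ∈ Complex.slitPlane) : w ≠ u := by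
  rintro rfl
  rw [sub_self, mul_zero] at hw
  exact Complex.zero_notMem_slitPlane hw

theorem rootAt_re_pos (hw : Complex.I * (w - u) ∈ Complex.slitPlane) : 0 < (rootAt u w).re :=
  exp_half_log_re_pos hw

theorem hasDerivAt_rootAt (hw : Complex.I * (w - u) ∈ Complex.slitPlane) :
    HasDerivAt (rootAt u) (Complex.I / (2 * rootAt u w)) w := by
  have h := (((((hasDerivAt_id w).sub_const u).const_mul Complex.I).clog hw).const_mul
    (1 / 2 : ℂ)).cexp
  refine h.congr_deriv ?_
  have hne := sub_ne_zero.mpr (ne_of_mem_slitPlane hw)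
  change rootAt u w * _ = _
  simp only [id]
  rw [← rootAt_mul_self (ne_of_mem_slitPlane hw)]
  have := rootAt_ne_zero (u := u) (w := w)
  field_simp

theorem exp_half_cutLog : Complex.exp (1 / 2 * cutLog (w - u)) =
    Complex.exp (-(Real.pi / 4 : ℝ) * Complex.I) * rootAt u w := by
  rw [cutLog, rootAt, ← Complex.exp_add]
  congr 1
  push_cast
  ring

theorem exp_quarter_sq : Complex.exp (-(Real.pi / 4 : ℝ) * Complex.I) *
    Complex.exp (-(Real.pi / 4 : ℝ) * Complex.I) = -Complex.I := by
  rw [← Complex.exp_add]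
  have : -((Real.pi / 4 : ℝ) : ℂ) * Complex.I + -((Real.pi / 4 : ℝ) : ℂ) * Complex.I =
      -Real.pi / 2 * Complex.I := by
    push_cast
    ring
  rw [this, Complex.exp_neg_pi_div_two_mul_I]

/-- The branch `-𝗂 √(𝗂 (λ - u)) √(𝗂 (λ - u'))` of `√((λ - u) (λ - u'))`. -/
def prodRoot (u u' w : ℂ) : ℂ := -Complex.I * (rootAt u w * rootAt u' w)

/-- A primitive of `1 / √((λ - u) (λ - u'))`. -/
def logPrim (u u' w : ℂ) : ℂ :=
  2 * Complex.log ((rootAt u w + rootAt u' w) / 2) - (Real.pi / 2 : ℝ) * Complex.I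

theorem prodRoot_comm : prodRoot u u' = prodRoot u' u := by
  funext w
  rw [prodRoot, prodRoot, mul_comm (rootAt u w)]

theorem logPrim_comm : logPrim u u' = logPrim u' u := by
  funext w
  rw [logPrim, logPrim, add_comm (rootAt u w)]

theorem prodRoot_ne_zero : prodRoot u u' w ≠ 0 :=
  mul_ne_zero (neg_ne_zero.mpr Complex.I_ne_zero) (mul_ne_zero rootAt_ne_zero rootAt_ne_zero)

theorem prodRoot_sq (hw : w ≠ u) (hw' : w ≠ u') :
    prodRoot u u' w ^ 2 = (w - u) * (w - u') := by
  have h1 := rootAt_mul_self hw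
  have h2 := rootAt_mul_self hw'
  calc _ = Complex.I ^ 2 * ((rootAt u w * rootAt u w) * (rootAt u' w * rootAt u' w)) := by
        rw [prodRoot]; ring
    _ = (Complex.I ^ 2) * (Complex.I ^ 2) * ((w - u) * (w - u')) := by rw [h1, h2]; ring
    _ = _ := by rw [Complex.I_sq]; ring

theorem add_div_two_mem_slitPlane {z z' : ℂ} (hz : 0 < z.re) (hz' : 0 < z'.re) :
    (z + z') / 2 ∈ Complex.slitPlane := by
  refine Or.inl ?_
  rw [Complex.div_ofNat_re, Complex.add_re]
  positivity

theorem hasDerivAt_logPrim (hw : Complex.I * (w - u) ∈ Complex.slitPlane)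
    (hw' : Complex.I * (w - u') ∈ Complex.slitPlane) :
    HasDerivAt (logPrim u u') (prodRoot u u' w)⁻¹ w := by
  have hm := add_div_two_mem_slitPlane (rootAt_re_pos hw) (rootAt_re_pos hw')
  have h := (((((hasDerivAt_rootAt hw).add (hasDerivAt_rootAt hw')).div_const 2).clog hm).const_mul
    2).sub_const ((Real.pi / 2 : ℝ) * Complex.I)
  refine h.congr_deriv ?_
  have h0 := rootAt_ne_zero (u := u) (w := w)
  have h1 := rootAt_ne_zero (u := u') (w := w)
  have h2 := Complex.slitPlane_ne_zero hm
  have h3 : rootAt u w + rootAt u' w ≠ 0 := fun h => h2 (by rw [h, zero_div])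
  simp only [Pi.add_apply]
  rw [prodRoot]
  have hI := Complex.I_ne_zero
  field_simp
  rw [Complex.I_sq]
  ring

theorem hasDerivAt_prodRoot (hw : Complex.I * (w - u) ∈ Complex.slitPlane)
    (hw' : Complex.I * (w - u') ∈ Complex.slitPlane) :
    HasDerivAt (prodRoot u u') ((w - (u + u') / 2) / prodRoot u u' w) w := by
  have h := ((hasDerivAt_rootAt hw).mul (hasDerivAt_rootAt hw')).const_mul (-Complex.I)
  refine h.congr_deriv ?_
  have h0 := rootAt_ne_zero (u := u) (w := w)
  have h1 := rootAt_ne_zero (u := u') (w := w)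
  have h2 := rootAt_mul_self (ne_of_mem_slitPlane hw)
  have h3 := rootAt_mul_self (ne_of_mem_slitPlane hw')
  rw [eq_div_iff prodRoot_ne_zero, prodRoot]
  field_simp
  rw [show Complex.I ^ 3 = Complex.I ^ 2 * Complex.I by ring, Complex.I_sq]
  linear_combination (-(Complex.I)) * h2 - (Complex.I) * h3 - (2 * w - u - u') * Complex.I_sq

theorem cutLog_eq_of_exp {z w : ℂ} (h : Complex.exp z = w) (h1 : -(3 * Real.pi / 2) < z.im)
    (h2 : z.im ≤ Real.pi / 2) : cutLog w = z := by
  have e : Complex.I * w = Complex.exp (z + (Real.pi / 2 : ℝ) * Complex.I) := by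
    rw [Complex.exp_add, h]
    push_cast
    rw [Complex.exp_pi_div_two_mul_I, mul_comm]
  have him : (z + (Real.pi / 2 : ℝ) * Complex.I).im = z.im + Real.pi / 2 := by
    rw [Complex.add_im, Complex.im_ofReal_mul, Complex.I_im, mul_one]
  rw [cutLog, e, Complex.log_exp, add_sub_cancel_right]
  · rw [him]; linarith
  · rw [him]; linarith

/-! #### The primitive near a branch point -/

/-- The power series of `artanh r / r` in the variable `r²`. -/
def artanhSer (z : ℂ) : ℂ := ∑' n : ℕ, z ^ n / ((2 * n + 1 : ℕ) : ℂ)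

theorem analyticAt_artanhSer : AnalyticAt ℂ artanhSer 0 := by
  have h : DifferentiableOn ℂ artanhSer (Metric.ball 0 (1 / 2)) := by
    refine Complex.differentiableOn_tsum_of_summable_norm
      (u := fun n : ℕ => (1 / 2 : ℝ) ^ n) summable_geometric_two (fun n => ?_)
      Metric.isOpen_ball fun n w hw => ?_
    · fun_prop
    · rw [norm_div, norm_pow, Complex.norm_natCast]
      have h1 : ‖w‖ ≤ 1 / 2 := by simpa using (Metric.mem_ball.mp hw).le
      have h2 : (1 : ℝ) ≤ ((2 * n + 1 : ℕ) : ℝ) := by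
        exact_mod_cast Nat.succ_le_succ (Nat.zero_le _)
      calc _ ≤ ‖w‖ ^ n := div_le_self (by positivity) h2
        _ ≤ _ := pow_le_pow_left₀ (norm_nonneg _) h1 n
  exact h.analyticAt (Metric.isOpen_ball.mem_nhds (by simp))

theorem artanhSer_zero : artanhSer 0 = 1 := by
  rw [artanhSer, tsum_eq_single 0 (fun n hn => by simp [hn])]
  simp

/-- The identity `log ((1 + r) / (1 - r)) = 2 artanh r`, from the power series of the arctangent. -/
theorem log_div_eq_artanhSer {r : ℂ} (hr : ‖r‖ < 1) :
    Complex.log ((1 + r) / (1 - r)) = 2 * r * artanhSer (r ^ 2) := by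
  have h1 := Complex.hasSum_arctan (z := -(Complex.I * r)) (by simpa using hr)
  have e1 : Complex.arctan (-(Complex.I * r)) =
      -Complex.I / 2 * Complex.log ((1 + r) / (1 - r)) := by
    rw [Complex.arctan]
    congr 3 <;> · linear_combination (norm := ring_nf) (0 : ℂ) * Complex.I_sq; simp
  have e2 : ∀ n : ℕ, (-1 : ℂ) ^ n * (-(Complex.I * r)) ^ (2 * n + 1) / ((2 * n + 1 : ℕ) : ℂ) =
      -Complex.I * r * ((r ^ 2) ^ n / ((2 * n + 1 : ℕ) : ℂ)) := by
    intro n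
    have : (-(Complex.I * r)) ^ (2 * n + 1) = (-1) ^ n * (r ^ 2) ^ n * (-(Complex.I * r)) := by
      rw [pow_succ, pow_mul, neg_sq, mul_pow, Complex.I_sq, ← mul_pow]
    have h2 : ((-1 : ℂ) ^ n) * (-1) ^ n = 1 := by
      rw [← mul_pow]; simp
    rw [this]
    linear_combination (-(Complex.I * r) * (r ^ 2) ^ n / ((2 * n + 1 : ℕ) : ℂ)) * h2
  rw [e1] at h1
  simp only [e2] at h1
  have h3 := h1.tsum_eq
  rw [tsum_mul_left] at h3
  change -Complex.I * r * artanhSer (r ^ 2) = _ at h3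
  have hI := Complex.I_ne_zero
  have h4 : Complex.I * (Complex.log ((1 + r) / (1 - r)) - 2 * r * artanhSer (r ^ 2)) = 0 := by
    linear_combination 2 * h3
  exact sub_eq_zero.mp ((mul_eq_zero.mp h4).resolve_left hI)

/-- The value of the primitive at the branch point `u`. -/
def primConst (u u' : ℂ) : ℂ := cutLog (u - u') - 2 * (Real.log 2 : ℝ)

/-- The domain of the two square roots. -/
def cutDom (u u' : ℂ) : Set ℂ :=
  {w | Complex.I * (w - u) ∈ Complex.slitPlane ∧ Complex.I * (w - u') ∈ Complex.slitPlane}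

theorem tendsto_rootAt (u u' : ℂ) :
    Filter.Tendsto (rootAt u) (nhdsWithin u (cutDom u u')) (nhds 0) := by
  rw [tendsto_zero_iff_norm_tendsto_zero]
  have h1 : Filter.Tendsto (fun w : ℂ => Real.sqrt ‖w - u‖) (nhdsWithin u (cutDom u u'))
      (nhds 0) := by
    have : Continuous fun w : ℂ => Real.sqrt ‖w - u‖ := by fun_prop
    have h := this.tendsto u
    simp only [sub_self, norm_zero, Real.sqrt_zero] at h
    exact h.mono_left nhdsWithin_le_nhds
  refine h1.congr' ?_
  filter_upwards [self_mem_nhdsWithin] with w hw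
  have h2 := congrArg norm (rootAt_mul_self (ne_of_mem_slitPlane hw.1))
  rw [norm_mul, norm_mul, Complex.norm_I, one_mul] at h2
  rw [← h2, Real.sqrt_mul_self (norm_nonneg _)]

theorem continuousAt_rootAt (hu : Complex.I * (u - u') ∈ Complex.slitPlane) :
    ContinuousAt (rootAt u') u := (hasDerivAt_rootAt hu).continuousAt

/-- The value of the formula for the primitive at the branch point, where one of the roots
vanishes. -/
theorem log_rootAt_div_two :
    2 * Complex.log (rootAt u' u / 2) - (Real.pi / 2 : ℝ) * Complex.I = primConst u u' := by
  have e : rootAt u' u / 2 =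
      Complex.exp (1 / 2 * Complex.log (Complex.I * (u - u')) - (Real.log 2 : ℝ)) := by
    rw [Complex.exp_sub, rootAt, ← Complex.ofReal_exp, Real.exp_log two_pos]
    norm_num
  have him : (1 / 2 * Complex.log (Complex.I * (u - u')) - (Real.log 2 : ℝ)).im =
      (Complex.I * (u - u')).arg / 2 := by
    rw [Complex.sub_im, Complex.ofReal_im, show (1 / 2 : ℂ) = ((1 / 2 : ℝ) : ℂ) by norm_num,
      Complex.im_ofReal_mul, Complex.log_im]
    ring
  have h1 := Complex.neg_pi_lt_arg (Complex.I * (u - u'))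
  have h2 := Complex.arg_le_pi (Complex.I * (u - u'))
  have hpi := Real.pi_pos
  rw [e, Complex.log_exp (by rw [him]; linarith) (by rw [him]; linarith), primConst, cutLog]
  ring

/-- With `r = rootAt u w / rootAt u' w`, the exponential of the normalised primitive is
`(1 + r) / (1 - r)`. -/
theorem exp_logPrim_sub (hu : u ≠ u') (hw : Complex.I * (w - u) ∈ Complex.slitPlane)
    (hw' : Complex.I * (w - u') ∈ Complex.slitPlane) :
    Complex.exp (logPrim u u' w - primConst u u') * (rootAt u' w - rootAt u w) =
      rootAt u' w + rootAt u w := by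
  have hm := add_div_two_mem_slitPlane (rootAt_re_pos hw) (rootAt_re_pos hw')
  have h2 : Complex.exp (2 * Complex.log ((rootAt u w + rootAt u' w) / 2)) =
      ((rootAt u w + rootAt u' w) / 2) ^ 2 := by
    rw [two_mul, Complex.exp_add, Complex.exp_log (Complex.slitPlane_ne_zero hm), sq]
  have h3 : Complex.exp ((Real.pi / 2 : ℝ) * Complex.I) = Complex.I := by
    push_cast
    exact Complex.exp_pi_div_two_mul_I
  have h4 : Complex.exp (2 * (Real.log 2 : ℝ)) = 4 := by
    rw [two_mul, Complex.exp_add, ← Complex.ofReal_exp, Real.exp_log two_pos]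
    norm_num
  have hne := sub_ne_zero.mpr hu
  have h5 := rootAt_mul_self (ne_of_mem_slitPlane hw)
  have h6 := rootAt_mul_self (ne_of_mem_slitPlane hw')
  rw [logPrim, primConst, Complex.exp_sub, Complex.exp_sub, Complex.exp_sub, h2, h3, h4,
    cutLog_exp hne]
  have hI := Complex.I_ne_zero
  field_simp
  linear_combination 4 * (rootAt u w + rootAt u' w) * (h6 - h5)

theorem analyticAt_rootAt (hw : Complex.I * (w - u) ∈ Complex.slitPlane) :
    AnalyticAt ℂ (rootAt u) w := by
  rw [Complex.analyticAt_iff_eventually_differentiableAt]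
  have hopen : ∀ᶠ z in nhds w, Complex.I * (z - u) ∈ Complex.slitPlane :=
    (Complex.isOpen_slitPlane.preimage (f := fun z => Complex.I * (z - u))
      (by fun_prop)).mem_nhds hw
  exact hopen.mono fun z hz => (hasDerivAt_rootAt hz).differentiableAt

/-- Near the branch point `u` the primitive, normalised to vanish there, is
`log ((1 + r) / (1 - r))` with `r² = (λ - u) / (λ - u')`, an odd function of `r`. -/
theorem logPrim_eq_artanhSer (hu : Complex.I * (u - u') ∈ Complex.slitPlane) :
    ∀ᶠ w in nhdsWithin u (cutDom u u'), logPrim u u' w - primConst u u' =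
      2 * (rootAt u w / rootAt u' w) * artanhSer ((w - u) / (w - u')) := by
  have hr : Filter.Tendsto (fun w => rootAt u w / rootAt u' w) (nhdsWithin u (cutDom u u'))
      (nhds 0) := by
    have := (tendsto_rootAt u u').div ((continuousAt_rootAt hu).tendsto.mono_left
      (nhdsWithin_le_nhds (s := cutDom u u'))) rootAt_ne_zero
    rwa [zero_div] at this
  have hL : Filter.Tendsto (fun w => logPrim u u' w - primConst u u')
      (nhdsWithin u (cutDom u u')) (nhds 0) := by
    have h1 := ((tendsto_rootAt u u').add ((continuousAt_rootAt hu).tendsto.mono_left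
      (nhdsWithin_le_nhds (s := cutDom u u')))).div_const 2
    rw [zero_add] at h1
    have hs : rootAt u' u / 2 ∈ Complex.slitPlane := by
      refine Or.inl ?_
      rw [Complex.div_ofNat_re]
      exact div_pos (rootAt_re_pos hu) two_pos
    have h2 := (((h1.clog hs).const_mul 2).sub_const ((Real.pi / 2 : ℝ) * Complex.I)).sub_const
      (primConst u u')
    rwa [log_rootAt_div_two, sub_self] at h2
  have hlog : Filter.Tendsto (fun w => Complex.log ((1 + rootAt u w / rootAt u' w) /
      (1 - rootAt u w / rootAt u' w))) (nhdsWithin u (cutDom u u')) (nhds 0) := by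
    have h1 := ((hr.const_add 1).div (hr.const_sub 1) (by norm_num))
    have h2 := h1.clog (by norm_num)
    simpa using h2
  -- both sides are logarithms of the same number, and both tend to zero, so they agree near `u`
  have hd := hL.sub hlog
  rw [sub_zero] at hd
  have hsmall := hd.eventually (Metric.ball_mem_nhds (0 : ℂ) (mul_pos two_pos Real.pi_pos))
  have hrs := hr.eventually (Metric.ball_mem_nhds (0 : ℂ) one_pos)
  filter_upwards [hsmall, hrs, self_mem_nhdsWithin] with w h1 h2 hw
  have h2' : ‖rootAt u w / rootAt u' w‖ < 1 := by simpa using h2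
  have hr1 : 1 - rootAt u w / rootAt u' w ≠ 0 := by
    intro h
    rw [← sub_eq_zero.mp h, norm_one] at h2'
    exact lt_irrefl _ h2'
  have hr2 : 1 + rootAt u w / rootAt u' w ≠ 0 := by
    intro h
    rw [← neg_eq_iff_add_eq_zero.mpr h, norm_neg, norm_one] at h2'
    exact lt_irrefl _ h2'
  have h0' := rootAt_ne_zero (u := u') (w := w)
  have hexp := exp_logPrim_sub (ne_of_mem_slitPlane hu) hw.1 hw.2
  have hone : Complex.exp (logPrim u u' w - primConst u u' -
      Complex.log ((1 + rootAt u w / rootAt u' w) / (1 - rootAt u w / rootAt u' w))) = 1 := by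
    rw [Complex.exp_sub, Complex.exp_log (div_ne_zero hr2 hr1), div_eq_one_iff_eq
      (div_ne_zero hr2 hr1), eq_div_iff hr1]
    field_simp
    exact hexp
  obtain ⟨n, hn⟩ := Complex.exp_eq_one_iff.mp hone
  have hn0 : n = 0 := by
    by_contra hne
    have h3 : ‖logPrim u u' w - primConst u u' - Complex.log ((1 + rootAt u w / rootAt u' w) /
        (1 - rootAt u w / rootAt u' w))‖ < 2 * Real.pi := by simpa using h1
    rw [hn, norm_mul, Complex.norm_intCast] at h3
    have h4 : ‖(2 * Real.pi * Complex.I : ℂ)‖ = 2 * Real.pi := by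
      simp [abs_of_pos Real.pi_pos]
    have h5 : (1 : ℝ) ≤ |(n : ℝ)| := by exact_mod_cast Int.one_le_abs hne
    rw [h4] at h3
    nlinarith [Real.pi_pos]
  rw [hn0, Int.cast_zero, zero_mul, sub_eq_zero] at hn
  have hsq : (rootAt u w / rootAt u' w) ^ 2 = (w - u) / (w - u') := by
    rw [div_pow, sq, sq, rootAt_mul_self (ne_of_mem_slitPlane hw.1),
      rootAt_mul_self (ne_of_mem_slitPlane hw.2), mul_div_mul_left _ _ Complex.I_ne_zero]
  rw [hn, log_div_eq_artanhSer h2', hsq]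

end

/-! #### The period vectors -/

theorem periodConst_neg_one : periodConst (-1) = ((Real.sqrt 2 : ℝ) : ℂ) := by
  have h1 := Complex.Gamma_add_one (-1 / 2) (by norm_num)
  rw [show (-1 / 2 + 1 : ℂ) = 1 / 2 by norm_num, Complex.Gamma_one_half_eq] at h1
  have h2 : ((Real.pi : ℂ)) ^ (1 / 2 : ℂ) = ((Real.sqrt Real.pi : ℝ) : ℂ) := by
    rw [Real.sqrt_eq_rpow, Complex.ofReal_cpow Real.pi_pos.le]
    norm_num
  have h3 : Complex.Gamma (-1 / 2) = -2 * ((Real.sqrt Real.pi : ℝ) : ℂ) := by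
    rw [h2] at h1
    linear_combination 2 * h1
  have hpi : ((Real.sqrt Real.pi : ℝ) : ℂ) ≠ 0 := by
    exact_mod_cast (Real.sqrt_pos.mpr Real.pi_pos).ne'
  have h2' : ((Real.sqrt 2 : ℝ) : ℂ) * ((Real.sqrt 2 : ℝ) : ℂ) = 2 := by
    rw [← Complex.ofReal_mul, Real.mul_self_sqrt (by norm_num)]
    norm_num
  have h20 : ((Real.sqrt 2 : ℝ) : ℂ) ≠ 0 := fun h => by rw [h] at h2'; norm_num at h2'
  rw [periodConst, show (((-1 : ℤ) : ℂ) + 1 / 2) = -1 / 2 by norm_num, h3,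
    Real.sqrt_mul (by norm_num)]
  push_cast
  norm_num
  field_simp
  linear_combination -h2'

/-- The other index. -/
def other (i : Fin 2) : Fin 2 := 1 - i

theorem other_ne (i : Fin 2) : i ≠ other i := by
  fin_cases i <;> simp [other]

/-- The period vector `I^{(-1)}_{e_i}`, in closed form. -/
def basePeriod (t : Fin 2 → ℂ) (i : Fin 2) (w : ℂ) : Fin 2 → ℂ :=
  ![logPrim (canonCoord t 0) (canonCoord t 1) w -
      primConst (canonCoord t i) (canonCoord t (other i)),
    prodRoot (canonCoord t 0) (canonCoord t 1) w / 2]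

theorem hasDerivAt_basePeriod {t : Fin 2 → ℂ} (i : Fin 2) {w : ℂ} (hw : w ∈ cutPlane t) :
    HasDerivAt (basePeriod t i) ![(prodRoot (canonCoord t 0) (canonCoord t 1) w)⁻¹,
      (w - t 0) / prodRoot (canonCoord t 0) (canonCoord t 1) w / 2] w := by
  have h := (mem_cutPlane_iff t w).mp hw
  rw [hasDerivAt_pi]
  refine Fin.forall_fin_two.mpr ⟨?_, ?_⟩
  · exact (hasDerivAt_logPrim (h 0) (h 1)).sub_const _
  · refine ((hasDerivAt_prodRoot (h 0) (h 1)).div_const 2).congr_deriv ?_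
    have : (canonCoord t 0 + canonCoord t 1) / 2 = t 0 := by
      simp [canonCoord]
    rw [this]
    rfl

theorem canonCoord_sub_mem {t : Fin 2 → ℂ} (ht : t 1 ∈ Complex.slitPlane) {i j : Fin 2}
    (hij : i ≠ j) : Complex.I * (canonCoord t i - canonCoord t j) ∈ Complex.slitPlane := by
  rw [Complex.mem_slitPlane_iff]
  refine Or.inr ?_
  simpa using canonCoord_re ht hij

/-- The difference of the canonical coordinates is `±4 √(t^2)`. The branch with argument in
`(-3π/2, π/2)` assigns the argument `-π` to the negative sign at `t^2 > 0`. -/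
theorem cutLog_canonCoord_sub {t : Fin 2 → ℂ} (ht : t 1 ∈ Complex.slitPlane) (i : Fin 2) :
    cutLog (canonCoord t i - canonCoord t (other i)) = 2 * (Real.log 2 : ℝ) +
      1 / 2 * Complex.log (t 1) - (if i = 1 then Real.pi * Complex.I else 0) := by
  have h4 : Complex.exp (2 * (Real.log 2 : ℝ)) = 4 := by
    rw [two_mul, Complex.exp_add, ← Complex.ofReal_exp, Real.exp_log two_pos]
    norm_num
  have him : (2 * ((Real.log 2 : ℝ) : ℂ) + 1 / 2 * Complex.log (t 1)).im = (t 1).arg / 2 := by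
    rw [Complex.add_im, show (1 / 2 : ℂ) = ((1 / 2 : ℝ) : ℂ) by norm_num, Complex.im_ofReal_mul,
      Complex.log_im, show (2 : ℂ) = ((2 : ℝ) : ℂ) by norm_num, Complex.im_ofReal_mul,
      Complex.ofReal_im]
    ring
  have h1 := Complex.neg_pi_lt_arg (t 1)
  have h2 := Complex.arg_le_pi (t 1)
  have h3 : (t 1).arg < Real.pi :=
    lt_of_le_of_ne h2 (Complex.mem_slitPlane_iff_arg.mp ht).1
  have hpi := Real.pi_pos
  have hσ := cpow_eq_exp ht (1 / 2)
  revert i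
  refine Fin.forall_fin_two.mpr ⟨?_, ?_⟩
  · rw [if_neg (by decide), sub_zero]
    refine cutLog_eq_of_exp ?_ (by rw [him]; linarith) (by rw [him]; linarith)
    rw [Complex.exp_add, h4, ← hσ]
    simp [canonCoord, other]
    ring
  · rw [if_pos rfl]
    refine cutLog_eq_of_exp ?_ ?_ ?_
    · rw [Complex.exp_sub, Complex.exp_add, h4, ← hσ, Complex.exp_pi_mul_I]
      simp [canonCoord, other]
      ring
    · rw [Complex.sub_im, him, Complex.im_ofReal_mul, Complex.I_im]
      linarith
    · rw [Complex.sub_im, him, Complex.im_ofReal_mul, Complex.I_im]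
      linarith

theorem primConst_canonCoord {t : Fin 2 → ℂ} (ht : t 1 ∈ Complex.slitPlane) (i : Fin 2) :
    primConst (canonCoord t i) (canonCoord t (other i)) = 1 / 2 * Complex.log (t 1) -
      (if i = 1 then Real.pi * Complex.I else 0) := by
  rw [primConst, cutLog_canonCoord_sub ht]
  ring

theorem mem_cutDom {t : Fin 2 → ℂ} (i : Fin 2) {w : ℂ} (hw : w ∈ cutPlane t) :
    w ∈ cutDom (canonCoord t i) (canonCoord t (other i)) :=
  ⟨(mem_cutPlane_iff t w).mp hw i, (mem_cutPlane_iff t w).mp hw (other i)⟩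

/-- The values at `u^i` of the holomorphic factors of the two components are the entries of the
`i`-th column of `Ψ⁻¹`, with the correct branches. -/
theorem psiInv_value {t : Fin 2 → ℂ} (ht : t 1 ∈ Complex.slitPlane) (i : Fin 2) :
    ![((Real.sqrt 2 : ℝ) : ℂ) /
        Complex.exp (1 / 2 * cutLog (canonCoord t i - canonCoord t (other i))),
      Complex.exp (1 / 2 * cutLog (canonCoord t i - canonCoord t (other i))) /
        (2 * ((Real.sqrt 2 : ℝ) : ℂ))] = (PsiInv t).mulVec (Pi.single i 1) := by
  have h2' : ((Real.sqrt 2 : ℝ) : ℂ) * ((Real.sqrt 2 : ℝ) : ℂ) = 2 := by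
    rw [← Complex.ofReal_mul, Real.mul_self_sqrt (by norm_num)]
    norm_num
  have h20 : ((Real.sqrt 2 : ℝ) : ℂ) ≠ 0 := fun h => by rw [h] at h2'; norm_num at h2'
  have hq : (t 1) ^ (1 / 4 : ℂ) ≠ 0 := by
    rw [cpow_eq_exp ht]
    exact Complex.exp_ne_zero _
  have hqi : (t 1) ^ (-1 / 4 : ℂ) = ((t 1) ^ (1 / 4 : ℂ))⁻¹ := by
    rw [neg_div, Complex.cpow_neg]
  have he : Complex.exp ((Real.log 2 : ℝ) + 1 / 4 * Complex.log (t 1)) =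
      2 * (t 1) ^ (1 / 4 : ℂ) := by
    rw [Complex.exp_add, ← Complex.ofReal_exp, Real.exp_log two_pos, cpow_eq_exp ht]
    norm_num
  have hI : Complex.exp (-Real.pi / 2 * Complex.I) = -Complex.I := Complex.exp_neg_pi_div_two_mul_I
  have hI0 := Complex.I_ne_zero
  rw [cutLog_canonCoord_sub ht, Matrix.mulVec_single_one]
  revert i
  refine Fin.forall_fin_two.mpr ⟨?_, ?_⟩
  · rw [if_neg (by decide), sub_zero, show (1 / 2 * (2 * ((Real.log 2 : ℝ) : ℂ) +
      1 / 2 * Complex.log (t 1))) = (Real.log 2 : ℝ) + 1 / 4 * Complex.log (t 1) by ring, he]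
    funext j
    revert j
    refine Fin.forall_fin_two.mpr ⟨?_, ?_⟩
    · simp [PsiInv, hqi, Matrix.col_apply]
      field_simp
      linear_combination h2'
    · simp [PsiInv, hqi, Matrix.col_apply]
      field_simp
  · rw [if_pos rfl, show (1 / 2 * (2 * ((Real.log 2 : ℝ) : ℂ) +
      1 / 2 * Complex.log (t 1) - Real.pi * Complex.I)) = ((Real.log 2 : ℝ) +
      1 / 4 * Complex.log (t 1)) + (-Real.pi / 2 * Complex.I) by ring, Complex.exp_add, he, hI]
    funext j
    revert j
    refine Fin.forall_fin_two.mpr ⟨?_, ?_⟩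
    · simp [PsiInv, hqi, Matrix.col_apply]
      field_simp
      rw [Complex.I_sq]
      linear_combination -h2'
    · simp [PsiInv, hqi, Matrix.col_apply]
      field_simp

/-- The local factor at `u^i` of the first component is an even function of the root
`√((λ - u^i) / (λ - u^j))`, that is, `artanhSer`. -/
theorem isPeriodVector_basePeriod {t : Fin 2 → ℂ} (ht : t 1 ∈ Complex.slitPlane) (i : Fin 2) :
    IsPeriodVector t i (-1) (basePeriod t i) := by
  rw [isPeriodVector_iff]
  set u := canonCoord t i with hu
  set u' := canonCoord t (other i) with hu'
  have huu : Complex.I * (u - u') ∈ Complex.slitPlane := canonCoord_sub_mem ht (other_ne i)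
  have hpr : prodRoot (canonCoord t 0) (canonCoord t 1) = prodRoot u u' :=
    (Fin.forall_fin_two (p := fun i => prodRoot (canonCoord t 0) (canonCoord t 1) =
      prodRoot (canonCoord t i) (canonCoord t (other i)))).mpr ⟨rfl, prodRoot_comm⟩ i
  have hlp : logPrim (canonCoord t 0) (canonCoord t 1) = logPrim u u' :=
    (Fin.forall_fin_two (p := fun i => logPrim (canonCoord t 0) (canonCoord t 1) =
      logPrim (canonCoord t i) (canonCoord t (other i)))).mpr ⟨rfl, logPrim_comm⟩ i
  have hs2 : ((Real.sqrt 2 : ℝ) : ℂ) * ((Real.sqrt 2 : ℝ) : ℂ) = 2 := by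
    rw [← Complex.ofReal_mul, Real.mul_self_sqrt (by norm_num)]
    norm_num
  have hs20 : ((Real.sqrt 2 : ℝ) : ℂ) ≠ 0 := fun h => by rw [h] at hs2; norm_num at hs2
  refine ⟨⟨fun w hw => (hasDerivAt_basePeriod i hw).differentiableAt.differentiableWithinAt,
    fun w hw => ?_⟩, fun w => ![((Real.sqrt 2 : ℝ) : ℂ) * artanhSer ((w - u) / (w - u')) /
      Complex.exp (1 / 2 * cutLog (w - u')), Complex.exp (1 / 2 * cutLog (w - u')) /
        (2 * ((Real.sqrt 2 : ℝ) : ℂ))], ⟨?_, ?_⟩, ?_⟩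
  · rw [(hasDerivAt_basePeriod i hw).deriv, euler_mulVec, muShift_apply]
    have h := (mem_cutPlane_iff t w).mp hw
    have hsq := prodRoot_sq (ne_of_mem_slitPlane (h 0)) (ne_of_mem_slitPlane (h 1))
    have hne := prodRoot_ne_zero (u := canonCoord t 0) (u' := canonCoord t 1) (w := w)
    have hu01 : (w - canonCoord t 0) * (w - canonCoord t 1) = (w - t 0) ^ 2 - 4 * t 1 := by
      have := sqrt_sq ht
      simp only [canonCoord, Matrix.cons_val_zero, Matrix.cons_val_one, Matrix.cons_val_fin_one]
      linear_combination -4 * this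
    rw [hu01] at hsq
    funext j
    revert j
    refine Fin.forall_fin_two.mpr ⟨?_, ?_⟩
    · simp [calU, Matrix.mulVec, dotProduct, Fin.sum_univ_two, basePeriod]
      field_simp
      ring
    · simp [calU, Matrix.mulVec, dotProduct, Fin.sum_univ_two, basePeriod]
      field_simp
      linear_combination hsq
  · have hz : AnalyticAt ℂ (fun w => (w - u) / (w - u')) u := by
      refine AnalyticAt.fun_div (by fun_prop) (by fun_prop) ?_
      exact sub_ne_zero.mpr (ne_of_mem_slitPlane huu)
    have hB : AnalyticAt ℂ (fun w => artanhSer ((w - u) / (w - u'))) u := by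
      refine AnalyticAt.fun_comp ?_ hz
      rw [sub_self, zero_div]
      exact analyticAt_artanhSer
    have hs : AnalyticAt ℂ (fun w => Complex.exp (1 / 2 * cutLog (w - u'))) u := by
      simp only [exp_half_cutLog]
      exact analyticAt_const.fun_mul (analyticAt_rootAt huu)
    rw [← hu]
    refine analyticAt_pi_iff.mpr (Fin.forall_fin_two.mpr ⟨?_, ?_⟩)
    · exact (analyticAt_const.fun_mul hB).fun_div hs (Complex.exp_ne_zero _)
    · exact hs.fun_div analyticAt_const (mul_ne_zero two_ne_zero hs20)
  · have h := logPrim_eq_artanhSer huu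
    rw [eventually_nhdsWithin_iff] at h
    filter_upwards [h] with w hw hwc
    have h1 := hw (mem_cutDom i hwc)
    have hr := rootAt_ne_zero (u := u) (w := w)
    have hr' := rootAt_ne_zero (u := u') (w := w)
    have he := Complex.exp_ne_zero (-(Real.pi / 4 : ℝ) * Complex.I)
    have he2 := exp_quarter_sq
    rw [basePeriod, hpr, hlp, ← hu, ← hu', h1, periodConst_neg_one,
      show (-((-1 : ℤ) : ℂ) - 1 / 2) = 1 / 2 by norm_num, exp_half_cutLog, exp_half_cutLog,
      prodRoot]
    funext j
    revert j
    refine Fin.forall_fin_two.mpr ⟨?_, ?_⟩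
    · simp only [Matrix.cons_val_zero, Pi.smul_apply, smul_eq_mul]
      field_simp
      rw [sq, hs2]
      ring
    · simp only [Matrix.cons_val_one, Matrix.cons_val_fin_one, Pi.smul_apply, smul_eq_mul]
      rw [← he2]
      field_simp
  · simp only [← hu, sub_self, zero_div, artanhSer_zero, mul_one]
    exact psiInv_value ht i

/-- Differentiation gives the period vectors with larger indices than `-1`. For the smaller indices
the matrix `μ + l + 1/2` is invertible, and the system itself gives them. -/
theorem exists_isPeriodVector {t : Fin 2 → ℂ} (ht : t 1 ∈ Complex.slitPlane) (i : Fin 2) (l : ℤ) :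
    ∃ J, IsPeriodVector t i l J := by
  have hup : ∀ k : ℕ, ∃ J, IsPeriodVector t i (-1 + k) J := by
    intro k
    induction k with
    | zero => exact ⟨_, by simpa using isPeriodVector_basePeriod ht i⟩
    | succ k ih =>
      obtain ⟨J, hJ⟩ := ih
      refine ⟨deriv J, ?_⟩
      rw [Nat.cast_succ, ← add_assoc]
      exact hJ.deriv
  have hdown : ∀ k : ℕ, ∃ J, IsPeriodVector t i (-1 - k) J := by
    intro k
    induction k with
    | zero => exact ⟨_, by simpa using isPeriodVector_basePeriod ht i⟩
    | succ k ih =>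
      obtain ⟨J, hJ⟩ := ih
      refine ⟨_, IsPeriodVector.lower ht (by push_cast; omega) (by push_cast; omega) (J := J) ?_⟩
      rwa [show (-1 - ((k + 1 : ℕ) : ℤ)) + 1 = -1 - k by push_cast; ring]
  rcases le_or_gt (-1) l with h | h
  · obtain ⟨J, hJ⟩ := hup (l + 1).toNat
    exact ⟨J, by rwa [show (-1 + ((l + 1).toNat : ℤ)) = l by omega] at hJ⟩
  · obtain ⟨J, hJ⟩ := hdown (-1 - l).toNat
    exact ⟨J, by rwa [show (-1 - ((-1 - l).toNat : ℤ)) = l by omega] at hJ⟩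

theorem isPeriodVector_periodVector {t : Fin 2 → ℂ} (ht : t 1 ∈ Complex.slitPlane) (i : Fin 2)
    (l : ℤ) : IsPeriodVector t i l (periodVector t i l) :=
  Classical.epsilon_spec (exists_isPeriodVector ht i l)

theorem periodVector_neg_one {t : Fin 2 → ℂ} (ht : t 1 ∈ Complex.slitPlane) (i : Fin 2) :
    Set.EqOn (periodVector t i (-1)) (basePeriod t i) (cutPlane t) :=
  (isPeriodVector_periodVector ht i _).unique ht (isPeriodVector_basePeriod ht i)

theorem periodVector_succ {t : Fin 2 → ℂ} (ht : t 1 ∈ Complex.slitPlane) (i : Fin 2) (l : ℤ) :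
    Set.EqOn (periodVector t i (l + 1)) (deriv (periodVector t i l)) (cutPlane t) :=
  (isPeriodVector_periodVector ht i _).unique ht (isPeriodVector_periodVector ht i l).deriv

theorem periodVector_lower {t : Fin 2 → ℂ} (ht : t 1 ∈ Complex.slitPlane) (i : Fin 2) {l : ℤ}
    (hl0 : l ≠ 0) (hl1 : l + 1 ≠ 0) :
    Set.EqOn (periodVector t i l) (fun w => (Matrix.diagonal ![((l : ℂ) + 1)⁻¹, (l : ℂ)⁻¹]).mulVec
      ((calU t - w • (1 : Matrix (Fin 2) (Fin 2) ℂ)).mulVec (periodVector t i (l + 1) w)))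
      (cutPlane t) :=
  (isPeriodVector_periodVector ht i _).unique ht
    (IsPeriodVector.lower ht hl0 hl1 (isPeriodVector_periodVector ht i (l + 1)))

/-! ### Taylor series -/

/-- The Taylor series at `0`. -/
def taylorSer (g : ℂ → ℂ) : PowerSeries ℂ :=
  PowerSeries.mk fun n => iteratedDeriv n g 0 / n.factorial

theorem taylorSer_congr {g h : ℂ → ℂ} (e : g =ᶠ[nhds 0] h) : taylorSer g = taylorSer h := by
  ext n
  simp only [taylorSer, PowerSeries.coeff_mk, e.iteratedDeriv_eq n]

theorem coeff_zero_taylorSer (g : ℂ → ℂ) : PowerSeries.coeff 0 (taylorSer g) = g 0 := by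
  simp [taylorSer]

theorem taylorSer_derivative (g : ℂ → ℂ) :
    PowerSeries.derivative ℂ (taylorSer g) = taylorSer (deriv g) := by
  ext n
  have h : ((n.factorial : ℕ) : ℂ) ≠ 0 := by exact_mod_cast n.factorial_ne_zero
  have h1 : (n : ℂ) + 1 ≠ 0 := by exact_mod_cast Nat.succ_ne_zero n
  rw [PowerSeries.coeff_derivative, taylorSer, taylorSer, PowerSeries.coeff_mk,
    PowerSeries.coeff_mk, iteratedDeriv_succ', Nat.factorial_succ]
  push_cast
  field_simp

theorem taylorSer_add {g h : ℂ → ℂ} (hg : AnalyticAt ℂ g 0) (hh : AnalyticAt ℂ h 0) :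
    taylorSer (fun x => g x + h x) = taylorSer g + taylorSer h := by
  ext n
  rw [map_add, taylorSer, taylorSer, taylorSer, PowerSeries.coeff_mk, PowerSeries.coeff_mk,
    PowerSeries.coeff_mk, ← add_div]
  congr 1
  exact iteratedDeriv_add hg.contDiffAt hh.contDiffAt

theorem taylorSer_mul {g h : ℂ → ℂ} (hg : AnalyticAt ℂ g 0) (hh : AnalyticAt ℂ h 0) :
    taylorSer (fun x => g x * h x) = taylorSer g * taylorSer h := by
  ext n
  have e := iteratedDeriv_mul (n := n) (x := 0) hg.contDiffAt hh.contDiffAt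
  rw [PowerSeries.coeff_mul, Finset.Nat.sum_antidiagonal_eq_sum_range_succ (fun i j =>
    PowerSeries.coeff i (taylorSer g) * PowerSeries.coeff j (taylorSer h))]
  simp only [taylorSer, PowerSeries.coeff_mk]
  change iteratedDeriv n (g * h) 0 / _ = _
  rw [e, Finset.sum_div]
  refine Finset.sum_congr rfl fun i hi => ?_
  have hi' : i ≤ n := by simpa [Nat.lt_succ_iff] using hi
  have h1 : ((i.factorial : ℕ) : ℂ) ≠ 0 := by exact_mod_cast i.factorial_ne_zero
  have h2 : (((n - i).factorial : ℕ) : ℂ) ≠ 0 := by exact_mod_cast (n - i).factorial_ne_zero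
  have h3 : ((n.choose i : ℕ) : ℂ) * i.factorial * (n - i).factorial = n.factorial := by
    exact_mod_cast Nat.choose_mul_factorial_mul_factorial hi'
  have h4 : ((n.choose i : ℕ) : ℂ) ≠ 0 := by exact_mod_cast (Nat.choose_pos hi').ne'
  rw [← h3]
  field_simp

theorem taylorSer_const (c : ℂ) : taylorSer (fun _ => c) = PowerSeries.C c := by
  ext n
  rw [taylorSer, PowerSeries.coeff_mk, PowerSeries.coeff_C, iteratedDeriv_const]
  split_ifs with h
  · simp [h]
  · simp

theorem taylorSer_id : taylorSer (fun x => x) = PowerSeries.X := by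
  have h : PowerSeries.derivative ℂ (taylorSer (fun x => x)) =
      PowerSeries.derivative ℂ (PowerSeries.X : PowerSeries ℂ) := by
    rw [taylorSer_derivative, PowerSeries.derivative_X]
    have : deriv (fun x : ℂ => x) = fun _ => 1 := by
      funext x
      exact deriv_id x
    rw [this, taylorSer_const, map_one]
  refine PowerSeries.derivative.ext h ?_
  rw [← PowerSeries.coeff_zero_eq_constantCoeff_apply, coeff_zero_taylorSer]
  simp

theorem taylorSer_const_mul {g : ℂ → ℂ} (c : ℂ) (hg : AnalyticAt ℂ g 0) :
    taylorSer (fun x => c * g x) = PowerSeries.C c * taylorSer g := by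
  rw [taylorSer_mul analyticAt_const hg, taylorSer_const]

theorem taylorSer_isBigO {g : ℂ → ℂ} (hg : AnalyticAt ℂ g 0) (N : ℕ) :
    (fun y => g y - ∑ n ∈ range N, PowerSeries.coeff n (taylorSer g) * y ^ n) =O[nhds 0]
      fun y => ‖y‖ ^ N := by
  have h := hg.hasFPowerSeriesAt.isBigO_sub_partialSum_pow N
  refine h.congr_left fun y => ?_
  rw [zero_add, FormalMultilinearSeries.partialSum]
  congr 1
  refine Finset.sum_congr rfl fun n _ => ?_
  rw [FormalMultilinearSeries.ofScalars_apply_eq, taylorSer, PowerSeries.coeff_mk, smul_eq_mul]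

/-! ### Asymptotic expansions -/

theorem van_order (φ : AsympSeries) : Van φ.order φ := fun _ h =>
  HahnSeries.coeff_eq_zero_of_lt_order h

theorem partialEval_eq {φ : AsympSeries} {m : ℤ} (h : Van m φ) (N : ℤ) (w : ℂ) :
    partialEval φ N w = ∑ n ∈ Finset.Icc m N, (φ.coeff n).eval (cutLog w) * w ^ (-n) := by
  by_cases h0 : φ = 0
  · subst h0
    simp [partialEval]
  · have hm : m ≤ φ.order := by
      by_contra hlt
      exact h0 (HahnSeries.coeff_order_eq_zero.mp (h _ (not_le.mp hlt)))
    refine Finset.sum_subset (Finset.Icc_subset_Icc_left hm) fun n hn hn' => ?_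
    have : n < φ.order := by
      simp only [Finset.mem_Icc, not_and, not_le] at hn hn'
      by_contra hle
      have := hn' (not_lt.mp hle)
      omega
    rw [HahnSeries.coeff_eq_zero_of_lt_order this]
    simp

theorem cutLog_ofReal_mul {r : ℝ} (hr : 0 < r) {ω : ℂ} (hω : ω ≠ 0) :
    cutLog (r * ω) = Real.log r + cutLog ω := by
  rw [cutLog, cutLog, show Complex.I * (r * ω) = r * (Complex.I * ω) by ring,
    Complex.log_ofReal_mul hr (mul_ne_zero Complex.I_ne_zero hω)]
  ring

theorem cutLog_one : cutLog 1 = 0 :=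
  cutLog_eq_of_exp Complex.exp_zero (by simp; positivity) (by simp; positivity)

/-- A nonzero polynomial in `log r` does not tend to zero. -/
theorem eq_zero_of_tendsto_eval_log {p : Polynomial ℂ}
    (h : Filter.Tendsto (fun r : ℝ => p.eval (Real.log r : ℂ)) Filter.atTop (nhds 0)) : p = 0 := by
  rcases lt_or_ge 0 p.degree with hd | hd
  · have h1 : Filter.Tendsto (fun r : ℝ => ‖(Real.log r : ℂ)‖) Filter.atTop Filter.atTop := by
      simp only [Complex.norm_real]
      exact tendsto_norm_atTop_atTop.comp Real.tendsto_log_atTop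
    exact absurd h.norm (not_tendsto_nhds_of_tendsto_atTop (p.tendsto_norm_atTop hd h1) _)
  · rw [Polynomial.eq_C_of_degree_le_zero hd] at h ⊢
    simp only [Polynomial.eval_C] at h
    rw [tendsto_nhds_unique tendsto_const_nhds h, map_zero]

/-- At the first order where two expansions differ, the difference of the coefficients is a
polynomial in `log r` that tends to zero along the positive real axis. -/
theorem HasAsympExp.unique {g : ℂ → ℂ} {φ χ : AsympSeries} (hφ : HasAsympExp g φ)
    (hχ : HasAsympExp g χ) : φ = χ := by
  set m := min φ.order χ.order with hm
  have hvφ : Van m φ := (van_order φ).mono (min_le_left _ _)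
  have hvχ : Van m χ := (van_order χ).mono (min_le_right _ _)
  have key : ∀ k : ℕ, φ.coeff (m + k) = χ.coeff (m + k) := by
    intro k
    induction k using Nat.strong_induction_on with
    | _ k ih =>
      -- on the positive real axis `cutLog r` is the real logarithm
      have h1 := (hχ 1 (by simp) (by simp [Complex.ext_iff]) (m + k)).sub
        (hφ 1 (by simp) (by simp [Complex.ext_iff]) (m + k))
      have h2 : (fun r : ℝ => g ((r : ℂ) * 1) - partialEval χ (m + k) ((r : ℂ) * 1) -
          (g ((r : ℂ) * 1) - partialEval φ (m + k) ((r : ℂ) * 1))) =ᶠ[Filter.atTop]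
          fun r : ℝ => (φ.coeff (m + k) - χ.coeff (m + k)).eval (Real.log r : ℂ) *
            ((r ^ (-(m + k)) : ℝ) : ℂ) := by
        filter_upwards [Filter.eventually_gt_atTop 0] with r hr
        have hl : cutLog ((r : ℂ) * 1) = Real.log r := by
          rw [cutLog_ofReal_mul hr one_ne_zero, cutLog_one, add_zero]
        rw [sub_sub_sub_cancel_left, partialEval_eq hvφ, partialEval_eq hvχ,
          ← Finset.sum_sub_distrib, Finset.sum_eq_single (m + k), hl, ← sub_mul,
          Polynomial.eval_sub, mul_one]
        · push_cast
          rfl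
        · intro n hn hne
          obtain ⟨j, rfl⟩ : ∃ j : ℕ, n = m + j := ⟨(n - m).toNat, by
            have := (Finset.mem_Icc.mp hn).1; omega⟩
          rw [ih j (by have := (Finset.mem_Icc.mp hn).2; omega), sub_self]
        · intro h
          exact absurd (Finset.mem_Icc.mpr ⟨by omega, le_rfl⟩) h
      have h3 := h1.congr' h2 Filter.EventuallyEq.rfl
      have h4 : (fun r : ℝ => ((r ^ (m + k) : ℝ) : ℂ)) =O[Filter.atTop] fun r : ℝ => r ^ (m + k) :=
        Asymptotics.IsBigO.of_bound 1 (Filter.Eventually.of_forall fun r => by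
          rw [Complex.norm_real, one_mul])
      have h5 := (h3.mul_isBigO h4).congr' (f₂ := fun r : ℝ =>
        (φ.coeff (m + k) - χ.coeff (m + k)).eval (Real.log r : ℂ)) (g₂ := fun _ => (1 : ℝ)) ?_ ?_
      · exact sub_eq_zero.mp (eq_zero_of_tendsto_eval_log ((Asymptotics.isLittleO_one_iff ℝ).mp h5))
      · filter_upwards [Filter.eventually_gt_atTop 0] with r hr
        rw [mul_assoc, ← Complex.ofReal_mul, ← zpow_add₀ hr.ne', neg_add_cancel, zpow_zero,
          Complex.ofReal_one, mul_one]
      · filter_upwards [Filter.eventually_gt_atTop 0] with r hr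
        rw [← zpow_add₀ hr.ne', neg_add_cancel, zpow_zero]
  ext1
  funext n
  rcases lt_or_ge n m with h | h
  · rw [hvφ n h, hvχ n h]
  · obtain ⟨k, rfl⟩ : ∃ k : ℕ, n = m + k := ⟨(n - m).toNat, by omega⟩
    exact key k

theorem asympExp_eq {g : ℂ → ℂ} {φ : AsympSeries} (h : HasAsympExp g φ) : asympExp g = φ :=
  (Classical.epsilon_spec (p := HasAsympExp g) ⟨φ, h⟩).unique h

theorem HasAsympExp.congr {g h : ℂ → ℂ} {φ : AsympSeries} (hg : HasAsympExp g φ)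
    (e : ∀ ω : ℂ, ‖ω‖ = 1 → ω ≠ Complex.I → ∀ᶠ r : ℝ in Filter.atTop, g (r * ω) = h (r * ω)) :
    HasAsympExp h φ := fun ω h1 h2 N =>
  (hg ω h1 h2 N).congr' ((e ω h1 h2).mono fun r hr => by simp only [hr]) Filter.EventuallyEq.rfl

theorem HasAsympExp.add {g h : ℂ → ℂ} {φ χ : AsympSeries} (hg : HasAsympExp g φ)
    (hh : HasAsympExp h χ) : HasAsympExp (fun w => g w + h w) (φ + χ) := by
  intro ω h1 h2 N
  have hvφ : Van (min φ.order χ.order) φ := (van_order φ).mono (min_le_left _ _)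
  have hvχ : Van (min φ.order χ.order) χ := (van_order χ).mono (min_le_right _ _)
  refine ((hg ω h1 h2 N).add (hh ω h1 h2 N)).congr_left fun r => ?_
  rw [partialEval_eq hvφ, partialEval_eq hvχ, partialEval_eq (hvφ.add hvχ)]
  simp only [HahnSeries.coeff_add, Polynomial.eval_add, add_mul, Finset.sum_add_distrib]
  ring

theorem HasAsympExp.const_mul {g : ℂ → ℂ} {φ : AsympSeries} (hg : HasAsympExp g φ) (c : ℂ) :
    HasAsympExp (fun w => c * g w) (asympConst c * φ) := by
  intro ω h1 h2 N
  refine ((hg ω h1 h2 N).const_mul_left c).congr_left fun r => ?_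
  rw [asympConst_mul, partialEval_eq (van_order φ), partialEval_eq ((van_order φ).csmul c)]
  simp only [HahnSeries.coeff_smul, Polynomial.eval_smul, smul_eq_mul, mul_sub, Finset.mul_sum,
    mul_assoc]

/-- The series `λ`. -/
def asympVar : AsympSeries := HahnSeries.single (-1) 1

theorem coeff_asympVar_mul (φ : AsympSeries) (n : ℤ) :
    (asympVar * φ).coeff n = φ.coeff (n + 1) := by
  rw [asympVar, HahnSeries.coeff_single_mul, one_mul, sub_neg_eq_add]

theorem HasAsympExp.var_mul {g : ℂ → ℂ} {φ : AsympSeries} (hg : HasAsympExp g φ) :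
    HasAsympExp (fun w => w * g w) (asympVar * φ) := by
  intro ω h1 h2 N
  have hv : Van (φ.order - 1) (asympVar * φ) := fun n hn => by
    rw [coeff_asympVar_mul, van_order φ _ (by omega)]
  have h3 := hg ω h1 h2 (N + 1)
  have h4 : (fun r : ℝ => (r : ℂ) * ω) =O[Filter.atTop] fun r : ℝ => r :=
    Asymptotics.IsBigO.of_bound 1 (Filter.Eventually.of_forall fun r => by simp [h1])
  refine (h4.mul_isLittleO h3).congr' ?_ ?_
  · filter_upwards [Filter.eventually_gt_atTop 0] with r hr
    have hw : (r : ℂ) * ω ≠ 0 := by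
      refine mul_ne_zero (by exact_mod_cast hr.ne') ?_
      rintro rfl
      simp at h1
    rw [partialEval_eq (van_order φ), partialEval_eq hv, mul_sub, Finset.mul_sum]
    congr 1
    refine Finset.sum_nbij' (fun n => n - 1) (fun n => n + 1) ?_ ?_ ?_ ?_ ?_
    · intro n hn; simp only [Finset.mem_Icc] at hn ⊢; omega
    · intro n hn; simp only [Finset.mem_Icc] at hn ⊢; omega
    · intro n _; ring
    · intro n _; ring
    · intro n _
      rw [coeff_asympVar_mul, sub_add_cancel, show -(n - 1) = 1 + -n by ring, zpow_add₀ hw,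
        zpow_one]
      ring
  · filter_upwards [Filter.eventually_gt_atTop 0] with r hr
    rw [show -N = 1 + -(N + 1) by ring, zpow_add₀ hr.ne', zpow_one]

theorem isLittleO_one_zpow {N : ℤ} (hN : N < 0) :
    (fun _ : ℝ => (1 : ℝ)) =o[Filter.atTop] fun r : ℝ => r ^ (-N) := by
  rw [Asymptotics.isLittleO_const_left]
  right
  obtain ⟨k, hk⟩ : ∃ k : ℕ, -N = k := ⟨(-N).toNat, by omega⟩
  simp only [hk, zpow_natCast]
  exact tendsto_norm_atTop_atTop.comp (Filter.tendsto_pow_atTop (by omega))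

theorem hasAsympExp_const (c : ℂ) : HasAsympExp (fun _ => c) (asympConst c) := by
  have hv : Van 0 (asympConst c) := fun n hn => HahnSeries.coeff_single_of_ne (by omega)
  intro ω h1 h2 N
  rcases lt_or_ge N 0 with hN | hN
  · refine Asymptotics.IsBigO.trans_isLittleO ?_ (isLittleO_one_zpow hN)
    simp only [partialEval_eq hv, Finset.Icc_eq_empty (not_le.mpr hN), Finset.sum_empty, sub_zero]
    exact Asymptotics.isBigO_const_const _ one_ne_zero _
  · refine (Asymptotics.isLittleO_zero _ _).congr_left fun r => ?_
    rw [partialEval_eq hv, Finset.sum_eq_single 0]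
    · simp [asympConst]
    · intro n _ hn
      rw [asympConst, HahnSeries.C_apply, HahnSeries.coeff_single_of_ne hn]
      simp
    · intro h
      exact absurd (Finset.mem_Icc.mpr ⟨le_rfl, hN⟩) h

theorem hasAsympExp_cutLog : HasAsympExp cutLog asympLog := by
  have hv : Van 0 asympLog := fun n hn => HahnSeries.coeff_single_of_ne (by omega)
  intro ω h1 h2 N
  have hω : ω ≠ 0 := by
    rintro rfl
    simp at h1
  rcases lt_or_ge N 0 with hN | hN
  · simp only [partialEval_eq hv, Finset.Icc_eq_empty (not_le.mpr hN), Finset.sum_empty, sub_zero]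
    have e : (fun r : ℝ => (Real.log r : ℂ) + cutLog ω) =ᶠ[Filter.atTop]
        fun r : ℝ => cutLog (r * ω) := by
      filter_upwards [Filter.eventually_gt_atTop 0] with r hr
      rw [cutLog_ofReal_mul hr hω]
    refine Asymptotics.IsLittleO.congr' ?_ e Filter.EventuallyEq.rfl
    refine Asymptotics.IsLittleO.add ?_ ?_
    · have h3 : (fun r : ℝ => (Real.log r : ℂ)) =o[Filter.atTop] fun r : ℝ => r := by
        refine Asymptotics.IsLittleO.of_norm_left ?_
        simp only [Complex.norm_real]
        exact Real.isLittleO_log_id_atTop.norm_left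
      refine h3.trans_isBigO (Asymptotics.IsBigO.of_bound 1 ?_)
      filter_upwards [Filter.eventually_ge_atTop 1] with r hr
      rw [one_mul, Real.norm_of_nonneg (by linarith), Real.norm_of_nonneg (by positivity)]
      calc r = r ^ (1 : ℤ) := (zpow_one r).symm
        _ ≤ _ := zpow_le_zpow_right₀ hr (by omega)
    · exact (Asymptotics.isBigO_const_const _ one_ne_zero _).trans_isLittleO (isLittleO_one_zpow hN)
  · refine (Asymptotics.isLittleO_zero _ _).congr_left fun r => ?_
    rw [partialEval_eq hv, Finset.sum_eq_single 0]
    · simp [asympLog]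
    · intro n _ hn
      rw [asympLog, HahnSeries.C_apply, HahnSeries.coeff_single_of_ne hn]
      simp
    · intro h
      exact absurd (Finset.mem_Icc.mpr ⟨le_rfl, hN⟩) h

theorem tendsto_ray_inv {ω : ℂ} (hω : ‖ω‖ = 1) :
    Filter.Tendsto (fun r : ℝ => ((r : ℂ) * ω)⁻¹) Filter.atTop (nhds 0) := by
  rw [tendsto_zero_iff_norm_tendsto_zero]
  have : (fun r : ℝ => ‖((r : ℂ) * ω)⁻¹‖) = fun r : ℝ => |r|⁻¹ := by
    funext r
    rw [norm_inv, norm_mul, hω, mul_one, Complex.norm_real, Real.norm_eq_abs]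
  rw [this]
  exact tendsto_inv_atTop_zero.comp Filter.tendsto_abs_atTop_atTop

/-- A holomorphic function of `λ⁻¹` is asymptotic to its Taylor series. -/
theorem hasAsympExp_taylorSer {g : ℂ → ℂ} (hg : AnalyticAt ℂ g 0) :
    HasAsympExp (fun w => g w⁻¹) (emb (taylorSer g)) := by
  intro ω h1 h2 N
  have hω : ω ≠ 0 := by
    rintro rfl
    simp at h1
  have ht := tendsto_ray_inv h1
  rcases lt_or_ge N 0 with hN | hN
  · -- below the leading order the partial sums are empty
    refine Asymptotics.IsBigO.trans_isLittleO ?_ (isLittleO_one_zpow hN)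
    simp only [partialEval_eq (van_emb _), Finset.Icc_eq_empty (not_le.mpr hN), Finset.sum_empty,
      sub_zero]
    exact (hg.continuousAt.tendsto.comp ht).isBigO_one ℝ
  · lift N to ℕ using hN
    have h3 := (taylorSer_isBigO hg (N + 1)).comp_tendsto ht
    have h4 : (fun r : ℝ => ‖((r : ℂ) * ω)⁻¹‖ ^ (N + 1)) =o[Filter.atTop]
        fun r : ℝ => r ^ (-(N : ℤ)) := by
      have h5 : (fun r : ℝ => r ^ (-(N : ℤ)) * r⁻¹) =o[Filter.atTop]
          fun r : ℝ => r ^ (-(N : ℤ)) * 1 :=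
        (Asymptotics.isBigO_refl _ _).mul_isLittleO
          ((Asymptotics.isLittleO_one_iff ℝ).mpr tendsto_inv_atTop_zero)
      simp only [mul_one] at h5
      refine h5.congr' ?_ Filter.EventuallyEq.rfl
      filter_upwards [Filter.eventually_gt_atTop 0] with r hr
      rw [norm_inv, norm_mul, h1, mul_one, Complex.norm_real, Real.norm_of_nonneg hr.le, pow_succ,
        inv_pow, zpow_neg, zpow_natCast]
    refine (h3.trans_isLittleO h4).congr_left fun r => ?_
    rw [partialEval_eq (van_emb _)]
    simp only [Function.comp]
    congr 1
    refine Finset.sum_nbij' (fun n : ℕ => (n : ℤ)) (fun n : ℤ => n.toNat) ?_ ?_ ?_ ?_ ?_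
    · intro n hn; simp only [Finset.mem_Icc, mem_range] at hn ⊢; omega
    · intro n hn; simp only [Finset.mem_Icc, mem_range] at hn ⊢; omega
    · intro n _; simp
    · intro n hn; simp only [Finset.mem_Icc] at hn; simp; omega
    · intro n _
      rw [coeff_emb, Polynomial.eval_C, zpow_neg, zpow_natCast, inv_pow]

/-! ### The period vectors near `λ = ∞` -/

/-- A neighbourhood of `λ = ∞` in the cut plane: the points far from the origin, without those
close to the positive imaginary axis. -/
def farSet (R : ℝ) : Set ℂ := {w | R < ‖w‖ ∧ (w.im < 0 ∨ R < |w.re|)}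

theorem isOpen_farSet (R : ℝ) : IsOpen (farSet R) := by
  refine (isOpen_lt continuous_const continuous_norm).inter
    ((isOpen_lt Complex.continuous_im continuous_const).union
      (isOpen_lt continuous_const (continuous_abs.comp Complex.continuous_re)))

/-- Every ray, except the positive imaginary axis, eventually stays in the neighbourhood. -/
theorem eventually_mem_farSet (R : ℝ) {ω : ℂ} (h1 : ‖ω‖ = 1) (h2 : ω ≠ Complex.I) :
    ∀ᶠ r : ℝ in Filter.atTop, (r : ℂ) * ω ∈ farSet R := by
  by_cases hre : ω.re = 0
  · have him : ω.im = -1 := by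
      have h3 : ω.im ^ 2 = 1 := by
        have := Complex.sq_norm ω
        rw [h1, Complex.normSq_apply, hre] at this
        nlinarith
      rcases mul_self_eq_one_iff.mp ((sq ω.im).symm.trans h3) with h | h
      · exact absurd (Complex.ext (by simp [hre]) (by simp [h])) h2
      · exact h
    filter_upwards [Filter.eventually_gt_atTop R, Filter.eventually_gt_atTop 0] with r hr hr0
    refine ⟨by simpa [h1, abs_of_pos hr0] using hr, Or.inl ?_⟩
    simp [him, hr0]
  · have hpos : 0 < |ω.re| := abs_pos.mpr hre
    filter_upwards [Filter.eventually_gt_atTop R, Filter.eventually_gt_atTop 0,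
      Filter.eventually_gt_atTop (R / |ω.re|)] with r hr hr0 hr2
    refine ⟨by simpa [h1, abs_of_pos hr0] using hr, Or.inr ?_⟩
    rw [div_lt_iff₀ hpos] at hr2
    simpa [abs_mul, abs_of_pos hr0] using hr2

theorem smul_mem_farSet {R : ℝ} {w : ℂ} (hw : w ∈ farSet R) {s : ℝ} (hs : 1 ≤ s) :
    (s : ℂ) * w ∈ farSet R := by
  have hs0 : 0 < s := by linarith
  refine ⟨?_, ?_⟩
  · rw [norm_mul, Complex.norm_real, Real.norm_of_nonneg hs0.le]
    exact hw.1.trans_le (le_mul_of_one_le_left (norm_nonneg _) hs)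
  · rcases hw.2 with h | h
    · left
      rw [Complex.im_ofReal_mul]
      exact mul_neg_of_pos_of_neg hs0 h
    · right
      rw [Complex.re_ofReal_mul, abs_mul, abs_of_pos hs0]
      exact h.trans_le (le_mul_of_one_le_left (abs_nonneg _) hs)

section

variable {R : ℝ} {u w : ℂ}

theorem ne_zero_of_mem_farSet (hR : 0 ≤ R) (hw : w ∈ farSet R) : w ≠ 0 := by
  rintro rfl
  have := hw.1
  simp at this
  linarith

theorem mem_slitPlane_of_mem_farSet (hu : 2 * ‖u‖ < R) (hw : w ∈ farSet R) :
    Complex.I * (w - u) ∈ Complex.slitPlane := by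
  have h1 := Complex.abs_re_le_norm u
  have h2 := Complex.abs_im_le_norm u
  have h3 := Complex.norm_le_abs_re_add_abs_im w
  rw [Complex.mem_slitPlane_iff]
  simp only [Complex.mul_re, Complex.mul_im, Complex.I_re, Complex.I_im, Complex.sub_re,
    Complex.sub_im, zero_mul, one_mul, zero_sub, zero_add]
  have hre : R < |w.re| + ‖u‖ → w.re - u.re ≠ 0 := by
    intro h h0
    rw [sub_eq_zero.mp h0] at h
    linarith
  rcases hw.2 with h | h
  · by_cases hc : 0 < -(w.im - u.im)
    · exact Or.inl hc
    · refine Or.inr (hre ?_)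
      have : |w.im| ≤ ‖u‖ := by
        rw [abs_of_neg h]
        linarith [neg_abs_le u.im]
      linarith [hw.1]
  · exact Or.inr (hre (by linarith [norm_nonneg u]))

theorem norm_mul_inv_lt (hu : 2 * ‖u‖ < R) {x : ℂ} (hx : x ∈ Metric.ball (0 : ℂ) R⁻¹) :
    ‖u * x‖ < 1 / 2 := by
  have hx' : ‖x‖ < R⁻¹ := by simpa using hx
  have hR : 0 < R := by linarith [norm_nonneg u]
  have h2 : R * ‖x‖ < 1 := by
    calc R * ‖x‖ < R * R⁻¹ := mul_lt_mul_of_pos_left hx' hR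
      _ = 1 := mul_inv_cancel₀ hR.ne'
  rw [norm_mul]
  nlinarith [norm_nonneg x, mul_nonneg (sub_nonneg.mpr hu.le) (norm_nonneg x)]

theorem one_sub_re_pos (hu : 2 * ‖u‖ < R) {x : ℂ} (hx : x ∈ Metric.ball (0 : ℂ) R⁻¹) :
    0 < (1 - u * x).re := by
  have h1 := norm_mul_inv_lt hu hx
  have h2 := Complex.re_le_norm (u * x)
  rw [Complex.sub_re, Complex.one_re]
  linarith

theorem inv_mem_ball (hR : 0 < R) (hw : w ∈ farSet R) : w⁻¹ ∈ Metric.ball (0 : ℂ) R⁻¹ := by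
  rw [mem_ball_zero_iff, norm_inv]
  exact inv_strictAnti₀ hR hw.1

theorem abs_arg_lt {z : ℂ} (hz : 0 < z.re) : |z.arg| < Real.pi / 2 :=
  Complex.abs_arg_lt_pi_div_two_iff.mpr (Or.inl hz)

theorem log_mul_of_re_pos {z z' : ℂ} (hz : 0 < z.re) (hz' : 0 < z'.re) :
    Complex.log (z * z') = Complex.log z + Complex.log z' := by
  have h1 := abs_lt.mp (abs_arg_lt hz)
  have h2 := abs_lt.mp (abs_arg_lt hz')
  refine Complex.log_mul (fun h => by simp [h] at hz) (fun h => by simp [h] at hz')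
    ⟨by linarith, by linarith⟩

theorem im_mul_eq (z z' : ℂ) : (z * z').im = ‖z‖ * ‖z'‖ * Real.sin (z.arg + z'.arg) := by
  rw [Complex.mul_im, Real.sin_add, ← Complex.norm_mul_cos_arg z, ← Complex.norm_mul_sin_arg z,
    ← Complex.norm_mul_cos_arg z', ← Complex.norm_mul_sin_arg z']
  simp only [Complex.norm_mul_cos_arg, Complex.norm_mul_sin_arg]
  rw [← Complex.norm_mul_cos_arg z, ← Complex.norm_mul_sin_arg z,
    ← Complex.norm_mul_cos_arg z', ← Complex.norm_mul_sin_arg z']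
  ring

/-- The logarithms add up without a multiple of `2π𝗂`, because far from the cut the numbers `𝗂 λ`
and `𝗂 (λ - u)` are on the same side of the negative real axis. -/
theorem log_sub_eq (hu : 2 * ‖u‖ < R) (hw : w ∈ farSet R) :
    Complex.log (Complex.I * (w - u)) =
      Complex.log (Complex.I * w) + Complex.log (1 - u * w⁻¹) := by
  have hR : 0 < R := by linarith [norm_nonneg u]
  have hw0 := ne_zero_of_mem_farSet hR.le hw
  have hb := one_sub_re_pos hu (inv_mem_ball hR hw)
  have e : Complex.I * (w - u) = Complex.I * w * (1 - u * w⁻¹) := by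
    field_simp
  have harg := abs_lt.mp (abs_arg_lt hb)
  have ha0 : Complex.I * w ≠ 0 := mul_ne_zero Complex.I_ne_zero hw0
  have hb0 : 1 - u * w⁻¹ ≠ 0 := fun h => by simp [h] at hb
  have hu2 := Complex.abs_re_le_norm u
  rw [e]
  rcases hw.2 with h | h
  · exact log_mul_of_re_pos (by simpa using h) hb
  · -- the imaginary parts of `𝗂 λ` and of `𝗂 (λ - u)` have the same sign
    have him : (Complex.I * w * (1 - u * w⁻¹)).im = w.re - u.re := by
      rw [← e]; simp
    have hn : 0 < ‖Complex.I * w‖ * ‖1 - u * w⁻¹‖ :=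
      mul_pos (norm_pos_iff.mpr ha0) (norm_pos_iff.mpr hb0)
    rw [im_mul_eq] at him
    have hpi := Real.pi_pos
    have h5 := Complex.neg_pi_lt_arg (Complex.I * w)
    have h6 := Complex.arg_le_pi (Complex.I * w)
    refine Complex.log_mul ha0 hb0 ⟨?_, ?_⟩
    · by_contra hlt
      have hneg : (Complex.I * w).arg < 0 := by linarith
      have hre : w.re < 0 := by simpa using Complex.arg_neg_iff.mp hneg
      rw [abs_of_neg hre] at h
      have hs : 0 ≤ Real.sin ((Complex.I * w).arg + (1 - u * w⁻¹).arg) := by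
        rw [← Real.sin_add_two_pi]
        exact Real.sin_nonneg_of_nonneg_of_le_pi (by linarith) (by linarith)
      have := mul_nonneg hn.le hs
      rw [him] at this
      linarith [neg_abs_le u.re, norm_nonneg u]
    · by_contra hlt
      have hnn : 0 < (Complex.I * w).arg := by linarith
      have hre : 0 ≤ w.re := by simpa using Complex.arg_nonneg_iff.mp hnn.le
      rw [abs_of_nonneg hre] at h
      have hs : Real.sin ((Complex.I * w).arg + (1 - u * w⁻¹).arg) ≤ 0 := by
        rw [← Real.sin_sub_two_pi]
        exact Real.sin_nonpos_of_nonpos_of_neg_pi_le (by linarith) (by linarith)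
      have := mul_nonpos_of_nonneg_of_nonpos hn.le hs
      rw [him] at this
      linarith [le_abs_self u.re, norm_nonneg u]

/-- The function `√(1 - u x)`. -/
def rootInf (u x : ℂ) : ℂ := Complex.exp (1 / 2 * Complex.log (1 - u * x))

theorem rootInf_ne_zero (u x : ℂ) : rootInf u x ≠ 0 := Complex.exp_ne_zero _

theorem rootInf_zero (u : ℂ) : rootInf u 0 = 1 := by simp [rootInf]

theorem rootInf_sq (hu : 2 * ‖u‖ < R) {x : ℂ} (hx : x ∈ Metric.ball (0 : ℂ) R⁻¹) :
    rootInf u x * rootInf u x = 1 - u * x := by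
  have hb := one_sub_re_pos hu hx
  rw [rootInf, ← Complex.exp_add, ← add_mul]
  norm_num
  rw [Complex.exp_log fun h => by simp [h] at hb]

theorem rootInf_re_pos (hu : 2 * ‖u‖ < R) {x : ℂ} (hx : x ∈ Metric.ball (0 : ℂ) R⁻¹) :
    0 < (rootInf u x).re := exp_half_log_re_pos (Or.inl (one_sub_re_pos hu hx))

theorem hasDerivAt_log_one_sub (hu : 2 * ‖u‖ < R) {x : ℂ} (hx : x ∈ Metric.ball (0 : ℂ) R⁻¹) :
    HasDerivAt (fun x => Complex.log (1 - u * x)) (-u / (1 - u * x)) x := by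
  have h := (((hasDerivAt_id x).const_mul u).const_sub 1).clog (Or.inl (one_sub_re_pos hu hx))
  simpa using h

theorem hasDerivAt_rootInf (hu : 2 * ‖u‖ < R) {x : ℂ} (hx : x ∈ Metric.ball (0 : ℂ) R⁻¹) :
    HasDerivAt (rootInf u) (-u / (2 * rootInf u x)) x := by
  have h := ((hasDerivAt_log_one_sub hu hx).const_mul (1 / 2 : ℂ)).cexp
  refine h.congr_deriv ?_
  change rootInf u x * _ = _
  rw [← rootInf_sq hu hx]
  have := rootInf_ne_zero u x
  field_simp

theorem rootAt_eq_rootInf (hu : 2 * ‖u‖ < R) (hw : w ∈ farSet R) :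
    rootAt u w = rootAt 0 w * rootInf u w⁻¹ := by
  rw [rootAt, rootAt, rootInf, ← Complex.exp_add, sub_zero, log_sub_eq hu hw, mul_add]

end

section

variable (t : Fin 2 → ℂ)

/-- A radius that is large with respect to the canonical coordinates. -/
def farRadius : ℝ := 2 * (‖canonCoord t 0‖ + ‖canonCoord t 1‖ + 1)

theorem farRadius_pos : 0 < farRadius t := by
  rw [farRadius]
  positivity

theorem lt_farRadius (i : Fin 2) : 2 * ‖canonCoord t i‖ < farRadius t := by
  have h0 := norm_nonneg (canonCoord t 0)
  have h1 := norm_nonneg (canonCoord t 1)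
  rw [farRadius]
  revert i
  exact Fin.forall_fin_two.mpr ⟨by linarith, by linarith⟩

theorem mem_cutPlane_of_mem_farSet {w : ℂ} (hw : w ∈ farSet (farRadius t)) : w ∈ cutPlane t :=
  (mem_cutPlane_iff t w).mpr fun i => mem_slitPlane_of_mem_farSet (lt_farRadius t i) hw

/-- The disk of the variable `x = λ⁻¹`. -/
def farBall : Set ℂ := Metric.ball (0 : ℂ) (farRadius t)⁻¹

theorem farBall_mem_nhds : farBall t ∈ nhds (0 : ℂ) :=
  Metric.ball_mem_nhds _ (inv_pos.mpr (farRadius_pos t))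

theorem analyticAt_zero_of_farBall {g : ℂ → ℂ} (hg : DifferentiableOn ℂ g (farBall t)) :
    AnalyticAt ℂ g 0 := hg.analyticAt (farBall_mem_nhds t)

/-- The function `p` with `√((λ - u^1)(λ - u^2)) = λ p(λ⁻¹)`. -/
def prodInf (x : ℂ) : ℂ := rootInf (canonCoord t 0) x * rootInf (canonCoord t 1) x

/-- The function `h` such that the primitive of `1 / √((λ - u^1)(λ - u^2))` is
`log λ + h(λ⁻¹)`. -/
def logInf (x : ℂ) : ℂ :=
  2 * Complex.log ((rootInf (canonCoord t 0) x + rootInf (canonCoord t 1) x) / 2)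

theorem prodInf_ne_zero (x : ℂ) : prodInf t x ≠ 0 :=
  mul_ne_zero (rootInf_ne_zero _ _) (rootInf_ne_zero _ _)

theorem prodInf_zero : prodInf t 0 = 1 := by
  rw [prodInf, rootInf_zero, rootInf_zero, mul_one]

theorem logInf_zero : logInf t 0 = 0 := by
  rw [logInf, rootInf_zero, rootInf_zero]
  norm_num

theorem differentiableOn_prodInf : DifferentiableOn ℂ (prodInf t) (farBall t) := fun _ hx =>
  ((hasDerivAt_rootInf (lt_farRadius t 0) hx).mul
    (hasDerivAt_rootInf (lt_farRadius t 1) hx)).differentiableAt.differentiableWithinAt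

variable {t}

theorem hasDerivAt_logInf {x : ℂ} (hx : x ∈ farBall t) :
    HasDerivAt (logInf t) (deriv (logInf t) x) x ∧
      prodInf t x * (1 - x * deriv (logInf t) x) = 1 := by
  set q := rootInf (canonCoord t 0) x with hq
  set q' := rootInf (canonCoord t 1) x with hq'
  have hm := add_div_two_mem_slitPlane (rootInf_re_pos (lt_farRadius t 0) hx)
    (rootInf_re_pos (lt_farRadius t 1) hx)
  have h := ((((hasDerivAt_rootInf (lt_farRadius t 0) hx).add
    (hasDerivAt_rootInf (lt_farRadius t 1) hx)).div_const 2).clog hm).const_mul 2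
  have h' : HasDerivAt (logInf t) _ x := h
  refine ⟨h'.differentiableAt.hasDerivAt, ?_⟩
  rw [h'.deriv, prodInf]
  simp only [Pi.add_apply]
  rw [← hq, ← hq']
  have e1 : q * q = 1 - canonCoord t 0 * x := rootInf_sq (lt_farRadius t 0) hx
  have e2 : q' * q' = 1 - canonCoord t 1 * x := rootInf_sq (lt_farRadius t 1) hx
  have h0 : q ≠ 0 := rootInf_ne_zero _ _
  have h1 : q' ≠ 0 := rootInf_ne_zero _ _
  have h2 : q + q' ≠ 0 := fun h => by
    rw [← hq, ← hq', h, zero_div] at hm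
    exact Complex.zero_notMem_slitPlane hm
  field_simp
  linear_combination q' * e1 + q * e2

theorem prodInf_sq (ht : t 1 ∈ Complex.slitPlane) {x : ℂ} (hx : x ∈ farBall t) :
    prodInf t x * prodInf t x = (1 - t 0 * x) * (1 - t 0 * x) - 4 * t 1 * (x * x) := by
  have e1 := rootInf_sq (lt_farRadius t 0) hx
  have e2 := rootInf_sq (lt_farRadius t 1) hx
  have hσ := sqrt_sq ht
  have e0 : canonCoord t 0 = t 0 + 2 * (t 1) ^ (1 / 2 : ℂ) := rfl
  have e0' : canonCoord t 1 = t 0 - 2 * (t 1) ^ (1 / 2 : ℂ) := rfl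
  calc _ = (rootInf (canonCoord t 0) x * rootInf (canonCoord t 0) x) *
        (rootInf (canonCoord t 1) x * rootInf (canonCoord t 1) x) := by rw [prodInf]; ring
    _ = _ := by
      rw [e1, e2, e0, e0']
      linear_combination -4 * x * x * hσ

theorem prodRoot_eq {w : ℂ} (hw : w ∈ farSet (farRadius t)) :
    prodRoot (canonCoord t 0) (canonCoord t 1) w = w * prodInf t w⁻¹ := by
  have h0 := rootAt_mul_self (u := 0) (ne_zero_of_mem_farSet (farRadius_pos t).le hw)
  rw [prodRoot, rootAt_eq_rootInf (lt_farRadius t 0) hw, rootAt_eq_rootInf (lt_farRadius t 1) hw,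
    prodInf]
  rw [sub_zero] at h0
  linear_combination (-Complex.I * rootInf (canonCoord t 0) w⁻¹ * rootInf (canonCoord t 1) w⁻¹) *
    h0 - w * rootInf (canonCoord t 0) w⁻¹ * rootInf (canonCoord t 1) w⁻¹ * Complex.I_sq

/-- The primitive is normalised so that no constant appears in its expansion at infinity. -/
theorem logPrim_eq {w : ℂ} (hw : w ∈ farSet (farRadius t)) :
    logPrim (canonCoord t 0) (canonCoord t 1) w = cutLog w + logInf t w⁻¹ := by
  have hR := farRadius_pos t
  have hx := inv_mem_ball hR hw
  have hre : 0 < ((rootInf (canonCoord t 0) w⁻¹ + rootInf (canonCoord t 1) w⁻¹) / 2).re := by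
    rw [Complex.div_ofNat_re, Complex.add_re]
    have h1 := rootInf_re_pos (lt_farRadius t 0) hx
    have h2 := rootInf_re_pos (lt_farRadius t 1) hx
    positivity
  have hs : Complex.I * (w - 0) ∈ Complex.slitPlane :=
    mem_slitPlane_of_mem_farSet (by simpa using hR) hw
  have him : (1 / 2 * Complex.log (Complex.I * (w - 0))).im = (Complex.I * (w - 0)).arg / 2 := by
    rw [show (1 / 2 : ℂ) = ((1 / 2 : ℝ) : ℂ) by norm_num, Complex.im_ofReal_mul, Complex.log_im]
    ring
  have h3 := Complex.neg_pi_lt_arg (Complex.I * (w - 0))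
  have h4 := Complex.arg_le_pi (Complex.I * (w - 0))
  have hpi := Real.pi_pos
  have e : (rootAt (canonCoord t 0) w + rootAt (canonCoord t 1) w) / 2 =
      rootAt 0 w * ((rootInf (canonCoord t 0) w⁻¹ + rootInf (canonCoord t 1) w⁻¹) / 2) := by
    rw [rootAt_eq_rootInf (lt_farRadius t 0) hw, rootAt_eq_rootInf (lt_farRadius t 1) hw]
    ring
  rw [logPrim, e, log_mul_of_re_pos (rootAt_re_pos hs) hre, rootAt,
    Complex.log_exp (by rw [him]; linarith) (by rw [him]; linarith), cutLog, logInf, sub_zero]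
  ring

end

/-! ### The asymptotic expansions of the period vectors -/

section

variable (ψ : ℂ) (t a : Fin 2 → ℂ)

/-- The expansions of the period vector with index `0`: the formal derivative `∂_λ` of `baseSer`. -/
def derivSer : Fin 2 → PowerSeries ℂ :=
  ![PowerSeries.C (a 0 + a 1) * (PowerSeries.X *
      (1 - PowerSeries.X * PowerSeries.derivative ℂ (taylorSer (logInf t)))),
    PowerSeries.C ((a 0 + a 1) / 2) * (taylorSer (prodInf t) -
      PowerSeries.X * PowerSeries.derivative ℂ (taylorSer (prodInf t)))]

/-- The expansions of the period vector with index `-1`. -/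
def baseSer : Fin 2 → AsympSeries :=
  ![asympConst (a 0 + a 1) * asympLog + (asympConst (-((a 0 + a 1) / 2 * Complex.log (t 1)) +
      a 1 * (Real.pi * Complex.I)) + asympConst (a 0 + a 1) * emb (taylorSer (logInf t))),
    asympVar * emb (PowerSeries.C ((a 0 + a 1) / 2) * taylorSer (prodInf t))]

/-- The formal version of `∂_λ (log λ + h(λ⁻¹)) = 1 / (λ p(λ⁻¹))`. -/
theorem taylorSer_prodInf_mul :
    taylorSer (prodInf t) * (1 - PowerSeries.X * PowerSeries.derivative ℂ (taylorSer (logInf t))) =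
      1 := by
  have hp := analyticAt_zero_of_farBall t (differentiableOn_prodInf t)
  have hh : AnalyticAt ℂ (logInf t) 0 := analyticAt_zero_of_farBall t fun x hx =>
    (hasDerivAt_logInf hx).1.differentiableAt.differentiableWithinAt
  have hx : AnalyticAt ℂ (fun x : ℂ => x) 0 := analyticAt_id
  have e1 : taylorSer (fun x => prodInf t x * (1 + (-1) * (x * deriv (logInf t) x))) =
      taylorSer fun _ => 1 := by
    refine taylorSer_congr ?_
    filter_upwards [farBall_mem_nhds t] with x hx
    have := (hasDerivAt_logInf hx).2
    linear_combination this
  have h3 := hx.fun_mul hh.deriv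
  rw [taylorSer_mul hp (analyticAt_const.fun_add (analyticAt_const.fun_mul h3)),
    taylorSer_add analyticAt_const (analyticAt_const.fun_mul h3), taylorSer_const_mul _ h3,
    taylorSer_mul hx hh.deriv, taylorSer_id, ← taylorSer_derivative, taylorSer_const, map_neg,
    map_one] at e1
  linear_combination e1

theorem taylorSer_prodInf_sq (ht : t 1 ∈ Complex.slitPlane) :
    taylorSer (prodInf t) * taylorSer (prodInf t) =
      (1 - PowerSeries.C (t 0) * PowerSeries.X) * (1 - PowerSeries.C (t 0) * PowerSeries.X) -
        PowerSeries.C (4 * t 1) * (PowerSeries.X * PowerSeries.X) := by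
  have hp := analyticAt_zero_of_farBall t (differentiableOn_prodInf t)
  have hx : AnalyticAt ℂ (fun x : ℂ => x) 0 := analyticAt_id
  have e1 : taylorSer (fun x => prodInf t x * prodInf t x) =
      taylorSer fun x => (1 + (-t 0) * x) * (1 + (-t 0) * x) + (-(4 * t 1)) * (x * x) := by
    refine taylorSer_congr ?_
    filter_upwards [farBall_mem_nhds t] with x hx
    rw [prodInf_sq ht hx]
    ring
  have h1 : AnalyticAt ℂ (fun x : ℂ => 1 + (-t 0) * x) 0 := by fun_prop
  rw [taylorSer_mul hp hp, taylorSer_add (h1.fun_mul h1) (by fun_prop), taylorSer_mul h1 h1,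
    taylorSer_add analyticAt_const (by fun_prop), taylorSer_const_mul _ hx,
    taylorSer_const_mul _ (hx.fun_mul hx), taylorSer_mul hx hx, taylorSer_id, taylorSer_const,
    map_neg, map_neg, map_one] at e1
  linear_combination e1

theorem taylorSer_prodInf_ne_zero : taylorSer (prodInf t) ≠ 0 := by
  intro h
  have := taylorSer_prodInf_mul t
  rw [h, zero_mul] at this
  exact zero_ne_one this

theorem mul_derivSer_zero : taylorSer (prodInf t) * derivSer t a 0 =
    PowerSeries.C (a 0 + a 1) * PowerSeries.X := by
  have h := taylorSer_prodInf_mul t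
  rw [derivSer, Matrix.cons_val_zero]
  linear_combination PowerSeries.C (a 0 + a 1) * PowerSeries.X * h

theorem mul_derivSer_one (ht : t 1 ∈ Complex.slitPlane) : taylorSer (prodInf t) * derivSer t a 1 =
    PowerSeries.C ((a 0 + a 1) / 2) * (1 - PowerSeries.C (t 0) * PowerSeries.X) := by
  have h := taylorSer_prodInf_sq t ht
  have h2 := congrArg (PowerSeries.derivative ℂ) h
  simp only [Derivation.leibniz, map_sub, smul_eq_mul, PowerSeries.derivative_X,
    PowerSeries.derivative_C, Derivation.map_one_eq_zero] at h2
  have h20 : (2 : PowerSeries ℂ) ≠ 0 := fun h => by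
    have h2 := congrArg PowerSeries.constantCoeff h
    rw [map_ofNat, map_zero] at h2
    exact two_ne_zero h2
  refine mul_left_cancel₀ h20 ?_
  rw [derivSer]
  simp only [Matrix.cons_val_one, Matrix.cons_val_fin_one]
  linear_combination PowerSeries.C ((a 0 + a 1) / 2) * (2 * h - PowerSeries.X * h2)

/-- The first row of `(𝒰 - λ) I^{(0)} = (μ - 1/2) I^{(-1)}`, multiplied by `λ⁻¹`; its right-hand
side vanishes. -/
theorem derivSer_row_zero (ht : t 1 ∈ Complex.slitPlane) :
    PowerSeries.X * (PowerSeries.C (t 0) * derivSer t a 0 + 2 * derivSer t a 1) -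
      derivSer t a 0 = 0 := by
  have h0 := mul_derivSer_zero t a
  have h1 := mul_derivSer_one t a ht
  refine mul_left_cancel₀ (taylorSer_prodInf_ne_zero t) ?_
  have e : PowerSeries.C (a 0 + a 1) = 2 * PowerSeries.C ((a 0 + a 1) / 2) := by
    rw [two_mul, ← map_add, add_halves]
  rw [e] at h0
  linear_combination (PowerSeries.X * PowerSeries.C (t 0) - 1) * h0 + 2 * PowerSeries.X * h1

/-- The second row of `(𝒰 - λ) I^{(0)} = (μ - 1/2) I^{(-1)}`, multiplied by `λ⁻¹`. -/
theorem derivSer_row_one (ht : t 1 ∈ Complex.slitPlane) :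
    PowerSeries.X * (PowerSeries.C (2 * t 1) * derivSer t a 0 +
      PowerSeries.C (t 0) * derivSer t a 1) - derivSer t a 1 =
      -(PowerSeries.C ((a 0 + a 1) / 2) * taylorSer (prodInf t)) := by
  have h0 := mul_derivSer_zero t a
  have h1 := mul_derivSer_one t a ht
  refine mul_left_cancel₀ (taylorSer_prodInf_ne_zero t) ?_
  have e : PowerSeries.C (a 0 + a 1) = 2 * PowerSeries.C ((a 0 + a 1) / 2) := by
    rw [two_mul, ← map_add, add_halves]
  have e2 : PowerSeries.C (4 * t 1) = 2 * PowerSeries.C (2 * t 1) := by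
    rw [two_mul, ← map_add]
    congr 1
    ring
  have h2 := taylorSer_prodInf_sq t ht
  rw [e] at h0
  rw [e2] at h2
  linear_combination PowerSeries.X * PowerSeries.C (2 * t 1) * h0 +
    (PowerSeries.X * PowerSeries.C (t 0) - 1) * h1 + PowerSeries.C ((a 0 + a 1) / 2) * h2

theorem coeff_emb_of_row {Y Z Q : PowerSeries ℂ} (h : PowerSeries.X * Y - Z = Q) (n : ℤ) :
    (emb Y).coeff n - (emb Z).coeff (n + 1) = (emb Q).coeff (n + 1) := by
  have hX : emb PowerSeries.X = HahnSeries.single 1 1 := by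
    rw [emb, RingHom.comp_apply, PowerSeries.map_X, HahnSeries.ofPowerSeries_X]
  rw [← h, map_sub, map_mul, hX, HahnSeries.coeff_sub, HahnSeries.coeff_single_mul, one_mul,
    add_sub_cancel_right]

theorem coeff_formalDeriv (φ : AsympSeries) (n : ℤ) : (formalDeriv φ).coeff n =
    Polynomial.derivative (φ.coeff (n - 1)) - ((n : ℂ) - 1) • φ.coeff (n - 1) := rfl

theorem formalDeriv_emb (φ : PowerSeries ℂ) : formalDeriv (emb φ) = emb (derInf φ) := by
  refine emb_ext (fun n hn => ?_) fun n => ?_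
  · rw [coeff_formalDeriv, van_emb φ _ (by omega)]
    simp
  · rw [coeff_formalDeriv]
    rcases n with _ | n
    · rw [van_emb φ _ (by omega), coeff_derInf_zero]
      simp
    · rw [show ((n + 1 : ℕ) : ℤ) - 1 = n by push_cast; ring, coeff_emb, coeff_derInf_succ,
        Polynomial.derivative_C, Polynomial.smul_C]
      push_cast
      simp

theorem formalDeriv_baseSer (i : Fin 2) : formalDeriv (baseSer t a i) = emb (derivSer t a i) := by
  revert i
  refine Fin.forall_fin_two.mpr ⟨?_, ?_⟩
  · have hD : derivSer t a 0 = PowerSeries.C (a 0 + a 1) * PowerSeries.X +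
        derInf (PowerSeries.C (a 0 + a 1) * taylorSer (logInf t)) := by
      rw [derivSer, derInf, Derivation.leibniz, PowerSeries.derivative_C, Matrix.cons_val_zero,
        smul_eq_mul, smul_zero]
      ring
    have hX : emb (PowerSeries.C (a 0 + a 1) * PowerSeries.X) =
        asympConst (a 0 + a 1) * HahnSeries.single 1 1 := by
      rw [map_mul]
      congr 1
      · rw [emb, RingHom.comp_apply, PowerSeries.map_C, HahnSeries.ofPowerSeries_C]
        rfl
      · rw [emb, RingHom.comp_apply, PowerSeries.map_X, HahnSeries.ofPowerSeries_X]
    rw [hD, map_add, ← formalDeriv_emb, hX, ← PowerSeries.smul_eq_C_mul _ (a 0 + a 1), emb_smul,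
      baseSer, Matrix.cons_val_zero]
    ext1
    funext n
    simp only [HahnSeries.coeff_add, coeff_formalDeriv, asympConst_mul, HahnSeries.coeff_smul,
      map_add, smul_add, Polynomial.derivative_smul]
    have hc : ∀ (c : ℂ) (n : ℤ), (asympConst c).coeff n = if n = 0 then Polynomial.C c else 0 := by
      intro c n
      rw [asympConst, HahnSeries.C_apply, HahnSeries.coeff_single]
      simp [eq_comm]
    have hl : ∀ (n : ℤ), asympLog.coeff n = if n = 0 then Polynomial.X else 0 := by
      intro n
      rw [asympLog, HahnSeries.C_apply, HahnSeries.coeff_single]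
      simp [eq_comm]
    rw [hc, hl]
    by_cases hn : n = 1
    · subst hn
      simp
    · rw [if_neg (by omega), if_neg (by omega), HahnSeries.coeff_single_of_ne hn]
      simp
  · have hv : ∀ n : ℤ, (baseSer t a 1).coeff n =
        (emb (PowerSeries.C ((a 0 + a 1) / 2) * taylorSer (prodInf t))).coeff (n + 1) := fun n => by
      rw [baseSer]
      exact coeff_asympVar_mul _ _
    refine emb_ext (fun n hn => ?_) fun n => ?_
    · rw [coeff_formalDeriv, hv, van_emb _ _ (by omega)]
      simp
    · rw [coeff_formalDeriv, hv, sub_add_cancel, coeff_emb, Polynomial.derivative_C,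
        Polynomial.smul_C, zero_sub, ← map_neg, derivSer, Matrix.cons_val_one,
        Matrix.cons_val_fin_one, PowerSeries.coeff_C_mul, PowerSeries.coeff_C_mul, map_sub]
      congr 1
      rcases n with _ | n
      · simp
      · rw [PowerSeries.coeff_succ_X_mul, PowerSeries.coeff_derivative, smul_eq_mul]
        push_cast
        ring

/-- Both sides solve the formal period system with index `-1`, and they agree in the two
coefficients that determine a solution. In the first component this is the place where
`(S_1)_{12} = ψ + log t^2` is matched with the branch of the primitive. -/
theorem formalPeriod_neg_one (ht : t 1 ∈ Complex.slitPlane) :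
    formalPeriod ψ t a (-1) = baseSer t a := by
  have hv : ∀ n : ℤ, (baseSer t a 1).coeff n =
      (emb (PowerSeries.C ((a 0 + a 1) / 2) * taylorSer (prodInf t))).coeff (n + 1) := fun n => by
    rw [baseSer]
    exact coeff_asympVar_mul _ _
  refine asymp_eq_of_system t (fun i n => ?_) ?_ ?_ ?_
  · simp only [formalDeriv_formalPeriod]
    rw [formalPeriod_algebraic]
    congr 1
    push_cast
    ring
  · have hconst : ∀ (c : ℂ) (Y : PowerSeries ℂ) (n : ℤ),
        (emb (PowerSeries.C c * Y)).coeff n = c • (emb Y).coeff n := by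
      intro c Y n
      rw [← PowerSeries.smul_eq_C_mul, emb_smul, HahnSeries.coeff_smul]
    simp only [formalDeriv_baseSer]
    refine Fin.forall_fin_two.mpr ⟨fun n => ?_, fun n => ?_⟩
    · have h := coeff_emb_of_row (derivSer_row_zero t a ht) n
      rw [map_add, HahnSeries.coeff_add, hconst, ← map_ofNat (PowerSeries.C (R := ℂ)) 2,
        hconst, map_zero, HahnSeries.coeff_zero] at h
      rw [Fin.sum_univ_two, show mu 0 0 - 1 / 2 = 0 by simp [mu], zero_smul]
      exact h
    · have h := coeff_emb_of_row (derivSer_row_one t a ht) n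
      rw [map_add, HahnSeries.coeff_add, hconst, hconst, map_neg, HahnSeries.coeff_neg] at h
      rw [Fin.sum_univ_two, show mu 1 1 - 1 / 2 = -1 by simp [mu]; norm_num, hv, neg_one_smul]
      exact h
  · have h1 : signedS ψ t 1 = (-1 : ℂ) ^ 1 • calS ψ t 1 := by
      exact_mod_cast signedS_natCast ψ t 1
    have h2 : (emb (taylorSer (logInf t))).coeff 0 = 0 := by
      have := coeff_emb (taylorSer (logInf t)) 0
      rw [coeff_zero_taylorSer, logInf_zero, map_zero] at this
      exact_mod_cast this
    rw [coeff_formalPeriod, baseSer, Matrix.cons_val_zero]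
    simp only [asympConst_mul, HahnSeries.coeff_add, HahnSeries.coeff_smul, h2]
    rw [show (0 : ℤ) - 1 - -1 = 0 by ring, show (0 : ℤ) - -1 = 1 by ring, zero_sub, signedS_zero,
      h1, thetaCoeff_neg_one, chiCoeff_zero, Matrix.smul_apply, calS_one_apply]
    simp only [asympLog, asympConst, HahnSeries.C_apply, HahnSeries.coeff_single_same]
    simp only [Polynomial.smul_eq_C_mul, Matrix.one_apply_eq, map_one, one_mul, mul_zero, add_zero,
      pow_one, smul_eq_mul, neg_mul, map_neg, ← map_mul, add_assoc]
    congr 1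
    rw [← map_neg, ← map_add]
    congr 1
    ring
  · rw [hv, neg_add_cancel, coeff_formalPeriod]
    have h2 := coeff_emb (PowerSeries.C ((a 0 + a 1) / 2) * taylorSer (prodInf t)) 0
    rw [PowerSeries.coeff_C_mul, coeff_zero_taylorSer, prodInf_zero, mul_one] at h2
    have h3 := chiCoeff_succ a (-1)
    rw [neg_add_cancel, chiCoeff_zero] at h3
    rw [Nat.cast_zero] at h2
    rw [h2, h3, signedS_of_neg ψ t (by omega), sub_self, signedS_zero]
    simp

end

section

variable {t a : Fin 2 → ℂ}

theorem HasAsympExp.congr_farSet {g h : ℂ → ℂ} {φ : AsympSeries} (hg : HasAsympExp g φ) {R : ℝ}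
    (e : ∀ w ∈ farSet R, g w = h w) : HasAsympExp h φ :=
  hg.congr fun _ h1 h2 => (eventually_mem_farSet R h1 h2).mono fun _ hr => e _ hr

/-- Near `λ = ∞` the function `f` is a holomorphic function of `λ⁻¹`, with Taylor series `φ`. -/
def IsFarSum (t : Fin 2 → ℂ) (f : ℂ → ℂ) (φ : PowerSeries ℂ) : Prop :=
  ∃ g : ℂ → ℂ, DifferentiableOn ℂ g (farBall t) ∧ (∀ w ∈ farSet (farRadius t), g w⁻¹ = f w) ∧
    taylorSer g = φ

theorem IsFarSum.hasAsympExp {f : ℂ → ℂ} {φ : PowerSeries ℂ} (h : IsFarSum t f φ) :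
    HasAsympExp f (emb φ) := by
  obtain ⟨g, hd, hg, rfl⟩ := h
  exact (hasAsympExp_taylorSer (analyticAt_zero_of_farBall t hd)).congr_farSet hg

theorem IsFarSum.congr {f f' : ℂ → ℂ} {φ : PowerSeries ℂ} (h : IsFarSum t f φ)
    (e : ∀ w ∈ farSet (farRadius t), f w = f' w) : IsFarSum t f' φ := by
  obtain ⟨g, hd, hg, hφ⟩ := h
  exact ⟨g, hd, fun w hw => (hg w hw).trans (e w hw), hφ⟩

theorem IsFarSum.deriv {f : ℂ → ℂ} {φ : PowerSeries ℂ} (h : IsFarSum t f φ) :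
    IsFarSum t (deriv f) (derInf φ) := by
  obtain ⟨g, hd, hg, rfl⟩ := h
  have hd' : DifferentiableOn ℂ (_root_.deriv g) (farBall t) := hd.deriv Metric.isOpen_ball
  have hg0 := analyticAt_zero_of_farBall t hd'
  have hx : AnalyticAt ℂ (fun x : ℂ => x) 0 := analyticAt_id
  refine ⟨fun x => (-1) * (x * (x * _root_.deriv g x)), ?_, fun w hw => ?_, ?_⟩
  · exact (differentiableOn_id.mul (differentiableOn_id.mul hd')).const_mul _
  · have hw0 := ne_zero_of_mem_farSet (farRadius_pos t).le hw
    have e : f =ᶠ[nhds w] fun w => g w⁻¹ :=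
      Filter.eventuallyEq_of_mem ((isOpen_farSet _).mem_nhds hw) fun v hv => (hg v hv).symm
    have h1 := (hd.differentiableAt (Metric.isOpen_ball.mem_nhds
      (inv_mem_ball (farRadius_pos t) hw))).hasDerivAt
    have h2 := h1.comp w (hasDerivAt_inv hw0)
    rw [e.deriv_eq]
    refine Eq.trans ?_ h2.deriv.symm
    field_simp
  · rw [taylorSer_const_mul _ (hx.fun_mul (hx.fun_mul hg0)), taylorSer_mul hx (hx.fun_mul hg0),
      taylorSer_mul hx hg0, taylorSer_id, ← taylorSer_derivative, derInf, map_neg, map_one]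
    ring

theorem period_apply (l : ℤ) (w : ℂ) (i : Fin 2) : period t a l w i =
    a 0 * periodVector t 0 l w i + a 1 * periodVector t 1 l w i := by
  rw [period, Fin.sum_univ_two]
  rfl

theorem period_succ (ht : t 1 ∈ Complex.slitPlane) (l : ℤ) (i : Fin 2) {w : ℂ}
    (hw : w ∈ cutPlane t) :
    period t a (l + 1) w i = deriv (fun w => period t a l w i) w := by
  have h : ∀ k, HasDerivAt (fun w => periodVector t k l w i) (periodVector t k (l + 1) w i) w := by
    intro k
    rw [periodVector_succ ht k l hw]
    exact hasDerivAt_pi.mp (((isPeriodVector_periodVector ht k l).1.differentiableAt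
      ((isOpen_cutPlane t).mem_nhds hw)).hasDerivAt) i
  simp only [period_apply]
  exact (((h 0).const_mul (a 0)).add ((h 1).const_mul (a 1))).deriv.symm

/-- `I_a^{(0)}` only depends on `a_1 + a_2`, since `I^{(-1)}_{e_1}` and `I^{(-1)}_{e_2}` differ by a
constant. -/
theorem period_zero (ht : t 1 ∈ Complex.slitPlane) {w : ℂ} (hw : w ∈ cutPlane t) :
    period t a 0 w = ![(a 0 + a 1) * (prodRoot (canonCoord t 0) (canonCoord t 1) w)⁻¹,
      (a 0 + a 1) * ((w - t 0) / prodRoot (canonCoord t 0) (canonCoord t 1) w / 2)] := by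
  have h : ∀ k, periodVector t k 0 w = ![(prodRoot (canonCoord t 0) (canonCoord t 1) w)⁻¹,
      (w - t 0) / prodRoot (canonCoord t 0) (canonCoord t 1) w / 2] := by
    intro k
    have h1 := periodVector_succ ht k (-1) hw
    rw [neg_add_cancel] at h1
    rw [h1, (Filter.eventuallyEq_of_mem ((isOpen_cutPlane t).mem_nhds hw)
      (periodVector_neg_one ht k)).deriv_eq, (hasDerivAt_basePeriod k hw).deriv]
  funext i
  rw [period_apply, h, h, ← add_mul]
  fin_cases i <;> rfl

/-- The period system, solved for the vector with the smaller index. -/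
theorem period_lower (ht : t 1 ∈ Complex.slitPlane) {l : ℤ} (hl0 : l ≠ 0) (hl1 : l + 1 ≠ 0)
    (i : Fin 2) {w : ℂ} (hw : w ∈ cutPlane t) :
    period t a l w i = (mu i i + l + 1 / 2)⁻¹ * ((calU t i 0 * period t a (l + 1) w 0 +
      calU t i 1 * period t a (l + 1) w 1) + (-1) * (w * period t a (l + 1) w i)) := by
  simp only [period_apply]
  rw [periodVector_lower ht 0 hl0 hl1 hw, periodVector_lower ht 1 hl0 hl1 hw]
  have e0 : mu 0 0 + (l : ℂ) + 1 / 2 = l + 1 := by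
    simp only [mu, Matrix.of_apply, Matrix.cons_val_zero]
    ring
  have e1 : mu 1 1 + (l : ℂ) + 1 / 2 = l := by
    simp only [mu, Matrix.of_apply, Matrix.cons_val_one, Matrix.cons_val_fin_one]
    ring
  revert i
  refine Fin.forall_fin_two.mpr ⟨?_, ?_⟩
  · rw [e0]
    simp only [Matrix.mulVec_diagonal, Matrix.mulVec, dotProduct, Fin.sum_univ_two,
      Matrix.sub_apply, Matrix.smul_apply, Matrix.one_apply, Matrix.cons_val_zero, smul_eq_mul,
      Matrix.diagonal_apply]
    norm_num
    ring
  · rw [e1]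
    simp only [Matrix.mulVec_diagonal, Matrix.mulVec, dotProduct, Fin.sum_univ_two,
      Matrix.sub_apply, Matrix.smul_apply, Matrix.one_apply, Matrix.cons_val_zero, smul_eq_mul,
      Matrix.diagonal_apply]
    norm_num
    ring

variable (t a)

theorem isFarSum_period_zero (ht : t 1 ∈ Complex.slitPlane) (i : Fin 2) :
    IsFarSum t (fun w => period t a 0 w i) (derivSer t a i) := by
  have hp := analyticAt_zero_of_farBall t (differentiableOn_prodInf t)
  -- both components are polynomials in `λ⁻¹` divided by `p(λ⁻¹)`
  have key : ∀ {q : ℂ → ℂ} {Q : PowerSeries ℂ}, Differentiable ℂ q →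
      taylorSer (prodInf t) * Q = taylorSer q →
      DifferentiableOn ℂ (fun x => q x / prodInf t x) (farBall t) ∧
        taylorSer (fun x => q x / prodInf t x) = Q := by
    intro q Q hq hQ
    have hd : DifferentiableOn ℂ (fun x => q x / prodInf t x) (farBall t) :=
      hq.differentiableOn.div (differentiableOn_prodInf t) fun x _ => prodInf_ne_zero t x
    refine ⟨hd, mul_left_cancel₀ (taylorSer_prodInf_ne_zero t) ?_⟩
    rw [hQ, ← taylorSer_mul hp (analyticAt_zero_of_farBall t hd)]
    congr 1
    funext x
    exact mul_div_cancel₀ _ (prodInf_ne_zero t x)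
  have hx : AnalyticAt ℂ (fun x : ℂ => x) 0 := analyticAt_id
  have h2 : AnalyticAt ℂ (fun x : ℂ => (-t 0) * x) 0 := by fun_prop
  revert i
  refine Fin.forall_fin_two.mpr ⟨?_, ?_⟩
  · obtain ⟨hd, hT⟩ := key (q := fun x => (a 0 + a 1) * x) (Q := derivSer t a 0) (by fun_prop)
      (by rw [mul_derivSer_zero, taylorSer_const_mul _ hx, taylorSer_id])
    refine ⟨_, hd, fun w hw => ?_, hT⟩
    have hw0 := ne_zero_of_mem_farSet (farRadius_pos t).le hw
    beta_reduce
    rw [period_zero ht (mem_cutPlane_of_mem_farSet t hw), prodRoot_eq hw]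
    have := prodInf_ne_zero t w⁻¹
    simp only [Matrix.cons_val_zero]
    field_simp
  · obtain ⟨hd, hT⟩ := key (q := fun x => ((a 0 + a 1) / 2) * (1 + (-t 0) * x))
      (Q := derivSer t a 1) (by fun_prop) (by
        rw [mul_derivSer_one t a ht, taylorSer_const_mul _ (analyticAt_const.fun_add h2),
          taylorSer_add analyticAt_const h2, taylorSer_const_mul _ hx, taylorSer_id,
          taylorSer_const, map_neg, map_one]
        ring)
    refine ⟨_, hd, fun w hw => ?_, hT⟩
    have hw0 := ne_zero_of_mem_farSet (farRadius_pos t).le hw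
    beta_reduce
    rw [period_zero ht (mem_cutPlane_of_mem_farSet t hw), prodRoot_eq hw]
    have := prodInf_ne_zero t w⁻¹
    simp only [Matrix.cons_val_one, Matrix.cons_val_fin_one]
    field_simp
    ring

theorem formalPeriod_zero (ψ : ℂ) (ht : t 1 ∈ Complex.slitPlane) (i : Fin 2) :
    formalPeriod ψ t a 0 i = emb (derivSer t a i) := by
  have := formalDeriv_formalPeriod ψ t a (-1) i
  rw [formalPeriod_neg_one ψ t a ht, formalDeriv_baseSer, neg_add_cancel] at this
  exact this.symm

/-- An asymptotic expansion cannot be differentiated in general; here it is the Taylor series of a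
holomorphic function of `λ⁻¹`. -/
theorem isFarSum_period_nat (ψ : ℂ) (ht : t 1 ∈ Complex.slitPlane) (l : ℕ) (i : Fin 2) :
    ∃ φ, IsFarSum t (fun w => period t a l w i) φ ∧ formalPeriod ψ t a l i = emb φ := by
  induction l with
  | zero => exact ⟨_, isFarSum_period_zero t a ht i, formalPeriod_zero t a ψ ht i⟩
  | succ l ih =>
    obtain ⟨φ, h1, h2⟩ := ih
    refine ⟨_, h1.deriv.congr fun w hw => ?_, ?_⟩
    · push_cast
      exact (period_succ ht l i (mem_cutPlane_of_mem_farSet t hw)).symm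
    · rw [← formalDeriv_emb, ← h2, formalDeriv_formalPeriod]
      push_cast
      rfl

theorem hasAsympExp_period_neg_one (ψ : ℂ) (ht : t 1 ∈ Complex.slitPlane) (i : Fin 2) :
    HasAsympExp (fun w => period t a (-1) w i) (formalPeriod ψ t a (-1) i) := by
  rw [formalPeriod_neg_one ψ t a ht]
  have hp := analyticAt_zero_of_farBall t (differentiableOn_prodInf t)
  have hh : AnalyticAt ℂ (logInf t) 0 := analyticAt_zero_of_farBall t fun x hx =>
    (hasDerivAt_logInf hx).1.differentiableAt.differentiableWithinAt
  revert i
  refine Fin.forall_fin_two.mpr ⟨?_, ?_⟩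
  · refine ((hasAsympExp_cutLog.const_mul (a 0 + a 1)).add
      ((hasAsympExp_const (-((a 0 + a 1) / 2 * Complex.log (t 1)) +
        a 1 * (Real.pi * Complex.I))).add
        ((hasAsympExp_taylorSer hh).const_mul (a 0 + a 1)))).congr_farSet
          (R := farRadius t) fun w hw => ?_
    have hc := mem_cutPlane_of_mem_farSet t hw
    rw [period_apply, periodVector_neg_one ht 0 hc, periodVector_neg_one ht 1 hc]
    simp only [basePeriod, primConst_canonCoord ht, logPrim_eq hw, Matrix.cons_val_zero]
    rw [if_neg (by decide), if_pos trivial]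
    ring
  · have h := (hasAsympExp_taylorSer (analyticAt_const.fun_mul hp :
      AnalyticAt ℂ (fun x => (a 0 + a 1) / 2 * prodInf t x) 0)).var_mul
    rw [taylorSer_const_mul _ hp] at h
    refine h.congr_farSet (R := farRadius t) fun w hw => ?_
    have hc := mem_cutPlane_of_mem_farSet t hw
    rw [period_apply, periodVector_neg_one ht 0 hc, periodVector_neg_one ht 1 hc]
    simp only [basePeriod, prodRoot_eq hw, Matrix.cons_val_one, Matrix.cons_val_fin_one]
    ring

/-- The period vectors and the formal ones satisfy the same system, which carries the expansion to
smaller indices without integration. -/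
theorem hasAsympExp_period_lower (ψ : ℂ) (ht : t 1 ∈ Complex.slitPlane) {l : ℤ} (hl0 : l ≠ 0)
    (hl1 : l + 1 ≠ 0)
    (ih : ∀ i, HasAsympExp (fun w => period t a (l + 1) w i) (formalPeriod ψ t a (l + 1) i))
    (i : Fin 2) : HasAsympExp (fun w => period t a l w i) (formalPeriod ψ t a l i) := by
  have hne : mu i i + (l : ℂ) + 1 / 2 ≠ 0 := by
    have h0 : (l : ℂ) ≠ 0 := by exact_mod_cast hl0
    have h1 : (l : ℂ) + 1 ≠ 0 := by exact_mod_cast hl1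
    revert i
    refine Fin.forall_fin_two.mpr ⟨fun h => h1 ?_, fun h => h0 ?_⟩
    · simp only [mu, Matrix.of_apply, Matrix.cons_val_zero] at h
      linear_combination h
    · simp only [mu, Matrix.of_apply, Matrix.cons_val_one, Matrix.cons_val_fin_one] at h
      linear_combination h
  have e : formalPeriod ψ t a l i = asympConst (mu i i + l + 1 / 2)⁻¹ *
      ((asympConst (calU t i 0) * formalPeriod ψ t a (l + 1) 0 +
        asympConst (calU t i 1) * formalPeriod ψ t a (l + 1) 1) +
        asympConst (-1) * (asympVar * formalPeriod ψ t a (l + 1) i)) := by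
    ext1
    funext n
    have h := formalPeriod_algebraic ψ t a l i n
    rw [Fin.sum_univ_two] at h
    simp only [asympConst_mul, HahnSeries.coeff_smul, HahnSeries.coeff_add, coeff_asympVar_mul]
    rw [neg_one_smul, ← sub_eq_add_neg, h, inv_smul_smul₀ hne]
  rw [e]
  exact ((((ih 0).const_mul _).add ((ih 1).const_mul _)).add
    ((ih i).var_mul.const_mul (-1)) |>.const_mul _).congr_farSet (R := farRadius t)
      fun w hw => (period_lower ht hl0 hl1 i (mem_cutPlane_of_mem_farSet t hw)).symm

theorem hasAsympExp_period (ψ : ℂ) (ht : t 1 ∈ Complex.slitPlane) (l : ℤ) (i : Fin 2) :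
    HasAsympExp (fun w => period t a l w i) (formalPeriod ψ t a l i) := by
  rcases le_or_gt 0 l with h | h
  · lift l to ℕ using h
    obtain ⟨φ, h1, h2⟩ := isFarSum_period_nat t a ψ ht l i
    rw [h2]
    exact h1.hasAsympExp
  · obtain ⟨n, rfl⟩ : ∃ n : ℕ, l = -1 - n := ⟨(-1 - l).toNat, by omega⟩
    clear h
    induction n generalizing i with
    | zero => simpa using hasAsympExp_period_neg_one t a ψ ht i
    | succ n ih =>
      refine hasAsympExp_period_lower t a ψ ht (by omega) (by omega) (fun k => ?_) i
      rw [show (-1 - ((n + 1 : ℕ) : ℤ)) + 1 = -1 - n by push_cast; ring]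
      exact ih k

theorem periodAsymp_eq (ψ : ℂ) (ht : t 1 ∈ Complex.slitPlane) :
    periodAsymp t a = formalPeriod ψ t a := by
  funext l i
  exact asympExp_eq (hasAsympExp_period t a ψ ht l i)

end

/-! ### The phase factor -/

section

variable (ψ : ℂ) (t a : Fin 2 → ℂ)

/-- The logarithm of `(1 - u^1 x) (1 - u^2 x)`. A multiple of it, at `x = ρ⁻¹`, is a primitive of
the integrand of the phase factor. -/
def logDisc (x : ℂ) : ℂ :=
  Complex.log (1 - canonCoord t 0 * x) + Complex.log (1 - canonCoord t 1 * x)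

/-- The logarithm of the phase factor, as a function of `x = λ⁻¹`. -/
def phaseLog (x : ℂ) : ℂ := cConst ψ t a / 2 + -((a 0 + a 1) ^ 2 / 4) * logDisc t x

variable {t}

theorem hasDerivAt_logDisc {x : ℂ} (hx : x ∈ farBall t) : HasDerivAt (logDisc t)
    (-canonCoord t 0 / (1 - canonCoord t 0 * x) + -canonCoord t 1 / (1 - canonCoord t 1 * x)) x :=
  (hasDerivAt_log_one_sub (lt_farRadius t 0) hx).add (hasDerivAt_log_one_sub (lt_farRadius t 1) hx)

theorem one_sub_ne_zero (i : Fin 2) {x : ℂ} (hx : x ∈ farBall t) : 1 - canonCoord t i * x ≠ 0 :=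
  fun h => by simpa [h] using one_sub_re_pos (lt_farRadius t i) hx

theorem prodInf_mul_self {x : ℂ} (hx : x ∈ farBall t) : prodInf t x * prodInf t x =
    (1 - canonCoord t 0 * x) * (1 - canonCoord t 1 * x) := by
  have e1 := rootInf_sq (lt_farRadius t 0) hx
  have e2 := rootInf_sq (lt_farRadius t 1) hx
  rw [← e1, ← e2, prodInf]
  ring

theorem etaForm_eq (v w : Fin 2 → ℂ) : etaForm v w = v 0 * w 1 + v 1 * w 0 := by
  simp [etaForm, Fin.sum_univ_two, eta]

theorem evalSeries_single (n : ℤ) (p : Polynomial ℂ) (w : ℂ) :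
    evalSeries (HahnSeries.single n p) w = p.eval (cutLog w) * w ^ (-n) := by
  rw [evalSeries, tsum_eq_single n, HahnSeries.coeff_single_same]
  intro m hm
  rw [HahnSeries.coeff_single_of_ne hm, Polynomial.eval_zero, zero_mul]

theorem calWInf_eq (w : ℂ) : calWInf ψ a w = (a 0 + a 1) ^ 2 / w := by
  have h0 : thetaCoeff ψ a 0 = Polynomial.C (a 0 + a 1) := by simpa using thetaCoeff_nat ψ a 0
  rw [calWInf, etaForm_eq, periodInf_zero, periodInf_one, evalSeries_single, evalSeries_single, h0,
    chiCoeff_zero, Polynomial.eval_C, Polynomial.eval_C, neg_zero, zpow_zero, zero_add,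
    zpow_neg_one]
  ring

variable {a}

theorem calW_eq (ht : t 1 ∈ Complex.slitPlane) {w : ℂ} (hw : w ∈ cutPlane t) :
    calW t a w = (a 0 + a 1) ^ 2 / 2 *
      ((w - canonCoord t 0)⁻¹ + (w - canonCoord t 1)⁻¹) := by
  have h := (mem_cutPlane_iff t w).mp hw
  have hne : ∀ i, w - canonCoord t i ≠ 0 := fun i => sub_ne_zero.mpr (ne_of_mem_slitPlane (h i))
  have hP := prodRoot_sq (ne_of_mem_slitPlane (h 0)) (ne_of_mem_slitPlane (h 1))
  have hP0 : prodRoot (canonCoord t 0) (canonCoord t 1) w ≠ 0 := prodRoot_ne_zero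
  have hsum : canonCoord t 0 + canonCoord t 1 = 2 * t 0 := by
    simp only [canonCoord, Matrix.cons_val_zero, Matrix.cons_val_one, Matrix.cons_val_fin_one]
    ring
  rw [calW, period_zero ht hw, etaForm_eq]
  simp only [Matrix.cons_val_zero, Matrix.cons_val_one, Matrix.cons_val_fin_one]
  calc _ = (a 0 + a 1) ^ 2 * (w - t 0) / prodRoot (canonCoord t 0) (canonCoord t 1) w ^ 2 := by
        field_simp
        ring
    _ = _ := by
        have h0 := hne 0
        have h1 := hne 1
        rw [hP]
        field_simp
        linear_combination (a 0 + a 1) ^ 2 * hsum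

section

variable {w : ℂ}

/-- The integrand of the phase factor, with the poles of the two terms at `ρ = ∞` cancelled. -/
theorem phaseIntegrand_eq (ht : t 1 ∈ Complex.slitPlane) (hw : w ∈ farSet (farRadius t)) {s : ℝ}
    (hs : 1 ≤ s) : phaseIntegrand ψ t a w s = (a 0 + a 1) ^ 2 / 2 *
      (canonCoord t 0 / (s * (s * w - canonCoord t 0)) +
        canonCoord t 1 / (s * (s * w - canonCoord t 1))) := by
  have hsw := mem_cutPlane_of_mem_farSet t (smul_mem_farSet hw hs)
  have h := (mem_cutPlane_iff t _).mp hsw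
  have h0 : (s : ℂ) * w - canonCoord t 0 ≠ 0 := sub_ne_zero.mpr (ne_of_mem_slitPlane (h 0))
  have h1 : (s : ℂ) * w - canonCoord t 1 ≠ 0 := sub_ne_zero.mpr (ne_of_mem_slitPlane (h 1))
  have hs0 : (s : ℂ) ≠ 0 := by exact_mod_cast (by linarith : s ≠ 0)
  have hw0 := ne_zero_of_mem_farSet (farRadius_pos t).le hw
  rw [phaseIntegrand, calW_eq ht hsw, calWInf_eq]
  field_simp
  ring

/-- The cancellation of the two terms at `ρ = ∞` makes the integrand `O(s⁻²)`. -/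
theorem norm_phaseIntegrand_le (ht : t 1 ∈ Complex.slitPlane) (hw : w ∈ farSet (farRadius t))
    {s : ℝ} (hs : 1 ≤ s) :
    ‖phaseIntegrand ψ t a w s‖ ≤ ‖(a 0 + a 1) ^ 2‖ * s ^ (-2 : ℝ) := by
  have hs0 : 0 < s := by linarith
  have key : ∀ i, ‖canonCoord t i / (s * (s * w - canonCoord t i))‖ ≤ s ^ (-2 : ℝ) := by
    intro i
    have h1 : 2 * ‖canonCoord t i‖ < ‖w‖ := (lt_farRadius t i).trans hw.1
    have h2 : s * ‖w‖ - ‖canonCoord t i‖ ≤ ‖(s : ℂ) * w - canonCoord t i‖ := by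
      have := norm_sub_norm_le ((s : ℂ) * w) (canonCoord t i)
      rwa [norm_mul, Complex.norm_real, Real.norm_of_nonneg hs0.le] at this
    have h0 := norm_nonneg (canonCoord t i)
    have h3 : s * ‖canonCoord t i‖ ≤ ‖(s : ℂ) * w - canonCoord t i‖ := by nlinarith
    have hsw : ‖w‖ ≤ s * ‖w‖ := le_mul_of_one_le_left (norm_nonneg w) hs
    have h4 : 0 < ‖(s : ℂ) * w - canonCoord t i‖ := by linarith
    rw [norm_div, norm_mul, Complex.norm_real, Real.norm_of_nonneg hs0.le, Real.rpow_neg hs0.le,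
      Real.rpow_two, div_le_iff₀ (by positivity), ← div_eq_inv_mul, le_div_iff₀ (by positivity)]
    nlinarith
  rw [phaseIntegrand_eq ψ ht hw hs, norm_mul, norm_div, Complex.norm_two]
  have := (norm_add_le _ _).trans (add_le_add (key 0) (key 1))
  have h2 := mul_le_mul_of_nonneg_left this (norm_nonneg ((a 0 + a 1) ^ 2))
  linarith

theorem integrableOn_phaseIntegrand (ht : t 1 ∈ Complex.slitPlane)
    (hw : w ∈ farSet (farRadius t)) :
    MeasureTheory.IntegrableOn (phaseIntegrand ψ t a w) (Set.Ioi (1 : ℝ)) := by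
  refine MeasureTheory.Integrable.mono'
    ((integrableOn_Ioi_rpow_of_lt (a := -2) (by norm_num) one_pos).const_mul
      ‖(a 0 + a 1) ^ 2‖) ?_ ?_
  · refine ContinuousOn.aestronglyMeasurable (ContinuousOn.congr ?_ fun s hs =>
      phaseIntegrand_eq ψ ht hw (le_of_lt hs)) measurableSet_Ioi
    have h : ∀ i, ContinuousOn (fun s : ℝ => canonCoord t i / (s * (s * w - canonCoord t i)))
        (Set.Ioi (1 : ℝ)) := by
      intro i
      refine ContinuousOn.div (by fun_prop) (by fun_prop) fun s hs => ?_
      have hs1 : (1 : ℝ) < s := hs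
      have h := (mem_cutPlane_iff t _).mp
        (mem_cutPlane_of_mem_farSet t (smul_mem_farSet hw hs1.le)) i
      refine mul_ne_zero ?_ (sub_ne_zero.mpr (ne_of_mem_slitPlane h))
      exact_mod_cast (by linarith : s ≠ 0)
    exact continuousOn_const.mul ((h 0).add (h 1))
  · refine (MeasureTheory.ae_restrict_iff' measurableSet_Ioi).mpr (Filter.Eventually.of_forall ?_)
    exact fun s hs => norm_phaseIntegrand_le ψ ht hw (le_of_lt hs)

/-- The primitive `logDisc` vanishes at `ρ = ∞`. -/
theorem integral_phaseIntegrand (ht : t 1 ∈ Complex.slitPlane) (hw : w ∈ farSet (farRadius t)) :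
    ∫ s in Set.Ioi (1 : ℝ), phaseIntegrand ψ t a w s =
      -((a 0 + a 1) ^ 2 / 2 * logDisc t w⁻¹) := by
  have hw0 := ne_zero_of_mem_farSet (farRadius_pos t).le hw
  have hball : ∀ s : ℝ, 1 ≤ s → ((s : ℂ) * w)⁻¹ ∈ farBall t := fun s hs =>
    inv_mem_ball (farRadius_pos t) (smul_mem_farSet hw hs)
  have hderiv : ∀ s : ℝ, 1 ≤ s → HasDerivAt
      (fun s : ℝ => (a 0 + a 1) ^ 2 / 2 * logDisc t ((s : ℂ) * w)⁻¹)
      (phaseIntegrand ψ t a w s) s := by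
    intro s hs
    have hs0 : (s : ℂ) ≠ 0 := by exact_mod_cast (by linarith : s ≠ 0)
    have h1 : HasDerivAt (fun z : ℂ => (z * w)⁻¹) (-(1 * w) / ((s : ℂ) * w) ^ 2) (s : ℂ) :=
      ((hasDerivAt_id (s : ℂ)).mul_const w).inv (mul_ne_zero hs0 hw0)
    have h2 := (((hasDerivAt_logDisc (hball s hs)).comp (s : ℂ) h1).const_mul
      ((a 0 + a 1) ^ 2 / 2)).comp_ofReal
    refine h2.congr_deriv ?_
    have hsw := mem_cutPlane_of_mem_farSet t (smul_mem_farSet hw hs)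
    have h := (mem_cutPlane_iff t _).mp hsw
    have e : ∀ i, -canonCoord t i / (1 - canonCoord t i * ((s : ℂ) * w)⁻¹) *
        (-(1 * w) / ((s : ℂ) * w) ^ 2) = canonCoord t i / (s * (s * w - canonCoord t i)) := by
      intro i
      have h0 : (s : ℂ) * w - canonCoord t i ≠ 0 := sub_ne_zero.mpr (ne_of_mem_slitPlane (h i))
      have e1 : 1 - canonCoord t i * ((s : ℂ) * w)⁻¹ = (s * w - canonCoord t i) / (s * w) := by
        field_simp
      rw [e1]
      field_simp
    rw [phaseIntegrand_eq ψ ht hw hs, add_mul, e, e]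
  -- `(s w)⁻¹` tends to `0`, where `logDisc` is continuous
  have hlim : Filter.Tendsto (fun s : ℝ => (a 0 + a 1) ^ 2 / 2 * logDisc t ((s : ℂ) * w)⁻¹)
      Filter.atTop (nhds ((a 0 + a 1) ^ 2 / 2 * logDisc t 0)) := by
    have h0 : (0 : ℂ) ∈ farBall t := Metric.mem_ball_self (inv_pos.mpr (farRadius_pos t))
    refine ((hasDerivAt_logDisc h0).continuousAt.tendsto.comp ?_).const_mul _
    have h1 := tendsto_ray_inv (norm_one (α := ℂ))
    have h2 := h1.mul_const w⁻¹
    rw [zero_mul] at h2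
    refine h2.congr fun s => ?_
    rw [mul_one, mul_inv]
  have := MeasureTheory.integral_Ioi_of_hasDerivAt_of_tendsto
    (hderiv 1 le_rfl).continuousAt.continuousWithinAt (fun s hs => hderiv s (le_of_lt hs))
    (integrableOn_phaseIntegrand ψ ht hw) hlim
  rw [this]
  simp [logDisc]

theorem phase_eq (ht : t 1 ∈ Complex.slitPlane) (hw : w ∈ farSet (farRadius t)) :
    phase ψ t a w = Complex.exp (phaseLog ψ t a w⁻¹) := by
  rw [phase, integral_phaseIntegrand ψ ht hw, phaseLog]
  congr 1
  ring

end

variable (t a)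

theorem hasDerivAt_phaseLog {x : ℂ} (hx : x ∈ farBall t) : HasDerivAt (phaseLog ψ t a)
    (deriv (phaseLog ψ t a) x) x ∧ prodInf t x * prodInf t x * deriv (phaseLog ψ t a) x =
      (a 0 + a 1) ^ 2 / 4 * ((canonCoord t 0 + canonCoord t 1) +
        -(2 * (canonCoord t 0 * canonCoord t 1)) * x) := by
  have h : HasDerivAt (phaseLog ψ t a) _ x :=
    ((hasDerivAt_logDisc hx).const_mul (-((a 0 + a 1) ^ 2 / 4))).const_add (cConst ψ t a / 2)
  refine ⟨h.differentiableAt.hasDerivAt, ?_⟩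
  have e : ∀ i, (1 - canonCoord t i * x) * (-canonCoord t i / (1 - canonCoord t i * x)) =
      -canonCoord t i := fun i => mul_div_cancel₀ _ (one_sub_ne_zero i hx)
  rw [h.deriv, prodInf_mul_self hx]
  linear_combination (-(a 0 + a 1) ^ 2 / 4) * ((1 - canonCoord t 1 * x) * e 0 +
    (1 - canonCoord t 0 * x) * e 1)

theorem analyticAt_phaseLog : AnalyticAt ℂ (phaseLog ψ t a) 0 :=
  analyticAt_zero_of_farBall t fun _ hx =>
    (hasDerivAt_phaseLog ψ t a hx).1.differentiableAt.differentiableWithinAt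

theorem hasAsympExp_phase (ht : t 1 ∈ Complex.slitPlane) : HasAsympExp (phase ψ t a)
    (emb (taylorSer fun x => Complex.exp (phaseLog ψ t a x))) :=
  (hasAsympExp_taylorSer (analyticAt_phaseLog ψ t a).cexp).congr_farSet (R := farRadius t)
    fun _ hw => (phase_eq ψ ht hw).symm

theorem emb_injective : Function.Injective emb := fun φ χ h => by
  ext n
  have := congrArg (fun ξ : AsympSeries => ξ.coeff (n : ℤ)) h
  simpa only [coeff_emb, Polynomial.C_inj] using this

/-- The formal series that governs the commutation of the two halves of the vertex operator is the
Taylor series of the logarithm of the phase factor: both have the same derivative and the same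
constant term. -/
theorem taylorSer_phaseLog (ht : t 1 ∈ Complex.slitPlane) :
    taylorSer (phaseLog ψ t a) = (1 / 2 : ℂ) • phaseSer ψ t a := by
  have hp := analyticAt_zero_of_farBall t (differentiableOn_prodInf t)
  have hx : AnalyticAt ℂ (fun x : ℂ => x) 0 := analyticAt_id
  have hL := analyticAt_phaseLog ψ t a
  set A := a 0 + a 1 with hA
  have hσ := sqrt_sq ht
  have hsum : canonCoord t 0 + canonCoord t 1 = 2 * t 0 := by
    simp only [canonCoord, Matrix.cons_val_zero, Matrix.cons_val_one, Matrix.cons_val_fin_one]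
    ring
  have hprod : canonCoord t 0 * canonCoord t 1 = t 0 ^ 2 - 4 * t 1 := by
    simp only [canonCoord, Matrix.cons_val_zero, Matrix.cons_val_one, Matrix.cons_val_fin_one]
    linear_combination -4 * hσ
  -- the phase density is the one of `I^{(0)}_a`
  have hD : ∀ i, halfSer ψ t a 0 i = derivSer t a i := fun i => emb_injective <| by
    rw [← formalPeriod_zero t a ψ ht]
    exact_mod_cast (formalPeriod_eq_emb ψ t a 0 i).symm
  have h1 : taylorSer (prodInf t) * taylorSer (prodInf t) *
      PowerSeries.derivative ℂ (taylorSer (phaseLog ψ t a)) = PowerSeries.C (A ^ 2 / 2) *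
        (PowerSeries.C (t 0) - PowerSeries.C (t 0 ^ 2 - 4 * t 1) * PowerSeries.X) := by
    rw [taylorSer_derivative, ← taylorSer_mul hp hp, ← taylorSer_mul (hp.fun_mul hp) hL.deriv]
    have h2 : AnalyticAt ℂ (fun x : ℂ => -(t 0 ^ 2 - 4 * t 1) * x) 0 := by fun_prop
    have e : taylorSer (fun x => prodInf t x * prodInf t x * deriv (phaseLog ψ t a) x) =
        taylorSer fun x => A ^ 2 / 2 * (t 0 + -(t 0 ^ 2 - 4 * t 1) * x) := by
      refine taylorSer_congr ?_
      filter_upwards [farBall_mem_nhds t] with x hx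
      rw [(hasDerivAt_phaseLog ψ t a hx).2, hsum, hprod]
      ring
    rw [e, taylorSer_const_mul _ (analyticAt_const.fun_add h2), taylorSer_add analyticAt_const h2,
      taylorSer_const_mul _ hx, taylorSer_const, taylorSer_id, map_neg]
    ring
  have h2 := derInf_phaseSer ψ t a
  rw [hD, hD, derInf] at h2
  have d0 := mul_derivSer_zero t a
  have d1 := mul_derivSer_one t a ht
  have hq := taylorSer_prodInf_sq t ht
  refine PowerSeries.derivative.ext ?_ ?_
  · -- compare the derivatives after multiplication by `x² (1 - u^1 x) (1 - u^2 x)`, which makes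
    -- both of them polynomials
    have hπ := taylorSer_prodInf_ne_zero t
    have hX : (PowerSeries.X : PowerSeries ℂ) ≠ 0 := PowerSeries.X_ne_zero
    refine mul_left_cancel₀ (mul_ne_zero (pow_ne_zero 2 hX) (mul_ne_zero hπ hπ)) ?_
    rw [mul_assoc, h1, PowerSeries.smul_eq_C_mul, Derivation.leibniz, PowerSeries.derivative_C,
      smul_zero, add_zero, smul_eq_mul]
    have c1 : PowerSeries.C (A ^ 2) = PowerSeries.C A * PowerSeries.C A := by rw [← map_mul, sq]
    have c2 : PowerSeries.C A = 2 * PowerSeries.C (A / 2) := by rw [two_mul, ← map_add, add_halves]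
    have c3 : PowerSeries.C (A ^ 2 / 2) = 2 * (PowerSeries.C (A / 2) * PowerSeries.C (A / 2)) := by
      rw [two_mul, ← map_mul, ← map_add]
      congr 1
      ring
    have c4 : PowerSeries.C (t 0 ^ 2 - 4 * t 1) =
        PowerSeries.C (t 0) * PowerSeries.C (t 0) - PowerSeries.C (4 * t 1) := by
      rw [← map_mul, ← map_sub, sq]
    have c5 : (2 : PowerSeries ℂ) * PowerSeries.C (1 / 2 : ℂ) = 1 := by
      rw [two_mul, ← map_add, add_halves, map_one]
    rw [← hA] at d0 d1 h2
    rw [c3, c4]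
    rw [c1, c2] at h2
    rw [c2] at d0
    set π := taylorSer (prodInf t)
    set B := PowerSeries.C (A / 2)
    set c := PowerSeries.C (t 0)
    set D := PowerSeries.C (4 * t 1)
    set h := PowerSeries.C (1 / 2 : ℂ)
    set X := (PowerSeries.X : PowerSeries ℂ)
    linear_combination h * π * π * h2 - 2 * h * π * derivSer t a 1 * d0 - 4 * h * B * X * d1 +
      4 * h * B * B * X * hq - 2 * B * B * X * X * (c - (c * c - D) * X) * c5
  · rw [← PowerSeries.coeff_zero_eq_constantCoeff_apply,
      ← PowerSeries.coeff_zero_eq_constantCoeff_apply, coeff_zero_taylorSer, PowerSeries.coeff_smul,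
      coeff_zero_phaseSer, phaseLog]
    simp [logDisc]
    ring

/-- The exponential of half the phase form is the asymptotic series of the phase factor. -/
theorem coeffHasSum_phase (ht : t 1 ∈ Complex.slitPlane) :
    CoeffHasSum (fun p => AS.val (dp ((1 / 2 : ℂ) • AS.of (emb (phaseSer ψ t a))) p))
      (emb (taylorSer fun x => Complex.exp (phaseLog ψ t a x))) := by
  have hL := analyticAt_phaseLog ψ t a
  have hE : AnalyticAt ℂ (fun x => Complex.exp (phaseLog ψ t a x)) 0 := hL.cexp
  refine coeffHasSum_emb (hasSum_coeff_dp ?_ ?_)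
  · rw [coeff_zero_taylorSer, ← taylorSer_phaseLog ψ t a ht, coeff_zero_taylorSer]
  · rw [← taylorSer_phaseLog ψ t a ht, taylorSer_derivative, taylorSer_derivative,
      ← taylorSer_mul hL.deriv hE]
    refine taylorSer_congr ?_
    filter_upwards [farBall_mem_nhds t] with x hx
    rw [(hasDerivAt_phaseLog ψ t a hx).1.cexp.deriv, mul_comm]

end

end

end CatalanFM

theorem mainTheorem11 (ψ : ℂ) (t : Fin 2 → ℂ) (ht : t 1 ∈ Complex.slitPlane) (a : Fin 2 → ℂ) :
    -- the objects are well defined: period vectors, asymptotic expansions, the integral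
    (∀ (i : Fin 2) (l : ℤ),
      CatalanFM.IsPeriodVector t i l (CatalanFM.periodVector t i l)) ∧
    (∀ (l : ℤ) (i : Fin 2),
      CatalanFM.HasAsympExp (fun w => CatalanFM.period t a l w i)
        (CatalanFM.periodAsymp t a l i)) ∧
    (∀ ω : ℂ, ‖ω‖ = 1 → ω ≠ Complex.I → ∀ᶠ r : ℝ in Filter.atTop,
      MeasureTheory.IntegrableOn (CatalanFM.phaseIntegrand ψ t a ((r : ℂ) * ω))
        (Set.Ioi (1 : ℝ))) ∧
    CatalanFM.HasAsympExp (CatalanFM.phase ψ t a)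
      (CatalanFM.asympExp (CatalanFM.phase ψ t a)) ∧
    -- the conjugation formula
    ∀ F : (CatalanFM.Var →₀ ℕ) → ℤ → ℂ, CatalanFM.IsTame F →
      CatalanFM.ExpConverges (CatalanFM.SHatNegTerm ψ t) (CatalanFM.toFock F) ∧
      CatalanFM.VertexConverges (CatalanFM.periodInf ψ a)
        (CatalanFM.SHatInv ψ t (CatalanFM.toFock F)) ∧
      CatalanFM.ExpConverges (CatalanFM.SHatTerm ψ t)
        (CatalanFM.vertexOp (CatalanFM.periodInf ψ a)
          (CatalanFM.SHatInv ψ t (CatalanFM.toFock F))) ∧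
      CatalanFM.VertexConverges (CatalanFM.periodAsymp t a) (CatalanFM.toFock F) ∧
      CatalanFM.SHat ψ t
          (CatalanFM.vertexOp (CatalanFM.periodInf ψ a)
            (CatalanFM.SHatInv ψ t (CatalanFM.toFock F))) =
        CatalanFM.asympExp (CatalanFM.phase ψ t a) •
          CatalanFM.vertexOp (CatalanFM.periodAsymp t a) (CatalanFM.toFock F) := by
  have hph := CatalanFM.hasAsympExp_phase ψ t a ht
  have hE := CatalanFM.asympExp_eq hph
  refine ⟨fun i l => CatalanFM.isPeriodVector_periodVector ht i l, fun l i => ?_, fun ω h1 h2 => ?_,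
    ?_, fun F hF => ?_⟩
  · rw [CatalanFM.periodAsymp_eq t a ψ ht]
    exact CatalanFM.hasAsympExp_period t a ψ ht l i
  · exact (CatalanFM.eventually_mem_farSet (CatalanFM.farRadius t) h1 h2).mono fun r hr =>
      CatalanFM.integrableOn_phaseIntegrand ψ ht hr
  · rw [hE]
    exact hph
  · rw [CatalanFM.periodAsymp_eq t a ψ ht, hE]
    exact CatalanFM.conj_vertexOp (CatalanFM.logS_zero ψ t) (CatalanFM.eta_mul_logS ψ t)
      (CatalanFM.expSeries_logS ψ t) (CatalanFM.van_periodInf ψ a)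
      (CatalanFM.van_formalPeriod_sub ψ t a) (CatalanFM.van_emb _)
      (CatalanFM.van_phaseSer_sub ψ t a) (CatalanFM.van_emb _)
      (CatalanFM.coeffHasSum_phase ψ t a ht) hF
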